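/- Let $\mathbf{k}$ be an algebraically closed field of characteristic $0$ and let $\mathcal{A}$ be a modular category over $\mathbf{k}$, i.e. a braided spherical fusion category whose $S$-matrix (the matrix of traces of double braidings of simple objects) is nondegenerate. Let $X_i$ be representatives of the simple objects, $d_i$ their dimensions, $\mathcal{D}=\sum_i d_i^2$; fix square roots $\sqrt{d_i}$ (with $\sqrt{d_{\mathbf 1}}=1$ and $\sqrt{d_{i^*}}=\sqrt{d_i}$) and $\sqrt{\mathcal{D}}$. Write $\langle Y,W\rangle=\operatorname{Hom}(\mathbf 1,Y\otimes W)$, let $c$ be the braiding, and for simple $X_k$ let $\sum_\alpha\alpha\otimes\alpha^*$ denote the sum over a pair of bases dual under the trace pairing. (1) On the Drinfeld center $\mathcal{Z}(\mathcal{A})$, with objects $(X,\gamma)$, $\gamma_A:A\otimes X\cong X\otimes A$, the reduced tensor product $(X,\gamma)\,\overline{\otimes}\,(Y,\mu)$ is the image of the endomorphism $Q_{\gamma,\mu}$ of $X\otimes Y$ equal to $\frac1{\mathcal{D}}$ times a closed strand coloured by $\sum_i d_iX_i$, which is created between $X$ and $Y$, whose left leg goes left under $X$ and returns through $\gamma$,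 whose right leg goes right through $\mu$ and returns over $Y$, and which is closed between $X$ and $Y$. Its half-braiding lets $A$ be absorbed by the left leg (between its two crossings with $X$) and be emitted by the right leg (between its two crossings with $Y$), summed over simple colours and dual bases. Its unit is $(\bigoplus_iX_i\otimes X_i^*,\Gamma)$, where the $(i,j)$ component of $\Gamma_B$ is $\sqrt{d_i}\sqrt{d_j}$ times the sum over dual bases $\alpha:B\otimes X_i\to X_j$, $\alpha^*:X_i^*\to X_j^*\otimes B$. The associator is the restriction of that of $\mathcal{A}$, and the left and right unit constraints are $\sum_i\frac{\sqrt{d_i}}{\sqrt{\mathcal{D}}}$ times: (left) $X_i^*$ passes to the right over $X$, $X_i$ passes through $\gamma$, and the two are closed; (right) $X_i$ passes to the left under $X$, returns through $\gamma$, and is closed with $X_i^*$. The dual of $(X,\gamma)$ is $(X^*,\gamma^\vee)$, where $A$ crosses under $X^*$, returns through the transpose of $\gamma_A$ and crosses over $X^*$; evaluation and coevaluation are $\sum_i\frac{\sqrt{d_i}}{\sqrt{\mathcal D}}$ times those of $X$ with the strand $X_i$ passed along in the same way. The pivotal structure is that of $\mathcal{A}$. All of this is well defined and makes $(\mathcal{Z}(\mathcal{A}),\overline{\otimes})$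 a pivotal multifusion category. (2) On $\mathcal{A}\boxtimes\mathcal{A}$ (finite direct sums of pairs $X\boxtimes Y$, with $\operatorname{Hom}(X\boxtimes Y,X'\boxtimes Y')=\operatorname{Hom}(X,X')\otimes\operatorname{Hom}(Y,Y')$), put $$(W_1\boxtimes Y_1)\,\overline{\otimes}\,(W_2\boxtimes Y_2)=\langle Y_1,W_2\rangle\cdot W_1\boxtimes Y_2,\qquad (f_1\boxtimes g_1)\,\overline{\otimes}\,(f_2\boxtimes g_2)=\langle g_1,f_2\rangle\cdot f_1\boxtimes g_2,$$ extended to direct sums, with the evident associator and unit $\overline{\mathbf 1}=\bigoplus_kX_k\boxtimes X_k^*$. The left unit constraint of $W\boxtimes Y$ is $\sqrt{d_k}$ times the canonical map $\langle X_k^*,W\rangle\cong\operatorname{Hom}(X_k,W)$ on the summand $\langle X_k^*,W\rangle\cdot X_k\boxtimes Y$; the right one is $\sqrt{d_k}$ times $\langle Y,X_k\rangle\cong\operatorname{Hom}(X_k^*,Y)$ on $\langle Y,X_k\rangle\cdot W\boxtimes X_k^*$. The dual is $(W\boxtimes Y)^\vee=Y^*\boxtimes W^*$, with evaluation $\operatorname{ev}_W\cdot\sum_k\sqrt{d_k}\sum_\alpha\alpha\boxtimes\alpha^*$,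 $\alpha:Y^*\to X_k$, $\alpha^*:Y\to X_k^*$, and coevaluation $\operatorname{coev}_Y\cdot\sum_k\sqrt{d_k}\sum_\alpha\alpha\boxtimes\alpha^*$, $\alpha:X_k\to W$, $\alpha^*:X_k^*\to W^*$; the pivotal structure is $\delta_{W\boxtimes Y}=\delta_W\boxtimes\delta_Y$. This makes $(\mathcal{A}\boxtimes\mathcal{A},\overline{\otimes})$ a pivotal multifusion category. (3) The additive $\mathbf{k}$-linear functor $$K:\mathcal{A}\boxtimes\mathcal{A}\to\mathcal{Z}(\mathcal{A}),\qquad X\boxtimes Y\mapsto(X\otimes Y,\,c\,c^{-1})=(X,c)\otimes(Y,c^{-1}),\quad f\boxtimes g\mapsto f\otimes g,$$ where the half-braiding $c\,c^{-1}$ lets $A$ pass under $X$ and over $Y$, is an equivalence of categories and underlies an equivalence of pivotal multifusion categories $(\mathcal{A}\boxtimes\mathcal{A},\overline\otimes)\simeq(\mathcal{Z}(\mathcal{A}),\overline\otimes)$: it has a (strong) monoidal structure, compatible with the pivotal structures, whose tensor isomorphism $$K(W_1\boxtimes Y_1)\,\overline{\otimes}\,K(W_2\boxtimes Y_2)\to\langle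 Y_1,W_2\rangle\cdot(W_1\otimes Y_2,c\,c^{-1})$$ is $\sum_m b_m\cdot(\mathrm{id}_{W_1}\otimes b^m\otimes\mathrm{id}_{Y_2})$ on the image of $Q$, for a basis $(b_m)$ of $\langle Y_1,W_2\rangle$ and the dual basis $(b^m)$ of $\operatorname{Hom}(Y_1\otimes W_2,\mathbf 1)$, and whose unit isomorphism $$K(\overline{\mathbf 1})=\Big(\bigoplus_iX_i\otimes X_i^*,c\,c^{-1}\Big)\to\overline{\mathbf 1}=\Big(\bigoplus_jX_j\otimes X_j^*,\Gamma\Big)$$ is given by the $S$-matrix: it is $\frac1{\sqrt{\mathcal D}}\sum_{i,j}\sqrt{d_i}\sqrt{d_j}\,S_{ij}$, where $S_{ij}:X_i\otimes X_i^*\to X_j\otimes X_j^*$ is the coevaluation of $X_j$ inserted between $X_i$ and $X_i^*$, followed by $X_j$ passing to the left under $X_i$ and $X_j^*$ passing to the right over $X_i^*$, followed by the evaluation $X_i\otimes X_i^*\to\mathbf 1$. -/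

import Mathlib

open CategoryTheory MonoidalCategory Limits
open scoped TensorProduct

universe w v u

noncomputable section

namespace ReducedTensor

attribute [instance] Abelian.hasFiniteBiproducts

/-! ## Pivotal, fusion and modular categories -/

section Pivotal

variable (D : Type u) [Category.{v} D] [MonoidalCategory D] [RightRigidCategory D]

/-- The canonical isomorphism `X** ⊗ Y** ≅ (X ⊗ Y)**` of a rigid category, as a morphism. -/
def doubleDualTensor {D : Type u} [Category.{v} D] [MonoidalCategory D] [RightRigidCategory D]
    (X Y : D) : (Xᘁ)ᘁ ⊗ (Yᘁ)ᘁ ⟶ ((X ⊗ Y)ᘁ)ᘁ :=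
  (rightDualTensorIso Yᘁ Xᘁ).inv ≫ rightAdjointMate (rightDualTensorIso X Y).hom

/-- A pivotal structure: a monoidal natural isomorphism `X ≅ X**`.  The dual written `X*` in the
comments below, with `ε : X* ⊗ X ⟶ 𝟙` and `η : 𝟙 ⟶ X ⊗ X*`, is `Xᘁ` in Mathlib. -/
class PivotalCategory where
  piv : ∀ X : D, X ≅ (Xᘁ)ᘁ
  piv_naturality : ∀ {X Y : D} (f : X ⟶ Y), 
    f ≫ (piv Y).hom = (piv X).hom ≫ rightAdjointMate (rightAdjointMate f)
  piv_tensor : ∀ X Y : D,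
    (piv (X ⊗ Y)).hom = ((piv X).hom ⊗ₘ (piv Y).hom) ≫ doubleDualTensor X Y

end Pivotal

section Traces

variable {D : Type u} [Category.{v} D] [MonoidalCategory D] [RightRigidCategory D]
  [PivotalCategory D]

open PivotalCategory

/-- The other evaluation `X ⊗ X* ⟶ 𝟙`, from the pivotal structure. -/
def pivEv (X : D) : X ⊗ Xᘁ ⟶ 𝟙_ D := (piv X).hom ▷ Xᘁ ≫ ε_ Xᘁ (Xᘁ)ᘁ

/-- The other coevaluation `𝟙 ⟶ X* ⊗ X`, from the pivotal structure. -/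
def pivCoev (X : D) : 𝟙_ D ⟶ Xᘁ ⊗ X := η_ Xᘁ (Xᘁ)ᘁ ≫ Xᘁ ◁ (piv X).inv

def rightTrace {X : D} (f : X ⟶ X) : 𝟙_ D ⟶ 𝟙_ D := η_ X Xᘁ ≫ f ▷ Xᘁ ≫ pivEv X

def leftTrace {X : D} (f : X ⟶ X) : 𝟙_ D ⟶ 𝟙_ D := pivCoev X ≫ Xᘁ ◁ f ≫ ε_ X Xᘁ

variable (D) in
/-- A pivotal category is spherical if left and right traces agree. -/
class SphericalCategory : Prop where
  trace_eq : ∀ {X : D} (f : X ⟶ X), leftTrace f = rightTrace f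

/-- The rotation `T* ⟶ S* ⊗ A` of a morphism `S ⟶ A ⊗ T`. -/
def rot {S A T : D} (q : S ⟶ A ⊗ T) : Tᘁ ⟶ Sᘁ ⊗ A :=
  𝟙 _ ⊗≫ pivCoev S ▷ Tᘁ ⊗≫ Sᘁ ◁ q ▷ Tᘁ ⊗≫ (Sᘁ ⊗ A) ◁ pivEv T ⊗≫ 𝟙 _

end Traces

section Semisimple

variable (𝕜 : Type w) [Field 𝕜]

/-- Finite semisimplicity of a `𝕜`-linear category: finite dimensional morphism spaces, every
object a finite direct sum of simple objects, finitely many simple objects up to isomorphism. -/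
class FiniteSemisimple (D : Type u) [Category.{v} D] [Preadditive D] [Linear 𝕜 D]
    [HasFiniteBiproducts D] : Prop where
  finiteDimensional : ∀ X Y : D, FiniteDimensional 𝕜 (X ⟶ Y)
  exists_iso_biproduct : ∀ X : D, ∃ (n : ℕ) (S : Fin n → D),
    (∀ k, Simple (S k)) ∧ Nonempty (X ≅ ⨁ S)
  finite_simples : ∃ (n : ℕ) (S : Fin n → D), ∀ X : D, Simple X → ∃ k, Nonempty (X ≅ S k)

/-- Multifusion categories: finite semisimple `𝕜`-linear abelian rigid monoidal categories with
bilinear tensor product (the unit object need not be simple). -/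
structure IsMultifusion (D : Type u) [Category.{v} D] [Preadditive D] [Linear 𝕜 D]
    [HasFiniteBiproducts D] [MonoidalCategory D] : Prop where
  hasKernels : HasKernels D
  hasCokernels : HasCokernels D
  normalMono : IsNormalMonoCategory D
  normalEpi : IsNormalEpiCategory D
  finiteSemisimple : FiniteSemisimple 𝕜 D
  monoidalPreadditive : MonoidalPreadditive D
  monoidalLinear : MonoidalLinear 𝕜 D
  rigid : ∀ X : D, (∃ Y : D, Nonempty (ExactPairing X Y)) ∧ ∃ Y : D, Nonempty (ExactPairing Y X)

instance homFiniteDimensional {D : Type u} [Category.{v} D] [Preadditive D] [Linear 𝕜 D]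
    [HasFiniteBiproducts D] [FiniteSemisimple 𝕜 D] (X Y : D) : FiniteDimensional 𝕜 (X ⟶ Y) :=
  FiniteSemisimple.finiteDimensional X Y

variable [IsAlgClosed 𝕜] {C : Type u} [Category.{v} C] [Abelian C] [Linear 𝕜 C]
  [FiniteSemisimple 𝕜 C]

/-- For `S` simple, composition `Hom(S, V) × Hom(V, S) → End(S) = 𝕜` is perfect. -/
theorem exists_dual_morphism (S V : C) [Simple S] (φ : (S ⟶ V) →ₗ[𝕜] 𝕜) :
    ∃ g : V ⟶ S, ∀ f : S ⟶ V, f ≫ g = φ f • 𝟙 S := by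
  classical
  obtain ⟨n, T, hT, ⟨e⟩⟩ := FiniteSemisimple.exists_iso_biproduct (𝕜 := 𝕜) V
  have key : ∀ k, ∃ g : T k ⟶ S, ∀ f : S ⟶ T k,
      f ≫ g = φ (f ≫ biproduct.ι T k ≫ e.inv) • 𝟙 S := by
    intro k
    have := hT k
    by_cases h : Nonempty (S ≅ T k)
    · obtain ⟨i⟩ := h
      refine ⟨φ (i.hom ≫ biproduct.ι T k ≫ e.inv) • i.inv, fun f => ?_⟩
      obtain ⟨c, hc⟩ := endomorphism_simple_eq_smul_id 𝕜 (f ≫ i.inv)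
      have hf : f = c • i.hom := by
        have := congrArg (· ≫ i.hom) hc
        simpa using this.symm
      subst hf
      simp [smul_smul, mul_comm]
    · refine ⟨0, fun f => ?_⟩
      have hf : f = 0 := by
        by_contra hne
        have := isIso_of_hom_simple hne
        exact h ⟨asIso f⟩
      subst hf
      simp
  choose g hg using key
  refine ⟨e.hom ≫ ∑ k, biproduct.π T k ≫ g k, fun f => ?_⟩
  have hf : f = ∑ k, (f ≫ e.hom ≫ biproduct.π T k) ≫ biproduct.ι T k ≫ e.inv := by
    calc f = (f ≫ e.hom ≫ (∑ k, biproduct.π T k ≫ biproduct.ι T k)) ≫ e.inv := by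
          rw [biproduct.total]; simp
      _ = _ := by
          simp only [Preadditive.sum_comp, Preadditive.comp_sum, Category.assoc]
  have hφ : φ f = ∑ k, φ ((f ≫ e.hom ≫ biproduct.π T k) ≫ biproduct.ι T k ≫ e.inv) := by
    rw [← map_sum, ← hf]
  rw [hφ, Finset.sum_smul]
  simp only [Preadditive.comp_sum]
  refine Finset.sum_congr rfl fun k _ => ?_
  rw [← hg k]
  simp

/-- A basis of `Hom(S, V)`. -/
def homBasis (S V : C) : Module.Basis (Fin (Module.finrank 𝕜 (S ⟶ V))) 𝕜 (S ⟶ V) :=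
  Module.finBasis 𝕜 (S ⟶ V)

/-- The basis of `Hom(V, S)` dual to `homBasis 𝕜 S V` under composition, for `S` simple:
`homBasis 𝕜 S V m ≫ homDual 𝕜 S V m'` is the identity of `S` if `m = m'` and `0` otherwise. -/
def homDual (S V : C) [Simple S] (m : Fin (Module.finrank 𝕜 (S ⟶ V))) : V ⟶ S :=
  Classical.choose (exists_dual_morphism 𝕜 S V ((homBasis 𝕜 S V).coord m))

variable [MonoidalCategory C] [Simple (𝟙_ C)]

/-- The scalar by which an endomorphism of the unit object acts. -/
def scalar (f : 𝟙_ C ⟶ 𝟙_ C) : 𝕜 := Classical.choose (endomorphism_simple_eq_smul_id 𝕜 f)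

variable [RightRigidCategory C] [PivotalCategory C]

def dim (X : C) : 𝕜 := scalar 𝕜 (rightTrace (𝟙 X))

end Semisimple

/-- Representatives `X i` of the isomorphism classes of simple objects of a pivotal fusion category
together with square roots of their dimensions `d i` and of the global dimension `∑ i, d i ^ 2`,
normalized so that the root attached to the unit object is `1` and dual objects have equal roots. -/
structure SimpleData (𝕜 : Type w) [Field 𝕜] [IsAlgClosed 𝕜] (C : Type u) [Category.{v} C]
    [Abelian C] [Linear 𝕜 C] [FiniteSemisimple 𝕜 C] [MonoidalCategory C] [Simple (𝟙_ C)]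
    [RightRigidCategory C] [PivotalCategory C] where
  ι : Type
  [fintype : Fintype ι]
  X : ι → C
  simple : ∀ i, Simple (X i)
  eq_of_iso : ∀ i j, Nonempty (X i ≅ X j) → i = j
  exists_iso : ∀ S : C, Simple S → ∃ i, Nonempty (S ≅ X i)
  sqrtDim : ι → 𝕜
  sqrtDim_sq : ∀ i, sqrtDim i ^ 2 = dim 𝕜 (X i)
  sqrtDim_unit : ∀ i, Nonempty (X i ≅ 𝟙_ C) → sqrtDim i = 1
  sqrtDim_dual : ∀ i j, Nonempty (X j ≅ (X i)ᘁ) → sqrtDim j = sqrtDim i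
  sqrtGlobalDim : 𝕜
  sqrtGlobalDim_sq : sqrtGlobalDim ^ 2 = ∑ i, dim 𝕜 (X i) ^ 2

attribute [instance] SimpleData.fintype SimpleData.simple

section Modular

variable {𝕜 : Type w} [Field 𝕜] [IsAlgClosed 𝕜] {C : Type u} [Category.{v} C]
  [Abelian C] [Linear 𝕜 C] [FiniteSemisimple 𝕜 C] [MonoidalCategory C] [Simple (𝟙_ C)]
  [BraidedCategory C] [RightRigidCategory C] [PivotalCategory C] (I : SimpleData 𝕜 C)

/-- The `S`-matrix: traces of the double braidings of the simple objects. -/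
def sMatrix : Matrix I.ι I.ι 𝕜 := fun i j =>
  scalar 𝕜 (rightTrace ((β_ (I.X i) (I.X j)).hom ≫ (β_ (I.X j) (I.X i)).hom))

open scoped Classical in
/-- A premodular category is modular if its `S`-matrix is nondegenerate. -/
def IsModular : Prop := (sMatrix I).det ≠ 0

end Modular

/-! ## Pivotal monoidal structures from explicit formulas -/

/-- The raw data (no axioms) of a monoidal category with duals and a pivotal structure. -/
structure PivotalData (D : Type u) [Category.{v} D] where
  tensorObj : D → D → D
  tensorHom : ∀ {X X₁ Y Y₁ : D}, (X ⟶ X₁) → (Y ⟶ Y₁) → (tensorObj X Y ⟶ tensorObj X₁ Y₁)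
  unit : D
  assoc : ∀ X Y Z : D, tensorObj (tensorObj X Y) Z ⟶ tensorObj X (tensorObj Y Z)
  leftUnitor : ∀ X : D, tensorObj unit X ⟶ X
  rightUnitor : ∀ X : D, tensorObj X unit ⟶ X
  dual : D → D
  ev : ∀ X : D, tensorObj (dual X) X ⟶ unit
  coev : ∀ X : D, unit ⟶ tensorObj X (dual X)
  piv : ∀ X : D, X ⟶ dual (dual X)

namespace PivotalData

variable {D : Type u} [Category.{v} D] (T : PivotalData D)

/-- The axioms of a monoidal category. -/
structure IsMonoidal : Prop where
  tensorHom_id : ∀ X Y : D, T.tensorHom (𝟙 X) (𝟙 Y) = 𝟙 (T.tensorObj X Y)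
  tensorHom_comp : ∀ {X₁ Y₁ Z₁ X₂ Y₂ Z₂ : D} (f₁ : X₁ ⟶ Y₁) (f₂ : X₂ ⟶ Y₂) (g₁ : Y₁ ⟶ Z₁)
    (g₂ : Y₂ ⟶ Z₂), T.tensorHom f₁ f₂ ≫ T.tensorHom g₁ g₂ = T.tensorHom (f₁ ≫ g₁) (f₂ ≫ g₂)
  assoc_isIso : ∀ X Y Z : D, IsIso (T.assoc X Y Z)
  leftUnitor_isIso : ∀ X : D, IsIso (T.leftUnitor X)
  rightUnitor_isIso : ∀ X : D, IsIso (T.rightUnitor X)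
  assoc_naturality : ∀ {X₁ X₂ X₃ Y₁ Y₂ Y₃ : D} (f₁ : X₁ ⟶ Y₁) (f₂ : X₂ ⟶ Y₂) (f₃ : X₃ ⟶ Y₃),
    T.tensorHom (T.tensorHom f₁ f₂) f₃ ≫ T.assoc Y₁ Y₂ Y₃ =
      T.assoc X₁ X₂ X₃ ≫ T.tensorHom f₁ (T.tensorHom f₂ f₃)
  leftUnitor_naturality : ∀ {X Y : D} (f : X ⟶ Y),
    T.tensorHom (𝟙 T.unit) f ≫ T.leftUnitor Y = T.leftUnitor X ≫ f
  rightUnitor_naturality : ∀ {X Y : D} (f : X ⟶ Y),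
    T.tensorHom f (𝟙 T.unit) ≫ T.rightUnitor Y = T.rightUnitor X ≫ f
  pentagon : ∀ W X Y Z : D,
    T.tensorHom (T.assoc W X Y) (𝟙 Z) ≫ T.assoc W (T.tensorObj X Y) Z ≫
        T.tensorHom (𝟙 W) (T.assoc X Y Z) =
      T.assoc (T.tensorObj W X) Y Z ≫ T.assoc W X (T.tensorObj Y Z)
  triangle : ∀ X Y : D,
    T.assoc X T.unit Y ≫ T.tensorHom (𝟙 X) (T.leftUnitor Y) = T.tensorHom (T.rightUnitor X) (𝟙 Y)

variable {T}

/-- The monoidal category given by raw data satisfying the axioms. -/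
@[reducible]
def IsMonoidal.monoidalCategory (h : T.IsMonoidal) : MonoidalCategory D where
  tensorObj := T.tensorObj
  tensorHom f g := T.tensorHom f g
  whiskerLeft X _ _ f := T.tensorHom (𝟙 X) f
  whiskerRight f Y := T.tensorHom f (𝟙 Y)
  tensorUnit := T.unit
  associator X Y Z := @asIso _ _ _ _ (T.assoc X Y Z) (h.assoc_isIso X Y Z)
  leftUnitor X := @asIso _ _ _ _ (T.leftUnitor X) (h.leftUnitor_isIso X)
  rightUnitor X := @asIso _ _ _ _ (T.rightUnitor X) (h.rightUnitor_isIso X)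
  tensorHom_def f g := by rw [h.tensorHom_comp]; simp
  id_tensorHom_id := h.tensorHom_id
  tensorHom_comp_tensorHom f₁ f₂ g₁ g₂ := h.tensorHom_comp f₁ f₂ g₁ g₂
  whiskerLeft_id := h.tensorHom_id
  id_whiskerRight := h.tensorHom_id
  associator_naturality f₁ f₂ f₃ := h.assoc_naturality f₁ f₂ f₃
  leftUnitor_naturality f := h.leftUnitor_naturality f
  rightUnitor_naturality f := h.rightUnitor_naturality f
  pentagon := h.pentagon
  triangle := h.triangle

/-- The zigzag identities: `dual X` is a dual of `X` with the given `ev` and `coev`. -/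
structure IsRigid (h : T.IsMonoidal) : Prop where
  coev_ev : letI := h.monoidalCategory
    ∀ X : D, (T.dual X) ◁ (T.coev X : 𝟙_ D ⟶ X ⊗ T.dual X) ≫ (α_ (T.dual X) X (T.dual X)).inv ≫
      (T.ev X : T.dual X ⊗ X ⟶ 𝟙_ D) ▷ (T.dual X) = (ρ_ (T.dual X)).hom ≫ (λ_ (T.dual X)).inv
  ev_coev : letI := h.monoidalCategory
    ∀ X : D, (T.coev X : 𝟙_ D ⟶ X ⊗ T.dual X) ▷ X ≫ (α_ X (T.dual X) X).hom ≫
      X ◁ (T.ev X : T.dual X ⊗ X ⟶ 𝟙_ D) = (λ_ X).hom ≫ (ρ_ X).inv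

@[reducible]
def IsRigid.rightRigidCategory {h : T.IsMonoidal} (hr : T.IsRigid h) :
    @RightRigidCategory D _ h.monoidalCategory :=
  letI := h.monoidalCategory
  { rightDual := fun X =>
      { rightDual := T.dual X
        exact :=
          { coevaluation' := T.coev X
            evaluation' := T.ev X
            coevaluation_evaluation' := hr.coev_ev X
            evaluation_coevaluation' := hr.ev_coev X } } }

/-- The morphisms `piv X : X ⟶ X**` form a monoidal natural isomorphism. -/
structure IsPivotal {h : T.IsMonoidal} (hr : T.IsRigid h) : Prop where
  piv_isIso : ∀ X : D, IsIso (T.piv X)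
  piv_naturality : letI := h.monoidalCategory; letI := hr.rightRigidCategory
    ∀ {X Y : D} (f : X ⟶ Y), f ≫ (T.piv Y : Y ⟶ (Yᘁ)ᘁ) =
      (T.piv X : X ⟶ (Xᘁ)ᘁ) ≫ rightAdjointMate (rightAdjointMate f)
  piv_tensor : letI := h.monoidalCategory; letI := hr.rightRigidCategory
    ∀ X Y : D, (T.piv (X ⊗ Y) : X ⊗ Y ⟶ ((X ⊗ Y)ᘁ)ᘁ) =
      ((T.piv X : X ⟶ (Xᘁ)ᘁ) ⊗ₘ (T.piv Y : Y ⟶ (Yᘁ)ᘁ)) ≫ doubleDualTensor X Y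

@[reducible]
def IsPivotal.pivotalCategory {h : T.IsMonoidal} {hr : T.IsRigid h} (hp : T.IsPivotal hr) :
    @PivotalCategory D _ h.monoidalCategory hr.rightRigidCategory :=
  letI := h.monoidalCategory
  letI := hr.rightRigidCategory
  { piv := fun X => @asIso _ _ _ _ (T.piv X : X ⟶ (Xᘁ)ᘁ) (hp.piv_isIso X)
    piv_naturality := fun f => hp.piv_naturality f
    piv_tensor := fun X Y => hp.piv_tensor X Y }

variable (T) in
/-- The raw data form a pivotal category. -/
structure IsPivotalCategory : Prop where
  monoidal : T.IsMonoidal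
  rigid : T.IsRigid monoidal
  pivotal : T.IsPivotal rigid

end PivotalData

section PivotalFunctor

variable {D : Type*} [Category* D] [MonoidalCategory D] [RightRigidCategory D]
  {E : Type*} [Category* E] [MonoidalCategory E] [RightRigidCategory E]

open Functor.LaxMonoidal Functor.OplaxMonoidal

/-- The canonical isomorphism `F(X*) ≅ F(X)*` of a monoidal functor, as a morphism. -/
def dualComparison (F : D ⥤ E) [F.Monoidal] (X : D) : F.obj Xᘁ ⟶ (F.obj X)ᘁ :=
  (ρ_ _).inv ≫ F.obj Xᘁ ◁ η_ (F.obj X) (F.obj X)ᘁ ≫ (α_ _ _ _).inv ≫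
    (μ F Xᘁ X ≫ F.map (ε_ X Xᘁ) ≫ η F) ▷ (F.obj X)ᘁ ≫ (λ_ _).hom

/-- A monoidal functor is pivotal if it carries the pivotal structure of its source to that of
its target. -/
def IsPivotalFunctor [PivotalCategory D] [PivotalCategory E] (F : D ⥤ E) [F.Monoidal] : Prop :=
  ∀ X : D, F.map (PivotalCategory.piv X).hom ≫ dualComparison F Xᘁ =
    (PivotalCategory.piv (F.obj X)).hom ≫ rightAdjointMate (dualComparison F X)

end PivotalFunctor

/-! ## The Drinfeld center and its reduced tensor product -/

section Center

/-- An object with a family of morphisms `A ⊗ X ⟶ X ⊗ A`, not yet required to be a half-braiding. -/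
structure PreCenter (C : Type u) [Category.{v} C] [MonoidalCategory C] where
  obj : C
  γ : ∀ A : C, A ⊗ obj ⟶ obj ⊗ A

namespace PreCenter

variable {C : Type u} [Category.{v} C] [MonoidalCategory C]

/-- Half-braidings `γ_A : A ⊗ X ≅ X ⊗ A`. -/
structure IsHalfBraiding (P : PreCenter C) : Prop where
  isIso : ∀ A : C, IsIso (P.γ A)
  naturality : ∀ {A B : C} (f : A ⟶ B), f ▷ P.obj ≫ P.γ B = P.γ A ≫ P.obj ◁ f
  hexagon : ∀ A B : C, P.γ (A ⊗ B) =
    (α_ A B P.obj).hom ≫ A ◁ P.γ B ≫ (α_ A P.obj B).inv ≫ P.γ A ▷ B ≫ (α_ P.obj A B).hom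

/-- Morphisms compatible with the half-braidings. -/
def IsHom (P R : PreCenter C) (f : P.obj ⟶ R.obj) : Prop :=
  ∀ A : C, A ◁ f ≫ R.γ A = P.γ A ≫ f ▷ A

/-- Mathlib's center uses the inverses `β_A : X ⊗ A ≅ A ⊗ X` of the half-braidings `γ_A`. -/
def ofCenter (Z : Center C) : PreCenter C := ⟨Z.1, fun A => (Z.2.β A).inv⟩

def toCenter (P : PreCenter C) (h : P.IsHalfBraiding) : Center C :=
  ⟨P.obj,
    { β := fun A => (@asIso _ _ _ _ (P.γ A) (h.isIso A)).symm
      monoidal := fun A B => by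
        have := h.isIso
        rw [← cancel_mono (P.γ (A ⊗ B))]
        simp [h.hexagon]
      naturality := fun {A B} f => by
        have := h.isIso
        simp only [Iso.symm_hom, asIso_inv, IsIso.eq_inv_comp, ← Category.assoc, IsIso.comp_inv_eq]
        exact (h.naturality f).symm }⟩

theorem isHalfBraiding_ofCenter (Z : Center C) : (ofCenter Z).IsHalfBraiding where
  isIso A := by dsimp only [ofCenter]; infer_instance
  naturality {A B} f := by
    dsimp only [ofCenter]
    rw [Iso.eq_inv_comp, ← Category.assoc, Iso.comp_inv_eq]
    exact (Z.2.naturality f).symm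
  hexagon A B := by
    dsimp only [ofCenter]
    rw [← cancel_epi (Z.2.β (A ⊗ B)).hom, Iso.hom_inv_id, Z.2.monoidal]
    simp

end PreCenter

end Center

section Reduced

variable {𝕜 : Type w} [Field 𝕜] [IsAlgClosed 𝕜] {C : Type u} [Category.{v} C]
  [Abelian C] [Linear 𝕜 C] [FiniteSemisimple 𝕜 C] [MonoidalCategory C] [Simple (𝟙_ C)]
  [BraidedCategory C] [RightRigidCategory C] [PivotalCategory C] (I : SimpleData 𝕜 C)

namespace PreCenter

/-- The endomorphism `Q` of `X ⊗ Y` given by the closed strand in the regular coloring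
`∑ i, d i • X i`, divided by the global dimension.  The strand is created between `X` and `Y`; its
left leg goes left under `X` and comes back through `γ`, its right leg goes right through `μ` and
comes back over `Y`, and it is closed between `X` and `Y`. -/
def proj (P R : PreCenter C) : P.obj ⊗ R.obj ⟶ P.obj ⊗ R.obj :=
  (I.sqrtGlobalDim ^ 2)⁻¹ • ∑ i, dim 𝕜 (I.X i) •
    (𝟙 _ ⊗≫ P.obj ◁ η_ (I.X i) (I.X i)ᘁ ▷ R.obj ⊗≫
      (β_ (I.X i) P.obj).inv ▷ ((I.X i)ᘁ ⊗ R.obj) ⊗≫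
      (I.X i ⊗ P.obj) ◁ R.γ (I.X i)ᘁ ⊗≫
      P.γ (I.X i) ▷ (R.obj ⊗ (I.X i)ᘁ) ⊗≫
      (P.obj ⊗ I.X i) ◁ (β_ R.obj (I.X i)ᘁ).hom ⊗≫
      P.obj ◁ pivEv (I.X i) ▷ R.obj ⊗≫ 𝟙 _)

/-- The transformation `A ⊗ (X ⊗ Y) ⟶ (X ⊗ Y) ⊗ A`: the same closed strand, with `A` absorbed by
its left leg (between the two crossings with `X`) and emitted by its right leg.  The strand is
colored by `X i` above and by `X j` below the two vertices; both arcs are in the regular coloring.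
The vertices run over bases of `Hom(A ⊗ X i, X j)` and `Hom((X i)*, (X j)* ⊗ A)` dual under the trace
pairing; the dual under composition used here is `d j` times the dual under the trace pairing,
whence the coefficient `d i` in place of `d i * d j`. -/
def tensorγAux (P R : PreCenter C) (A : C) : A ⊗ (P.obj ⊗ R.obj) ⟶ (P.obj ⊗ R.obj) ⊗ A :=
  (I.sqrtGlobalDim ^ 2)⁻¹ • ∑ i, ∑ j, ∑ m : Fin (Module.finrank 𝕜 (I.X j ⟶ A ⊗ I.X i)),
    dim 𝕜 (I.X i) •
    (𝟙 _ ⊗≫ (A ⊗ P.obj) ◁ η_ (I.X i) (I.X i)ᘁ ▷ R.obj ⊗≫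
      A ◁ (β_ (I.X i) P.obj).inv ▷ ((I.X i)ᘁ ⊗ R.obj) ⊗≫
      (A ⊗ I.X i ⊗ P.obj) ◁ R.γ (I.X i)ᘁ ⊗≫
      homDual 𝕜 (I.X j) (A ⊗ I.X i) m ▷ (P.obj ⊗ R.obj ⊗ (I.X i)ᘁ) ⊗≫
      (I.X j ⊗ P.obj ⊗ R.obj) ◁ rot (homBasis 𝕜 (I.X j) (A ⊗ I.X i) m) ⊗≫
      P.γ (I.X j) ▷ (R.obj ⊗ (I.X j)ᘁ ⊗ A) ⊗≫
      (P.obj ⊗ I.X j) ◁ (β_ R.obj (I.X j)ᘁ).hom ▷ A ⊗≫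
      P.obj ◁ pivEv (I.X j) ▷ (R.obj ⊗ A) ⊗≫ 𝟙 _)

/-- The inclusion of the image of the projection `Q`. -/
def incl (P R : PreCenter C) : image (proj I P R) ⟶ P.obj ⊗ R.obj := image.ι (proj I P R)

/-- The projection onto the image of `Q`. -/
def onto (P R : PreCenter C) : P.obj ⊗ R.obj ⟶ image (proj I P R) :=
  factorThruImage (proj I P R)

/-- The reduced tensor product: the image of `Q` with the transformation `tensorγAux` restricted
to it. -/
def tensor (P R : PreCenter C) : PreCenter C where
  obj := image (proj I P R)
  γ A := A ◁ incl I P R ≫ tensorγAux I P R A ≫ onto I P R ▷ A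

/-- The reduced tensor product of morphisms. -/
def tensorHom {P P₁ R R₁ : PreCenter C} (f : P.obj ⟶ P₁.obj) (g : R.obj ⟶ R₁.obj) :
    (tensor I P R).obj ⟶ (tensor I P₁ R₁).obj :=
  incl I P R ≫ (f ⊗ₘ g) ≫ onto I P₁ R₁

/-- The unit `(⨁ i, X i ⊗ (X i)*, Γ)`.  The component of `Γ_B` from the `i`-th to the `j`-th summand
is `√(d i) √(d j)` times the sum over bases dual under the trace pairing. -/
def unit : PreCenter C where
  obj := ⨁ fun i => I.X i ⊗ (I.X i)ᘁ
  γ B := ∑ i, ∑ j, ∑ m : Fin (Module.finrank 𝕜 (I.X j ⟶ B ⊗ I.X i)),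
    (I.sqrtDim i * I.sqrtDim j * (dim 𝕜 (I.X j))⁻¹) •
    (B ◁ biproduct.π (fun i => I.X i ⊗ (I.X i)ᘁ) i ≫
      (𝟙 _ ⊗≫ homDual 𝕜 (I.X j) (B ⊗ I.X i) m ▷ (I.X i)ᘁ ⊗≫
        I.X j ◁ rot (homBasis 𝕜 (I.X j) (B ⊗ I.X i) m) ⊗≫ 𝟙 _) ≫
      biproduct.ι (fun i => I.X i ⊗ (I.X i)ᘁ) j ▷ B)

/-- The associativity constraint, the restriction of that of `C`. -/
def assoc (P R S : PreCenter C) :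
    (tensor I (tensor I P R) S).obj ⟶ (tensor I P (tensor I R S)).obj :=
  incl I (tensor I P R) S ≫ incl I P R ▷ S.obj ≫ (α_ P.obj R.obj S.obj).hom ≫
    P.obj ◁ onto I R S ≫ onto I P (tensor I R S)

/-- The left unit constraint: `(X i)*` passes over `X` to the right, `X i` passes through `γ`. -/
def leftUnitor (P : PreCenter C) : (tensor I (unit I) P).obj ⟶ P.obj :=
  incl I (unit I) P ≫ ∑ i, (I.sqrtDim i * I.sqrtGlobalDim⁻¹) •
    (biproduct.π (fun i => I.X i ⊗ (I.X i)ᘁ) i ▷ P.obj ≫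
      (𝟙 _ ⊗≫ I.X i ◁ (β_ P.obj (I.X i)ᘁ).inv ⊗≫ P.γ (I.X i) ▷ (I.X i)ᘁ ⊗≫
        P.obj ◁ pivEv (I.X i) ⊗≫ 𝟙 _))

/-- The right unit constraint: `X i` passes under `X` to the left and back through `γ`. -/
def rightUnitor (P : PreCenter C) : (tensor I P (unit I)).obj ⟶ P.obj :=
  incl I P (unit I) ≫ ∑ i, (I.sqrtDim i * I.sqrtGlobalDim⁻¹) •
    (P.obj ◁ biproduct.π (fun i => I.X i ⊗ (I.X i)ᘁ) i ≫
      (𝟙 _ ⊗≫ (β_ (I.X i) P.obj).inv ▷ (I.X i)ᘁ ⊗≫ P.γ (I.X i) ▷ (I.X i)ᘁ ⊗≫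
        P.obj ◁ pivEv (I.X i) ⊗≫ 𝟙 _))

/-- The transformation `A ⊗ X* ⟶ X* ⊗ A` of the dual: `A` crosses under `X*`, then the transpose of
`γ_A` takes it back, and then it crosses over `X*`. -/
def dualγ (P : PreCenter C) (A : C) : A ⊗ P.objᘁ ⟶ P.objᘁ ⊗ A :=
  (β_ A P.objᘁ).hom ⊗≫ (P.objᘁ ⊗ A) ◁ η_ P.obj P.objᘁ ⊗≫ P.objᘁ ◁ P.γ A ▷ P.objᘁ ⊗≫
    ε_ P.obj P.objᘁ ▷ (A ⊗ P.objᘁ) ⊗≫ (β_ P.objᘁ A).inv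

/-- The dual `(X*, γ^∨)`. -/
def dual (P : PreCenter C) : PreCenter C where
  obj := HasRightDual.rightDual P.obj
  γ A := dualγ P A

/-- The evaluation `(X*, γ^∨) ⊗ (X, γ) ⟶ unit`. -/
def ev (P : PreCenter C) : (tensor I (dual P) P).obj ⟶ (unit I).obj :=
  incl I (dual P) P ≫ ∑ i, (I.sqrtDim i * I.sqrtGlobalDim⁻¹) •
    ((𝟙 ((P.objᘁ : C) ⊗ P.obj) ⊗≫ P.objᘁ ◁ η_ (I.X i) (I.X i)ᘁ ▷ P.obj ⊗≫
        (β_ (I.X i) P.objᘁ).inv ▷ ((I.X i)ᘁ ⊗ P.obj) ⊗≫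
        (I.X i ⊗ P.objᘁ) ◁ P.γ (I.X i)ᘁ ⊗≫ I.X i ◁ ε_ P.obj P.objᘁ ▷ (I.X i)ᘁ ⊗≫ 𝟙 _) ≫
      biproduct.ι (fun i => I.X i ⊗ (I.X i)ᘁ) i)

/-- The coevaluation `unit ⟶ (X, γ) ⊗ (X*, γ^∨)`. -/
def coev (P : PreCenter C) : (unit I).obj ⟶ (tensor I P (dual P)).obj :=
  (∑ i, (I.sqrtDim i * I.sqrtGlobalDim⁻¹) •
    (biproduct.π (fun i => I.X i ⊗ (I.X i)ᘁ) i ≫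
      (𝟙 _ ⊗≫ I.X i ◁ η_ P.obj P.objᘁ ▷ (I.X i)ᘁ ⊗≫ P.γ (I.X i) ▷ (P.objᘁ ⊗ (I.X i)ᘁ) ⊗≫
        (P.obj ⊗ I.X i) ◁ (β_ P.objᘁ (I.X i)ᘁ).hom ⊗≫
        P.obj ◁ pivEv (I.X i) ▷ P.objᘁ ⊗≫ 𝟙 (P.obj ⊗ (P.objᘁ : C))))) ≫ onto I P (dual P)

end PreCenter

/-- All the formulas above preserve half-braidings and morphisms of half-braidings: the reduced
tensor product, its constraints and its duals are well defined on the Drinfeld center. -/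
structure ReducedWellDefined : Prop where
  tensor : ∀ P R : PreCenter C, P.IsHalfBraiding → R.IsHalfBraiding →
    (PreCenter.tensor I P R).IsHalfBraiding
  tensorHom : ∀ {P P₁ R R₁ : PreCenter C} (f : P.obj ⟶ P₁.obj) (g : R.obj ⟶ R₁.obj),
    P.IsHalfBraiding → P₁.IsHalfBraiding → R.IsHalfBraiding → R₁.IsHalfBraiding →
    PreCenter.IsHom P P₁ f → PreCenter.IsHom R R₁ g →
    PreCenter.IsHom (PreCenter.tensor I P R) (PreCenter.tensor I P₁ R₁)
      (PreCenter.tensorHom I f g)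
  unit : (PreCenter.unit I).IsHalfBraiding
  assoc : ∀ P R S : PreCenter C, P.IsHalfBraiding → R.IsHalfBraiding → S.IsHalfBraiding →
    PreCenter.IsHom _ _ (PreCenter.assoc I P R S)
  leftUnitor : ∀ P : PreCenter C, P.IsHalfBraiding →
    PreCenter.IsHom _ _ (PreCenter.leftUnitor I P)
  rightUnitor : ∀ P : PreCenter C, P.IsHalfBraiding →
    PreCenter.IsHom _ _ (PreCenter.rightUnitor I P)
  dual : ∀ P : PreCenter C, P.IsHalfBraiding → P.dual.IsHalfBraiding
  ev : ∀ P : PreCenter C, P.IsHalfBraiding → PreCenter.IsHom _ _ (PreCenter.ev I P)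
  coev : ∀ P : PreCenter C, P.IsHalfBraiding → PreCenter.IsHom _ _ (PreCenter.coev I P)
  piv : ∀ P : PreCenter C, P.IsHalfBraiding →
    PreCenter.IsHom P P.dual.dual (PivotalCategory.piv P.obj).hom

end Reduced

/-! ## The Drinfeld center as a `𝕜`-linear category -/

/-- The Drinfeld center: objects with half-braidings `γ_A : A ⊗ X ≅ X ⊗ A`.  (Mathlib's `Center`
uses the inverses `β_A` of the `γ_A` and carries the usual tensor product; this copy is for the
reduced one; the two are equivalent by `toMathlibCenter` below.) -/
structure RedCenter (C : Type u) [Category.{v} C] [MonoidalCategory C] where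
  pre : PreCenter C
  isHalfBraiding : pre.IsHalfBraiding

namespace RedCenter

section Category

variable {C : Type u} [Category.{v} C] [MonoidalCategory C]

/-- Morphisms of the Drinfeld center. -/
@[ext]
structure Hom (X Y : RedCenter C) where
  f : X.pre.obj ⟶ Y.pre.obj
  isHom : PreCenter.IsHom X.pre Y.pre f

instance : Category.{v} (RedCenter C) where
  Hom := Hom
  id X := ⟨𝟙 _, fun A => by simp⟩
  comp {X Y Z} f g := ⟨f.f ≫ g.f, fun A => by
    have hf := f.isHom A
    have hg := g.isHom A
    rw [MonoidalCategory.whiskerLeft_comp, Category.assoc, hg, ← Category.assoc, hf,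
      Category.assoc, MonoidalCategory.comp_whiskerRight]⟩

@[ext]
theorem hom_ext {X Y : RedCenter C} {f g : X ⟶ Y} (h : f.f = g.f) : f = g := Hom.ext h

@[simp]
theorem id_f (X : RedCenter C) : Hom.f (𝟙 X) = 𝟙 X.pre.obj := rfl

@[simp]
theorem comp_f {X Y Z : RedCenter C} (f : X ⟶ Y) (g : Y ⟶ Z) : (f ≫ g).f = f.f ≫ g.f := rfl

/-- The equivalence with Mathlib's center: invert the half-braidings. -/
def toMathlibCenter : RedCenter C ⥤ Center C where
  obj X := X.pre.toCenter X.isHalfBraiding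
  map {X Y} f :=
    { f := f.f
      comm := fun A => by
        have hX := X.isHalfBraiding.isIso A
        have hY := Y.isHalfBraiding.isIso A
        have hf := f.isHom A
        change f.f ▷ A ≫ inv (Y.pre.γ A) = inv (X.pre.γ A) ≫ A ◁ f.f
        rw [IsIso.comp_inv_eq, Category.assoc, hf, IsIso.inv_hom_id_assoc] }

instance : (toMathlibCenter (C := C)).IsEquivalence where
  faithful := ⟨fun h => hom_ext (congrArg Center.Hom.f h)⟩
  full := ⟨fun {X Y} g => ⟨⟨g.f, fun A => by
    have hX := X.isHalfBraiding.isIso A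
    have hY := Y.isHalfBraiding.isIso A
    obtain ⟨g, hg⟩ := g
    replace hg := hg A
    revert g
    change ∀ g : X.pre.obj ⟶ Y.pre.obj, _ →
      g ▷ A ≫ inv (Y.pre.γ A) = inv (X.pre.γ A) ≫ A ◁ g → A ◁ g ≫ Y.pre.γ A = X.pre.γ A ≫ g ▷ A
    intro g _ hg
    rw [IsIso.comp_inv_eq, Category.assoc, IsIso.eq_inv_comp] at hg
    exact hg.symm⟩, rfl⟩⟩
  essSurj := ⟨fun Z => ⟨⟨PreCenter.ofCenter Z, PreCenter.isHalfBraiding_ofCenter Z⟩, ⟨by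
    let f : toMathlibCenter.obj ⟨PreCenter.ofCenter Z, PreCenter.isHalfBraiding_ofCenter Z⟩ ⟶ Z :=
      { f := 𝟙 Z.1
        comm := fun A => by
          change 𝟙 Z.1 ▷ A ≫ (Z.2.β A).hom = inv (Z.2.β A).inv ≫ A ◁ 𝟙 Z.1
          simp }
    have : IsIso f.f := inferInstanceAs (IsIso (𝟙 Z.1))
    exact Center.isoMk f⟩⟩⟩

end Category

section Linear

variable {C : Type u} [Category.{v} C] [MonoidalCategory C] [Preadditive C] [MonoidalPreadditive C]

instance (X Y : RedCenter C) : Zero (X ⟶ Y) := ⟨⟨0, fun A => by simp⟩⟩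

instance (X Y : RedCenter C) : Add (X ⟶ Y) :=
  ⟨fun f g => ⟨f.f + g.f, fun A => by
    have hf := f.isHom A
    have hg := g.isHom A
    simp only [MonoidalPreadditive.add_whiskerRight, MonoidalPreadditive.whiskerLeft_add,
      Preadditive.add_comp, Preadditive.comp_add, hf, hg]⟩⟩

instance (X Y : RedCenter C) : Neg (X ⟶ Y) :=
  ⟨fun f => ⟨-f.f, fun A => by
    have hf := f.isHom A
    have h : (-f.f) ▷ A = -(f.f ▷ A) := (tensorRight A).map_neg (f := f.f)
    have h2 : A ◁ (-f.f) = -(A ◁ f.f) := (tensorLeft A).map_neg (f := f.f)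
    rw [h, h2, Preadditive.neg_comp, Preadditive.comp_neg, hf]⟩⟩

@[simp]
theorem zero_f (X Y : RedCenter C) : Hom.f (0 : X ⟶ Y) = 0 := rfl

@[simp]
theorem add_f {X Y : RedCenter C} (f g : X ⟶ Y) : Hom.f (f + g) = f.f + g.f := rfl

@[simp]
theorem neg_f {X Y : RedCenter C} (f : X ⟶ Y) : Hom.f (-f) = -f.f := rfl

instance (X Y : RedCenter C) : AddCommGroup (X ⟶ Y) where
  nsmul := nsmulRec
  zsmul := zsmulRec
  add_assoc f g h := by ext; simp [add_assoc]
  zero_add f := by ext; simp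
  add_zero f := by ext; simp
  neg_add_cancel f := by ext; simp
  add_comm f g := by ext; simp [add_comm]

instance : Preadditive (RedCenter C) where
  add_comp _ _ _ f f' g := by ext; simp
  comp_add _ _ _ f g g' := by ext; simp

variable {𝕜 : Type w} [Field 𝕜] [Linear 𝕜 C] [MonoidalLinear 𝕜 C]

instance (X Y : RedCenter C) : SMul 𝕜 (X ⟶ Y) :=
  ⟨fun r f => ⟨r • f.f, fun A => by
    have hf := f.isHom A
    simp only [MonoidalLinear.smul_whiskerRight, MonoidalLinear.whiskerLeft_smul,
      Linear.smul_comp, Linear.comp_smul, hf]⟩⟩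

@[simp]
theorem smul_f {X Y : RedCenter C} (r : 𝕜) (f : X ⟶ Y) : Hom.f (r • f) = r • f.f := rfl

instance (X Y : RedCenter C) : Module 𝕜 (X ⟶ Y) where
  one_smul f := by ext; simp
  mul_smul r s f := by ext; simp [mul_smul]
  smul_zero r := by ext; simp
  smul_add r f g := by ext; simp
  add_smul r s f := by ext; simp [add_smul]
  zero_smul f := by ext; simp

instance : Linear 𝕜 (RedCenter C) where
  smul_comp _ _ _ r f g := by ext; simp
  comp_smul _ _ _ f r g := by ext; simp

/-- The underlying morphism, as an additive map. -/
def homToBase (X Y : RedCenter C) : (X ⟶ Y) →+ (X.pre.obj ⟶ Y.pre.obj) where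
  toFun f := f.f
  map_zero' := rfl
  map_add' _ _ := rfl

theorem isHalfBraiding_of_total {n : ℕ} {Z : Fin n → RedCenter C} {P : PreCenter C}
    (ι : ∀ k, (Z k).pre.obj ⟶ P.obj) (π : ∀ k, P.obj ⟶ (Z k).pre.obj)
    (hι : ∀ k, PreCenter.IsHom (Z k).pre P (ι k)) (hπ : ∀ k, PreCenter.IsHom P (Z k).pre (π k))
    (total : ∑ k, π k ≫ ι k = 𝟙 P.obj) : P.IsHalfBraiding := by
  have ext_left : ∀ {A Y : C} {f g : A ⊗ P.obj ⟶ Y}, (∀ k, A ◁ ι k ≫ f = A ◁ ι k ≫ g) → f = g := by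
    intro A Y f g h
    have key : ∀ f : A ⊗ P.obj ⟶ Y, f = ∑ k, A ◁ π k ≫ A ◁ ι k ≫ f := by
      intro f
      simp only [← Category.assoc, ← MonoidalCategory.whiskerLeft_comp]
      rw [← Preadditive.sum_comp, ← whiskerLeft_sum, total]
      simp
    rw [key f, key g]
    simp only [h]
  refine ⟨fun A => ?_, fun {A B} f => ?_, fun A B => ?_⟩
  · have := fun k => (Z k).isHalfBraiding.isIso A
    refine ⟨⟨∑ k, π k ▷ A ≫ inv ((Z k).pre.γ A) ≫ A ◁ ι k, ?_, ?_⟩⟩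
    · rw [Preadditive.comp_sum, ← MonoidalCategory.whiskerLeft_id, ← total, whiskerLeft_sum]
      refine Finset.sum_congr rfl fun k _ => ?_
      rw [← Category.assoc, ← hπ k A]
      simp
    · rw [Preadditive.sum_comp, ← MonoidalCategory.id_whiskerRight, ← total, sum_whiskerRight]
      refine Finset.sum_congr rfl fun k _ => ?_
      rw [Category.assoc, Category.assoc, hι k A]
      simp
  · refine ext_left fun k => ?_
    have h := (Z k).isHalfBraiding.naturality f
    have h1 := hι k A
    have h2 := hι k B
    rw [← Category.assoc, whisker_exchange, Category.assoc, h2, ← Category.assoc, h,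
      ← Category.assoc, h1, Category.assoc, Category.assoc, whisker_exchange]
  · refine ext_left fun k => ?_
    have h := (Z k).isHalfBraiding.hexagon A B
    have h1 := hι k A
    have h2 := hι k B
    rw [hι k (A ⊗ B), h]
    calc _ = (α_ A B (Z k).pre.obj).hom ≫ A ◁ (Z k).pre.γ B ≫ (α_ A (Z k).pre.obj B).inv ≫
          ((Z k).pre.γ A ≫ ι k ▷ A) ▷ B ≫ (α_ P.obj A B).hom := by simp
      _ = (α_ A B (Z k).pre.obj).hom ≫ A ◁ ((Z k).pre.γ B ≫ ι k ▷ B) ≫ (α_ A P.obj B).inv ≫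
          P.γ A ▷ B ≫ (α_ P.obj A B).hom := by rw [← h1]; simp
      _ = _ := by rw [← h2]; simp

section Sum

variable [HasFiniteBiproducts C] {n : ℕ} (Z : Fin n → RedCenter C)

/-- The underlying object of the direct sum. -/
abbrev sumObj : C := ⨁ fun k => (Z k).pre.obj

/-- The inclusion of a summand. -/
abbrev sumι (k : Fin n) : (Z k).pre.obj ⟶ sumObj Z := biproduct.ι (fun k => (Z k).pre.obj) k

/-- The projection to a summand. -/
abbrev sumπ (k : Fin n) : sumObj Z ⟶ (Z k).pre.obj := biproduct.π (fun k => (Z k).pre.obj) k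

/-- The diagonal half-braiding of the direct sum. -/
def sumγ (A : C) : A ⊗ sumObj Z ⟶ sumObj Z ⊗ A :=
  ∑ k, A ◁ sumπ Z k ≫ (Z k).pre.γ A ≫ sumι Z k ▷ A

theorem sumι_sumγ (A : C) (j : Fin n) :
    A ◁ sumι Z j ≫ sumγ Z A = (Z j).pre.γ A ≫ sumι Z j ▷ A := by
  classical
  rw [sumγ, Preadditive.comp_sum, Finset.sum_eq_single j]
  · rw [← Category.assoc, ← MonoidalCategory.whiskerLeft_comp]; simp
  · intro k _ hk
    rw [← Category.assoc, ← MonoidalCategory.whiskerLeft_comp, biproduct.ι_π_ne _ hk.symm]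
    simp
  · simp

theorem sumγ_sumπ (A : C) (j : Fin n) :
    sumγ Z A ≫ sumπ Z j ▷ A = A ◁ sumπ Z j ≫ (Z j).pre.γ A := by
  classical
  rw [sumγ, Preadditive.sum_comp, Finset.sum_eq_single j]
  · simp only [Category.assoc]
    rw [← MonoidalCategory.comp_whiskerRight]; simp
  · intro k _ hk
    simp only [Category.assoc]
    rw [← MonoidalCategory.comp_whiskerRight, biproduct.ι_π_ne _ hk]
    simp
  · simp

/-- The direct sum in the Drinfeld center. -/
def sum : RedCenter C where
  pre := ⟨sumObj Z, sumγ Z⟩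
  isHalfBraiding := isHalfBraiding_of_total (sumι Z) (sumπ Z) (fun k A => sumι_sumγ Z A k)
    (fun k A => (sumγ_sumπ Z A k).symm) biproduct.total

/-- The inclusion of a summand. -/
def inj (k : Fin n) : Z k ⟶ sum Z := ⟨sumι Z k, fun A => sumι_sumγ Z A k⟩

/-- The projection to a summand. -/
def proj (k : Fin n) : sum Z ⟶ Z k := ⟨sumπ Z k, fun A => (sumγ_sumπ Z A k).symm⟩

theorem total : ∑ k, proj Z k ≫ inj Z k = 𝟙 (sum Z) := by
  ext
  have h : homToBase (sum Z) (sum Z) (∑ k, proj Z k ≫ inj Z k) = ∑ k, sumπ Z k ≫ sumι Z k :=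
    map_sum _ _ _
  exact h.trans biproduct.total

instance : HasBiproduct Z :=
  hasBiproduct_of_total
    { pt := sum Z
      π := proj Z
      ι := inj Z
      ι_π := fun j k => by
        by_cases h : j = k
        · subst h
          ext
          rw [dif_pos rfl]
          exact biproduct.ι_π_self _ _
        · rw [dif_neg h]
          ext
          exact biproduct.ι_π_ne _ h } (total Z)

end Sum

instance [HasFiniteBiproducts C] : HasFiniteBiproducts (RedCenter C) where
  out _ := { has_biproduct := fun _ => inferInstance }

end Linear

end RedCenter

/-! ## The reduced tensor product on the Drinfeld center -/

section ReducedData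

variable {𝕜 : Type w} [Field 𝕜] [IsAlgClosed 𝕜] {C : Type u} [Category.{v} C]
  [Abelian C] [Linear 𝕜 C] [FiniteSemisimple 𝕜 C] [MonoidalCategory C] [Simple (𝟙_ C)]
  [BraidedCategory C] [RightRigidCategory C] [PivotalCategory C] (I : SimpleData 𝕜 C)

/-- The reduced tensor product on the Drinfeld center, with its unit, constraints, duals and
pivotal structure. -/
def reducedData (h : ReducedWellDefined I) : PivotalData (RedCenter C) where
  tensorObj X Y := ⟨PreCenter.tensor I X.pre Y.pre,
    h.tensor X.pre Y.pre X.isHalfBraiding Y.isHalfBraiding⟩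
  tensorHom {X X₁ Y Y₁} f g := ⟨PreCenter.tensorHom I f.f g.f,
    h.tensorHom f.f g.f X.isHalfBraiding X₁.isHalfBraiding Y.isHalfBraiding Y₁.isHalfBraiding
      f.isHom g.isHom⟩
  unit := ⟨PreCenter.unit I, h.unit⟩
  assoc X Y Z := ⟨PreCenter.assoc I X.pre Y.pre Z.pre,
    h.assoc X.pre Y.pre Z.pre X.isHalfBraiding Y.isHalfBraiding Z.isHalfBraiding⟩
  leftUnitor X := ⟨PreCenter.leftUnitor I X.pre, h.leftUnitor X.pre X.isHalfBraiding⟩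
  rightUnitor X := ⟨PreCenter.rightUnitor I X.pre, h.rightUnitor X.pre X.isHalfBraiding⟩
  dual X := ⟨X.pre.dual, h.dual X.pre X.isHalfBraiding⟩
  ev X := ⟨PreCenter.ev I X.pre, h.ev X.pre X.isHalfBraiding⟩
  coev X := ⟨PreCenter.coev I X.pre, h.coev X.pre X.isHalfBraiding⟩
  piv X := ⟨(PivotalCategory.piv X.pre.obj).hom, h.piv X.pre X.isHalfBraiding⟩

end ReducedData

/-! ## The product `C ⊠ C` -/

section Box

/-- Pairs `X ⊠ Y` of objects.  Morphisms `X ⊠ Y ⟶ X₁ ⊠ Y₁` are the elements of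
`Hom(X, X₁) ⊗ Hom(Y, Y₁)`. -/
structure BoxPair (𝕜 : Type w) (C : Type u) where
  fst : C
  snd : C

namespace BoxPair

variable {𝕜 : Type w} [Field 𝕜] {C : Type u} [Category.{v} C] [Preadditive C] [Linear 𝕜 C]

instance : Category.{v} (BoxPair 𝕜 C) where
  Hom X Y := (X.fst ⟶ Y.fst) ⊗[𝕜] (X.snd ⟶ Y.snd)
  id X := 𝟙 X.fst ⊗ₜ[𝕜] 𝟙 X.snd
  comp {X Y Z} f g := TensorProduct.map₂ (Linear.comp (S := 𝕜) X.fst Y.fst Z.fst)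
    (Linear.comp (S := 𝕜) X.snd Y.snd Z.snd) f g
  id_comp f := by
    induction f using TensorProduct.induction_on with
    | zero => simp
    | tmul f g => simp
    | add f g hf hg => rw [map_add, hf, hg]
  comp_id f := by
    induction f using TensorProduct.induction_on with
    | zero => simp
    | tmul f g => simp
    | add f g hf hg => rw [map_add, LinearMap.add_apply, hf, hg]
  assoc f g h := by
    induction f using TensorProduct.induction_on with
    | zero => simp
    | add f₁ f₂ h₁ h₂ => simp only [map_add, LinearMap.add_apply, h₁, h₂]
    | tmul f f' =>
      induction g using TensorProduct.induction_on with
      | zero => simp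
      | add g₁ g₂ h₁ h₂ => simp only [map_add, LinearMap.add_apply, h₁, h₂]
      | tmul g g' =>
        induction h using TensorProduct.induction_on with
        | zero => simp
        | add g₁ g₂ h₁ h₂ => simp only [map_add, h₁, h₂]
        | tmul h h' => simp

/-- The pure tensor `f ⊠ g` as a morphism. -/
def homMk {X Y : BoxPair 𝕜 C} (f : X.fst ⟶ Y.fst) (g : X.snd ⟶ Y.snd) : X ⟶ Y := f ⊗ₜ[𝕜] g

instance (X Y : BoxPair 𝕜 C) : AddCommGroup (X ⟶ Y) :=
  inferInstanceAs (AddCommGroup ((X.fst ⟶ Y.fst) ⊗[𝕜] (X.snd ⟶ Y.snd)))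

instance (X Y : BoxPair 𝕜 C) : Module 𝕜 (X ⟶ Y) :=
  inferInstanceAs (Module 𝕜 ((X.fst ⟶ Y.fst) ⊗[𝕜] (X.snd ⟶ Y.snd)))

instance : Preadditive (BoxPair 𝕜 C) where
  add_comp X Y Z f f' g := by
    exact (LinearMap.congr_fun (map_add (TensorProduct.map₂ (Linear.comp (S := 𝕜) X.fst Y.fst Z.fst)
      (Linear.comp (S := 𝕜) X.snd Y.snd Z.snd)) f f') g)
  comp_add X Y Z f g g' := by
    exact (map_add (TensorProduct.map₂ (Linear.comp (S := 𝕜) X.fst Y.fst Z.fst)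
      (Linear.comp (S := 𝕜) X.snd Y.snd Z.snd) f) g g')

instance : Linear 𝕜 (BoxPair 𝕜 C) where
  smul_comp X Y Z r f g := by
    exact (LinearMap.congr_fun (map_smul (TensorProduct.map₂
      (Linear.comp (S := 𝕜) X.fst Y.fst Z.fst) (Linear.comp (S := 𝕜) X.snd Y.snd Z.snd)) r f) g)
  comp_smul X Y Z f r g := by
    exact (map_smul (TensorProduct.map₂ (Linear.comp (S := 𝕜) X.fst Y.fst Z.fst)
      (Linear.comp (S := 𝕜) X.snd Y.snd Z.snd) f) r g)

end BoxPair

section MatLinear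

variable {𝕜 : Type w} [Field 𝕜] {D : Type u} [Category.{v} D] [Preadditive D] [Linear 𝕜 D]

instance (M N : Mat_ D) : Module 𝕜 (M ⟶ N) where
  smul r f := fun i j => r • f i j
  one_smul f := by ext i j; exact one_smul 𝕜 (f i j)
  mul_smul r s f := by ext i j; exact mul_smul r s (f i j)
  smul_zero r := by ext i j; exact smul_zero r
  smul_add r f g := by ext i j; exact smul_add r (f i j) (g i j)
  add_smul r s f := by ext i j; exact add_smul r s (f i j)
  zero_smul f := by ext i j; exact zero_smul 𝕜 (f i j)

@[simp]
theorem mat_smul_apply {M N : Mat_ D} (r : 𝕜) (f : M ⟶ N) (i : M.ι) (j : N.ι) :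
    (r • f) i j = r • f i j := rfl

instance : Linear 𝕜 (Mat_ D) where
  smul_comp _ _ _ r f g := by ext i j; simp [Finset.smul_sum]
  comp_smul _ _ _ f r g := by ext i j; simp [Finset.smul_sum]

end MatLinear

/-- The product `C ⊠ C`: formal finite direct sums of pairs `X ⊠ Y`, with matrices as morphisms.
For a finite semisimple category over an algebraically closed field this is the Deligne product. -/
abbrev Deligne (𝕜 : Type w) [Field 𝕜] (C : Type u) [Category.{v} C] [Preadditive C] [Linear 𝕜 C] :=
  Mat_ (BoxPair 𝕜 C)

end Box

section DeligneReduced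

variable {𝕜 : Type w} [Field 𝕜] {C : Type u} [Category.{v} C]
  [Abelian C] [Linear 𝕜 C] [FiniteSemisimple 𝕜 C] [MonoidalCategory C] [MonoidalPreadditive C]
  [MonoidalLinear 𝕜 C]

namespace Deligne

variable (𝕜) in
/-- The dimension of `⟨Y, W⟩ = Hom(𝟙, Y ⊗ W)`. -/
abbrev mult (Y W : C) : ℕ := Module.finrank 𝕜 (𝟙_ C ⟶ Y ⊗ W)

/-- The matrix entries of the linear maps `⟨g, f⟩ : ⟨Y, W⟩ → ⟨Y₁, W₁⟩`. -/
def multEntry {Y Y₁ W W₁ : C} (m : Fin (mult 𝕜 Y W)) (m₁ : Fin (mult 𝕜 Y₁ W₁)) :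
    (Y ⟶ Y₁) →ₗ[𝕜] (W ⟶ W₁) →ₗ[𝕜] 𝕜 :=
  LinearMap.mk₂ 𝕜 (fun g f => (homBasis 𝕜 (𝟙_ C) (Y₁ ⊗ W₁)).coord m₁
      (homBasis 𝕜 (𝟙_ C) (Y ⊗ W) m ≫ (g ⊗ₘ f)))
    (fun g g' f => by
      rw [MonoidalPreadditive.add_tensor, Preadditive.comp_add, map_add])
    (fun r g f => by
      rw [MonoidalCategory.tensorHom_def, MonoidalLinear.smul_whiskerRight, Linear.smul_comp,
        Linear.comp_smul, map_smul, ← MonoidalCategory.tensorHom_def])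
    (fun g f f' => by
      rw [MonoidalPreadditive.tensor_add, Preadditive.comp_add, map_add])
    (fun r g f => by
      rw [MonoidalCategory.tensorHom_def, MonoidalLinear.whiskerLeft_smul, Linear.comp_smul,
        Linear.comp_smul, map_smul, ← MonoidalCategory.tensorHom_def])

/-- The bilinear extension of `(f₁ ⊠ g₁, f₂ ⊠ g₂) ↦ ⟨g₁, f₂⟩ • f₁ ⊠ g₂`, for one matrix entry of
`⟨g₁, f₂⟩`. -/
def tensorEntry {A A₁ B B₁ : BoxPair 𝕜 C} (f : A ⟶ A₁) (g : B ⟶ B₁)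
    (m : Fin (mult 𝕜 A.snd B.fst)) (m₁ : Fin (mult 𝕜 A₁.snd B₁.fst)) :
    (⟨A.fst, B.snd⟩ : BoxPair 𝕜 C) ⟶ ⟨A₁.fst, B₁.snd⟩ :=
  TensorProduct.lid 𝕜 _
    (TensorProduct.map (TensorProduct.lift (multEntry m m₁)) LinearMap.id
      (TensorProduct.tensorTensorTensorComm 𝕜 (A.snd ⟶ A₁.snd) (A.fst ⟶ A₁.fst)
        (B.fst ⟶ B₁.fst) (B.snd ⟶ B₁.snd)
        ((TensorProduct.comm 𝕜 (A.fst ⟶ A₁.fst) (A.snd ⟶ A₁.snd) f) ⊗ₜ[𝕜] g)))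

theorem tensorEntry_homMk {A A₁ B B₁ : BoxPair 𝕜 C} (f₁ : A.fst ⟶ A₁.fst) (g₁ : A.snd ⟶ A₁.snd)
    (f₂ : B.fst ⟶ B₁.fst) (g₂ : B.snd ⟶ B₁.snd)
    (m : Fin (mult 𝕜 A.snd B.fst)) (m₁ : Fin (mult 𝕜 A₁.snd B₁.fst)) :
    tensorEntry (BoxPair.homMk f₁ g₁ : A ⟶ A₁) (BoxPair.homMk f₂ g₂ : B ⟶ B₁) m m₁ =
      (homBasis 𝕜 (𝟙_ C) (A₁.snd ⊗ B₁.fst)).coord m₁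
        (homBasis 𝕜 (𝟙_ C) (A.snd ⊗ B.fst) m ≫ (g₁ ⊗ₘ f₂)) •
        (BoxPair.homMk f₁ g₂ : (⟨A.fst, B.snd⟩ : BoxPair 𝕜 C) ⟶ ⟨A₁.fst, B₁.snd⟩) := rfl

/-- The reduced tensor product `(W₁ ⊠ Y₁, W₂ ⊠ Y₂) ↦ ⟨Y₁, W₂⟩ • W₁ ⊠ Y₂`, extended to direct sums. -/
def tensorObj (M N : Deligne 𝕜 C) : Deligne 𝕜 C where
  ι := Σ i : M.ι, Σ j : N.ι, Fin (mult 𝕜 (M.X i).snd (N.X j).fst)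
  X p := ⟨(M.X p.1).fst, (N.X p.2.1).snd⟩

def tensorHom {M M₁ N N₁ : Deligne 𝕜 C} (f : M ⟶ M₁) (g : N ⟶ N₁) :
    tensorObj M N ⟶ tensorObj M₁ N₁ :=
  fun p q => tensorEntry (f p.1 q.1) (g p.2.1 q.2.1) p.2.2 q.2.2

open scoped Classical in
/-- The morphism of direct sums that maps the summand `a` identically to the summand `e a`. -/
def relabel {A B : Deligne 𝕜 C} (e : A.ι → B.ι) (he : ∀ a, A.X a = B.X (e a)) : A ⟶ B :=
  fun a b => if h : e a = b then eqToHom ((he a).trans (congrArg B.X h)) else 0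

/-- The associativity constraint matches the summands `⟨Y₁, W₂⟩ ⟨Y₂, W₃⟩ W₁ ⊠ Y₃`. -/
def assoc (M N P : Deligne 𝕜 C) :
    tensorObj (tensorObj M N) P ⟶ tensorObj M (tensorObj N P) :=
  relabel (fun p => ⟨p.1.1, ⟨p.1.2.1, p.2.1, p.2.2⟩, p.1.2.2⟩) (fun _ => rfl)

open scoped Classical in
/-- The morphism of direct sums that maps the summand `i` to the summand `e i` by `f i`. -/
def diag {M N : Deligne 𝕜 C} (e : M.ι → N.ι) (f : ∀ i, M.X i ⟶ N.X (e i)) : M ⟶ N :=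
  fun i j => if h : e i = j then f i ≫ eqToHom (congrArg N.X h) else 0

variable [RightRigidCategory C]

/-- The dual `W ⊠ Y ↦ Y* ⊠ W*`, extended to direct sums. -/
def dual (M : Deligne 𝕜 C) : Deligne 𝕜 C where
  ι := M.ι
  X i := ⟨HasRightDual.rightDual (M.X i).snd, HasRightDual.rightDual (M.X i).fst⟩

variable [IsAlgClosed 𝕜] [Simple (𝟙_ C)] [PivotalCategory C] (I : SimpleData 𝕜 C)

/-- The unit `⨁ k, X k ⊠ (X k)*`. -/
def unit : Deligne 𝕜 C where
  ι := I.ι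
  X k := ⟨I.X k, HasRightDual.rightDual (I.X k)⟩

/-- The bijection `⟨(X k)*, W⟩ → Hom(X k, W)`. -/
def bendLeft (k : I.ι) (W : C) (b : 𝟙_ C ⟶ (I.X k)ᘁ ⊗ W) : I.X k ⟶ W :=
  𝟙 _ ⊗≫ I.X k ◁ b ⊗≫ pivEv (I.X k) ▷ W ⊗≫ 𝟙 _

/-- The bijection `⟨Y, X k⟩ → Hom((X k)*, Y)`. -/
def bendRight (k : I.ι) (Y : C) (b : 𝟙_ C ⟶ Y ⊗ I.X k) : (I.X k)ᘁ ⟶ Y :=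
  𝟙 _ ⊗≫ b ▷ (I.X k)ᘁ ⊗≫ Y ◁ pivEv (I.X k) ⊗≫ 𝟙 _

/-- The left unit constraint.  On the summand `⟨(X k)*, W⟩ • X k ⊠ Y` of `unit ⊗ (W ⊠ Y)` it is `√(d k)`
times the canonical map `⟨(X k)*, W⟩ = Hom(X k, W)`, `b ↦ b ⊠ 𝟙`. -/
def leftUnitor (M : Deligne 𝕜 C) : tensorObj (unit I) M ⟶ M :=
  diag (fun p => p.2.1) (fun p =>
    I.sqrtDim p.1 • (BoxPair.homMk
      (bendLeft I p.1 (M.X p.2.1).fst (homBasis 𝕜 (𝟙_ C) ((I.X p.1)ᘁ ⊗ (M.X p.2.1).fst) p.2.2))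
      (𝟙 (M.X p.2.1).snd) : (⟨I.X p.1, (M.X p.2.1).snd⟩ : BoxPair 𝕜 C) ⟶ M.X p.2.1))

/-- The right unit constraint.  On the summand `⟨Y, X k⟩ • W ⊠ (X k)*` of `(W ⊠ Y) ⊗ unit` it is
`√(d k)` times the canonical map `⟨Y, X k⟩ = Hom((X k)*, Y)`, `b ↦ 𝟙 ⊠ b`. -/
def rightUnitor (M : Deligne 𝕜 C) : tensorObj M (unit I) ⟶ M :=
  diag (fun p => p.1) (fun p =>
    I.sqrtDim p.2.1 • (BoxPair.homMk (𝟙 (M.X p.1).fst)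
      (bendRight I p.2.1 (M.X p.1).snd (homBasis 𝕜 (𝟙_ C) ((M.X p.1).snd ⊗ I.X p.2.1) p.2.2)) :
        (⟨(M.X p.1).fst, HasRightDual.rightDual (I.X p.2.1)⟩ : BoxPair 𝕜 C) ⟶ M.X p.1))

open scoped Classical in
/-- The evaluation.  On the summand `⟨W*, W⟩ • Y* ⊠ Y` of `(W ⊠ Y)* ⊗ (W ⊠ Y)` it is the evaluation of
`W` times `∑ k, √(d k) ∑ t, α_t ⊠ α^t`, for bases of `Hom(Y*, X k)` and `Hom(Y, (X k)*)` dual under the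
trace pairing.  The dual under composition used here is `d k` times the dual under the trace
pairing. -/
def ev (M : Deligne 𝕜 C) : tensorObj (dual M) M ⟶ unit I :=
  fun p (k : I.ι) => if h : p.2.1 = p.1 then
    scalar 𝕜 (homBasis 𝕜 (𝟙_ C) ((M.X p.1).fstᘁ ⊗ (M.X p.2.1).fst) p.2.2 ≫
      (M.X p.1).fstᘁ ◁ eqToHom (congrArg (fun i => (M.X i).fst) h) ≫
        ε_ (M.X p.1).fst (M.X p.1).fstᘁ) •
    ∑ t : Fin (Module.finrank 𝕜 (I.X k ⟶ (M.X p.1).sndᘁ)),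
      (I.sqrtDim k * (dim 𝕜 (I.X k))⁻¹) • (BoxPair.homMk
        (homDual 𝕜 (I.X k) (M.X p.1).sndᘁ t)
        (eqToHom (congrArg (fun i => (M.X i).snd) h) ≫
          (PivotalCategory.piv (M.X p.1).snd).hom ≫
            rightAdjointMate (homBasis 𝕜 (I.X k) (M.X p.1).sndᘁ t)) :
        (⟨HasRightDual.rightDual (M.X p.1).snd, (M.X p.2.1).snd⟩ : BoxPair 𝕜 C) ⟶
          ⟨I.X k, HasRightDual.rightDual (I.X k)⟩)
  else 0

open scoped Classical in
/-- The coevaluation.  To the summand `⟨Y, Y*⟩ • W ⊠ W*` of `(W ⊠ Y) ⊗ (W ⊠ Y)*` it is the coevaluation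
of `Y` times `∑ k, √(d k) ∑ t, α_t ⊠ α^t`, for bases of `Hom(X k, W)` and `Hom((X k)*, W*)` dual under
the trace pairing. -/
def coev (M : Deligne 𝕜 C) : unit I ⟶ tensorObj M (dual M) :=
  fun (k : I.ι) p => if h : p.1 = p.2.1 then
    (homBasis 𝕜 (𝟙_ C) ((M.X p.1).snd ⊗ (M.X p.2.1).sndᘁ)).coord p.2.2
      (η_ (M.X p.1).snd (M.X p.1).sndᘁ ≫
        (M.X p.1).snd ◁ eqToHom (congrArg (fun i => HasRightDual.rightDual (M.X i).snd) h)) •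
    ∑ t : Fin (Module.finrank 𝕜 (I.X k ⟶ (M.X p.1).fst)),
      (I.sqrtDim k * (dim 𝕜 (I.X k))⁻¹) • (BoxPair.homMk
        (homBasis 𝕜 (I.X k) (M.X p.1).fst t)
        (rightAdjointMate (homDual 𝕜 (I.X k) (M.X p.1).fst t) ≫
          eqToHom (congrArg (fun i => HasRightDual.rightDual (M.X i).fst) h)) :
        (⟨I.X k, HasRightDual.rightDual (I.X k)⟩ : BoxPair 𝕜 C) ⟶
          ⟨(M.X p.1).fst, HasRightDual.rightDual (M.X p.2.1).fst⟩)
  else 0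

/-- The pivotal structure, `δ_W ⊠ δ_Y` on `W ⊠ Y`. -/
def piv (M : Deligne 𝕜 C) : M ⟶ dual (dual M) :=
  diag (fun i => i) (fun i => BoxPair.homMk
    (PivotalCategory.piv (M.X i).fst).hom (PivotalCategory.piv (M.X i).snd).hom)

end Deligne

/-- The reduced tensor product on `C ⊠ C`, with its unit, constraints, duals and pivotal
structure. -/
def deligneData [IsAlgClosed 𝕜] [RightRigidCategory C] [Simple (𝟙_ C)] [PivotalCategory C] (I : SimpleData 𝕜 C) :
    PivotalData (Deligne 𝕜 C) where
  tensorObj := Deligne.tensorObj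
  tensorHom f g := Deligne.tensorHom f g
  unit := Deligne.unit I
  assoc := Deligne.assoc
  leftUnitor := Deligne.leftUnitor I
  rightUnitor := Deligne.rightUnitor I
  dual := Deligne.dual
  ev := Deligne.ev I
  coev := Deligne.coev I
  piv := Deligne.piv

end DeligneReduced

/-! ## The functor `K` -/

section FunctorK

namespace PreCenter

variable {C : Type u} [Category.{v} C] [MonoidalCategory C] [BraidedCategory C]

/-- The object `W ⊗ Y` with the half-braiding in which the strand `A` passes under `W` (by the braiding) and
then over `Y` (by the inverse braiding). -/
def box (W Y : C) : PreCenter C where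
  obj := W ⊗ Y
  γ A := (α_ A W Y).inv ≫ (β_ A W).hom ▷ Y ≫ (α_ W A Y).hom ≫ W ◁ (β_ Y A).inv ≫ (α_ W Y A).inv

theorem isHalfBraiding_box (W Y : C) : (box W Y).IsHalfBraiding where
  isIso A := by dsimp only [box]; infer_instance
  naturality {A B} f := by
    dsimp only [box]
    calc _ = 𝟙 _ ⊗≫ (f ▷ W ≫ (β_ B W).hom) ▷ Y ⊗≫ W ◁ (β_ Y B).inv ⊗≫ 𝟙 _ := by monoidal
      _ = 𝟙 _ ⊗≫ (β_ A W).hom ▷ Y ⊗≫ W ◁ (f ▷ Y ≫ (β_ Y B).inv) ⊗≫ 𝟙 _ := by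
        rw [BraidedCategory.braiding_naturality_left]; monoidal
      _ = _ := by rw [BraidedCategory.braiding_inv_naturality_left]; monoidal
  hexagon A B := by
    dsimp only [box]
    rw [BraidedCategory.braiding_tensor_left_hom, BraidedCategory.braiding_tensor_right_inv]
    calc _ = 𝟙 _ ⊗≫ A ◁ (β_ B W).hom ▷ Y ⊗≫
          ((β_ A W).hom ▷ (B ⊗ Y) ≫ (W ⊗ A) ◁ (β_ Y B).inv) ⊗≫
            W ◁ (β_ Y A).inv ▷ B ⊗≫ 𝟙 _ := by monoidal
      _ = _ := by rw [← whisker_exchange]; monoidal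

theorem isHom_box {W W₁ Y Y₁ : C} (f : W ⟶ W₁) (g : Y ⟶ Y₁) :
    IsHom (box W Y) (box W₁ Y₁) (f ⊗ₘ g) := by
  intro A
  dsimp only [box]
  calc _ = 𝟙 _ ⊗≫ A ◁ W ◁ g ⊗≫ (A ◁ f ≫ (β_ A W₁).hom) ▷ Y₁ ⊗≫ W₁ ◁ (β_ Y₁ A).inv ⊗≫ 𝟙 _ := by
        rw [MonoidalCategory.tensorHom_def']; monoidal
    _ = 𝟙 _ ⊗≫ ((A ⊗ W) ◁ g ≫ (β_ A W).hom ▷ Y₁) ⊗≫ f ▷ (A ⊗ Y₁) ⊗≫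
          W₁ ◁ (β_ Y₁ A).inv ⊗≫ 𝟙 _ := by
        rw [BraidedCategory.braiding_naturality_right]; monoidal
    _ = 𝟙 _ ⊗≫ (β_ A W).hom ▷ Y ⊗≫ (W ◁ A ◁ g ≫ f ▷ (A ⊗ Y₁)) ⊗≫
          W₁ ◁ (β_ Y₁ A).inv ⊗≫ 𝟙 _ := by
        rw [whisker_exchange]; monoidal
    _ = 𝟙 _ ⊗≫ (β_ A W).hom ▷ Y ⊗≫ f ▷ (A ⊗ Y) ⊗≫ W₁ ◁ (A ◁ g ≫ (β_ Y₁ A).inv) ⊗≫ 𝟙 _ := by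
        rw [whisker_exchange]; monoidal
    _ = 𝟙 _ ⊗≫ (β_ A W).hom ▷ Y ⊗≫ (f ▷ (A ⊗ Y) ≫ W₁ ◁ (β_ Y A).inv) ⊗≫ W₁ ◁ g ▷ A ⊗≫ 𝟙 _ := by
        rw [BraidedCategory.braiding_inv_naturality_right]; monoidal
    _ = _ := by rw [← whisker_exchange, MonoidalCategory.tensorHom_def]; monoidal

end PreCenter

variable {𝕜 : Type w} [Field 𝕜] {C : Type u} [Category.{v} C] [Preadditive C] [Linear 𝕜 C]
  [MonoidalCategory C] [MonoidalPreadditive C] [MonoidalLinear 𝕜 C] [BraidedCategory C]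

variable (𝕜) in
/-- The linear extension of `f ⊠ g ↦ f ⊗ g`. -/
def boxHom (W W₁ Y Y₁ : C) :
    (W ⟶ W₁) ⊗[𝕜] (Y ⟶ Y₁) →ₗ[𝕜]
      ((⟨PreCenter.box W Y, PreCenter.isHalfBraiding_box W Y⟩ : RedCenter C) ⟶
        ⟨PreCenter.box W₁ Y₁, PreCenter.isHalfBraiding_box W₁ Y₁⟩) :=
  TensorProduct.lift (LinearMap.mk₂ 𝕜 (fun f g => ⟨f ⊗ₘ g, PreCenter.isHom_box f g⟩)
    (fun f f' g => RedCenter.hom_ext (MonoidalPreadditive.add_tensor f f' g))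
    (fun r f g => RedCenter.hom_ext (by
      change (r • f) ⊗ₘ g = r • (f ⊗ₘ g)
      rw [MonoidalCategory.tensorHom_def, MonoidalLinear.smul_whiskerRight, Linear.smul_comp,
        ← MonoidalCategory.tensorHom_def]))
    (fun f g g' => RedCenter.hom_ext (MonoidalPreadditive.tensor_add f g g'))
    (fun r f g => RedCenter.hom_ext (by
      change f ⊗ₘ (r • g) = r • (f ⊗ₘ g)
      rw [MonoidalCategory.tensorHom_def, MonoidalLinear.whiskerLeft_smul, Linear.comp_smul,
        ← MonoidalCategory.tensorHom_def])))

/-- The functor `W ⊠ Y ↦ (W ⊗ Y, c c⁻¹)`, `f ⊠ g ↦ f ⊗ g`. -/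
def boxFunctor : BoxPair 𝕜 C ⥤ RedCenter C where
  obj P := ⟨PreCenter.box P.fst P.snd, PreCenter.isHalfBraiding_box P.fst P.snd⟩
  map {P R} f := boxHom 𝕜 P.fst R.fst P.snd R.snd f
  map_id P := RedCenter.hom_ext (MonoidalCategory.id_tensorHom_id P.fst P.snd)
  map_comp {P R S} f g := by
    let φ := TensorProduct.map₂ (Linear.comp (S := 𝕜) P.fst R.fst S.fst)
      (Linear.comp (S := 𝕜) P.snd R.snd S.snd)
    change boxHom 𝕜 P.fst S.fst P.snd S.snd (φ f g) = _
    induction f using TensorProduct.induction_on with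
    | zero =>
      rw [map_zero, LinearMap.zero_apply, map_zero, map_zero]
      exact Limits.zero_comp.symm
    | add f₁ f₂ h₁ h₂ =>
      rw [map_add, LinearMap.add_apply, map_add, map_add, h₁, h₂]
      exact (Preadditive.add_comp _ _ _ _ _ _).symm
    | tmul f f' =>
      induction g using TensorProduct.induction_on with
      | zero =>
        rw [map_zero, map_zero, map_zero]
        exact Limits.comp_zero.symm
      | add g₁ g₂ h₁ h₂ =>
        rw [map_add, map_add, map_add, h₁, h₂]
        exact (Preadditive.comp_add _ _ _ _ _ _).symm
      | tmul g g' =>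
        exact RedCenter.hom_ext (MonoidalCategory.tensorHom_comp_tensorHom f f' g g').symm

instance : (boxFunctor (𝕜 := 𝕜) (C := C)).Additive where
  map_add {P R f g} := map_add (boxHom 𝕜 P.fst R.fst P.snd R.snd) f g

variable [HasFiniteBiproducts C]

/-- The functor `K`, the additive extension of `W ⊠ Y ↦ (W ⊗ Y, c c⁻¹)` to direct sums. -/
def functorK : Deligne 𝕜 C ⥤ RedCenter C where
  obj M := ⨁ fun i => boxFunctor.obj (M.X i)
  map f := biproduct.matrix fun i j => boxFunctor.map (f i j)
  map_id M := by
    classical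
    apply biproduct.hom_ext'
    intro i
    apply biproduct.hom_ext
    intro j
    by_cases h : i = j
    · subst h
      simp
    · simp [h]
  map_comp {M N P} f g := by
    classical
    apply biproduct.hom_ext'
    intro i
    apply biproduct.hom_ext
    intro j
    simp [biproduct.lift_desc, Functor.map_sum]

instance : (functorK (𝕜 := 𝕜) (C := C)).Additive where
  map_add {M N f g} := by
    have h : (biproduct.matrix fun i j => boxFunctor.map ((f + g) i j)) =
        (biproduct.matrix fun i j => boxFunctor.map (f i j)) +
          biproduct.matrix fun i j => boxFunctor.map (g i j) := by
      apply biproduct.hom_ext'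
      intro i
      apply biproduct.hom_ext
      intro j
      simp only [Category.assoc, biproduct.matrix_π, biproduct.ι_desc, Preadditive.add_comp, Preadditive.comp_add,
        Mat_.add_apply, Functor.map_add]
    exact h

instance : (functorK (𝕜 := 𝕜) (C := C)).Linear 𝕜 where
  map_smul {M N} f r := by
    have h : (biproduct.matrix fun i j => boxFunctor.map ((r • f) i j)) =
        r • (biproduct.matrix fun i j => boxFunctor.map (f i j)) := by
      apply biproduct.hom_ext'
      intro i
      apply biproduct.hom_ext
      intro j
      simp only [Category.assoc, biproduct.matrix_π, biproduct.ι_desc, Linear.smul_comp, Linear.comp_smul,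
        mat_smul_apply]
      exact map_smul (boxHom 𝕜 (M.X i).fst (N.X j).fst (M.X i).snd (N.X j).snd) r (f i j)
    exact h

end FunctorK

section Structure

variable {𝕜 : Type w} [Field 𝕜] [IsAlgClosed 𝕜] {C : Type u} [Category.{v} C]
  [Abelian C] [Linear 𝕜 C] [FiniteSemisimple 𝕜 C] [MonoidalCategory C] [MonoidalPreadditive C]
  [MonoidalLinear 𝕜 C] [Simple (𝟙_ C)] [BraidedCategory C] [RightRigidCategory C]
  [PivotalCategory C] (I : SimpleData 𝕜 C)

/-- The tensor structure `K(M) ⊗ K(N) ⟶ K(M ⊗ N)` for the reduced tensor products.  From the summand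
`(W₁ ⊗ Y₁) ⊗ (W₂ ⊗ Y₂)` to `⟨Y₁, W₂⟩ • W₁ ⊗ Y₂` it is the sum over a basis of `⟨Y₁, W₂⟩` and the dual basis
of `Hom(Y₁ ⊗ W₂, 𝟙)`, the latter applied to the two middle strands. -/
def tensorK (M N : Deligne 𝕜 C) :
    (PreCenter.tensor I (functorK.obj M).pre (functorK.obj N).pre).obj ⟶
      (functorK.obj (Deligne.tensorObj M N)).pre.obj :=
  PreCenter.incl I (functorK.obj M).pre (functorK.obj N).pre ≫
    ∑ p : (Deligne.tensorObj M N).ι,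
      ((biproduct.π (fun i => boxFunctor.obj (M.X i)) p.1).f ⊗ₘ
        (biproduct.π (fun j => boxFunctor.obj (N.X j)) p.2.1).f) ≫
      (𝟙 (((M.X p.1).fst ⊗ (M.X p.1).snd) ⊗ (N.X p.2.1).fst ⊗ (N.X p.2.1).snd) ⊗≫
        (M.X p.1).fst ◁
          homDual 𝕜 (𝟙_ C) ((M.X p.1).snd ⊗ (N.X p.2.1).fst) p.2.2 ▷ (N.X p.2.1).snd ⊗≫
        𝟙 ((M.X p.1).fst ⊗ (N.X p.2.1).snd)) ≫
      (biproduct.ι (fun p => boxFunctor.obj ((Deligne.tensorObj M N).X p)) p).f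

/-- The `S`-matrix as a morphism `X i ⊗ (X i)* ⟶ X j ⊗ (X j)*`: the cup on `X i` and the cap on `X j`,
linked.  The strand `X i` passes over `X j`, and `(X j)*` passes over `(X i)*`. -/
def clasp (i j : I.ι) : I.X i ⊗ (I.X i)ᘁ ⟶ I.X j ⊗ (I.X j)ᘁ :=
  𝟙 _ ⊗≫ I.X i ◁ η_ (I.X j) (I.X j)ᘁ ▷ (I.X i)ᘁ ⊗≫
    (β_ (I.X j) (I.X i)).inv ▷ ((I.X j)ᘁ ⊗ (I.X i)ᘁ) ⊗≫
    (I.X j ⊗ I.X i) ◁ (β_ (I.X i)ᘁ (I.X j)ᘁ).inv ⊗≫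
    I.X j ◁ pivEv (I.X i) ▷ (I.X j)ᘁ ⊗≫ 𝟙 _

/-- The unit isomorphism `K(unit) ⟶ unit`, the `S`-matrix divided by the root of the global
dimension. -/
def unitK : (functorK.obj (Deligne.unit I)).pre.obj ⟶ (PreCenter.unit I).obj :=
  I.sqrtGlobalDim⁻¹ • ∑ i, ∑ j, (I.sqrtDim i * I.sqrtDim j) •
    ((biproduct.π (fun k => boxFunctor.obj ((Deligne.unit I).X k)) i).f ≫ clasp I i j ≫
      biproduct.ι (fun j => I.X j ⊗ (I.X j)ᘁ) j)

end Structure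

end ReducedTensor

end

set_option linter.unusedSectionVars false

noncomputable section

namespace ReducedTensor

local prefix:max "†" => HasRightDual.rightDual

section PivotalLemmas

variable {D : Type u} [Category.{v} D] [MonoidalCategory D] [RightRigidCategory D]

theorem coev_zigzag (X : D) : 𝟙 X ⊗≫ η_ X Xᘁ ▷ X ⊗≫ X ◁ ε_ X Xᘁ ⊗≫ 𝟙 X = 𝟙 X := by
  calc _ = 𝟙 X ⊗≫ (η_ X Xᘁ ▷ X ≫ (α_ _ _ _).hom ≫ X ◁ ε_ X Xᘁ) ⊗≫ 𝟙 X := by monoidal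
    _ = _ := by rw [ExactPairing.evaluation_coevaluation]; monoidal

theorem ev_zigzag (X : D) : 𝟙 Xᘁ ⊗≫ Xᘁ ◁ η_ X Xᘁ ⊗≫ ε_ X Xᘁ ▷ Xᘁ ⊗≫ 𝟙 Xᘁ = 𝟙 Xᘁ := by
  calc _ = 𝟙 Xᘁ ⊗≫ (Xᘁ ◁ η_ X Xᘁ ≫ (α_ _ _ _).inv ≫ ε_ X Xᘁ ▷ Xᘁ) ⊗≫ 𝟙 Xᘁ := by monoidal
    _ = _ := by rw [ExactPairing.coevaluation_evaluation]; monoidal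

theorem dual_hom_ext {X Z : D} {f g : Z ⟶ Xᘁ} (h : f ▷ X ≫ ε_ X Xᘁ = g ▷ X ≫ ε_ X Xᘁ) : f = g := by
  have key : ∀ f : Z ⟶ Xᘁ, f = 𝟙 Z ⊗≫ Z ◁ η_ X Xᘁ ⊗≫ (f ▷ X ≫ ε_ X Xᘁ) ▷ Xᘁ ⊗≫ 𝟙 _ := by
    intro f
    calc f = f ≫ (𝟙 Xᘁ ⊗≫ Xᘁ ◁ η_ X Xᘁ ⊗≫ ε_ X Xᘁ ▷ Xᘁ ⊗≫ 𝟙 Xᘁ) := by rw [ev_zigzag]; simp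
      _ = 𝟙 Z ⊗≫ (f ▷ 𝟙_ D ≫ Xᘁ ◁ η_ X Xᘁ) ⊗≫ ε_ X Xᘁ ▷ Xᘁ ⊗≫ 𝟙 _ := by monoidal
      _ = _ := by rw [← whisker_exchange]; monoidal
  rw [key f, key g, h]

theorem rightDualTensorIso_inv_ev (X Y : D) :
    (rightDualTensorIso X Y).inv ▷ (X ⊗ Y) ≫ ε_ (X ⊗ Y) (X ⊗ Y)ᘁ =
      𝟙 _ ⊗≫ †Y ◁ ε_ X Xᘁ ▷ Y ⊗≫ ε_ Y Yᘁ := by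
  have h := @rightAdjointMate_comp_evaluation D _ _ (X ⊗ Y) (X ⊗ Y) inferInstance ⟨Yᘁ ⊗ Xᘁ⟩ (𝟙 _)
  rw [MonoidalCategory.whiskerLeft_id, Category.id_comp] at h
  exact h

theorem coev_rightDualTensorIso_hom (X Y : D) :
    η_ (X ⊗ Y) (X ⊗ Y)ᘁ ≫ (X ⊗ Y) ◁ (rightDualTensorIso X Y).hom =
      η_ X Xᘁ ⊗≫ X ◁ η_ Y Yᘁ ▷ †X ⊗≫ 𝟙 (((X ⊗ Y) ⊗ †Y ⊗ †X)) := by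
  have h := @coevaluation_comp_rightAdjointMate D _ _ (X ⊗ Y) (X ⊗ Y) ⟨Yᘁ ⊗ Xᘁ⟩ inferInstance (𝟙 _)
  rw [MonoidalCategory.id_whiskerRight, Category.comp_id] at h
  refine h.trans ?_
  refine (ExactPairing.tensor_coevaluation (Y₁ := †X) (Y₂ := †Y)).trans ?_
  monoidal

variable [PivotalCategory D]

open PivotalCategory

theorem pivEv_natural {V W : D} (f : V ⟶ W) :
    f ▷ Wᘁ ≫ pivEv W = V ◁ rightAdjointMate f ≫ pivEv V := by
  rw [pivEv, pivEv, ← comp_whiskerRight_assoc, piv_naturality, comp_whiskerRight_assoc,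
    rightAdjointMate_comp_evaluation, whisker_exchange_assoc]

theorem pivEv_zigzag (X : D) : 𝟙 X ⊗≫ X ◁ pivCoev X ⊗≫ pivEv X ▷ X ⊗≫ 𝟙 X = 𝟙 X := by
  calc _ = 𝟙 X ⊗≫ X ◁ η_ Xᘁ (Xᘁ)ᘁ ⊗≫ X ◁ Xᘁ ◁ (piv X).inv ⊗≫ (piv X).hom ▷ (Xᘁ ⊗ X) ⊗≫
        ε_ Xᘁ (Xᘁ)ᘁ ▷ X ⊗≫ 𝟙 X := by rw [pivEv, pivCoev]; monoidal
    _ = 𝟙 X ⊗≫ X ◁ η_ Xᘁ (Xᘁ)ᘁ ⊗≫ (X ◁ Xᘁ ◁ (piv X).inv ≫ (piv X).hom ▷ (Xᘁ ⊗ X)) ⊗≫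
        ε_ Xᘁ (Xᘁ)ᘁ ▷ X ⊗≫ 𝟙 X := by monoidal
    _ = 𝟙 X ⊗≫ (X ◁ η_ Xᘁ (Xᘁ)ᘁ ≫ (piv X).hom ▷ (Xᘁ ⊗ (Xᘁ)ᘁ)) ⊗≫
        (†(†X) ⊗ Xᘁ) ◁ (piv X).inv ⊗≫ ε_ Xᘁ (Xᘁ)ᘁ ▷ X ⊗≫ 𝟙 X := by
      rw [whisker_exchange]; monoidal
    _ = 𝟙 X ⊗≫ (piv X).hom ⊗≫ †(†X) ◁ η_ Xᘁ (Xᘁ)ᘁ ⊗≫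
        ((†(†X) ⊗ Xᘁ) ◁ (piv X).inv ≫ ε_ Xᘁ (Xᘁ)ᘁ ▷ X) ⊗≫ 𝟙 X := by
      rw [whisker_exchange]; monoidal
    _ = 𝟙 X ⊗≫ (piv X).hom ⊗≫ (𝟙 (†(†X)) ⊗≫ †(†X) ◁ η_ Xᘁ (Xᘁ)ᘁ ⊗≫
        ε_ Xᘁ (Xᘁ)ᘁ ▷ (†(†X)) ⊗≫ 𝟙 (†(†X))) ⊗≫ (piv X).inv ⊗≫ 𝟙 X := by
      rw [whisker_exchange]; monoidal
    _ = 𝟙 X ⊗≫ ((piv X).hom ≫ (piv X).inv) ⊗≫ 𝟙 X := by rw [ev_zigzag]; monoidal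
    _ = _ := by rw [Iso.hom_inv_id]; monoidal

theorem pivCoev_zigzag (X : D) :
    𝟙 Xᘁ ⊗≫ pivCoev X ▷ Xᘁ ⊗≫ †X ◁ pivEv X ⊗≫ 𝟙 Xᘁ = 𝟙 Xᘁ := by
  calc _ = 𝟙 Xᘁ ⊗≫ η_ Xᘁ (Xᘁ)ᘁ ▷ †X ⊗≫ †X ◁ ((piv X).inv ≫ (piv X).hom) ▷ †X ⊗≫
        †X ◁ ε_ Xᘁ (Xᘁ)ᘁ ⊗≫ 𝟙 Xᘁ := by rw [pivEv, pivCoev]; monoidal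
    _ = 𝟙 Xᘁ ⊗≫ η_ Xᘁ (Xᘁ)ᘁ ▷ †X ⊗≫ †X ◁ ε_ Xᘁ (Xᘁ)ᘁ ⊗≫ 𝟙 Xᘁ := by
      rw [Iso.inv_hom_id]; monoidal
    _ = _ := coev_zigzag _

theorem pivEv_tensor (X Y : D) :
    (X ⊗ Y) ◁ (rightDualTensorIso X Y).inv ≫ pivEv (X ⊗ Y) =
      𝟙 _ ⊗≫ X ◁ pivEv Y ▷ Xᘁ ⊗≫ pivEv X := by
  rw [pivEv, piv_tensor, doubleDualTensor]
  have h : rightAdjointMate (rightDualTensorIso X Y).hom ▷ (X ⊗ Y)ᘁ ≫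
      ε_ (X ⊗ Y)ᘁ ((X ⊗ Y)ᘁ)ᘁ = _ ◁ (rightDualTensorIso X Y).hom ≫ ε_ (†Y ⊗ Xᘁ) _ :=
    rightAdjointMate_comp_evaluation _
  rw [comp_whiskerRight, Category.assoc, comp_whiskerRight, Category.assoc, h,
    ← whisker_exchange_assoc, ← whisker_exchange_assoc, ← MonoidalCategory.whiskerLeft_comp_assoc, Iso.inv_hom_id,
    MonoidalCategory.whiskerLeft_id, Category.id_comp, rightDualTensorIso_inv_ev,
    MonoidalCategory.tensorHom_def']
  calc _ = 𝟙 _ ⊗≫ X ◁ (piv Y).hom ▷ (†Y ⊗ †X) ⊗≫ ((piv X).hom ▷ (†(†Y) ⊗ Yᘁ) ≫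
        †(†X) ◁ ε_ Yᘁ (Yᘁ)ᘁ) ▷ †X ⊗≫ ε_ Xᘁ (Xᘁ)ᘁ := by monoidal
    _ = _ := by rw [← whisker_exchange]; simp only [pivEv]; monoidal

theorem rightTrace_comm {X Y : D} (f : X ⟶ Y) (g : Y ⟶ X) :
    rightTrace (f ≫ g) = rightTrace (g ≫ f) := by
  rw [rightTrace, rightTrace, comp_whiskerRight, Category.assoc, pivEv_natural, comp_whiskerRight,
    Category.assoc, ← whisker_exchange_assoc, ← coevaluation_comp_rightAdjointMate_assoc]

theorem rightTrace_tensor {X Y : D} (f : X ⊗ Y ⟶ X ⊗ Y) :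
    rightTrace f = η_ X Xᘁ ⊗≫ X ◁ η_ Y Yᘁ ▷ Xᘁ ⊗≫ f ▷ (†Y ⊗ Xᘁ) ⊗≫
      X ◁ pivEv Y ▷ Xᘁ ⊗≫ pivEv X := by
  have h : rightTrace f = η_ (X ⊗ Y) (X ⊗ Y)ᘁ ≫ (X ⊗ Y) ◁ (rightDualTensorIso X Y).hom ≫
      f ▷ _ ≫ (X ⊗ Y) ◁ (rightDualTensorIso X Y).inv ≫ pivEv (X ⊗ Y) := by
    rw [rightTrace, ← whisker_exchange_assoc, ← MonoidalCategory.whiskerLeft_comp_assoc]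
    simp
  rw [h, pivEv_tensor]
  rw [← Category.assoc, coev_rightDualTensorIso_hom]
  monoidal

theorem rightTrace_tensorHom {X Y : D} (f : X ⟶ X) (g : Y ⟶ Y) :
    rightTrace (f ⊗ₘ g) = η_ X Xᘁ ⊗≫ f ▷ Xᘁ ⊗≫ X ◁ rightTrace g ▷ Xᘁ ⊗≫ pivEv X := by
  rw [rightTrace_tensor, rightTrace, MonoidalCategory.tensorHom_def]
  calc _ = η_ X †X ⊗≫ (X ◁ η_ Y †Y ≫ f ▷ (Y ⊗ †Y)) ▷ †X ⊗≫ X ◁ g ▷ (†Y ⊗ †X) ⊗≫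
      X ◁ pivEv Y ▷ †X ⊗≫ pivEv X := by monoidal
    _ = _ := by rw [whisker_exchange]; monoidal

end PivotalLemmas


section Unit

variable {D : Type u} [Category.{v} D] [MonoidalCategory D]

theorem unit_whiskerLeft_eq_whiskerRight {U : D} (i : 𝟙_ D ≅ U) (f : 𝟙_ D ⟶ 𝟙_ D) :
    𝟙 U ⊗≫ U ◁ f ⊗≫ 𝟙 U = 𝟙 U ⊗≫ f ▷ U ⊗≫ 𝟙 U := by
  calc _ = (i.inv ≫ i.hom) ⊗≫ U ◁ f ⊗≫ 𝟙 U := by rw [i.inv_hom_id]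
    _ = i.inv ⊗≫ (i.hom ▷ 𝟙_ D ≫ U ◁ f) ⊗≫ 𝟙 U := by monoidal
    _ = i.inv ⊗≫ (f ▷ 𝟙_ D ≫ 𝟙_ D ◁ i.hom) ⊗≫ 𝟙 U := by rw [← whisker_exchange]; monoidal
    _ = 𝟙 U ⊗≫ (𝟙_ D ◁ i.inv ≫ f ▷ 𝟙_ D) ⊗≫ i.hom ⊗≫ 𝟙 U := by monoidal
    _ = 𝟙 U ⊗≫ f ▷ U ⊗≫ (i.inv ≫ i.hom) ⊗≫ 𝟙 U := by rw [whisker_exchange]; monoidal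
    _ = _ := by rw [i.inv_hom_id]; monoidal

end Unit

section PivDual

variable {D : Type u} [Category.{v} D] [MonoidalCategory D] [RightRigidCategory D]
  [PivotalCategory D]

open PivotalCategory

theorem isIso_of_iso_unit {X : D} (f : 𝟙_ D ≅ X) : IsIso (η_ X Xᘁ) ∧ IsIso (ε_ X Xᘁ) := by
  let e : †X ⟶ 𝟙_ D := 𝟙 _ ⊗≫ †X ◁ f.hom ⊗≫ ε_ X Xᘁ
  let g : 𝟙_ D ⟶ †X := η_ X Xᘁ ⊗≫ f.inv ▷ †X ⊗≫ 𝟙 _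
  have h1 : e ≫ g = 𝟙 _ := by
    dsimp only [e, g]
    calc _ = 𝟙 _ ⊗≫ †X ◁ f.hom ⊗≫ (ε_ X Xᘁ ▷ 𝟙_ D ≫ 𝟙_ D ◁ η_ X Xᘁ) ⊗≫ f.inv ▷ †X ⊗≫ 𝟙 _ := by
          monoidal
      _ = 𝟙 _ ⊗≫ †X ◁ (f.hom ▷ 𝟙_ D ≫ X ◁ η_ X Xᘁ) ⊗≫ (ε_ X Xᘁ ▷ (X ⊗ †X) ≫ 𝟙_ D ◁ f.inv ▷ †X)
          ⊗≫ 𝟙 _ := by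
          rw [← whisker_exchange]; monoidal
      _ = 𝟙 _ ⊗≫ †X ◁ η_ X Xᘁ ⊗≫ †X ◁ ((f.hom ▷ X ≫ X ◁ f.inv)) ▷ †X ⊗≫ ε_ X Xᘁ ▷ †X
          ⊗≫ 𝟙 _ := by
          rw [← whisker_exchange, ← whisker_exchange]; monoidal
      _ = 𝟙 _ ⊗≫ †X ◁ η_ X Xᘁ ⊗≫ †X ◁ (f.inv ≫ f.hom) ▷ †X ⊗≫ ε_ X Xᘁ ▷ †X
          ⊗≫ 𝟙 _ := by
          rw [← whisker_exchange]; monoidal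
      _ = 𝟙 †X ⊗≫ †X ◁ η_ X Xᘁ ⊗≫ ε_ X Xᘁ ▷ †X ⊗≫ 𝟙 †X := by rw [f.inv_hom_id]; monoidal
      _ = 𝟙 _ := ev_zigzag X
  have h2 : g ≫ e = 𝟙 _ := by
    dsimp only [e, g]
    calc _ = η_ X Xᘁ ⊗≫ (f.inv ▷ (†X ⊗ 𝟙_ D) ≫ 𝟙_ D ◁ (†X ◁ f.hom)) ⊗≫ ε_ X Xᘁ := by
          monoidal
      _ = 𝟙 (𝟙_ D) ⊗≫ (η_ X Xᘁ ▷ 𝟙_ D ≫ (X ⊗ †X) ◁ f.hom) ⊗≫ (f.inv ▷ (†X ⊗ X) ≫ 𝟙_ D ◁ ε_ X Xᘁ) ⊗≫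
          𝟙 (𝟙_ D) := by
          rw [← whisker_exchange]; monoidal
      _ = 𝟙 _ ⊗≫ f.hom ⊗≫ (𝟙 X ⊗≫ η_ X Xᘁ ▷ X ⊗≫ X ◁ ε_ X Xᘁ ⊗≫ 𝟙 X) ⊗≫ f.inv ⊗≫ 𝟙 _ := by
          rw [← whisker_exchange, ← whisker_exchange]; monoidal
      _ = 𝟙 _ ⊗≫ (f.hom ≫ f.inv) ⊗≫ 𝟙 _ := by rw [coev_zigzag]; monoidal
      _ = 𝟙 _ := by rw [f.hom_inv_id]; monoidal
  have he : IsIso e := ⟨g, h1, h2⟩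
  have hg : IsIso g := ⟨e, h2, h1⟩
  constructor
  · have : η_ X Xᘁ = g ≫ (λ_ _).inv ≫ f.hom ▷ †X := by
      dsimp only [g]
      calc _ = η_ X Xᘁ ⊗≫ (f.inv ≫ f.hom) ▷ †X ⊗≫ 𝟙 _ := by rw [f.inv_hom_id]; monoidal
        _ = _ := by monoidal
    rw [this]; infer_instance
  · have : ε_ X Xᘁ = †X ◁ f.inv ≫ (ρ_ _).hom ≫ e := by
      dsimp only [e]
      calc _ = 𝟙 _ ⊗≫ †X ◁ (f.inv ≫ f.hom) ⊗≫ ε_ X Xᘁ := by rw [f.inv_hom_id]; monoidal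
        _ = _ := by monoidal
    rw [this]; infer_instance

theorem isIso_pivEv_of_iso_unit {X : D} (f : 𝟙_ D ≅ X) : IsIso (pivEv X) := by
  have h := (isIso_of_iso_unit f).1
  have h1 : IsIso (f.inv ▷ †X) := inferInstance
  have h2 := (isIso_of_iso_unit (asIso (η_ X Xᘁ) ≪≫ asIso (f.inv ▷ †X) ≪≫ λ_ _)).2
  rw [pivEv]
  infer_instance

theorem rightTrace_of_iso_unit {U : D} (i : 𝟙_ D ≅ U) : rightTrace (𝟙 U) = 𝟙 (𝟙_ D) := by
  have h : IsIso (rightTrace (𝟙 U)) := by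
    have h1 := (isIso_of_iso_unit i).1
    have h2 := isIso_pivEv_of_iso_unit i
    rw [rightTrace, id_whiskerRight, Category.id_comp]
    infer_instance
  rw [← cancel_mono (rightTrace (𝟙 U)), Category.id_comp]
  have h2 : rightTrace (𝟙 (U ⊗ U)) = rightTrace (𝟙 U) := by
    have := rightTrace_comm (U ◁ i.inv ≫ (ρ_ U).hom) ((ρ_ U).inv ≫ U ◁ i.hom)
    simpa [← MonoidalCategory.whiskerLeft_comp_assoc] using this
  rw [← MonoidalCategory.id_tensorHom_id, rightTrace_tensorHom] at h2
  refine Eq.trans ?_ h2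
  calc _ = 𝟙 _ ⊗≫ (rightTrace (𝟙 U) ▷ 𝟙_ D ≫ 𝟙_ D ◁ η_ U Uᘁ) ⊗≫ pivEv U := by
          conv_lhs => enter [2]; rw [rightTrace]
          monoidal
    _ = 𝟙 _ ⊗≫ η_ U Uᘁ ⊗≫ (𝟙 U ⊗≫ rightTrace (𝟙 U) ▷ U ⊗≫ 𝟙 U) ▷ †U ⊗≫ pivEv U := by
      rw [← whisker_exchange]; monoidal
    _ = _ := by
      rw [← unit_whiskerLeft_eq_whiskerRight i]; monoidal

/-- The evaluation `X* ⊗ X** ⟶ 𝟙` attached to `X*` by the pivotal structure. -/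
theorem pivEv_dual (X : D) : pivEv (†X) = †X ◁ (piv X).inv ≫ ε_ X †X := by
  let u : †(†X) ⟶ X := 𝟙 _ ⊗≫ η_ X †X ▷ †(†X) ⊗≫ X ◁ pivEv (†X) ⊗≫ 𝟙 _
  have key : ∀ {U : D} (i : 𝟙_ D ≅ U), u ▷ †X ≫ pivEv X = ε_ †X †(†X) := by
    intro U i
    have hU := rightTrace_of_iso_unit i
    have h1 := pivEv_natural (i.inv ≫ η_ X †X)
    have hm : (i.inv ≫ η_ X †X) ▷ ((†(†X)) ⊗ †X) ⊗≫ X ◁ pivEv †X ▷ †X ⊗≫ pivEv X =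
        U ◁ ((rightDualTensorIso X †X).inv ≫ rightAdjointMate (i.inv ≫ η_ X †X)) ≫ pivEv U := by
      rw [MonoidalCategory.whiskerLeft_comp, Category.assoc, ← h1, whisker_exchange_assoc, pivEv_tensor]
      monoidal
    have h2 : (rightDualTensorIso X †X).inv ≫ rightAdjointMate (i.inv ≫ η_ X †X) =
        𝟙 _ ⊗≫ ε_ †X †(†X) ⊗≫ (η_ U †U ⊗≫ i.inv ▷ †U ⊗≫ 𝟙 _) := by
      apply dual_hom_ext
      rw [comp_whiskerRight, Category.assoc, rightAdjointMate_comp_evaluation,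
        ← whisker_exchange_assoc, rightDualTensorIso_inv_ev]
      calc _ = 𝟙 _ ⊗≫ (†(†X) ⊗ †X) ◁ i.inv ⊗≫ †(†X) ◁ (𝟙 †X ⊗≫ †X ◁ η_ X †X ⊗≫
            ε_ X †X ▷ †X ⊗≫ 𝟙 †X) ⊗≫ ε_ †X †(†X) := by monoidal
        _ = 𝟙 _ ⊗≫ ((†(†X) ⊗ †X) ◁ i.inv ≫ ε_ †X †(†X) ▷ 𝟙_ D) ⊗≫ 𝟙 _ := by
            rw [ev_zigzag]; monoidal
        _ = 𝟙 _ ⊗≫ ε_ †X †(†X) ▷ U ⊗≫ (𝟙 U ⊗≫ η_ U †U ▷ U ⊗≫ U ◁ ε_ U †U ⊗≫ 𝟙 U) ⊗≫ i.inv := by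
            rw [whisker_exchange, coev_zigzag]; monoidal
        _ = 𝟙 _ ⊗≫ ε_ †X †(†X) ▷ U ⊗≫ η_ U †U ▷ U ⊗≫ (U ◁ ε_ U †U ≫ i.inv ▷ 𝟙_ D) ⊗≫ 𝟙 (𝟙_ D) := by
            monoidal
        _ = _ := by rw [whisker_exchange]; monoidal
    rw [h2] at hm
    calc _ = 𝟙 (†(†X) ⊗ †X) ⊗≫ (i.hom ≫ i.inv) ▷ (†(†X) ⊗ †X) ⊗≫ η_ X †X ▷ ((†(†X)) ⊗ †X) ⊗≫
          X ◁ pivEv †X ▷ †X ⊗≫ pivEv X := by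
          rw [i.hom_inv_id]; dsimp only [u]; monoidal
      _ = 𝟙 (†(†X) ⊗ †X) ⊗≫ i.hom ▷ (†(†X) ⊗ †X) ⊗≫ ((i.inv ≫ η_ X †X) ▷ ((†(†X)) ⊗ †X) ⊗≫
          X ◁ pivEv †X ▷ †X ⊗≫ pivEv X) := by monoidal
      _ = 𝟙 (†(†X) ⊗ †X) ⊗≫ (i.hom ▷ (†(†X) ⊗ †X) ≫ U ◁ ε_ †X †(†X)) ⊗≫ U ◁ η_ U †U ⊗≫
          U ◁ i.inv ▷ †U ⊗≫ pivEv U := by rw [hm]; monoidal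
      _ = ε_ †X †(†X) ⊗≫ (i.hom ▷ 𝟙_ D ≫ U ◁ η_ U †U) ⊗≫
          U ◁ i.inv ▷ †U ⊗≫ pivEv U := by rw [← whisker_exchange]; monoidal
      _ = ε_ †X †(†X) ⊗≫ η_ U †U ⊗≫ (i.hom ▷ U ≫ U ◁ i.inv) ▷ †U ⊗≫ pivEv U := by
          rw [← whisker_exchange]; monoidal
      _ = ε_ †X †(†X) ⊗≫ η_ U †U ⊗≫ (i.inv ≫ i.hom) ▷ †U ⊗≫ pivEv U := by
          rw [← whisker_exchange]; monoidal
      _ = ε_ †X †(†X) ⊗≫ (η_ U †U ≫ (𝟙 U) ▷ †U ≫ pivEv U) := by rw [i.inv_hom_id]; monoidal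
      _ = _ := by rw [← rightTrace, hU]; monoidal
  have h := key (Iso.refl _)
  have h3 : u = (piv X).inv := by
    rw [← cancel_mono (piv X).hom, Iso.inv_hom_id]
    apply dual_hom_ext
    rw [comp_whiskerRight, Category.assoc, ← pivEv, h]
    simp
  rw [← h3]
  dsimp only [u]
  calc _ = (𝟙 †X ⊗≫ †X ◁ η_ X Xᘁ ⊗≫ ε_ X Xᘁ ▷ †X ⊗≫ 𝟙 †X) ▷ †(†X) ⊗≫ pivEv †X := by
        rw [ev_zigzag]; monoidal
    _ = 𝟙 _ ⊗≫ †X ◁ η_ X Xᘁ ▷ †(†X) ⊗≫ (ε_ X Xᘁ ▷ (†X ⊗ †(†X)) ≫ _ ◁ pivEv †X) ⊗≫ 𝟙 _ := by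
        monoidal
    _ = _ := by rw [← whisker_exchange]; monoidal

theorem ev_eq_pivEv_dual (X : D) : ε_ X †X = †X ◁ (piv X).hom ≫ pivEv (†X) := by
  rw [pivEv_dual, ← MonoidalCategory.whiskerLeft_comp_assoc]; simp

theorem rightTrace_dual (X : D) : rightTrace (𝟙 (†X)) = leftTrace (𝟙 X) := by
  rw [rightTrace, leftTrace, pivEv_dual, pivCoev]
  simp

theorem rightTrace_rightDual {T : D} (f : †T ⟶ †T) :
    rightTrace f = pivCoev T ≫ f ▷ T ≫ ε_ T †T := by
  rw [rightTrace, pivEv_dual, pivCoev, ← whisker_exchange_assoc, Category.assoc]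

/-- The morphism `S* ⊗ A ⟶ T*` obtained by bending a morphism `A ⊗ T ⟶ S`. -/
def unrot {S A T : D} (p : A ⊗ T ⟶ S) : †S ⊗ A ⟶ †T :=
  𝟙 _ ⊗≫ (†S ⊗ A) ◁ η_ T †T ⊗≫ †S ◁ p ▷ †T ⊗≫ ε_ S †S ▷ †T ⊗≫ 𝟙 _

theorem rightTrace_rot_unrot {S A T : D} (q : S ⟶ A ⊗ T) (p : A ⊗ T ⟶ S) :
    rightTrace (rot q ≫ unrot p) = leftTrace (q ≫ p) := by
  rw [rightTrace_rightDual, rot, unrot, leftTrace]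
  calc _ = pivCoev T ⊗≫ pivCoev S ▷ (†T ⊗ T) ⊗≫ †S ◁ q ▷ (†T ⊗ T) ⊗≫
        (†S ⊗ A) ◁ (pivEv T ⊗≫ η_ T †T) ▷ T ⊗≫
        †S ◁ p ▷ (†T ⊗ T) ⊗≫ (ε_ S †S ▷ (†T ⊗ T) ≫ 𝟙_ D ◁ ε_ T †T) ⊗≫ 𝟙 _ := by monoidal
    _ = pivCoev T ⊗≫ pivCoev S ▷ (†T ⊗ T) ⊗≫ †S ◁ q ▷ (†T ⊗ T) ⊗≫
        (†S ⊗ A) ◁ (pivEv T ⊗≫ η_ T †T) ▷ T ⊗≫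
        †S ◁ (p ▷ (†T ⊗ T) ≫ S ◁ ε_ T †T) ⊗≫ ε_ S †S := by rw [← whisker_exchange]; monoidal
    _ = pivCoev T ⊗≫ pivCoev S ▷ (†T ⊗ T) ⊗≫ †S ◁ q ▷ (†T ⊗ T) ⊗≫
        (†S ⊗ A) ◁ pivEv T ▷ T ⊗≫ (†S ⊗ A) ◁ (𝟙 T ⊗≫ η_ T †T ▷ T ⊗≫ T ◁ ε_ T †T ⊗≫ 𝟙 T) ⊗≫
        †S ◁ p ⊗≫ ε_ S †S := by rw [← whisker_exchange]; monoidal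
    _ = 𝟙 (𝟙_ D) ⊗≫ (𝟙_ D ◁ pivCoev T ≫ pivCoev S ▷ (†T ⊗ T)) ⊗≫ †S ◁ q ▷ (†T ⊗ T) ⊗≫
        (†S ⊗ A) ◁ pivEv T ▷ T ⊗≫ †S ◁ p ⊗≫ ε_ S †S := by rw [coev_zigzag]; monoidal
    _ = pivCoev S ⊗≫ †S ◁ (S ◁ pivCoev T ≫ q ▷ (†T ⊗ T)) ⊗≫
        (†S ⊗ A) ◁ pivEv T ▷ T ⊗≫ †S ◁ p ⊗≫ ε_ S †S := by rw [whisker_exchange]; monoidal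
    _ = pivCoev S ⊗≫ †S ◁ q ⊗≫ (†S ⊗ A) ◁ (𝟙 T ⊗≫ T ◁ pivCoev T ⊗≫ pivEv T ▷ T ⊗≫ 𝟙 T) ⊗≫
        †S ◁ p ⊗≫ ε_ S †S := by rw [whisker_exchange]; monoidal
    _ = _ := by rw [pivEv_zigzag]; monoidal

/-- The inverse of the rotation `rot`. -/
def rotInv {S A T : D} (r : †T ⟶ †S ⊗ A) : S ⟶ A ⊗ T :=
  𝟙 _ ⊗≫ S ◁ pivCoev T ⊗≫ S ◁ r ▷ T ⊗≫ pivEv S ▷ (A ⊗ T) ⊗≫ 𝟙 _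

theorem rot_rotInv {S A T : D} (r : †T ⟶ †S ⊗ A) : rot (rotInv r) = r := by
  rw [rot, rotInv]
  calc _ = 𝟙 _ ⊗≫ pivCoev S ▷ †T ⊗≫ (†S ⊗ S) ◁ pivCoev T ▷ †T ⊗≫ (†S ⊗ S) ◁ r ▷ (T ⊗ †T) ⊗≫
        †S ◁ (pivEv S ▷ (A ⊗ T ⊗ †T) ≫ 𝟙_ D ◁ (A ◁ pivEv T)) ⊗≫ 𝟙 _ := by monoidal
    _ = 𝟙 _ ⊗≫ pivCoev S ▷ †T ⊗≫ (†S ⊗ S) ◁ pivCoev T ▷ †T ⊗≫ (†S ⊗ S) ◁ (r ▷ (T ⊗ †T) ≫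
        (†S ⊗ A) ◁ pivEv T) ⊗≫ †S ◁ pivEv S ▷ A ⊗≫ 𝟙 _ := by rw [← whisker_exchange]; monoidal
    _ = 𝟙 _ ⊗≫ pivCoev S ▷ †T ⊗≫ (†S ⊗ S) ◁ (𝟙 †T ⊗≫ pivCoev T ▷ †T ⊗≫ †T ◁ pivEv T ⊗≫ 𝟙 †T) ⊗≫
        (†S ⊗ S) ◁ r ⊗≫ †S ◁ pivEv S ▷ A ⊗≫ 𝟙 _ := by rw [← whisker_exchange]; monoidal
    _ = 𝟙 _ ⊗≫ (pivCoev S ▷ †T ≫ (†S ⊗ S) ◁ r) ⊗≫ †S ◁ pivEv S ▷ A ⊗≫ 𝟙 _ := by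
      rw [pivCoev_zigzag]; monoidal
    _ = r ⊗≫ (𝟙 †S ⊗≫ pivCoev S ▷ †S ⊗≫ †S ◁ pivEv S ⊗≫ 𝟙 †S) ▷ A ⊗≫ 𝟙 _ := by
      rw [← whisker_exchange]; monoidal
    _ = _ := by rw [pivCoev_zigzag]; monoidal

/-- Every morphism `Y* ⟶ X*` is a mate. -/
theorem exists_rightAdjointMate_eq {X Y : D} (g : †Y ⟶ †X) :
    ∃ f : X ⟶ Y, rightAdjointMate f = g := by
  refine ⟨𝟙 _ ⊗≫ η_ Y †Y ▷ X ⊗≫ Y ◁ g ▷ X ⊗≫ Y ◁ ε_ X †X ⊗≫ 𝟙 _, ?_⟩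
  apply dual_hom_ext
  rw [rightAdjointMate_comp_evaluation]
  calc _ = 𝟙 _ ⊗≫ †Y ◁ η_ Y †Y ▷ X ⊗≫ (†Y ⊗ Y) ◁ g ▷ X ⊗≫ ((†Y ⊗ Y) ◁ ε_ X †X ≫
        ε_ Y †Y ▷ 𝟙_ D) ⊗≫ 𝟙 _ := by monoidal
    _ = 𝟙 _ ⊗≫ †Y ◁ η_ Y †Y ▷ X ⊗≫ ((†Y ⊗ Y) ◁ (g ▷ X) ≫ ε_ Y †Y ▷ (†X ⊗ X)) ⊗≫
        ε_ X †X := by rw [whisker_exchange]; monoidal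
    _ = (𝟙 †Y ⊗≫ †Y ◁ η_ Y †Y ⊗≫ ε_ Y †Y ▷ †Y ⊗≫ 𝟙 †Y) ▷ X ⊗≫ g ▷ X ⊗≫ ε_ X †X := by
      rw [whisker_exchange]; monoidal
    _ = _ := by rw [ev_zigzag]; monoidal

end PivDual

section SemisimpleLemmas

variable {𝕜 : Type w} [Field 𝕜] [IsAlgClosed 𝕜] {C : Type u} [Category.{v} C]
  [Abelian C] [Linear 𝕜 C] [FiniteSemisimple 𝕜 C]

theorem exists_eq_smul_id {S : C} [Simple S] (f : S ⟶ S) : ∃ c : 𝕜, f = c • 𝟙 S := by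
  obtain ⟨c, hc⟩ := endomorphism_simple_eq_smul_id 𝕜 f
  exact ⟨c, hc.symm⟩

theorem comp_homDual {S V : C} [Simple S] (f : S ⟶ V) (m : Fin (Module.finrank 𝕜 (S ⟶ V))) :
    f ≫ homDual 𝕜 S V m = (homBasis 𝕜 S V).coord m f • 𝟙 S :=
  Classical.choose_spec (exists_dual_morphism 𝕜 S V ((homBasis 𝕜 S V).coord m)) f

theorem homBasis_comp_homDual {S V : C} [Simple S] (m n : Fin (Module.finrank 𝕜 (S ⟶ V))) :
    homBasis 𝕜 S V m ≫ homDual 𝕜 S V n = if m = n then 𝟙 S else 0 := by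
  rw [comp_homDual]
  simp [Module.Basis.coord_apply, Finsupp.single_apply]

theorem sum_comp_homDual_comp_homBasis {S V : C} [Simple S] (f : S ⟶ V) :
    ∑ m, f ≫ homDual 𝕜 S V m ≫ homBasis 𝕜 S V m = f := by
  conv_rhs => rw [← (homBasis 𝕜 S V).sum_repr f]
  refine Finset.sum_congr rfl fun m _ => ?_
  rw [← Category.assoc, comp_homDual]
  simp [Module.Basis.coord_apply]

theorem smul_id_injective {S : C} [Simple S] {a b : 𝕜} (h : a • 𝟙 S = b • 𝟙 S) : a = b := by
  by_contra hne
  have h2 : (a - b) • 𝟙 S = 0 := by rw [sub_smul, h, sub_self]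
  rcases smul_eq_zero.mp h2 with h3 | h3
  · exact hne (sub_eq_zero.mp h3)
  · exact id_nonzero S h3

variable [MonoidalCategory C] [Simple (𝟙_ C)]

theorem scalar_smul_id (f : 𝟙_ C ⟶ 𝟙_ C) : scalar 𝕜 f • 𝟙 (𝟙_ C) = f :=
  Classical.choose_spec (endomorphism_simple_eq_smul_id 𝕜 f)

theorem scalar_eq {f : 𝟙_ C ⟶ 𝟙_ C} {r : 𝕜} (h : f = r • 𝟙 (𝟙_ C)) : scalar 𝕜 f = r :=
  smul_id_injective (by rw [scalar_smul_id, h])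

theorem scalar_smul (r : 𝕜) (f : 𝟙_ C ⟶ 𝟙_ C) : scalar 𝕜 (r • f) = r * scalar 𝕜 f :=
  scalar_eq (by rw [mul_smul, scalar_smul_id])

theorem scalar_sum {α : Type*} (s : Finset α) (f : α → (𝟙_ C ⟶ 𝟙_ C)) :
    scalar 𝕜 (∑ a ∈ s, f a) = ∑ a ∈ s, scalar 𝕜 (f a) :=
  scalar_eq (by rw [Finset.sum_smul]; exact Finset.sum_congr rfl fun _ _ => (scalar_smul_id _).symm)

end SemisimpleLemmas

section Linearity

variable {𝕜 : Type w} [Field 𝕜] {C : Type u} [Category.{v} C] [Preadditive C] [Linear 𝕜 C]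
  [MonoidalCategory C] [MonoidalPreadditive C] [MonoidalLinear 𝕜 C]

theorem coherence_comp_smul {X Y Z W : C} [MonoidalCoherence Y Z] (r : 𝕜) (f : X ⟶ Y) (g : Z ⟶ W) :
    f ⊗≫ (r • g) = r • (f ⊗≫ g) := by simp [monoidalComp]

theorem smul_coherence_comp {X Y Z W : C} [MonoidalCoherence Y Z] (r : 𝕜) (f : X ⟶ Y) (g : Z ⟶ W) :
    (r • f) ⊗≫ g = r • (f ⊗≫ g) := by simp [monoidalComp]

theorem coherence_comp_sum {X Y Z W : C} [MonoidalCoherence Y Z] {α : Type*} (s : Finset α)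
    (f : X ⟶ Y) (g : α → (Z ⟶ W)) :
    f ⊗≫ (∑ a ∈ s, g a) = ∑ a ∈ s, f ⊗≫ g a := by simp [monoidalComp, Preadditive.comp_sum]

theorem sum_coherence_comp {X Y Z W : C} [MonoidalCoherence Y Z] {α : Type*} (s : Finset α)
    (f : α → (X ⟶ Y)) (g : Z ⟶ W) :
    (∑ a ∈ s, f a) ⊗≫ g = ∑ a ∈ s, f a ⊗≫ g := by simp [monoidalComp, Preadditive.sum_comp]

end Linearity

section Fusion

variable {𝕜 : Type w} [Field 𝕜] [IsAlgClosed 𝕜] {C : Type u} [Category.{v} C]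
  [Abelian C] [Linear 𝕜 C] [FiniteSemisimple 𝕜 C] [MonoidalCategory C] [MonoidalPreadditive C]
  [MonoidalLinear 𝕜 C] [Simple (𝟙_ C)] [RightRigidCategory C] [PivotalCategory C]
  (I : SimpleData 𝕜 C)

namespace SimpleData

theorem hom_eq_zero {i j : I.ι} (h : i ≠ j) (f : I.X i ⟶ I.X j) : f = 0 := by
  by_contra hf
  have := isIso_of_hom_simple hf
  exact h (I.eq_of_iso i j ⟨asIso f⟩)

theorem hom_ext {V W : C} {g h : V ⟶ W} (H : ∀ i, ∀ f : I.X i ⟶ V, f ≫ g = f ≫ h) : g = h := by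
  obtain ⟨n, S, hS, ⟨e⟩⟩ := FiniteSemisimple.exists_iso_biproduct (𝕜 := 𝕜) V
  rw [← cancel_epi e.inv]
  apply biproduct.hom_ext'
  intro k
  obtain ⟨i, ⟨φ⟩⟩ := I.exists_iso (S k) (hS k)
  rw [← cancel_epi φ.inv]
  simpa using H i (φ.inv ≫ biproduct.ι S k ≫ e.inv)

theorem complete (V : C) :
    ∑ i, ∑ m, homDual 𝕜 (I.X i) V m ≫ homBasis 𝕜 (I.X i) V m = 𝟙 V := by
  classical
  refine I.hom_ext fun i f => ?_
  rw [Preadditive.comp_sum, Finset.sum_eq_single i]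
  · rw [Preadditive.comp_sum, sum_comp_homDual_comp_homBasis, Category.comp_id]
  · intro j _ hj
    rw [Preadditive.comp_sum]
    refine Finset.sum_eq_zero fun m _ => ?_
    rw [← Category.assoc, I.hom_eq_zero hj.symm (f ≫ homDual 𝕜 (I.X j) V m), zero_comp]
  · simp

/-- The index of the unit object. -/
def one : I.ι := Classical.choose (I.exists_iso (𝟙_ C) inferInstance)

def oneIso : 𝟙_ C ≅ I.X I.one :=
  Classical.choice (Classical.choose_spec (I.exists_iso (𝟙_ C) inferInstance))

theorem sqrtDim_one : I.sqrtDim I.one = 1 := I.sqrtDim_unit _ ⟨I.oneIso.symm⟩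

theorem dim_one : dim 𝕜 (I.X I.one) = 1 := by rw [← I.sqrtDim_sq, sqrtDim_one, one_pow]

end SimpleData

/-- A morphism `S ⊗ S* ⟶ 𝟙` out of a simple object is a multiple of the evaluation. -/
theorem exists_eq_smul_pivEv (S : C) [Simple S] (h : S ⊗ †S ⟶ 𝟙_ C) :
    ∃ c : 𝕜, h = c • pivEv S := by
  obtain ⟨c, hc⟩ := exists_eq_smul_id (𝕜 := 𝕜) (𝟙 S ⊗≫ S ◁ pivCoev S ⊗≫ h ▷ S ⊗≫ 𝟙 S)
  refine ⟨c, ?_⟩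
  calc h = 𝟙 _ ⊗≫ S ◁ (𝟙 †S ⊗≫ pivCoev S ▷ †S ⊗≫ †S ◁ pivEv S ⊗≫ 𝟙 †S) ⊗≫ h := by
        rw [pivCoev_zigzag]; monoidal
    _ = 𝟙 _ ⊗≫ S ◁ pivCoev S ▷ †S ⊗≫ ((S ⊗ †S) ◁ pivEv S ≫ h ▷ 𝟙_ C) ⊗≫ 𝟙 _ := by monoidal
    _ = (𝟙 S ⊗≫ S ◁ pivCoev S ⊗≫ h ▷ S ⊗≫ 𝟙 S) ▷ †S ≫ pivEv S := by
      rw [whisker_exchange]; monoidal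
    _ = _ := by rw [hc, MonoidalLinear.smul_whiskerRight]; simp

theorem coev_ne_zero (S : C) [Simple S] : η_ S †S ≠ 0 := by
  intro h
  have := coev_zigzag S
  rw [h] at this
  simp only [monoidalComp, MonoidalPreadditive.zero_whiskerRight, zero_comp, comp_zero] at this
  exact id_nonzero S this.symm

theorem dim_smul_id (S : C) : dim 𝕜 S • 𝟙 (𝟙_ C) = rightTrace (𝟙 S) := scalar_smul_id _

theorem dim_ne_zero (S : C) [Simple S] : dim 𝕜 S ≠ 0 := by
  intro hd
  have h0 : η_ S †S ≫ pivEv S = 0 := by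
    have := dim_smul_id (𝕜 := 𝕜) S
    rw [hd, zero_smul, rightTrace] at this
    simpa using this.symm
  refine coev_ne_zero S ?_
  rw [← sum_comp_homDual_comp_homBasis (𝕜 := 𝕜) (η_ S †S)]
  refine Finset.sum_eq_zero fun m _ => ?_
  obtain ⟨c, hc⟩ := exists_eq_smul_pivEv (𝕜 := 𝕜) S (homDual 𝕜 (𝟙_ C) (S ⊗ †S) m)
  rw [← Category.assoc, hc, Linear.comp_smul, h0, smul_zero, zero_comp]

theorem rightAdjointMate_smul {X Y : C} (r : 𝕜) (f : X ⟶ Y) :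
    rightAdjointMate (r • f) = r • rightAdjointMate f := by
  apply dual_hom_ext
  rw [MonoidalLinear.smul_whiskerRight, Linear.smul_comp, rightAdjointMate_comp_evaluation,
    rightAdjointMate_comp_evaluation, MonoidalLinear.whiskerLeft_smul, Linear.smul_comp]

theorem rightAdjointMate_zero (X Y : C) : rightAdjointMate (0 : X ⟶ Y) = 0 := by
  apply dual_hom_ext
  rw [rightAdjointMate_comp_evaluation]
  simp

theorem rightAdjointMate_sum {α : Type*} (s : Finset α) {X Y : C} (f : α → (X ⟶ Y)) :
    rightAdjointMate (∑ a ∈ s, f a) = ∑ a ∈ s, rightAdjointMate (f a) := by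
  apply dual_hom_ext
  simp only [sum_whiskerRight, whiskerLeft_sum, Preadditive.sum_comp,
    rightAdjointMate_comp_evaluation]

/-- The dual of an isomorphism. -/
def dualIso {X Y : C} (φ : X ≅ Y) : †X ≅ †Y where
  hom := rightAdjointMate φ.inv
  inv := rightAdjointMate φ.hom
  hom_inv_id := by rw [← comp_rightAdjointMate]; simp
  inv_hom_id := by rw [← comp_rightAdjointMate]; simp

theorem simple_rightDual (𝕜 : Type w) [Field 𝕜] [IsAlgClosed 𝕜] {C : Type u} [Category.{v} C]
    [Abelian C] [Linear 𝕜 C] [FiniteSemisimple 𝕜 C] [MonoidalCategory C] [MonoidalPreadditive C]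
    [MonoidalLinear 𝕜 C] [Simple (𝟙_ C)] [RightRigidCategory C] [PivotalCategory C] (S : C)
    [Simple S] : Simple (†S) := by
  obtain ⟨n, T, hT, ⟨e⟩⟩ := FiniteSemisimple.exists_iso_biproduct (𝕜 := 𝕜) (†S)
  have hne : ∃ k : Fin n, True := by
    by_contra hno
    push Not at hno
    refine coev_ne_zero S ?_
    have h1 : 𝟙 (†S) = 0 := by
      rw [← cancel_epi e.inv]
      apply biproduct.hom_ext'
      intro k
      exact (hno k).elim
    calc η_ S †S = η_ S †S ≫ S ◁ 𝟙 (†S) := by simp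
      _ = 0 := by rw [h1]; simp
  obtain ⟨k, -⟩ := hne
  obtain ⟨f, hf⟩ := exists_rightAdjointMate_eq (e.hom ≫ biproduct.π T k ≫ biproduct.ι T k ≫ e.inv)
  obtain ⟨c, hc⟩ := exists_eq_smul_id (𝕜 := 𝕜) f
  have hT' := hT k
  have hce : e.hom ≫ biproduct.π T k ≫ biproduct.ι T k ≫ e.inv = c • 𝟙 (†S) := by
    rw [← hf, hc, rightAdjointMate_smul, rightAdjointMate_id]
  have hc0 : c ≠ 0 := by
    intro h0
    have : (biproduct.ι T k ≫ e.inv) ≫ (e.hom ≫ biproduct.π T k ≫ biproduct.ι T k ≫ e.inv) ≫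
        e.hom ≫ biproduct.π T k = 𝟙 _ := by simp
    rw [hce, h0] at this
    simp at this
    exact id_nonzero _ this.symm
  let i : †S ≅ T k :=
    { hom := e.hom ≫ biproduct.π T k
      inv := biproduct.ι T k ≫ e.inv
      hom_inv_id := by
        have hcc : c = 1 := by
          have h2 : (c • 𝟙 (†S)) ≫ (e.hom ≫ biproduct.π T k) = e.hom ≫ biproduct.π T k := by
            rw [← hce]; simp
          have h3 : c • (e.hom ≫ biproduct.π T k) = (1 : 𝕜) • (e.hom ≫ biproduct.π T k) := by
            simpa using h2
          by_contra hne
          have h4 : (c - 1) • (e.hom ≫ biproduct.π T k) = 0 := by rw [sub_smul, h3, sub_self]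
          rcases smul_eq_zero.mp h4 with h5 | h5
          · exact hne (sub_eq_zero.mp h5)
          · have : (biproduct.ι T k ≫ e.inv) ≫ (e.hom ≫ biproduct.π T k) = 𝟙 _ := by simp
            rw [h5, comp_zero] at this
            exact id_nonzero _ this.symm
        rw [Category.assoc, hce, hcc, one_smul]
      inv_hom_id := by simp }
  exact Simple.of_iso i

theorem SimpleData.dual_hom_ext {V W : C} {g h : V ⟶ W}
    (H : ∀ i, ∀ f : †(I.X i) ⟶ V, f ≫ g = f ≫ h) : g = h := by
  refine I.hom_ext fun i f => ?_
  have := simple_rightDual 𝕜 (I.X i)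
  obtain ⟨j, ⟨φ⟩⟩ := I.exists_iso (†(I.X i)) inferInstance
  let ψ : I.X i ≅ †(I.X j) := PivotalCategory.piv (I.X i) ≪≫ dualIso φ
  rw [← cancel_epi ψ.inv]
  simpa using H j (ψ.inv ≫ f)

theorem SimpleData.dual_hom_eq_zero {i j : I.ι} (h : i ≠ j) (f : †(I.X i) ⟶ †(I.X j)) : f = 0 := by
  obtain ⟨g, rfl⟩ := exists_rightAdjointMate_eq f
  rw [I.hom_eq_zero h.symm g, rightAdjointMate_zero]

section Spherical

variable [SphericalCategory C]

theorem dim_rightDual (X : C) : dim 𝕜 (†X) = dim 𝕜 X := by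
  rw [dim, dim, rightTrace_dual, SphericalCategory.trace_eq]

theorem rightTrace_smul {X : C} (r : 𝕜) (f : X ⟶ X) : rightTrace (r • f) = r • rightTrace f := by
  simp [rightTrace]

theorem rot_smul {S A T : C} (r : 𝕜) (q : S ⟶ A ⊗ T) : rot (r • q) = r • rot q := by
  simp [rot, monoidalComp]

theorem rot_sum {α : Type*} (s : Finset α) {S A T : C} (q : α → (S ⟶ A ⊗ T)) :
    rot (∑ a ∈ s, q a) = ∑ a ∈ s, rot (q a) := by
  simp [rot, monoidalComp, sum_whiskerRight, whiskerLeft_sum, Preadditive.sum_comp,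
    Preadditive.comp_sum]

/-- Rotated bases are dual up to the ratio of the dimensions. -/
theorem SimpleData.rotated_complete (A : C) (j : I.ι) :
    ∑ i, ∑ m : Fin (Module.finrank 𝕜 (I.X j ⟶ A ⊗ I.X i)), dim 𝕜 (I.X i) •
      (unrot (homDual 𝕜 (I.X j) (A ⊗ I.X i) m) ≫ rot (homBasis 𝕜 (I.X j) (A ⊗ I.X i) m)) =
      dim 𝕜 (I.X j) • 𝟙 _ := by
  classical
  refine I.dual_hom_ext fun i r => ?_
  obtain ⟨q, rfl⟩ : ∃ q, rot q = r := ⟨rotInv r, rot_rotInv r⟩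
  have hs := simple_rightDual 𝕜 (I.X i)
  rw [Preadditive.comp_sum, Finset.sum_eq_single i]
  · have key : ∀ m, dim 𝕜 (I.X i) • (rot q ≫ unrot (homDual 𝕜 (I.X j) (A ⊗ I.X i) m)) =
        (dim 𝕜 (I.X j) * (homBasis 𝕜 (I.X j) (A ⊗ I.X i)).coord m q) • 𝟙 _ := by
      intro m
      obtain ⟨c, hc⟩ := exists_eq_smul_id (𝕜 := 𝕜)
        (rot q ≫ unrot (homDual 𝕜 (I.X j) (A ⊗ I.X i) m))
      have ht := rightTrace_rot_unrot q (homDual 𝕜 (I.X j) (A ⊗ I.X i) m)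
      rw [hc, comp_homDual, SphericalCategory.trace_eq, rightTrace_smul, rightTrace_smul,
        ← dim_smul_id (𝕜 := 𝕜), ← dim_smul_id (𝕜 := 𝕜), dim_rightDual, smul_smul, smul_smul] at ht
      rw [hc, smul_smul, mul_comm, smul_id_injective ht, mul_comm]
    conv_rhs => rw [← (homBasis 𝕜 (I.X j) (A ⊗ I.X i)).sum_repr q]
    rw [Preadditive.comp_sum, rot_sum, Preadditive.sum_comp]
    refine Finset.sum_congr rfl fun m _ => ?_
    rw [Linear.comp_smul, ← Category.assoc, ← Linear.smul_comp, key, rot_smul]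
    simp [Module.Basis.coord_apply, smul_smul]
  · intro k _ hk
    rw [Preadditive.comp_sum]
    refine Finset.sum_eq_zero fun m _ => ?_
    rw [Linear.comp_smul, ← Category.assoc, I.dual_hom_eq_zero hk.symm (rot q ≫ _), zero_comp,
      smul_zero]
  · simp

/-- Sliding a morphism `A` over the regular cup. -/
theorem SimpleData.sum_coev_vertex (A : C) (j : I.ι) :
    ∑ i, ∑ m : Fin (Module.finrank 𝕜 (I.X j ⟶ A ⊗ I.X i)), dim 𝕜 (I.X i) •
      (𝟙 A ⊗≫ A ◁ η_ (I.X i) †(I.X i) ⊗≫ homDual 𝕜 (I.X j) (A ⊗ I.X i) m ▷ †(I.X i) ⊗≫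
        I.X j ◁ rot (homBasis 𝕜 (I.X j) (A ⊗ I.X i) m)) =
      dim 𝕜 (I.X j) • (𝟙 A ⊗≫ η_ (I.X j) †(I.X j) ▷ A ⊗≫ 𝟙 (I.X j ⊗ †(I.X j) ⊗ A)) := by
  have h := congrArg (fun f => 𝟙 A ⊗≫ η_ (I.X j) †(I.X j) ▷ A ⊗≫ I.X j ◁ f)
    (I.rotated_complete A j)
  simp only [whiskerLeft_sum, MonoidalLinear.whiskerLeft_smul, coherence_comp_sum,
    coherence_comp_smul] at h
  have e : ∀ i (m : Fin (Module.finrank 𝕜 (I.X j ⟶ A ⊗ I.X i))),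
      𝟙 A ⊗≫ η_ (I.X j) †(I.X j) ▷ A ⊗≫ I.X j ◁
        (unrot (homDual 𝕜 (I.X j) (A ⊗ I.X i) m) ≫ rot (homBasis 𝕜 (I.X j) (A ⊗ I.X i) m)) =
      𝟙 A ⊗≫ A ◁ η_ (I.X i) †(I.X i) ⊗≫ homDual 𝕜 (I.X j) (A ⊗ I.X i) m ▷ †(I.X i) ⊗≫
        I.X j ◁ rot (homBasis 𝕜 (I.X j) (A ⊗ I.X i) m) := by
    intro i m
    rw [unrot]
    generalize rot (homBasis 𝕜 (I.X j) (A ⊗ I.X i) m) = b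
    generalize homDual 𝕜 (I.X j) (A ⊗ I.X i) m = a
    calc _ = 𝟙 A ⊗≫ (η_ (I.X j) †(I.X j) ▷ (A ⊗ 𝟙_ C) ≫ (I.X j ⊗ †(I.X j)) ◁ (A ◁ η_ (I.X i) †(I.X i)))
          ⊗≫ (I.X j ⊗ †(I.X j)) ◁ a ▷ †(I.X i) ⊗≫ I.X j ◁ ε_ (I.X j) †(I.X j) ▷ †(I.X i) ⊗≫
          I.X j ◁ b := by monoidal
      _ = 𝟙 A ⊗≫ A ◁ η_ (I.X i) †(I.X i) ⊗≫ (η_ (I.X j) †(I.X j) ▷ (A ⊗ I.X i) ≫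
          (I.X j ⊗ †(I.X j)) ◁ a) ▷ †(I.X i) ⊗≫ I.X j ◁ ε_ (I.X j) †(I.X j) ▷ †(I.X i) ⊗≫
          I.X j ◁ b := by rw [← whisker_exchange]; monoidal
      _ = 𝟙 A ⊗≫ A ◁ η_ (I.X i) †(I.X i) ⊗≫ a ▷ †(I.X i) ⊗≫ (𝟙 (I.X j) ⊗≫ η_ (I.X j) †(I.X j) ▷ I.X j ⊗≫
          I.X j ◁ ε_ (I.X j) †(I.X j) ⊗≫ 𝟙 (I.X j)) ▷ †(I.X i) ⊗≫
          I.X j ◁ b := by rw [← whisker_exchange]; monoidal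
      _ = _ := by rw [coev_zigzag]; monoidal
  simp only [e] at h
  rw [h]
  congr 1
  monoidal

end Spherical

/-- Closing a vertex and its rotation. -/
theorem vertex_pivEv {S A T : C} (p : A ⊗ T ⟶ S) (q : S ⟶ A ⊗ T) :
    p ▷ †T ⊗≫ S ◁ rot q ⊗≫ pivEv S ▷ A ⊗≫ 𝟙 A = (p ≫ q) ▷ †T ⊗≫ A ◁ pivEv T ⊗≫ 𝟙 A := by
  have h : 𝟙 (S ⊗ †T) ⊗≫ S ◁ rot q ⊗≫ pivEv S ▷ A ⊗≫ 𝟙 A = q ▷ †T ⊗≫ A ◁ pivEv T ⊗≫ 𝟙 A := by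
    rw [rot]
    calc _ = 𝟙 (S ⊗ †T) ⊗≫ S ◁ pivCoev S ▷ †T ⊗≫ (S ⊗ †S) ◁ q ▷ †T ⊗≫ ((S ⊗ †S) ◁ (A ◁ pivEv T) ≫
          pivEv S ▷ (A ⊗ 𝟙_ C)) ⊗≫ 𝟙 A := by monoidal
      _ = 𝟙 (S ⊗ †T) ⊗≫ S ◁ pivCoev S ▷ †T ⊗≫ ((S ⊗ †S) ◁ q ≫ pivEv S ▷ (A ⊗ T)) ▷ †T ⊗≫
          A ◁ pivEv T ⊗≫ 𝟙 A := by rw [whisker_exchange]; monoidal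
      _ = (𝟙 S ⊗≫ S ◁ pivCoev S ⊗≫ pivEv S ▷ S ⊗≫ 𝟙 S) ▷ †T ⊗≫ q ▷ †T ⊗≫
          A ◁ pivEv T ⊗≫ 𝟙 A := by rw [whisker_exchange]; monoidal
      _ = _ := by rw [pivEv_zigzag]; monoidal
  calc _ = p ▷ †T ⊗≫ (𝟙 (S ⊗ †T) ⊗≫ S ◁ rot q ⊗≫ pivEv S ▷ A ⊗≫ 𝟙 A) := by monoidal
    _ = _ := by rw [h]; monoidal

theorem SimpleData.sum_vertex_pivEv (A : C) (i : I.ι) :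
    ∑ j, ∑ m : Fin (Module.finrank 𝕜 (I.X j ⟶ A ⊗ I.X i)),
      (homDual 𝕜 (I.X j) (A ⊗ I.X i) m ▷ †(I.X i) ⊗≫
        I.X j ◁ rot (homBasis 𝕜 (I.X j) (A ⊗ I.X i) m) ⊗≫ pivEv (I.X j) ▷ A ⊗≫ 𝟙 A) =
      𝟙 ((A ⊗ I.X i) ⊗ †(I.X i)) ⊗≫ A ◁ pivEv (I.X i) ⊗≫ 𝟙 A := by
  simp only [vertex_pivEv]
  rw [← MonoidalCategory.id_whiskerRight (A ⊗ I.X i) †(I.X i), ← I.complete (A ⊗ I.X i)]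
  simp only [sum_whiskerRight, sum_coherence_comp]

end Fusion

section HalfBraidings

variable {C : Type u} [Category.{v} C] [MonoidalCategory C]

/-- A family `σ A : A ⊗ V ⟶ V ⊗ A` is a half-braiding. -/
abbrev IsHB {V : C} (σ : ∀ A : C, A ⊗ V ⟶ V ⊗ A) : Prop := (PreCenter.mk V σ).IsHalfBraiding

namespace IsHB

variable {V : C} {σ : ∀ A : C, A ⊗ V ⟶ V ⊗ A} (h : IsHB σ)

include h

theorem nat {A B : C} (f : A ⟶ B) : f ▷ V ≫ σ B = σ A ≫ V ◁ f := h.naturality f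

theorem iso (A : C) : IsIso (σ A) := h.isIso A

theorem hex (A B : C) : σ (A ⊗ B) = 𝟙 _ ⊗≫ A ◁ σ B ⊗≫ σ A ▷ B ⊗≫ 𝟙 _ := by
  refine (h.hexagon A B).trans ?_
  dsimp only
  monoidal

theorem unit_eq : σ (𝟙_ C) = 𝟙 _ ⊗≫ 𝟙 _ := by
  have := h.iso (𝟙_ C)
  have h1 := h.hex (𝟙_ C) (𝟙_ C)
  have h2 := h.nat (λ_ (𝟙_ C)).hom
  rw [h1] at h2
  obtain ⟨g, hg⟩ : ∃ g, g = (λ_ V).inv ≫ σ (𝟙_ C) ≫ (ρ_ V).hom := ⟨_, rfl⟩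
  have h3 : g = g ≫ g := by
    calc g = (𝟙 V ⊗≫ 𝟙 ((𝟙_ C ⊗ 𝟙_ C) ⊗ V)) ≫ ((λ_ (𝟙_ C)).hom ▷ V ≫ σ (𝟙_ C)) ≫
          (𝟙 (V ⊗ 𝟙_ C) ⊗≫ 𝟙 V) := by rw [hg]; monoidal
      _ = _ := by rw [h2, hg]; monoidal
  have h4 : IsIso g := by rw [hg]; infer_instance
  have h5 : g = 𝟙 V := by
    rw [← cancel_mono g, ← h3, Category.id_comp]
  calc _ = (λ_ V).hom ≫ ((λ_ V).inv ≫ σ (𝟙_ C) ≫ (ρ_ V).hom) ≫ (ρ_ V).inv := by simp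
    _ = _ := by rw [← hg, h5]; monoidal

theorem merge {A B S : C} (f : A ⊗ B ⟶ S) :
    𝟙 (A ⊗ B ⊗ V) ⊗≫ f ▷ V ≫ σ S = A ◁ σ B ⊗≫ σ A ▷ B ⊗≫ V ◁ f := by
  rw [h.nat, h.hex]; monoidal

theorem split {A B S : C} (f : S ⟶ A ⊗ B) :
    σ S ≫ V ◁ f ⊗≫ 𝟙 (V ⊗ A ⊗ B) = f ▷ V ⊗≫ A ◁ σ B ⊗≫ σ A ▷ B ⊗≫ 𝟙 (V ⊗ A ⊗ B) := by
  calc _ = (σ S ≫ V ◁ f) ⊗≫ 𝟙 (V ⊗ A ⊗ B) := by monoidal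
    _ = _ := by rw [← h.nat, h.hex]; monoidal

theorem cup {A B : C} (f : 𝟙_ C ⟶ A ⊗ B) :
    𝟙 V ⊗≫ f ▷ V ⊗≫ A ◁ σ B ⊗≫ σ A ▷ B ⊗≫ 𝟙 (V ⊗ A ⊗ B) = 𝟙 V ⊗≫ V ◁ f ⊗≫ 𝟙 (V ⊗ A ⊗ B) := by
  calc _ = 𝟙 V ⊗≫ (f ▷ V ⊗≫ A ◁ σ B ⊗≫ σ A ▷ B ⊗≫ 𝟙 (V ⊗ A ⊗ B)) := by monoidal
    _ = _ := by rw [← h.split, h.unit_eq]; monoidal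

theorem cap {A B : C} (f : A ⊗ B ⟶ 𝟙_ C) :
    𝟙 (A ⊗ B ⊗ V) ⊗≫ A ◁ σ B ⊗≫ σ A ▷ B ⊗≫ V ◁ f ⊗≫ 𝟙 V = 𝟙 (A ⊗ B ⊗ V) ⊗≫ f ▷ V ⊗≫ 𝟙 V := by
  calc _ = 𝟙 (A ⊗ B ⊗ V) ⊗≫ (A ◁ σ B ⊗≫ σ A ▷ B ⊗≫ V ◁ f) ⊗≫ 𝟙 V := by monoidal
    _ = _ := by rw [← h.merge, h.unit_eq]; monoidal

end IsHB

/-- The half-braiding of `V ⊗ W` in which `A` passes `V` and then `W`. -/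
def prodγ {V W : C} (σ : ∀ A : C, A ⊗ V ⟶ V ⊗ A) (τ : ∀ A : C, A ⊗ W ⟶ W ⊗ A) (A : C) :
    A ⊗ (V ⊗ W) ⟶ (V ⊗ W) ⊗ A :=
  (α_ A V W).inv ≫ σ A ▷ W ≫ (α_ V A W).hom ≫ V ◁ τ A ≫ (α_ V W A).inv

theorem IsHB.prod {V W : C} {σ : ∀ A : C, A ⊗ V ⟶ V ⊗ A} {τ : ∀ A : C, A ⊗ W ⟶ W ⊗ A}
    (hσ : IsHB σ) (hτ : IsHB τ) : IsHB (prodγ σ τ) where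
  isIso A := by
    have := hσ.iso A
    have := hτ.iso A
    dsimp only [prodγ]
    infer_instance
  naturality {A B} f := by
    dsimp only [prodγ]
    calc _ = 𝟙 _ ⊗≫ (f ▷ V ≫ σ B) ▷ W ⊗≫ V ◁ τ B ⊗≫ 𝟙 _ := by monoidal
      _ = 𝟙 _ ⊗≫ σ A ▷ W ⊗≫ V ◁ (f ▷ W ≫ τ B) ⊗≫ 𝟙 _ := by rw [hσ.nat]; monoidal
      _ = _ := by rw [hτ.nat]; monoidal
  hexagon A B := by
    dsimp only [prodγ]
    rw [hσ.hex, hτ.hex]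
    calc _ = 𝟙 _ ⊗≫ A ◁ σ B ▷ W ⊗≫ (σ A ▷ (B ⊗ W) ≫ (V ⊗ A) ◁ τ B) ⊗≫ V ◁ τ A ▷ B ⊗≫ 𝟙 _ := by
          monoidal
      _ = _ := by rw [← whisker_exchange]; monoidal

/-- `f` intertwines the families `σ` and `τ`. -/
abbrev Intertwines {V W : C} (σ : ∀ A : C, A ⊗ V ⟶ V ⊗ A) (τ : ∀ A : C, A ⊗ W ⟶ W ⊗ A)
    (f : V ⟶ W) : Prop := PreCenter.IsHom ⟨V, σ⟩ ⟨W, τ⟩ f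

theorem Intertwines.eq {V W : C} {σ : ∀ A : C, A ⊗ V ⟶ V ⊗ A} {τ : ∀ A : C, A ⊗ W ⟶ W ⊗ A}
    {f : V ⟶ W} (h : Intertwines σ τ f) (A : C) : A ◁ f ≫ τ A = σ A ≫ f ▷ A := h A

theorem Intertwines.id {V : C} (σ : ∀ A : C, A ⊗ V ⟶ V ⊗ A) : Intertwines σ σ (𝟙 V) := by
  intro A; simp

theorem Intertwines.comp {V W U : C} {σ : ∀ A : C, A ⊗ V ⟶ V ⊗ A} {τ : ∀ A : C, A ⊗ W ⟶ W ⊗ A}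
    {υ : ∀ A : C, A ⊗ U ⟶ U ⊗ A} {f : V ⟶ W} {g : W ⟶ U} (hf : Intertwines σ τ f)
    (hg : Intertwines τ υ g) : Intertwines σ υ (f ≫ g) := by
  intro A
  have h1 := hf.eq A
  have h2 := hg.eq A
  dsimp only
  rw [MonoidalCategory.whiskerLeft_comp, Category.assoc, h2, reassoc_of% h1, comp_whiskerRight]

theorem Intertwines.whiskerRight {V V' W : C} {σ : ∀ A : C, A ⊗ V ⟶ V ⊗ A}
    {σ' : ∀ A : C, A ⊗ V' ⟶ V' ⊗ A} {f : V ⟶ V'} (hf : Intertwines σ σ' f)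
    (τ : ∀ A : C, A ⊗ W ⟶ W ⊗ A) : Intertwines (prodγ σ τ) (prodγ σ' τ) (f ▷ W) := by
  intro A
  dsimp only [prodγ]
  calc _ = 𝟙 _ ⊗≫ (A ◁ f ≫ σ' A) ▷ W ⊗≫ V' ◁ τ A ⊗≫ 𝟙 _ := by monoidal
    _ = 𝟙 _ ⊗≫ σ A ▷ W ⊗≫ (f ▷ (A ⊗ W) ≫ V' ◁ τ A) ⊗≫ 𝟙 _ := by rw [hf.eq]; monoidal
    _ = _ := by rw [← whisker_exchange]; monoidal

theorem Intertwines.whiskerLeft {V W W' : C} {τ : ∀ A : C, A ⊗ W ⟶ W ⊗ A}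
    {τ' : ∀ A : C, A ⊗ W' ⟶ W' ⊗ A} {f : W ⟶ W'} (hf : Intertwines τ τ' f)
    (σ : ∀ A : C, A ⊗ V ⟶ V ⊗ A) : Intertwines (prodγ σ τ) (prodγ σ τ') (V ◁ f) := by
  intro A
  dsimp only [prodγ]
  calc _ = 𝟙 _ ⊗≫ ((A ⊗ V) ◁ f ≫ σ A ▷ W') ⊗≫ V ◁ τ' A ⊗≫ 𝟙 _ := by monoidal
    _ = 𝟙 _ ⊗≫ σ A ▷ W ⊗≫ V ◁ (A ◁ f ≫ τ' A) ⊗≫ 𝟙 _ := by rw [whisker_exchange]; monoidal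
    _ = _ := by rw [hf.eq]; monoidal

section Braided

variable [BraidedCategory C]

/-- The half-braiding in which `A` passes under `V`. -/
def underγ (V A : C) : A ⊗ V ⟶ V ⊗ A := (β_ A V).hom

/-- The half-braiding in which `A` passes over `V`. -/
def overγ (V A : C) : A ⊗ V ⟶ V ⊗ A := (β_ V A).inv

theorem isHB_under (V : C) : IsHB (underγ V) where
  isIso A := by dsimp only [underγ]; infer_instance
  naturality {A B} f := BraidedCategory.braiding_naturality_left f V
  hexagon A B := by
    dsimp only [underγ]; rw [BraidedCategory.braiding_tensor_left_hom]

theorem isHB_over (V : C) : IsHB (overγ V) where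
  isIso A := by dsimp only [overγ]; infer_instance
  naturality {A B} f := BraidedCategory.braiding_inv_naturality_left f V
  hexagon A B := by
    dsimp only [overγ]; rw [BraidedCategory.braiding_tensor_right_inv]

theorem under_natural {V W : C} (f : V ⟶ W) : Intertwines (underγ V) (underγ W) f :=
  fun A => BraidedCategory.braiding_naturality_right A f

theorem over_natural {V W : C} (f : V ⟶ W) : Intertwines (overγ V) (overγ W) f :=
  fun A => BraidedCategory.braiding_inv_naturality_right A f

theorem under_tensor (V W A : C) : underγ (V ⊗ W) A = prodγ (underγ V) (underγ W) A := by
  simp only [underγ, prodγ]; rw [BraidedCategory.braiding_tensor_right_hom]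

theorem over_tensor (V W A : C) : overγ (V ⊗ W) A = prodγ (overγ V) (overγ W) A := by
  simp only [overγ, prodγ]; rw [BraidedCategory.braiding_tensor_left_inv]

end Braided

/-- The loop coloured by `X` around `V`: `X*` passes `V` by `σ'` and `X` by `σ`. -/
def loop [RightRigidCategory C] [PivotalCategory C] (X : C) {V : C}
    (σ σ' : ∀ A : C, A ⊗ V ⟶ V ⊗ A) : V ⟶ V :=
  𝟙 V ⊗≫ η_ X †X ▷ V ⊗≫ X ◁ σ' †X ⊗≫ σ X ▷ †X ⊗≫ V ◁ pivEv X ⊗≫ 𝟙 V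

end HalfBraidings

section Loop

variable {C : Type u} [Category.{v} C] [MonoidalCategory C] [RightRigidCategory C]
  [PivotalCategory C] {V W U : C}

theorem loop_self_eq (X : C) {σ : ∀ A : C, A ⊗ V ⟶ V ⊗ A} (h : IsHB σ) :
    loop X σ σ = 𝟙 V ⊗≫ V ◁ rightTrace (𝟙 X) ⊗≫ 𝟙 V := by
  rw [loop, rightTrace]
  calc _ = (𝟙 V ⊗≫ η_ X †X ▷ V ⊗≫ X ◁ σ †X ⊗≫ σ X ▷ †X ⊗≫ 𝟙 (V ⊗ X ⊗ †X)) ⊗≫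
        V ◁ pivEv X ⊗≫ 𝟙 V := by monoidal
    _ = _ := by rw [h.cup]; monoidal

theorem comp_loop (X : C) {σ σ' : ∀ A : C, A ⊗ V ⟶ V ⊗ A} {τ τ' : ∀ A : C, A ⊗ W ⟶ W ⊗ A}
    {f : V ⟶ W} (h : Intertwines σ τ f) (h' : Intertwines σ' τ' f) :
    f ≫ loop X τ τ' = loop X σ σ' ≫ f := by
  rw [loop, loop]
  calc _ = 𝟙 V ⊗≫ (𝟙_ C ◁ f ≫ η_ X †X ▷ W) ⊗≫ X ◁ τ' †X ⊗≫ τ X ▷ †X ⊗≫ W ◁ pivEv X ⊗≫ 𝟙 W := by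
        monoidal
    _ = 𝟙 V ⊗≫ η_ X †X ▷ V ⊗≫ X ◁ (†X ◁ f ≫ τ' †X) ⊗≫ τ X ▷ †X ⊗≫ W ◁ pivEv X ⊗≫ 𝟙 W := by
        rw [whisker_exchange]; monoidal
    _ = 𝟙 V ⊗≫ η_ X †X ▷ V ⊗≫ X ◁ σ' †X ⊗≫ (X ◁ f ≫ τ X) ▷ †X ⊗≫ W ◁ pivEv X ⊗≫ 𝟙 W := by
        rw [h'.eq]; monoidal
    _ = 𝟙 V ⊗≫ η_ X †X ▷ V ⊗≫ X ◁ σ' †X ⊗≫ σ X ▷ †X ⊗≫ (f ▷ (X ⊗ †X) ≫ W ◁ pivEv X) ⊗≫ 𝟙 W := by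
        rw [h.eq]; monoidal
    _ = _ := by rw [← whisker_exchange]; monoidal

theorem loop_eq_trace (X : C) {σ σ' : ∀ A : C, A ⊗ V ⟶ V ⊗ A} (h : IsHB σ) [IsIso (σ †X)] :
    loop X σ σ' = 𝟙 V ⊗≫ η_ X †X ▷ V ⊗≫ X ◁ (σ' †X ≫ inv (σ †X)) ⊗≫ pivEv X ▷ V ⊗≫ 𝟙 V := by
  rw [loop]
  calc _ = 𝟙 V ⊗≫ η_ X †X ▷ V ⊗≫ X ◁ (σ' †X ≫ inv (σ †X) ≫ σ †X) ⊗≫ σ X ▷ †X ⊗≫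
        V ◁ pivEv X ⊗≫ 𝟙 V := by simp
    _ = 𝟙 V ⊗≫ η_ X †X ▷ V ⊗≫ X ◁ (σ' †X ≫ inv (σ †X)) ⊗≫ (𝟙 (X ⊗ †X ⊗ V) ⊗≫ X ◁ σ †X ⊗≫
        σ X ▷ †X ⊗≫ V ◁ pivEv X ⊗≫ 𝟙 V) := by monoidal
    _ = _ := by rw [h.cap]; monoidal

theorem loop_prod_left (X : C) {τ : ∀ A : C, A ⊗ U ⟶ U ⊗ A} {σ σ' : ∀ A : C, A ⊗ V ⟶ V ⊗ A}
    (h : IsHB τ) : loop X (prodγ τ σ) (prodγ τ σ') = U ◁ loop X σ σ' := by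
  rw [loop, loop, prodγ, prodγ]
  calc _ = 𝟙 (U ⊗ V) ⊗≫ η_ X †X ▷ (U ⊗ V) ⊗≫ X ◁ τ †X ▷ V ⊗≫ ((X ⊗ U) ◁ σ' †X ≫ τ X ▷ (V ⊗ †X)) ⊗≫
        U ◁ σ X ▷ †X ⊗≫ (U ⊗ V) ◁ pivEv X ⊗≫ 𝟙 (U ⊗ V) := by monoidal
    _ = (𝟙 U ⊗≫ η_ X †X ▷ U ⊗≫ X ◁ τ †X ⊗≫ τ X ▷ †X ⊗≫ 𝟙 (U ⊗ X ⊗ †X)) ▷ V ⊗≫ U ◁ X ◁ σ' †X ⊗≫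
        U ◁ σ X ▷ †X ⊗≫ (U ⊗ V) ◁ pivEv X ⊗≫ 𝟙 (U ⊗ V) := by rw [whisker_exchange]; monoidal
    _ = _ := by rw [h.cup]; monoidal

theorem loop_prod_right (X : C) {τ : ∀ A : C, A ⊗ U ⟶ U ⊗ A} {σ σ' : ∀ A : C, A ⊗ V ⟶ V ⊗ A}
    (h : IsHB τ) : loop X (prodγ σ τ) (prodγ σ' τ) = loop X σ σ' ▷ U := by
  rw [loop, loop, prodγ, prodγ]
  calc _ = 𝟙 (V ⊗ U) ⊗≫ η_ X †X ▷ (V ⊗ U) ⊗≫ X ◁ σ' †X ▷ U ⊗≫ ((X ⊗ V) ◁ τ †X ≫ σ X ▷ (U ⊗ †X)) ⊗≫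
        V ◁ τ X ▷ †X ⊗≫ (V ⊗ U) ◁ pivEv X ⊗≫ 𝟙 (V ⊗ U) := by monoidal
    _ = 𝟙 (V ⊗ U) ⊗≫ η_ X †X ▷ (V ⊗ U) ⊗≫ X ◁ σ' †X ▷ U ⊗≫ σ X ▷ (†X ⊗ U) ⊗≫ V ◁ (𝟙 (X ⊗ †X ⊗ U) ⊗≫
        X ◁ τ †X ⊗≫ τ X ▷ †X ⊗≫ U ◁ pivEv X ⊗≫ 𝟙 U) ⊗≫ 𝟙 (V ⊗ U) := by
      rw [whisker_exchange]; monoidal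
    _ = _ := by rw [h.cap]; monoidal

/-- The loop with a strand `A` absorbed by its left leg and emitted by its right leg. -/
def loopVertex (σ σ' : ∀ A : C, A ⊗ V ⟶ V ⊗ A) {A X S : C} (p : A ⊗ X ⟶ S) (q : S ⟶ A ⊗ X) :
    A ⊗ V ⟶ V ⊗ A :=
  𝟙 (A ⊗ V) ⊗≫ A ◁ η_ X †X ▷ V ⊗≫ (A ⊗ X) ◁ σ' †X ⊗≫ p ▷ (V ⊗ †X) ⊗≫ (S ⊗ V) ◁ rot q ⊗≫
    σ S ▷ (†S ⊗ A) ⊗≫ V ◁ pivEv S ▷ A ⊗≫ 𝟙 (V ⊗ A)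

theorem loopVertex_eq_below {σ : ∀ A : C, A ⊗ V ⟶ V ⊗ A} (h : IsHB σ) (σ' : ∀ A : C, A ⊗ V ⟶ V ⊗ A)
    {A X S : C} (p : A ⊗ X ⟶ S) (q : S ⟶ A ⊗ X) :
    loopVertex σ σ' p q = 𝟙 (A ⊗ V) ⊗≫ A ◁ η_ X †X ▷ V ⊗≫ (A ⊗ X) ◁ σ' †X ⊗≫ A ◁ σ X ▷ †X ⊗≫
      σ A ▷ (X ⊗ †X) ⊗≫ V ◁ (p ▷ †X ⊗≫ S ◁ rot q ⊗≫ pivEv S ▷ A ⊗≫ 𝟙 A) ⊗≫ 𝟙 (V ⊗ A) := by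
  rw [loopVertex]
  calc _ = 𝟙 (A ⊗ V) ⊗≫ A ◁ η_ X †X ▷ V ⊗≫ (A ⊗ X) ◁ σ' †X ⊗≫ p ▷ (V ⊗ †X) ⊗≫ ((S ⊗ V) ◁ rot q ≫
        σ S ▷ (†S ⊗ A)) ⊗≫ V ◁ pivEv S ▷ A ⊗≫ 𝟙 (V ⊗ A) := by monoidal
    _ = 𝟙 (A ⊗ V) ⊗≫ A ◁ η_ X †X ▷ V ⊗≫ (A ⊗ X) ◁ σ' †X ⊗≫ (𝟙 (A ⊗ X ⊗ V) ⊗≫ p ▷ V ≫ σ S) ▷ †X ⊗≫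
        (V ⊗ S) ◁ rot q ⊗≫ V ◁ pivEv S ▷ A ⊗≫ 𝟙 (V ⊗ A) := by rw [whisker_exchange]; monoidal
    _ = _ := by rw [h.merge]; monoidal

theorem loopVertex_eq_above (σ : ∀ A : C, A ⊗ V ⟶ V ⊗ A) {σ' : ∀ A : C, A ⊗ V ⟶ V ⊗ A} (h : IsHB σ')
    {A X S : C} (p : A ⊗ X ⟶ S) (q : S ⟶ A ⊗ X) :
    loopVertex σ σ' p q = 𝟙 (A ⊗ V) ⊗≫ (𝟙 A ⊗≫ A ◁ η_ X †X ⊗≫ p ▷ †X ⊗≫ S ◁ rot q) ▷ V ⊗≫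
      (S ⊗ †S) ◁ σ' A ⊗≫ S ◁ σ' †S ▷ A ⊗≫ σ S ▷ (†S ⊗ A) ⊗≫ V ◁ pivEv S ▷ A ⊗≫ 𝟙 (V ⊗ A) := by
  rw [loopVertex]
  calc _ = 𝟙 (A ⊗ V) ⊗≫ A ◁ η_ X †X ▷ V ⊗≫ ((A ⊗ X) ◁ σ' †X ≫ p ▷ (V ⊗ †X)) ⊗≫ (S ⊗ V) ◁ rot q ⊗≫
        σ S ▷ (†S ⊗ A) ⊗≫ V ◁ pivEv S ▷ A ⊗≫ 𝟙 (V ⊗ A) := by monoidal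
    _ = 𝟙 (A ⊗ V) ⊗≫ A ◁ η_ X †X ▷ V ⊗≫ p ▷ (†X ⊗ V) ⊗≫ S ◁ (σ' †X ≫ V ◁ rot q ⊗≫ 𝟙 (V ⊗ †S ⊗ A)) ⊗≫
        σ S ▷ (†S ⊗ A) ⊗≫ V ◁ pivEv S ▷ A ⊗≫ 𝟙 (V ⊗ A) := by rw [whisker_exchange]; monoidal
    _ = _ := by rw [h.split]; monoidal

end Loop

section Average

variable {𝕜 : Type w} [Field 𝕜] [IsAlgClosed 𝕜] {C : Type u} [Category.{v} C]
  [Abelian C] [Linear 𝕜 C] [FiniteSemisimple 𝕜 C] [MonoidalCategory C] [MonoidalPreadditive C]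
  [MonoidalLinear 𝕜 C] [Simple (𝟙_ C)] [RightRigidCategory C] [PivotalCategory C]
  (I : SimpleData 𝕜 C) {V W U : C}

/-- The loop in the regular colouring, divided by the global dimension. -/
def avg (σ σ' : ∀ A : C, A ⊗ V ⟶ V ⊗ A) : V ⟶ V :=
  (I.sqrtGlobalDim ^ 2)⁻¹ • ∑ i, dim 𝕜 (I.X i) • loop (I.X i) σ σ'

theorem loop_self (X : C) {σ : ∀ A : C, A ⊗ V ⟶ V ⊗ A} (h : IsHB σ) :
    loop X σ σ = dim 𝕜 X • 𝟙 V := by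
  rw [loop_self_eq X h, ← dim_smul_id (𝕜 := 𝕜)]
  rw [MonoidalLinear.whiskerLeft_smul, smul_coherence_comp, coherence_comp_smul]
  congr 1
  monoidal

theorem avg_self (hD : I.sqrtGlobalDim ≠ 0) {σ : ∀ A : C, A ⊗ V ⟶ V ⊗ A} (h : IsHB σ) :
    avg I σ σ = 𝟙 V := by
  rw [avg]
  simp only [loop_self (𝕜 := 𝕜) _ h, smul_smul, ← Finset.sum_smul, ← pow_two]
  rw [← I.sqrtGlobalDim_sq, inv_mul_cancel₀ (pow_ne_zero 2 hD), one_smul]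

theorem comp_avg {σ σ' : ∀ A : C, A ⊗ V ⟶ V ⊗ A} {τ τ' : ∀ A : C, A ⊗ W ⟶ W ⊗ A}
    {f : V ⟶ W} (h : Intertwines σ τ f) (h' : Intertwines σ' τ' f) :
    f ≫ avg I τ τ' = avg I σ σ' ≫ f := by
  simp only [avg, Linear.comp_smul, Linear.smul_comp, Preadditive.comp_sum, Preadditive.sum_comp,
    comp_loop _ h h']

theorem avg_prod_left {τ : ∀ A : C, A ⊗ U ⟶ U ⊗ A} {σ σ' : ∀ A : C, A ⊗ V ⟶ V ⊗ A}
    (h : IsHB τ) : avg I (prodγ τ σ) (prodγ τ σ') = U ◁ avg I σ σ' := by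
  simp only [avg, loop_prod_left _ h, MonoidalLinear.whiskerLeft_smul, whiskerLeft_sum]

theorem avg_prod_right {τ : ∀ A : C, A ⊗ U ⟶ U ⊗ A} {σ σ' : ∀ A : C, A ⊗ V ⟶ V ⊗ A}
    (h : IsHB τ) : avg I (prodγ σ τ) (prodγ σ' τ) = avg I σ σ' ▷ U := by
  simp only [avg, loop_prod_right _ h, MonoidalLinear.smul_whiskerRight, sum_whiskerRight]

theorem sum_loopVertex_below {σ : ∀ A : C, A ⊗ V ⟶ V ⊗ A} (h : IsHB σ)
    (σ' : ∀ A : C, A ⊗ V ⟶ V ⊗ A) (A : C) (i : I.ι) :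
    ∑ j, ∑ m, loopVertex σ σ' (homDual 𝕜 (I.X j) (A ⊗ I.X i) m) (homBasis 𝕜 (I.X j) (A ⊗ I.X i) m) =
      A ◁ loop (I.X i) σ σ' ≫ σ A := by
  have e := congrArg (fun f => 𝟙 (A ⊗ V) ⊗≫ A ◁ η_ (I.X i) †(I.X i) ▷ V ⊗≫ (A ⊗ I.X i) ◁ σ' †(I.X i) ⊗≫
    A ◁ σ (I.X i) ▷ †(I.X i) ⊗≫ σ A ▷ (I.X i ⊗ †(I.X i)) ⊗≫ V ◁ f ⊗≫ 𝟙 (V ⊗ A))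
    (I.sum_vertex_pivEv A i)
  simp only [whiskerLeft_sum, sum_coherence_comp, coherence_comp_sum] at e
  simp only [loopVertex_eq_below h]
  rw [e, loop]
  calc _ = 𝟙 (A ⊗ V) ⊗≫ A ◁ η_ (I.X i) †(I.X i) ▷ V ⊗≫ (A ⊗ I.X i) ◁ σ' †(I.X i) ⊗≫
        A ◁ σ (I.X i) ▷ †(I.X i) ⊗≫ (σ A ▷ (I.X i ⊗ †(I.X i)) ≫ (V ⊗ A) ◁ pivEv (I.X i)) ⊗≫ 𝟙 (V ⊗ A) := by
        monoidal
    _ = _ := by rw [← whisker_exchange]; monoidal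

variable [SphericalCategory C]

theorem sum_loopVertex_above (σ : ∀ A : C, A ⊗ V ⟶ V ⊗ A) {σ' : ∀ A : C, A ⊗ V ⟶ V ⊗ A}
    (h : IsHB σ') (A : C) (j : I.ι) :
    ∑ i, ∑ m, dim 𝕜 (I.X i) • loopVertex σ σ' (homDual 𝕜 (I.X j) (A ⊗ I.X i) m)
        (homBasis 𝕜 (I.X j) (A ⊗ I.X i) m) =
      dim 𝕜 (I.X j) • (σ' A ≫ loop (I.X j) σ σ' ▷ A) := by
  have e := congrArg (fun f => 𝟙 (A ⊗ V) ⊗≫ f ▷ V ⊗≫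
      (I.X j ⊗ †(I.X j)) ◁ σ' A ⊗≫ I.X j ◁ σ' †(I.X j) ▷ A ⊗≫ σ (I.X j) ▷ (†(I.X j) ⊗ A) ⊗≫
        V ◁ pivEv (I.X j) ▷ A ⊗≫ 𝟙 (V ⊗ A))
    (I.sum_coev_vertex A j)
  simp only [sum_whiskerRight, sum_coherence_comp, coherence_comp_sum,
    MonoidalLinear.smul_whiskerRight, smul_coherence_comp, coherence_comp_smul] at e
  simp only [loopVertex_eq_above σ h]
  rw [e, loop]
  congr 1
  calc _ = 𝟙 (A ⊗ V) ⊗≫ (η_ (I.X j) †(I.X j) ▷ (A ⊗ V) ≫ (I.X j ⊗ †(I.X j)) ◁ σ' A) ⊗≫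
        I.X j ◁ σ' †(I.X j) ▷ A ⊗≫ σ (I.X j) ▷ (†(I.X j) ⊗ A) ⊗≫
        V ◁ pivEv (I.X j) ▷ A ⊗≫ 𝟙 (V ⊗ A) := by monoidal
    _ = _ := by rw [← whisker_exchange]; monoidal

/-- The regular loop lets strands through. -/
theorem whiskerLeft_avg_comp {σ σ' : ∀ A : C, A ⊗ V ⟶ V ⊗ A} (h : IsHB σ) (h' : IsHB σ') (A : C) :
    A ◁ avg I σ σ' ≫ σ A = σ' A ≫ avg I σ σ' ▷ A := by
  simp only [avg, MonoidalLinear.whiskerLeft_smul, MonoidalLinear.smul_whiskerRight, whiskerLeft_sum,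
    sum_whiskerRight, Linear.smul_comp, Linear.comp_smul, Preadditive.sum_comp, Preadditive.comp_sum]
  simp only [← sum_loopVertex_below I h σ' A, ← sum_loopVertex_above I σ h' A, Finset.smul_sum]
  rw [Finset.sum_comm]

end Average

section Crossing

variable {C : Type u} [Category.{v} C] [MonoidalCategory C]

/-- A natural family `χ B A : A ⊗ B ⟶ B ⊗ A` of crossings, monoidal in `B`. -/
structure IsCrossing (χ : ∀ B A : C, A ⊗ B ⟶ B ⊗ A) : Prop where
  nat : ∀ {B B' : C} (f : B ⟶ B') (A : C), A ◁ f ≫ χ B' A = χ B A ≫ f ▷ A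
  nat_left : ∀ (B : C) {A A' : C} (f : A ⟶ A'), f ▷ B ≫ χ B A' = χ B A ≫ B ◁ f
  tensor : ∀ B B' A : C, χ (B ⊗ B') A = prodγ (χ B) (χ B') A
  unit : ∀ A : C, χ (𝟙_ C) A = 𝟙 _ ⊗≫ 𝟙 _

theorem isCrossing_under [BraidedCategory C] : IsCrossing (underγ (C := C)) where
  nat f A := under_natural f A
  nat_left B _ _ f := (isHB_under B).nat f
  tensor := under_tensor
  unit A := by
    simp only [underγ, braiding_tensorUnit_right]; monoidal

theorem isCrossing_over [BraidedCategory C] : IsCrossing (overγ (C := C)) where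
  nat f A := over_natural f A
  nat_left B _ _ f := (isHB_over B).nat f
  tensor := over_tensor
  unit A := by
    simp only [overγ, braiding_inv_tensorUnit_left]; monoidal

namespace IsCrossing

variable {χ : ∀ B A : C, A ⊗ B ⟶ B ⊗ A} (h : IsCrossing χ)

include h

theorem cup {X Y : C} (f : 𝟙_ C ⟶ X ⊗ Y) (A : C) :
    𝟙 A ⊗≫ A ◁ f ⊗≫ χ X A ▷ Y ⊗≫ X ◁ χ Y A ⊗≫ 𝟙 (X ⊗ Y ⊗ A) = 𝟙 A ⊗≫ f ▷ A ⊗≫ 𝟙 (X ⊗ Y ⊗ A) := by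
  have := h.nat f A
  rw [h.tensor, h.unit, prodγ] at this
  calc _ = 𝟙 A ⊗≫ (A ◁ f ≫ (α_ A X Y).inv ≫ χ X A ▷ Y ≫ (α_ X A Y).hom ≫ X ◁ χ Y A ≫
        (α_ X Y A).inv) ⊗≫ 𝟙 (X ⊗ Y ⊗ A) := by monoidal
    _ = _ := by rw [this]; monoidal

theorem cap {X Y : C} (f : X ⊗ Y ⟶ 𝟙_ C) (A : C) :
    𝟙 (A ⊗ X ⊗ Y) ⊗≫ χ X A ▷ Y ⊗≫ X ◁ χ Y A ⊗≫ f ▷ A ⊗≫ 𝟙 A = 𝟙 (A ⊗ X ⊗ Y) ⊗≫ A ◁ f ⊗≫ 𝟙 A := by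
  have := h.nat f A
  rw [h.tensor, h.unit, prodγ] at this
  calc _ = 𝟙 (A ⊗ X ⊗ Y) ⊗≫ (((α_ A X Y).inv ≫ χ X A ▷ Y ≫ (α_ X A Y).hom ≫ X ◁ χ Y A ≫
        (α_ X Y A).inv) ≫ f ▷ A) ⊗≫ 𝟙 A := by monoidal
    _ = _ := by rw [← this]; monoidal

end IsCrossing

/-- The Yang-Baxter compatibility of `τ` and `σ`, with strands crossing by `χ`. -/
def YangBaxter (χ : ∀ B A : C, A ⊗ B ⟶ B ⊗ A) {V : C} (τ σ : ∀ A : C, A ⊗ V ⟶ V ⊗ A) : Prop :=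
  ∀ A B : C, A ◁ σ B ⊗≫ τ A ▷ B ⊗≫ V ◁ χ B A = 𝟙 (A ⊗ B ⊗ V) ⊗≫ χ B A ▷ V ⊗≫ B ◁ τ A ⊗≫ σ B ▷ A ⊗≫
    𝟙 (V ⊗ B ⊗ A)

theorem yangBaxter_self (χ : ∀ B A : C, A ⊗ B ⟶ B ⊗ A) {V : C} {σ : ∀ A : C, A ⊗ V ⟶ V ⊗ A}
    (h : IsHB σ) : YangBaxter χ σ σ := by
  intro A B
  rw [← h.merge]
  calc _ = 𝟙 (A ⊗ B ⊗ V) ⊗≫ (χ B A ▷ V ≫ σ (B ⊗ A)) := by monoidal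
    _ = _ := by rw [h.hex]; monoidal

theorem yangBaxter_prod {χ : ∀ B A : C, A ⊗ B ⟶ B ⊗ A} {V W : C} {τ σ : ∀ A : C, A ⊗ V ⟶ V ⊗ A}
    {τ' σ' : ∀ A : C, A ⊗ W ⟶ W ⊗ A} (h : YangBaxter χ τ σ) (h' : YangBaxter χ τ' σ') :
    YangBaxter χ (prodγ τ τ') (prodγ σ σ') := by
  intro A B
  have h := h A B
  have h' := h' A B
  simp only [prodγ]
  calc _ = 𝟙 (A ⊗ B ⊗ V ⊗ W) ⊗≫ A ◁ σ B ▷ W ⊗≫ ((A ⊗ V) ◁ σ' B ≫ τ A ▷ (W ⊗ B)) ⊗≫ V ◁ τ' A ▷ B ⊗≫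
        V ◁ W ◁ χ B A ⊗≫ 𝟙 ((V ⊗ W) ⊗ B ⊗ A) := by monoidal
    _ = 𝟙 (A ⊗ B ⊗ V ⊗ W) ⊗≫ A ◁ σ B ▷ W ⊗≫ τ A ▷ (B ⊗ W) ⊗≫ V ◁ (A ◁ σ' B ⊗≫ τ' A ▷ B ⊗≫
        W ◁ χ B A) ⊗≫ 𝟙 ((V ⊗ W) ⊗ B ⊗ A) := by rw [whisker_exchange]; monoidal
    _ = 𝟙 (A ⊗ B ⊗ V ⊗ W) ⊗≫ (A ◁ σ B ⊗≫ τ A ▷ B ⊗≫ V ◁ χ B A) ▷ W ⊗≫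
        V ◁ B ◁ τ' A ⊗≫ V ◁ σ' B ▷ A ⊗≫ 𝟙 ((V ⊗ W) ⊗ B ⊗ A) := by rw [h']; monoidal
    _ = 𝟙 (A ⊗ B ⊗ V ⊗ W) ⊗≫ χ B A ▷ (V ⊗ W) ⊗≫ B ◁ τ A ▷ W ⊗≫ (σ B ▷ (A ⊗ W) ≫
        (V ⊗ B) ◁ τ' A) ⊗≫ V ◁ σ' B ▷ A ⊗≫ 𝟙 ((V ⊗ W) ⊗ B ⊗ A) := by rw [h]; monoidal
    _ = _ := by rw [← whisker_exchange]; monoidal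

/-- A crossing family is compatible with any family, by naturality. -/
theorem yangBaxter_left {χ : ∀ B A : C, A ⊗ B ⟶ B ⊗ A} (h : IsCrossing χ) {V : C}
    (σ : ∀ A : C, A ⊗ V ⟶ V ⊗ A) : YangBaxter χ (χ V) σ := by
  intro A B
  have := h.nat (σ B) A
  rw [h.tensor, h.tensor, prodγ, prodγ] at this
  calc _ = (A ◁ σ B ≫ (α_ A V B).inv ≫ χ V A ▷ B ≫ (α_ V A B).hom ≫ V ◁ χ B A ≫ (α_ V B A).inv) ⊗≫
        𝟙 (V ⊗ B ⊗ A) := by monoidal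
    _ = _ := by rw [this]; monoidal

theorem yangBaxter_right {χ χ' : ∀ B A : C, A ⊗ B ⟶ B ⊗ A} (h : IsCrossing χ')
    (hχ : ∀ A B, χ B A ≫ χ' A B = 𝟙 _) (hχ' : ∀ A B, χ' B A ≫ χ A B = 𝟙 _) {V : C}
    (τ : ∀ A : C, A ⊗ V ⟶ V ⊗ A) : YangBaxter χ τ (χ' V) := by
  intro A B
  have := yangBaxter_left h τ B A
  calc _ = 𝟙 (A ⊗ B ⊗ V) ⊗≫ (χ B A ≫ χ' A B) ▷ V ⊗≫ A ◁ χ' V B ⊗≫ τ A ▷ B ⊗≫ V ◁ χ B A := by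
        rw [hχ]; monoidal
    _ = 𝟙 (A ⊗ B ⊗ V) ⊗≫ χ B A ▷ V ⊗≫ (𝟙 (B ⊗ A ⊗ V) ⊗≫ χ' A B ▷ V ⊗≫ A ◁ χ' V B ⊗≫ τ A ▷ B ⊗≫
        𝟙 (V ⊗ A ⊗ B)) ⊗≫ V ◁ χ B A := by monoidal
    _ = 𝟙 (A ⊗ B ⊗ V) ⊗≫ χ B A ▷ V ⊗≫ B ◁ τ A ⊗≫ χ' V B ▷ A ⊗≫ V ◁ (χ' A B ≫ χ B A) := by
        rw [← this]; monoidal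
    _ = _ := by rw [hχ']; monoidal

/-- Two half-braidings of one object whose loops commute with both. -/
structure Compatible {V : C} (σ σ' : ∀ A : C, A ⊗ V ⟶ V ⊗ A) : Prop where
  left : IsHB σ
  right : IsHB σ'
  yb : ∃ χ : ∀ B A : C, A ⊗ B ⟶ B ⊗ A, IsCrossing χ ∧ YangBaxter χ σ σ'
  yb' : ∃ χ : ∀ B A : C, A ⊗ B ⟶ B ⊗ A, IsCrossing χ ∧ YangBaxter χ σ' σ

theorem Compatible.symm {V : C} {σ σ' : ∀ A : C, A ⊗ V ⟶ V ⊗ A} (h : Compatible σ σ') :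
    Compatible σ' σ := ⟨h.right, h.left, h.yb', h.yb⟩

section

variable [BraidedCategory C]

theorem Compatible.over_right {V : C} {σ : ∀ A : C, A ⊗ V ⟶ V ⊗ A} (h : IsHB σ) :
    Compatible σ (overγ V) :=
  ⟨h, isHB_over V, ⟨underγ, isCrossing_under, yangBaxter_right isCrossing_over
    (fun A B => by simp [underγ, overγ]) (fun A B => by simp [underγ, overγ]) σ⟩,
    ⟨overγ, isCrossing_over, yangBaxter_left isCrossing_over σ⟩⟩

/-- The pair of half-braidings defining the reduced tensor product. -/
theorem Compatible.reduced {V W : C} {σ : ∀ A : C, A ⊗ V ⟶ V ⊗ A} {τ : ∀ A : C, A ⊗ W ⟶ W ⊗ A}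
    (hσ : IsHB σ) (hτ : IsHB τ) : Compatible (prodγ σ (overγ W)) (prodγ (underγ V) τ) :=
  ⟨hσ.prod (isHB_over W), (isHB_under V).prod hτ,
    ⟨overγ, isCrossing_over, yangBaxter_prod (yangBaxter_right isCrossing_under
      (fun A B => by simp [underγ, overγ]) (fun A B => by simp [underγ, overγ]) σ)
      (yangBaxter_left isCrossing_over τ)⟩,
    ⟨underγ, isCrossing_under, yangBaxter_prod (yangBaxter_left isCrossing_under σ)
      (yangBaxter_right isCrossing_over (fun A B => by simp [underγ, overγ])
        (fun A B => by simp [underγ, overγ]) τ)⟩⟩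

end

variable [RightRigidCategory C] [PivotalCategory C]

theorem loop_commute (X : C) {χ : ∀ B A : C, A ⊗ B ⟶ B ⊗ A} (hχ : IsCrossing χ) {V : C}
    {τ σ σ' : ∀ A : C, A ⊗ V ⟶ V ⊗ A} (h : YangBaxter χ τ σ) (h' : YangBaxter χ τ σ') (A : C) :
    A ◁ loop X σ σ' ≫ τ A = τ A ≫ loop X σ σ' ▷ A := by
  have h := h A X
  have h' := h' A †X
  rw [loop]
  calc _ = 𝟙 (A ⊗ V) ⊗≫ A ◁ η_ X †X ▷ V ⊗≫ A ◁ X ◁ σ' †X ⊗≫ A ◁ σ X ▷ †X ⊗≫ ((A ⊗ V) ◁ pivEv X ≫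
        τ A ▷ 𝟙_ C) ⊗≫ 𝟙 (V ⊗ A) := by monoidal
    _ = 𝟙 (A ⊗ V) ⊗≫ A ◁ η_ X †X ▷ V ⊗≫ A ◁ X ◁ σ' †X ⊗≫ A ◁ σ X ▷ †X ⊗≫ τ A ▷ (X ⊗ †X) ⊗≫
        V ◁ (𝟙 (A ⊗ X ⊗ †X) ⊗≫ A ◁ pivEv X ⊗≫ 𝟙 A) := by rw [whisker_exchange]; monoidal
    _ = 𝟙 (A ⊗ V) ⊗≫ A ◁ η_ X †X ▷ V ⊗≫ A ◁ X ◁ σ' †X ⊗≫ (A ◁ σ X ⊗≫ τ A ▷ X ⊗≫ V ◁ χ X A) ▷ †X ⊗≫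
        V ◁ X ◁ χ †X A ⊗≫ V ◁ pivEv X ▷ A ⊗≫ 𝟙 (V ⊗ A) := by rw [← hχ.cap]; monoidal
    _ = 𝟙 (A ⊗ V) ⊗≫ A ◁ η_ X †X ▷ V ⊗≫ ((A ⊗ X) ◁ σ' †X ≫ χ X A ▷ (V ⊗ †X)) ⊗≫ X ◁ τ A ▷ †X ⊗≫
        σ X ▷ (A ⊗ †X) ⊗≫ (V ⊗ X) ◁ χ †X A ⊗≫ V ◁ pivEv X ▷ A ⊗≫ 𝟙 (V ⊗ A) := by
      rw [h]; monoidal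
    _ = 𝟙 (A ⊗ V) ⊗≫ A ◁ η_ X †X ▷ V ⊗≫ χ X A ▷ (†X ⊗ V) ⊗≫ X ◁ A ◁ σ' †X ⊗≫ X ◁ τ A ▷ †X ⊗≫
        (σ X ▷ (A ⊗ †X) ≫ (V ⊗ X) ◁ χ †X A) ⊗≫ V ◁ pivEv X ▷ A ⊗≫ 𝟙 (V ⊗ A) := by
      rw [whisker_exchange]; monoidal
    _ = 𝟙 (A ⊗ V) ⊗≫ A ◁ η_ X †X ▷ V ⊗≫ χ X A ▷ (†X ⊗ V) ⊗≫ X ◁ (A ◁ σ' †X ⊗≫ τ A ▷ †X ⊗≫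
        V ◁ χ †X A) ⊗≫ σ X ▷ (†X ⊗ A) ⊗≫ V ◁ pivEv X ▷ A ⊗≫ 𝟙 (V ⊗ A) := by
      rw [← whisker_exchange]; monoidal
    _ = 𝟙 (A ⊗ V) ⊗≫ (𝟙 A ⊗≫ A ◁ η_ X †X ⊗≫ χ X A ▷ †X ⊗≫ X ◁ χ †X A ⊗≫ 𝟙 (X ⊗ †X ⊗ A)) ▷ V ⊗≫
        (X ⊗ †X) ◁ τ A ⊗≫ X ◁ σ' †X ▷ A ⊗≫ σ X ▷ (†X ⊗ A) ⊗≫ V ◁ pivEv X ▷ A ⊗≫ 𝟙 (V ⊗ A) := by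
      rw [h']; monoidal
    _ = 𝟙 (A ⊗ V) ⊗≫ (η_ X †X ▷ (A ⊗ V) ≫ (X ⊗ †X) ◁ τ A) ⊗≫ X ◁ σ' †X ▷ A ⊗≫ σ X ▷ (†X ⊗ A) ⊗≫
        V ◁ pivEv X ▷ A ⊗≫ 𝟙 (V ⊗ A) := by rw [hχ.cup]; monoidal
    _ = _ := by rw [← whisker_exchange]; monoidal

theorem comp_loop_of_eq (X : C) {V W : C} {σ σ' : ∀ A : C, A ⊗ V ⟶ V ⊗ A} {f : W ⟶ V}
    (h : ∀ A : C, A ◁ f ≫ σ A = A ◁ f ≫ σ' A) : f ≫ loop X σ σ' = f ≫ loop X σ σ := by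
  have key : ∀ σ' : ∀ A : C, A ⊗ V ⟶ V ⊗ A, f ≫ loop X σ σ' = 𝟙 W ⊗≫ η_ X †X ▷ W ⊗≫
      X ◁ (†X ◁ f ≫ σ' †X) ⊗≫ σ X ▷ †X ⊗≫ V ◁ pivEv X ⊗≫ 𝟙 V := by
    intro σ'
    rw [loop]
    calc _ = 𝟙 W ⊗≫ (𝟙_ C ◁ f ≫ η_ X †X ▷ V) ⊗≫ X ◁ σ' †X ⊗≫ σ X ▷ †X ⊗≫ V ◁ pivEv X ⊗≫ 𝟙 V := by
          monoidal
      _ = _ := by rw [whisker_exchange]; monoidal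
  rw [key, key, h]

theorem loop_comp_of_eq (X : C) {V W : C} {σ σ' : ∀ A : C, A ⊗ V ⟶ V ⊗ A} {f : V ⟶ W}
    (h : ∀ A : C, σ A ≫ f ▷ A = σ' A ≫ f ▷ A) : loop X σ σ' ≫ f = loop X σ' σ' ≫ f := by
  have key : ∀ σ : ∀ A : C, A ⊗ V ⟶ V ⊗ A, loop X σ σ' ≫ f = 𝟙 V ⊗≫ η_ X †X ▷ V ⊗≫
      X ◁ σ' †X ⊗≫ (σ X ≫ f ▷ X) ▷ †X ⊗≫ W ◁ pivEv X ⊗≫ 𝟙 W := by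
    intro σ
    rw [loop]
    calc _ = 𝟙 V ⊗≫ η_ X †X ▷ V ⊗≫ X ◁ σ' †X ⊗≫ σ X ▷ †X ⊗≫ (V ◁ pivEv X ≫ f ▷ 𝟙_ C) ⊗≫ 𝟙 W := by
          monoidal
      _ = _ := by rw [whisker_exchange]; monoidal
  rw [key, key, h]

end Crossing

section Average

variable {𝕜 : Type w} [Field 𝕜] [IsAlgClosed 𝕜] {C : Type u} [Category.{v} C]
  [Abelian C] [Linear 𝕜 C] [FiniteSemisimple 𝕜 C] [MonoidalCategory C] [MonoidalPreadditive C]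
  [MonoidalLinear 𝕜 C] [Simple (𝟙_ C)] [RightRigidCategory C] [PivotalCategory C]
  (I : SimpleData 𝕜 C) {V W U : C}

theorem comp_avg_of_eq (hD : I.sqrtGlobalDim ≠ 0) {σ σ' : ∀ A : C, A ⊗ V ⟶ V ⊗ A} (hσ : IsHB σ)
    {f : W ⟶ V} (h : ∀ A : C, A ◁ f ≫ σ A = A ◁ f ≫ σ' A) : f ≫ avg I σ σ' = f := by
  conv_rhs => rw [← Category.comp_id f, ← avg_self I hD hσ]
  simp only [avg, Linear.comp_smul, Preadditive.comp_sum, comp_loop_of_eq _ h]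

theorem avg_comp_of_eq (hD : I.sqrtGlobalDim ≠ 0) {σ σ' : ∀ A : C, A ⊗ V ⟶ V ⊗ A} (hσ : IsHB σ')
    {f : V ⟶ W} (h : ∀ A : C, σ A ≫ f ▷ A = σ' A ≫ f ▷ A) : avg I σ σ' ≫ f = f := by
  conv_rhs => rw [← Category.id_comp f, ← avg_self I hD hσ]
  simp only [avg, Linear.smul_comp, Preadditive.sum_comp, loop_comp_of_eq _ h]

namespace Compatible

variable {σ σ' : ∀ A : C, A ⊗ V ⟶ V ⊗ A} (h : Compatible σ σ')

include h

theorem avg_left : Intertwines σ σ (avg I σ σ') := by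
  intro A
  obtain ⟨χ, hχ, hy⟩ := h.yb
  simp only [avg, MonoidalLinear.whiskerLeft_smul, MonoidalLinear.smul_whiskerRight, whiskerLeft_sum,
    sum_whiskerRight, Linear.smul_comp, Linear.comp_smul, Preadditive.sum_comp, Preadditive.comp_sum,
    loop_commute _ hχ (yangBaxter_self χ h.left) hy]

theorem avg_right : Intertwines σ' σ' (avg I σ σ') := by
  intro A
  obtain ⟨χ, hχ, hy⟩ := h.yb'
  simp only [avg, MonoidalLinear.whiskerLeft_smul, MonoidalLinear.smul_whiskerRight, whiskerLeft_sum,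
    sum_whiskerRight, Linear.smul_comp, Linear.comp_smul, Preadditive.sum_comp, Preadditive.comp_sum,
    loop_commute _ hχ hy (yangBaxter_self χ h.right)]

variable [SphericalCategory C]

theorem whiskerLeft_avg (A : C) : A ◁ avg I σ σ' ≫ σ A = A ◁ avg I σ σ' ≫ σ' A :=
  (whiskerLeft_avg_comp I h.left h.right A).trans (h.avg_right I A).symm

theorem avg_whiskerRight (A : C) : σ A ≫ avg I σ σ' ▷ A = σ' A ≫ avg I σ σ' ▷ A :=
  (h.avg_left I A).symm.trans (whiskerLeft_avg_comp I h.left h.right A)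

theorem avg_comp_avg (hD : I.sqrtGlobalDim ≠ 0) : avg I σ σ' ≫ avg I σ σ' = avg I σ σ' :=
  comp_avg_of_eq I hD h.left (h.whiskerLeft_avg I)

theorem avg_symm (hD : I.sqrtGlobalDim ≠ 0) : avg I σ σ' = avg I σ' σ := by
  have h1 : avg I σ σ' ≫ avg I σ' σ = avg I σ σ' :=
    comp_avg_of_eq I hD h.right fun A => (h.whiskerLeft_avg I A).symm
  have h2 : avg I σ σ' ≫ avg I σ' σ = avg I σ' σ :=
    avg_comp_of_eq I hD h.right fun A => (h.symm.avg_whiskerRight I A).symm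
  rw [← h1, h2]

end Compatible

end Average

section Killing

variable {𝕜 : Type w} [Field 𝕜] [IsAlgClosed 𝕜] {C : Type u} [Category.{v} C]
  [Abelian C] [Linear 𝕜 C] [FiniteSemisimple 𝕜 C] [MonoidalCategory C] [MonoidalPreadditive C]
  [MonoidalLinear 𝕜 C] [Simple (𝟙_ C)] [BraidedCategory C] [RightRigidCategory C]
  [PivotalCategory C] [SphericalCategory C] (I : SimpleData 𝕜 C)

theorem rightTrace_loop {C : Type u} [Category.{v} C] [MonoidalCategory C] [BraidedCategory C]
    [RightRigidCategory C] [PivotalCategory C] (V X : C) :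
    rightTrace (loop X (underγ V) (overγ V)) = rightTrace ((β_ V X).hom ≫ (β_ X V).hom) := by
  have h : loop X (underγ V) (overγ V) = 𝟙 V ⊗≫ V ◁ η_ X †X ⊗≫ ((β_ V X).hom ≫ (β_ X V).hom) ▷ †X ⊗≫
      V ◁ pivEv X ⊗≫ 𝟙 V := by
    rw [loop]
    calc _ = 𝟙 V ⊗≫ η_ X †X ▷ V ⊗≫ X ◁ overγ V †X ⊗≫ (overγ V X ≫ (β_ V X).hom ≫ underγ V X) ▷ †X ⊗≫
          V ◁ pivEv X ⊗≫ 𝟙 V := by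
          rw [overγ, overγ, Iso.inv_hom_id_assoc]
      _ = (𝟙 V ⊗≫ η_ X †X ▷ V ⊗≫ X ◁ overγ V †X ⊗≫ overγ V X ▷ †X ⊗≫ 𝟙 (V ⊗ X ⊗ †X)) ⊗≫
          ((β_ V X).hom ≫ underγ V X) ▷ †X ⊗≫ V ◁ pivEv X ⊗≫ 𝟙 V := by monoidal
      _ = _ := by rw [(isHB_over V).cup, underγ]; monoidal
  rw [rightTrace_tensor, h, rightTrace]
  monoidal

/-- The loop in the regular colouring. -/
def regLoop {V : C} (σ σ' : ∀ A : C, A ⊗ V ⟶ V ⊗ A) : V ⟶ V :=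
  ∑ i, dim 𝕜 (I.X i) • loop (I.X i) σ σ'

theorem avg_eq_regLoop {V : C} (σ σ' : ∀ A : C, A ⊗ V ⟶ V ⊗ A) :
    avg I σ σ' = (I.sqrtGlobalDim ^ 2)⁻¹ • regLoop I σ σ' := rfl

theorem whiskerLeft_regLoop_comp {V : C} {σ σ' : ∀ A : C, A ⊗ V ⟶ V ⊗ A} (h : IsHB σ)
    (h' : IsHB σ') (A : C) : A ◁ regLoop I σ σ' ≫ σ A = σ' A ≫ regLoop I σ σ' ▷ A := by
  simp only [regLoop, MonoidalLinear.whiskerLeft_smul, MonoidalLinear.smul_whiskerRight,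
    whiskerLeft_sum, sum_whiskerRight, Linear.smul_comp, Linear.comp_smul, Preadditive.sum_comp,
    Preadditive.comp_sum]
  simp only [← sum_loopVertex_below I h σ' A, ← sum_loopVertex_above I σ h' A, Finset.smul_sum]
  rw [Finset.sum_comm]

theorem under_eq_over_unit : underγ (𝟙_ C) = overγ (𝟙_ C) := by
  funext A
  rw [isCrossing_under.unit, isCrossing_over.unit]

theorem transparent_of_iso_unit {U : C} (i : 𝟙_ C ≅ U) : underγ U = overγ U := by
  funext A
  have h1 := under_natural i.hom A
  have h2 := over_natural i.hom A
  dsimp only at h1 h2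
  rw [← cancel_epi (A ◁ i.hom), h1, h2, under_eq_over_unit]

theorem rightTrace_id_tensor (X Y : C) :
    scalar 𝕜 (rightTrace (𝟙 (X ⊗ Y))) = dim 𝕜 X * dim 𝕜 Y := by
  rw [← MonoidalCategory.id_tensorHom_id, rightTrace_tensorHom, ← dim_smul_id (𝕜 := 𝕜) Y,
    mul_comm]
  conv_rhs => rw [dim.eq_1 _ X, ← scalar_smul]
  congr 1
  rw [MonoidalLinear.smul_whiskerRight, MonoidalLinear.whiskerLeft_smul, smul_coherence_comp,
    coherence_comp_smul, coherence_comp_smul]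
  congr 1
  rw [rightTrace]
  monoidal

theorem sMatrix_of_transparent {i : I.ι} (h : underγ (I.X i) = overγ (I.X i)) (j : I.ι) :
    sMatrix I i j = dim 𝕜 (I.X i) * dim 𝕜 (I.X j) := by
  have h' := congrFun h (I.X j)
  rw [underγ, overγ] at h'
  rw [sMatrix, h', Iso.hom_inv_id, rightTrace_id_tensor]

theorem regLoop_scalar (i : I.ι) : ∃ ν : 𝕜,
    regLoop I (underγ (I.X i)) (overγ (I.X i)) = ν • 𝟙 (I.X i) := exists_eq_smul_id _

variable (hI : IsModular I)

include hI

theorem eq_one_of_transparent {i : I.ι} (h : underγ (I.X i) = overγ (I.X i)) : i = I.one := by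
  classical
  by_contra hne
  have hdet : (sMatrix I).det ≠ 0 := by convert hI
  let x : I.ι → 𝕜 := fun k => if k = i then 1 else if k = I.one then - dim 𝕜 (I.X i) else 0
  have hx : Matrix.vecMul x (sMatrix I) = 0 := by
    funext j
    rw [Matrix.vecMul, dotProduct, Finset.sum_eq_add i I.one hne]
    · simp only [x, if_true, if_neg (Ne.symm hne)]
      rw [sMatrix_of_transparent I h,
        sMatrix_of_transparent I (transparent_of_iso_unit I.oneIso), I.dim_one]
      simp
    · intro k _ hk
      simp [x, hk.1, hk.2]
    · simp
    · simp
  have := congrFun (Matrix.eq_zero_of_vecMul_eq_zero hdet hx) i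
  simp [x] at this

theorem regLoop_eq_zero {i : I.ι} (h : i ≠ I.one) :
    regLoop I (underγ (I.X i)) (overγ (I.X i)) = 0 := by
  obtain ⟨ν, hν⟩ := regLoop_scalar I i
  by_cases h0 : ν = 0
  · rw [hν, h0, zero_smul]
  · refine absurd (eq_one_of_transparent I hI ?_) h
    funext A
    have := whiskerLeft_regLoop_comp I (isHB_under (I.X i)) (isHB_over (I.X i)) A
    rw [hν, MonoidalLinear.whiskerLeft_smul, MonoidalLinear.smul_whiskerRight, Linear.smul_comp,
      Linear.comp_smul, MonoidalCategory.whiskerLeft_id, MonoidalCategory.id_whiskerRight,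
      Category.id_comp, Category.comp_id] at this
    exact smul_right_injective _ h0 this

theorem sqrtGlobalDim_ne_zero : I.sqrtGlobalDim ≠ 0 := by
  classical
  intro hD
  have hD2 : ∑ i, dim 𝕜 (I.X i) ^ 2 = 0 := by rw [← I.sqrtGlobalDim_sq, hD]; simp
  have hz : ∀ i, regLoop I (underγ (I.X i)) (overγ (I.X i)) = 0 := by
    intro i
    by_cases h : i = I.one
    · subst h
      rw [regLoop, transparent_of_iso_unit I.oneIso]
      simp only [loop_self (𝕜 := 𝕜) _ (isHB_over (I.X I.one)), smul_smul, ← Finset.sum_smul,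
        ← pow_two]
      rw [hD2, zero_smul]
    · exact regLoop_eq_zero I hI h
  have hdet : (sMatrix I).det ≠ 0 := by convert hI
  have hx : Matrix.mulVec (sMatrix I) (fun j => dim 𝕜 (I.X j)) = 0 := by
    funext i
    have h1 : ∑ j, dim 𝕜 (I.X j) * sMatrix I i j =
        scalar 𝕜 (rightTrace (regLoop I (underγ (I.X i)) (overγ (I.X i)))) := by
      have h2 : rightTrace (regLoop I (underγ (I.X i)) (overγ (I.X i))) =
          ∑ j, dim 𝕜 (I.X j) • rightTrace (loop (I.X j) (underγ (I.X i)) (overγ (I.X i))) := by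
        simp only [regLoop, rightTrace, sum_whiskerRight, Preadditive.sum_comp,
          Preadditive.comp_sum, MonoidalLinear.smul_whiskerRight, Linear.smul_comp,
          Linear.comp_smul]
      rw [h2, scalar_sum]
      simp only [scalar_smul, rightTrace_loop, sMatrix]
    rw [Matrix.mulVec, dotProduct]
    simp only [mul_comm (sMatrix I i _)]
    rw [h1, hz]
    exact scalar_eq (by simp [rightTrace])
  have := congrFun (Matrix.eq_zero_of_mulVec_eq_zero hdet hx) I.one
  simp [I.dim_one] at this

theorem avg_under_over_simple {i : I.ι} (h : i ≠ I.one) :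
    avg I (underγ (I.X i)) (overγ (I.X i)) = 0 := by
  rw [avg_eq_regLoop, regLoop_eq_zero I hI h, smul_zero]

theorem avg_under_over_unit {U : C} (i : 𝟙_ C ≅ U) : avg I (underγ U) (overγ U) = 𝟙 U := by
  rw [transparent_of_iso_unit i, avg_self I (sqrtGlobalDim_ne_zero I hI) (isHB_over U)]

/-- The regular loop around `V` is the projection to the invariants of `V`. -/
theorem avg_under_over (V : C) : avg I (underγ V) (overγ V) =
    ∑ m, homDual 𝕜 (𝟙_ C) V m ≫ homBasis 𝕜 (𝟙_ C) V m := by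
  refine I.hom_ext fun i f => ?_
  rw [comp_avg I (under_natural f) (over_natural f), Preadditive.comp_sum]
  by_cases h : i = I.one
  · subst h
    rw [avg_under_over_unit I hI I.oneIso, Category.id_comp, ← cancel_epi I.oneIso.hom,
      Preadditive.comp_sum]
    conv_lhs => rw [← sum_comp_homDual_comp_homBasis (𝕜 := 𝕜) (I.oneIso.hom ≫ f)]
    simp only [Category.assoc]
  · rw [avg_under_over_simple I hI h, zero_comp]
    symm
    refine Finset.sum_eq_zero fun m _ => ?_
    have : (f ≫ homDual 𝕜 (𝟙_ C) V m) ≫ I.oneIso.hom = 0 := I.hom_eq_zero h _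
    have h2 : f ≫ homDual 𝕜 (𝟙_ C) V m = 0 := by
      rw [← cancel_mono I.oneIso.hom, this, zero_comp]
    rw [← Category.assoc, h2, zero_comp]

theorem avg_over_under (V : C) : avg I (overγ V) (underγ V) =
    ∑ m, homDual 𝕜 (𝟙_ C) V m ≫ homBasis 𝕜 (𝟙_ C) V m := by
  rw [← avg_under_over I hI, (Compatible.over_right (isHB_under V)).avg_symm I
    (sqrtGlobalDim_ne_zero I hI)]

end Killing

section Reduced

variable {𝕜 : Type w} [Field 𝕜] [IsAlgClosed 𝕜] {C : Type u} [Category.{v} C]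
  [Abelian C] [Linear 𝕜 C] [FiniteSemisimple 𝕜 C] [MonoidalCategory C] [MonoidalPreadditive C]
  [MonoidalLinear 𝕜 C] [Simple (𝟙_ C)] [BraidedCategory C] [RightRigidCategory C]
  [PivotalCategory C] [SphericalCategory C] (I : SimpleData 𝕜 C)

theorem coev_underγ {C : Type u} [Category.{v} C] [MonoidalCategory C] [BraidedCategory C]
    [RightRigidCategory C] (X V : C) :
    𝟙 V ⊗≫ η_ X †X ▷ V ⊗≫ X ◁ underγ V †X ⊗≫ 𝟙 (X ⊗ V ⊗ †X) =
      𝟙 V ⊗≫ V ◁ η_ X †X ⊗≫ (β_ X V).inv ▷ †X ⊗≫ 𝟙 (X ⊗ V ⊗ †X) := by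
  calc _ = 𝟙 V ⊗≫ η_ X †X ▷ V ⊗≫ X ◁ underγ V †X ⊗≫ (underγ V X ≫ (β_ X V).inv) ▷ †X ⊗≫
        𝟙 (X ⊗ V ⊗ †X) := by
        rw [underγ, underγ, Iso.hom_inv_id]; monoidal
    _ = (𝟙 V ⊗≫ η_ X †X ▷ V ⊗≫ X ◁ underγ V †X ⊗≫ underγ V X ▷ †X ⊗≫ 𝟙 (V ⊗ X ⊗ †X)) ⊗≫
        (β_ X V).inv ▷ †X ⊗≫ 𝟙 (X ⊗ V ⊗ †X) := by monoidal
    _ = _ := by rw [(isHB_under V).cup]; monoidal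

theorem overγ_pivEv {C : Type u} [Category.{v} C] [MonoidalCategory C] [BraidedCategory C]
    [RightRigidCategory C] [PivotalCategory C] (X V : C) :
    𝟙 (X ⊗ V ⊗ †X) ⊗≫ overγ V X ▷ †X ⊗≫ V ◁ pivEv X ⊗≫ 𝟙 V =
      𝟙 (X ⊗ V ⊗ †X) ⊗≫ X ◁ (β_ V †X).hom ⊗≫ pivEv X ▷ V ⊗≫ 𝟙 V := by
  calc _ = 𝟙 (X ⊗ V ⊗ †X) ⊗≫ X ◁ ((β_ V †X).hom ≫ overγ V †X) ⊗≫ overγ V X ▷ †X ⊗≫ V ◁ pivEv X ⊗≫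
        𝟙 V := by
        rw [overγ, overγ, Iso.hom_inv_id]; monoidal
    _ = 𝟙 (X ⊗ V ⊗ †X) ⊗≫ X ◁ (β_ V †X).hom ⊗≫ (𝟙 (X ⊗ †X ⊗ V) ⊗≫ X ◁ overγ V †X ⊗≫
        overγ V X ▷ †X ⊗≫ V ◁ pivEv X ⊗≫ 𝟙 V) := by monoidal
    _ = _ := by rw [(isHB_over V).cap]; monoidal

namespace PreCenter

/-- The half-braiding of `P ⊗ R` in which `A` passes `P` by its half-braiding and over `R`. -/
abbrev leftγ {C : Type u} [Category.{v} C] [MonoidalCategory C] [BraidedCategory C]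
    (P R : PreCenter C) : ∀ A : C, A ⊗ (P.obj ⊗ R.obj) ⟶ (P.obj ⊗ R.obj) ⊗ A :=
  prodγ P.γ (overγ R.obj)

/-- The half-braiding of `P ⊗ R` in which `A` passes under `P` and passes `R` by its half-braiding. -/
abbrev rightγ {C : Type u} [Category.{v} C] [MonoidalCategory C] [BraidedCategory C]
    (P R : PreCenter C) : ∀ A : C, A ⊗ (P.obj ⊗ R.obj) ⟶ (P.obj ⊗ R.obj) ⊗ A :=
  prodγ (underγ P.obj) R.γ

theorem proj_eq_avg (P R : PreCenter C) : proj I P R = avg I (leftγ P R) (rightγ P R) := by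
  obtain ⟨V, σ⟩ := P
  obtain ⟨W, τ⟩ := R
  rw [proj, avg]
  congr 1
  refine Finset.sum_congr rfl fun i _ => ?_
  congr 1
  dsimp only [leftγ, rightγ]
  rw [loop, prodγ, prodγ]
  generalize I.X i = X
  symm
  calc _ = (𝟙 V ⊗≫ η_ X †X ▷ V ⊗≫ X ◁ underγ V †X ⊗≫ 𝟙 (X ⊗ V ⊗ †X)) ▷ W ⊗≫ (X ⊗ V) ◁ τ †X ⊗≫
        σ X ▷ (W ⊗ †X) ⊗≫ V ◁ (𝟙 (X ⊗ W ⊗ †X) ⊗≫ overγ W X ▷ †X ⊗≫ W ◁ pivEv X ⊗≫ 𝟙 W) ⊗≫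
        𝟙 (V ⊗ W) := by monoidal
    _ = _ := by rw [coev_underγ, overγ_pivEv]; monoidal

theorem loopVertex_reduced {C : Type u} [Category.{v} C] [MonoidalCategory C] [BraidedCategory C]
    [RightRigidCategory C] [PivotalCategory C] (P R : PreCenter C) {A X S : C} (p : A ⊗ X ⟶ S)
    (q : S ⟶ A ⊗ X) : loopVertex (leftγ P R) (rightγ P R) p q =
      𝟙 _ ⊗≫ (A ⊗ P.obj) ◁ η_ X Xᘁ ▷ R.obj ⊗≫ A ◁ (β_ X P.obj).inv ▷ (†X ⊗ R.obj) ⊗≫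
      (A ⊗ X ⊗ P.obj) ◁ R.γ †X ⊗≫ p ▷ (P.obj ⊗ R.obj ⊗ †X) ⊗≫
      (S ⊗ P.obj ⊗ R.obj) ◁ rot q ⊗≫ P.γ S ▷ (R.obj ⊗ †S ⊗ A) ⊗≫
      (P.obj ⊗ S) ◁ (β_ R.obj †S).hom ▷ A ⊗≫ P.obj ◁ pivEv S ▷ (R.obj ⊗ A) ⊗≫ 𝟙 _ := by
  obtain ⟨V, σ⟩ := P
  obtain ⟨W, τ⟩ := R
  dsimp only [leftγ, rightγ]
  rw [loopVertex, prodγ, prodγ]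
  calc _ = 𝟙 (A ⊗ V ⊗ W) ⊗≫ A ◁ (𝟙 V ⊗≫ η_ X †X ▷ V ⊗≫ X ◁ underγ V †X ⊗≫ 𝟙 (X ⊗ V ⊗ †X)) ▷ W ⊗≫
        (A ⊗ X ⊗ V) ◁ τ †X ⊗≫ p ▷ (V ⊗ W ⊗ †X) ⊗≫ (S ⊗ V ⊗ W) ◁ rot q ⊗≫ σ S ▷ (W ⊗ †S ⊗ A) ⊗≫
        V ◁ (𝟙 (S ⊗ W ⊗ †S) ⊗≫ overγ W S ▷ †S ⊗≫ W ◁ pivEv S ⊗≫ 𝟙 W) ▷ A ⊗≫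
        𝟙 ((V ⊗ W) ⊗ A) := by monoidal
    _ = _ := by rw [coev_underγ, overγ_pivEv]; monoidal

theorem tensorγAux_eq_sum (P R : PreCenter C) (A : C) : tensorγAux I P R A =
    (I.sqrtGlobalDim ^ 2)⁻¹ • ∑ i, ∑ j, ∑ m, dim 𝕜 (I.X i) • loopVertex (leftγ P R) (rightγ P R)
      (homDual 𝕜 (I.X j) (A ⊗ I.X i) m) (homBasis 𝕜 (I.X j) (A ⊗ I.X i) m) := by
  simp only [loopVertex_reduced]
  rfl

theorem tensorγAux_eq {P : PreCenter C} (hP : P.IsHalfBraiding) (R : PreCenter C) (A : C) :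
    tensorγAux I P R A = A ◁ proj I P R ≫ leftγ P R A := by
  rw [tensorγAux_eq_sum, proj_eq_avg]
  simp only [avg, MonoidalLinear.whiskerLeft_smul, whiskerLeft_sum, Linear.smul_comp,
    Preadditive.sum_comp]
  congr 1
  refine Finset.sum_congr rfl fun i _ => ?_
  rw [← sum_loopVertex_below I (σ := leftγ P R) (IsHB.prod hP (isHB_over _)) _ A i]
  simp only [Finset.smul_sum]

end PreCenter

theorem IsHB.of_retract {V T : C} {σ : ∀ A : C, A ⊗ V ⟶ V ⊗ A} {τ : ∀ A : C, A ⊗ T ⟶ T ⊗ A}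
    (h : IsHB σ) {i : T ⟶ V} {p : V ⟶ T} (hi : Intertwines τ σ i) (hp : Intertwines σ τ p)
    (hip : i ≫ p = 𝟙 T) : IsHB τ :=
  RedCenter.isHalfBraiding_of_total (n := 1) (Z := fun _ => ⟨⟨V, σ⟩, h⟩) (P := ⟨T, τ⟩)
    (fun _ => p) (fun _ => i) (fun _ => hp) (fun _ => hi) (by simpa using hip)

theorem prodγ_assoc {V W U : C} (σ : ∀ A : C, A ⊗ V ⟶ V ⊗ A) (τ : ∀ A : C, A ⊗ W ⟶ W ⊗ A)
    (υ : ∀ A : C, A ⊗ U ⟶ U ⊗ A) :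
    Intertwines (prodγ (prodγ σ τ) υ) (prodγ σ (prodγ τ υ)) (α_ V W U).hom := by
  intro A
  simp only [prodγ]
  monoidal

theorem prodγ_assoc_inv {V W U : C} (σ : ∀ A : C, A ⊗ V ⟶ V ⊗ A) (τ : ∀ A : C, A ⊗ W ⟶ W ⊗ A)
    (υ : ∀ A : C, A ⊗ U ⟶ U ⊗ A) :
    Intertwines (prodγ σ (prodγ τ υ)) (prodγ (prodγ σ τ) υ) (α_ V W U).inv := by
  intro A
  simp only [prodγ]
  monoidal

theorem prodγ_over (V W : C) : prodγ (overγ V) (overγ W) = overγ (V ⊗ W) := by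
  funext A; rw [over_tensor]

theorem prodγ_under (V W : C) : prodγ (underγ V) (underγ W) = underγ (V ⊗ W) := by
  funext A; rw [under_tensor]

theorem Intertwines.tensorHom {V V' W W' : C} {σ : ∀ A : C, A ⊗ V ⟶ V ⊗ A}
    {σ' : ∀ A : C, A ⊗ V' ⟶ V' ⊗ A} {τ : ∀ A : C, A ⊗ W ⟶ W ⊗ A} {τ' : ∀ A : C, A ⊗ W' ⟶ W' ⊗ A}
    {f : V ⟶ V'} {g : W ⟶ W'} (hf : Intertwines σ σ' f) (hg : Intertwines τ τ' g) :
    Intertwines (prodγ σ τ) (prodγ σ' τ') (f ⊗ₘ g) := by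
  rw [MonoidalCategory.tensorHom_def]
  exact (hf.whiskerRight τ).comp (hg.whiskerLeft σ')

section Retract

variable {P R S : PreCenter C} (hD : I.sqrtGlobalDim ≠ 0) (hP : P.IsHalfBraiding)
  (hR : R.IsHalfBraiding) (hS : S.IsHalfBraiding)

namespace PreCenter

/-- The inclusion of the reduced tensor product. -/
def tensorι (P R : PreCenter C) : (tensor I P R).obj ⟶ P.obj ⊗ R.obj := incl I P R

/-- The projection to the reduced tensor product. -/
def tensorπ (P R : PreCenter C) : P.obj ⊗ R.obj ⟶ (tensor I P R).obj := onto I P R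

theorem tensorπ_ι (P R : PreCenter C) : tensorπ I P R ≫ tensorι I P R = proj I P R :=
  image.fac _

instance (P R : PreCenter C) : Mono (tensorι I P R) := inferInstanceAs (Mono (image.ι _))

instance (P R : PreCenter C) : Epi (tensorπ I P R) := inferInstanceAs (Epi (factorThruImage _))

theorem compatible (hP : P.IsHalfBraiding) (hR : R.IsHalfBraiding) :
    Compatible (leftγ P R) (rightγ P R) := Compatible.reduced hP hR

include hD hP hR

theorem proj_comp_proj : proj I P R ≫ proj I P R = proj I P R := by
  rw [proj_eq_avg, (compatible hP hR).avg_comp_avg I hD]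

theorem tensorι_proj : tensorι I P R ≫ proj I P R = tensorι I P R := by
  rw [← cancel_epi (tensorπ I P R), ← Category.assoc, tensorπ_ι, proj_comp_proj I hD hP hR]

theorem proj_tensorπ : proj I P R ≫ tensorπ I P R = tensorπ I P R := by
  rw [← cancel_mono (tensorι I P R), Category.assoc, tensorπ_ι, proj_comp_proj I hD hP hR]

theorem tensorι_π : tensorι I P R ≫ tensorπ I P R = 𝟙 _ := by
  rw [← cancel_mono (tensorι I P R), Category.assoc, tensorπ_ι, tensorι_proj I hD hP hR, Category.id_comp]

theorem tensor_γ (A : C) : (tensor I P R).γ A =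
    A ◁ tensorι I P R ≫ leftγ P R A ≫ tensorπ I P R ▷ A := by
  change A ◁ tensorι I P R ≫ tensorγAux I P R A ≫ tensorπ I P R ▷ A = _
  rw [tensorγAux_eq I hP, Category.assoc, ← MonoidalCategory.whiskerLeft_comp_assoc,
    tensorι_proj I hD hP hR]

theorem tensorι_left : Intertwines (tensor I P R).γ (leftγ P R) (tensorι I P R) := by
  intro A
  have h := (compatible hP hR).avg_left I A
  dsimp only at h ⊢
  rw [tensor_γ I hD hP hR, Category.assoc, Category.assoc, ← comp_whiskerRight, tensorπ_ι,
    proj_eq_avg, ← h, ← proj_eq_avg, ← MonoidalCategory.whiskerLeft_comp_assoc,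
    tensorι_proj I hD hP hR]

theorem tensorπ_left : Intertwines (leftγ P R) (tensor I P R).γ (tensorπ I P R) := by
  intro A
  have h := (compatible hP hR).avg_left I A
  dsimp only at h ⊢
  rw [tensor_γ I hD hP hR, ← MonoidalCategory.whiskerLeft_comp_assoc, tensorπ_ι, ← Category.assoc,
    proj_eq_avg, h, ← proj_eq_avg, Category.assoc, ← comp_whiskerRight, proj_tensorπ I hD hP hR]

theorem whiskerLeft_tensorι (A : C) : A ◁ tensorι I P R ≫ leftγ P R A = A ◁ tensorι I P R ≫ rightγ P R A := by
  have h := (compatible hP hR).whiskerLeft_avg I A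
  have h2 : A ◁ tensorι I P R = A ◁ tensorι I P R ≫ A ◁ proj I P R := by
    rw [← MonoidalCategory.whiskerLeft_comp, tensorι_proj I hD hP hR]
  rw [h2, Category.assoc, Category.assoc, proj_eq_avg, h]

theorem tensorπ_whiskerRight (A : C) :
    leftγ P R A ≫ tensorπ I P R ▷ A = rightγ P R A ≫ tensorπ I P R ▷ A := by
  have h := (compatible hP hR).avg_whiskerRight I A
  have h2 : tensorπ I P R ▷ A = proj I P R ▷ A ≫ tensorπ I P R ▷ A := by
    rw [← comp_whiskerRight, proj_tensorπ I hD hP hR]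
  rw [h2, ← Category.assoc, ← Category.assoc, proj_eq_avg, h]

theorem tensorι_right : Intertwines (tensor I P R).γ (rightγ P R) (tensorι I P R) := by
  intro A
  have h := tensorι_left I hD hP hR A
  exact (whiskerLeft_tensorι I hD hP hR A).symm.trans h

theorem tensorπ_right : Intertwines (rightγ P R) (tensor I P R).γ (tensorπ I P R) := by
  intro A
  have h := tensorπ_left I hD hP hR A
  exact h.trans (tensorπ_whiskerRight I hD hP hR A)

theorem isHalfBraiding_tensor : (tensor I P R).IsHalfBraiding :=
  IsHB.of_retract (IsHB.prod hP (isHB_over R.obj)) (tensorι_left I hD hP hR) (tensorπ_left I hD hP hR)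
    (tensorι_π I hD hP hR)

/-- Morphisms on which the two half-braidings agree factor through the image of `Q`. -/
theorem comp_proj {W : C} {f : W ⟶ P.obj ⊗ R.obj}
    (h : ∀ A : C, A ◁ f ≫ leftγ P R A = A ◁ f ≫ rightγ P R A) : f ≫ proj I P R = f := by
  rw [proj_eq_avg, comp_avg_of_eq I hD (compatible hP hR).left h]

theorem proj_comp {W : C} {f : P.obj ⊗ R.obj ⟶ W}
    (h : ∀ A : C, leftγ P R A ≫ f ▷ A = rightγ P R A ≫ f ▷ A) : proj I P R ≫ f = f := by
  rw [proj_eq_avg, avg_comp_of_eq I hD (compatible hP hR).right h]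

end PreCenter

end Retract

namespace PreCenter

section Hom

variable {P P₁ R R₁ : PreCenter C}

theorem tensorHom_proj {f : P.obj ⟶ P₁.obj} {g : R.obj ⟶ R₁.obj} (hf : IsHom P P₁ f)
    (hg : IsHom R R₁ g) : (f ⊗ₘ g) ≫ proj I P₁ R₁ = proj I P R ≫ (f ⊗ₘ g) := by
  rw [proj_eq_avg, proj_eq_avg]
  exact comp_avg I (Intertwines.tensorHom hf (over_natural g))
    (Intertwines.tensorHom (under_natural f) hg)

theorem tensorHom_eq (f : P.obj ⟶ P₁.obj) (g : R.obj ⟶ R₁.obj) :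
    tensorHom I f g = tensorι I P R ≫ (f ⊗ₘ g) ≫ tensorπ I P₁ R₁ := rfl

variable (hD : I.sqrtGlobalDim ≠ 0) (hP : P.IsHalfBraiding) (hP₁ : P₁.IsHalfBraiding)
  (hR : R.IsHalfBraiding) (hR₁ : R₁.IsHalfBraiding)

include hD hP hR in
theorem tensorHom_ι {f : P.obj ⟶ P₁.obj} {g : R.obj ⟶ R₁.obj} (hf : IsHom P P₁ f)
    (hg : IsHom R R₁ g) : tensorHom I f g ≫ tensorι I P₁ R₁ = tensorι I P R ≫ (f ⊗ₘ g) := by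
  rw [tensorHom_eq, Category.assoc, Category.assoc, tensorπ_ι, tensorHom_proj I hf hg,
    reassoc_of% (tensorι_proj I hD hP hR)]

include hD hP₁ hR₁ in
theorem tensorπ_tensorHom {f : P.obj ⟶ P₁.obj} {g : R.obj ⟶ R₁.obj} (hf : IsHom P P₁ f)
    (hg : IsHom R R₁ g) : tensorπ I P R ≫ tensorHom I f g = (f ⊗ₘ g) ≫ tensorπ I P₁ R₁ := by
  rw [tensorHom_eq, ← Category.assoc, tensorπ_ι, ← Category.assoc, ← tensorHom_proj I hf hg,
    Category.assoc, proj_tensorπ I hD hP₁ hR₁]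

include hD hP hP₁ hR hR₁ in
theorem isHom_tensorHom {f : P.obj ⟶ P₁.obj} (g : R.obj ⟶ R₁.obj) (hf : IsHom P P₁ f) : IsHom (tensor I P R) (tensor I P₁ R₁) (tensorHom I f g) :=
  Intertwines.comp (tensorι_left I hD hP hR)
    (Intertwines.comp (Intertwines.tensorHom hf (over_natural g)) (tensorπ_left I hD hP₁ hR₁))

end Hom

section Assoc

theorem assoc_eq (P R S : PreCenter C) : assoc I P R S = tensorι I (tensor I P R) S ≫
    tensorι I P R ▷ S.obj ≫ (α_ P.obj R.obj S.obj).hom ≫ P.obj ◁ tensorπ I R S ≫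
      tensorπ I P (tensor I R S) := rfl

variable {P R S : PreCenter C} (hD : I.sqrtGlobalDim ≠ 0) (hP : P.IsHalfBraiding)
  (hR : R.IsHalfBraiding) (hS : S.IsHalfBraiding)

include hD hP hR hS

theorem proj_ι_left : proj I (tensor I P R) S ≫ tensorι I P R ▷ S.obj =
    tensorι I P R ▷ S.obj ≫ (α_ P.obj R.obj S.obj).hom ≫ P.obj ◁ proj I R S ≫
      (α_ P.obj R.obj S.obj).inv := by
  have h : Intertwines (prodγ (tensor I P R).γ (overγ S.obj))
      (prodγ (underγ P.obj) (prodγ R.γ (overγ S.obj)))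
      (tensorι I P R ▷ S.obj ≫ (α_ P.obj R.obj S.obj).hom) :=
    ((tensorι_right I hD hP hR).whiskerRight _).comp (prodγ_assoc _ _ _)
  have h' : Intertwines (prodγ (underγ (tensor I P R).obj) S.γ)
      (prodγ (underγ P.obj) (prodγ (underγ R.obj) S.γ))
      (tensorι I P R ▷ S.obj ≫ (α_ P.obj R.obj S.obj).hom) := by
    refine ((under_natural (tensorι I P R)).whiskerRight _).comp ?_
    rw [← prodγ_under]
    exact prodγ_assoc _ _ _
  have := comp_avg I h h'
  rw [avg_prod_left I (isHB_under P.obj), ← proj_eq_avg, ← proj_eq_avg] at this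
  rw [← cancel_mono (α_ P.obj R.obj S.obj).hom]
  simpa using this.symm

theorem proj_ι_right : proj I P (tensor I R S) ≫ P.obj ◁ tensorι I R S =
    P.obj ◁ tensorι I R S ≫ (α_ P.obj R.obj S.obj).inv ≫ proj I P R ▷ S.obj ≫
      (α_ P.obj R.obj S.obj).hom := by
  have h : Intertwines (prodγ P.γ (overγ (tensor I R S).obj))
      (prodγ (prodγ P.γ (overγ R.obj)) (overγ S.obj))
      (P.obj ◁ tensorι I R S ≫ (α_ P.obj R.obj S.obj).inv) := by
    refine ((over_natural (tensorι I R S)).whiskerLeft _).comp ?_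
    rw [← prodγ_over]
    exact prodγ_assoc_inv _ _ _
  have h' : Intertwines (prodγ (underγ P.obj) (tensor I R S).γ)
      (prodγ (prodγ (underγ P.obj) R.γ) (overγ S.obj))
      (P.obj ◁ tensorι I R S ≫ (α_ P.obj R.obj S.obj).inv) :=
    ((tensorι_left I hD hR hS).whiskerLeft _).comp (prodγ_assoc_inv _ _ _)
  have := comp_avg I h h'
  rw [avg_prod_right I (isHB_over S.obj), ← proj_eq_avg, ← proj_eq_avg] at this
  rw [← cancel_mono (α_ P.obj R.obj S.obj).inv]
  simpa using this.symm

theorem assoc_ι : assoc I P R S ≫ tensorι I P (tensor I R S) ≫ P.obj ◁ tensorι I R S =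
    tensorι I (tensor I P R) S ≫ tensorι I P R ▷ S.obj ≫ (α_ P.obj R.obj S.obj).hom := by
  have hT := isHalfBraiding_tensor I hD hP hR
  have e1 : tensorι I (tensor I P R) S ≫ tensorι I P R ▷ S.obj ≫ (α_ P.obj R.obj S.obj).hom ≫
      P.obj ◁ proj I R S = tensorι I (tensor I P R) S ≫ tensorι I P R ▷ S.obj ≫
        (α_ P.obj R.obj S.obj).hom := by
    have := proj_ι_left I hD hP hR hS
    rw [← cancel_mono (α_ P.obj R.obj S.obj).hom] at this
    simp only [Category.assoc, Iso.inv_hom_id, Category.comp_id] at this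
    rw [← this, reassoc_of% (tensorι_proj I hD hT hS)]
  rw [assoc_eq]
  simp only [Category.assoc]
  rw [reassoc_of% (tensorπ_ι I P (tensor I R S)), proj_ι_right I hD hP hR hS,
    ← MonoidalCategory.whiskerLeft_comp_assoc, tensorπ_ι, reassoc_of% e1, Iso.hom_inv_id_assoc,
    ← comp_whiskerRight_assoc, tensorι_proj I hD hP hR]

theorem isHom_assoc : IsHom _ _ (assoc I P R S) := by
  have hT := isHalfBraiding_tensor I hD hP hR
  have hT' := isHalfBraiding_tensor I hD hR hS
  refine Intertwines.comp (tensorι_left I hD hT hS) ?_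
  refine Intertwines.comp ((tensorι_left I hD hP hR).whiskerRight _) ?_
  refine Intertwines.comp (prodγ_assoc _ _ _) ?_
  rw [prodγ_over]
  exact Intertwines.comp ((over_natural (tensorπ I R S)).whiskerLeft _) (tensorπ_left I hD hP hT')

/-- The inverse of the associator. -/
theorem isIso_assoc : IsIso (assoc I P R S) := by
  have hT := isHalfBraiding_tensor I hD hP hR
  have hT' := isHalfBraiding_tensor I hD hR hS
  let g : (tensor I P (tensor I R S)).obj ⟶ (tensor I (tensor I P R) S).obj :=
    tensorι I P (tensor I R S) ≫ P.obj ◁ tensorι I R S ≫ (α_ P.obj R.obj S.obj).inv ≫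
      tensorπ I P R ▷ S.obj ≫ tensorπ I (tensor I P R) S
  have hg : g ≫ tensorι I (tensor I P R) S ≫ tensorι I P R ▷ S.obj =
      tensorι I P (tensor I R S) ≫ P.obj ◁ tensorι I R S ≫ (α_ P.obj R.obj S.obj).inv := by
    have e1 : tensorι I P (tensor I R S) ≫ P.obj ◁ tensorι I R S ≫ (α_ P.obj R.obj S.obj).inv ≫
        proj I P R ▷ S.obj = tensorι I P (tensor I R S) ≫ P.obj ◁ tensorι I R S ≫
          (α_ P.obj R.obj S.obj).inv := by
      have := proj_ι_right I hD hP hR hS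
      rw [← cancel_mono (α_ P.obj R.obj S.obj).inv] at this
      simp only [Category.assoc, Iso.hom_inv_id, Category.comp_id] at this
      rw [← this, reassoc_of% (tensorι_proj I hD hP hT')]
    dsimp only [g]
    simp only [Category.assoc]
    rw [reassoc_of% (tensorπ_ι I (tensor I P R) S), proj_ι_left I hD hP hR hS,
      ← comp_whiskerRight_assoc, tensorπ_ι, reassoc_of% e1, Iso.inv_hom_id_assoc,
      ← MonoidalCategory.whiskerLeft_comp_assoc, tensorι_proj I hD hR hS]
  have hrs : IsSplitMono (P.obj ◁ tensorι I R S) :=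
    ⟨⟨⟨P.obj ◁ tensorπ I R S, by rw [← MonoidalCategory.whiskerLeft_comp, tensorι_π I hD hR hS]; simp⟩⟩⟩
  have hpr : IsSplitMono (tensorι I P R ▷ S.obj) :=
    ⟨⟨⟨tensorπ I P R ▷ S.obj, by rw [← comp_whiskerRight, tensorι_π I hD hP hR]; simp⟩⟩⟩
  refine ⟨⟨g, ?_, ?_⟩⟩
  · rw [← cancel_mono (tensorι I (tensor I P R) S ≫ tensorι I P R ▷ S.obj), Category.assoc, hg]
    have := assoc_ι I hD hP hR hS
    simp only [← Category.assoc] at this ⊢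
    rw [this]
    simp
  · rw [← cancel_mono (tensorι I P (tensor I R S) ≫ P.obj ◁ tensorι I R S), Category.assoc,
      assoc_ι I hD hP hR hS]
    have := hg
    simp only [← Category.assoc] at this ⊢
    rw [this]
    simp

end Assoc

end PreCenter

end Reduced

section HalfLoops

variable {C : Type u} [Category.{v} C] [MonoidalCategory C] [RightRigidCategory C] {V W : C}

/-- The upper half of a loop: the right leg `X*` passes `V`. -/
def coevLoop (X : C) (σ : ∀ A : C, A ⊗ V ⟶ V ⊗ A) : V ⟶ X ⊗ V ⊗ †X :=
  𝟙 V ⊗≫ η_ X †X ▷ V ⊗≫ X ◁ σ †X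

/-- The lower half of a loop: the left leg `X` passes `V`. -/
def evLoop [PivotalCategory C] (X : C) (σ : ∀ A : C, A ⊗ V ⟶ V ⊗ A) : X ⊗ V ⊗ †X ⟶ V :=
  𝟙 (X ⊗ V ⊗ †X) ⊗≫ σ X ▷ †X ⊗≫ V ◁ pivEv X ⊗≫ 𝟙 V

/-- A morphism in the middle of a coloured cup. -/
def insertHom (X : C) (c : V ⟶ 𝟙_ C) : X ⊗ V ⊗ †X ⟶ X ⊗ †X :=
  X ◁ c ▷ †X ⊗≫ 𝟙 (X ⊗ †X)

/-- A morphism in the middle of a coloured cap. -/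
def insertCoHom (X : C) (d : 𝟙_ C ⟶ V) : X ⊗ †X ⟶ X ⊗ V ⊗ †X :=
  𝟙 (X ⊗ †X) ⊗≫ X ◁ d ▷ †X

variable [PivotalCategory C]

/-- A strand `A` absorbed by the cup coloured by `X`, whose colour becomes `S`. -/
def vertex {A X S : C} (p : A ⊗ X ⟶ S) (q : S ⟶ A ⊗ X) (V : C) :
    A ⊗ (X ⊗ V ⊗ †X) ⟶ (S ⊗ V ⊗ †S) ⊗ A :=
  𝟙 _ ⊗≫ p ▷ (V ⊗ †X) ⊗≫ (S ⊗ V) ◁ rot q ⊗≫ 𝟙 _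

/-- The same without an object in the middle. -/
def vertex₀ {A X S : C} (p : A ⊗ X ⟶ S) (q : S ⟶ A ⊗ X) : A ⊗ (X ⊗ †X) ⟶ (S ⊗ †S) ⊗ A :=
  𝟙 _ ⊗≫ p ▷ †X ⊗≫ S ◁ rot q ⊗≫ 𝟙 _

theorem vertex_insertHom {A X S : C} (p : A ⊗ X ⟶ S) (q : S ⟶ A ⊗ X) (c : V ⟶ 𝟙_ C) :
    vertex p q V ≫ insertHom S c ▷ A = A ◁ insertHom X c ≫ vertex₀ p q := by
  rw [vertex, vertex₀, insertHom, insertHom]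
  calc _ = 𝟙 _ ⊗≫ p ▷ (V ⊗ †X) ⊗≫ S ◁ (V ◁ rot q ≫ c ▷ (†S ⊗ A)) ⊗≫ 𝟙 _ := by monoidal
    _ = 𝟙 _ ⊗≫ (p ▷ (V ⊗ †X) ≫ S ◁ (c ▷ †X)) ⊗≫ S ◁ rot q ⊗≫ 𝟙 _ := by
      rw [whisker_exchange]; monoidal
    _ = _ := by rw [← whisker_exchange]; monoidal

theorem insertCoHom_vertex {A X S : C} (p : A ⊗ X ⟶ S) (q : S ⟶ A ⊗ X) (d : 𝟙_ C ⟶ V) :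
    A ◁ insertCoHom X d ≫ vertex p q V = vertex₀ p q ≫ insertCoHom S d ▷ A := by
  rw [vertex, vertex₀, insertCoHom, insertCoHom]
  calc _ = 𝟙 _ ⊗≫ ((A ⊗ X) ◁ (d ▷ †X) ≫ p ▷ (V ⊗ †X)) ⊗≫ (S ⊗ V) ◁ rot q ⊗≫ 𝟙 _ := by monoidal
    _ = 𝟙 _ ⊗≫ p ▷ †X ⊗≫ S ◁ (d ▷ †X ≫ V ◁ rot q) ⊗≫ 𝟙 _ := by
      rw [whisker_exchange]; monoidal
    _ = _ := by rw [← whisker_exchange]; monoidal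

theorem coevLoop_vertex {σ : ∀ A : C, A ⊗ V ⟶ V ⊗ A} (h : IsHB σ) {A X S : C} (p : A ⊗ X ⟶ S)
    (q : S ⟶ A ⊗ X) : A ◁ coevLoop X σ ≫ vertex p q V =
      𝟙 (A ⊗ V) ⊗≫ (𝟙 A ⊗≫ A ◁ η_ X †X ⊗≫ p ▷ †X ⊗≫ S ◁ rot q) ▷ V ⊗≫
      (S ⊗ †S) ◁ σ A ⊗≫ S ◁ σ †S ▷ A ⊗≫ 𝟙 ((S ⊗ V ⊗ †S) ⊗ A) := by
  rw [coevLoop, vertex]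
  calc _ = 𝟙 (A ⊗ V) ⊗≫ A ◁ η_ X †X ▷ V ⊗≫ ((A ⊗ X) ◁ σ †X ≫ p ▷ (V ⊗ †X)) ⊗≫ (S ⊗ V) ◁ rot q ⊗≫
        𝟙 ((S ⊗ V ⊗ †S) ⊗ A) := by monoidal
    _ = 𝟙 (A ⊗ V) ⊗≫ A ◁ η_ X †X ▷ V ⊗≫ p ▷ (†X ⊗ V) ⊗≫ S ◁ (σ †X ≫ V ◁ rot q ⊗≫ 𝟙 (V ⊗ †S ⊗ A)) ⊗≫
        𝟙 ((S ⊗ V ⊗ †S) ⊗ A) := by rw [whisker_exchange]; monoidal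
    _ = _ := by rw [h.split]; monoidal

theorem vertex_evLoop {σ : ∀ A : C, A ⊗ V ⟶ V ⊗ A} (h : IsHB σ) {A X S : C} (p : A ⊗ X ⟶ S)
    (q : S ⟶ A ⊗ X) : vertex p q V ≫ evLoop S σ ▷ A =
      𝟙 (A ⊗ X ⊗ V ⊗ †X) ⊗≫ A ◁ σ X ▷ †X ⊗≫
      σ A ▷ (X ⊗ †X) ⊗≫ V ◁ (p ▷ †X ⊗≫ S ◁ rot q ⊗≫ pivEv S ▷ A ⊗≫ 𝟙 A) ⊗≫ 𝟙 (V ⊗ A) := by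
  rw [vertex, evLoop]
  calc _ = 𝟙 (A ⊗ X ⊗ V ⊗ †X) ⊗≫ p ▷ (V ⊗ †X) ⊗≫ ((S ⊗ V) ◁ rot q ≫
        σ S ▷ (†S ⊗ A)) ⊗≫ V ◁ pivEv S ▷ A ⊗≫ 𝟙 (V ⊗ A) := by monoidal
    _ = 𝟙 (A ⊗ X ⊗ V ⊗ †X) ⊗≫ (𝟙 (A ⊗ X ⊗ V) ⊗≫ p ▷ V ≫ σ S) ▷ †X ⊗≫
        (V ⊗ S) ◁ rot q ⊗≫ V ◁ pivEv S ▷ A ⊗≫ 𝟙 (V ⊗ A) := by rw [whisker_exchange]; monoidal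
    _ = _ := by rw [h.merge]; monoidal

end HalfLoops

section UnitIso

variable {C : Type u} [Category.{v} C] [MonoidalCategory C] {V : C}

theorem IsHB.of_iso_unit {σ : ∀ A : C, A ⊗ V ⟶ V ⊗ A} (h : IsHB σ) {U : C} (i : 𝟙_ C ≅ U) :
    σ U = i.inv ▷ V ⊗≫ V ◁ i.hom := by
  have := h.nat i.inv
  calc σ U = σ U ≫ V ◁ (i.inv ≫ i.hom) := by simp
    _ = (σ U ≫ V ◁ i.inv) ≫ V ◁ i.hom := by simp
    _ = _ := by rw [← this, h.unit_eq]; monoidal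

variable [RightRigidCategory C] [PivotalCategory C]

/-- The dual of the unit object. -/
def dualUnitIso {U : C} (i : 𝟙_ C ≅ U) : 𝟙_ C ≅ †U :=
  haveI := (isIso_of_iso_unit i).1
  asIso (η_ U †U) ≪≫ whiskerRightIso i.symm †U ≪≫ λ_ _

theorem loop_of_iso_unit {σ σ' : ∀ A : C, A ⊗ V ⟶ V ⊗ A} (h : IsHB σ) (h' : IsHB σ') {U : C}
    (i : 𝟙_ C ≅ U) : loop U σ σ' = 𝟙 V := by
  have : loop U σ σ' = loop U σ σ := by
    rw [loop, loop, h.of_iso_unit (dualUnitIso i), h'.of_iso_unit (dualUnitIso i)]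
  rw [this, loop_self_eq U h, rightTrace_of_iso_unit i]
  monoidal

theorem coevLoop_of_iso_unit {σ : ∀ A : C, A ⊗ V ⟶ V ⊗ A} (h : IsHB σ) {U : C}
    (i : 𝟙_ C ≅ U) (c : V ⟶ 𝟙_ C) : coevLoop U σ ≫ insertHom U c ≫ pivEv U = c := by
  rw [coevLoop, insertHom, h.of_iso_unit (dualUnitIso i)]
  generalize dualUnitIso i = a
  calc _ = 𝟙 V ⊗≫ η_ U †U ▷ V ⊗≫ U ◁ a.inv ▷ V ⊗≫ U ◁ (V ◁ a.hom ≫ c ▷ †U) ⊗≫ pivEv U := by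
        monoidal
    _ = 𝟙 V ⊗≫ ((η_ U †U ⊗≫ U ◁ a.inv) ▷ V ≫ (U ⊗ 𝟙_ C) ◁ c) ⊗≫ U ◁ a.hom ⊗≫ pivEv U := by
        rw [whisker_exchange]; monoidal
    _ = c ⊗≫ η_ U †U ⊗≫ U ◁ (a.inv ≫ a.hom) ⊗≫ pivEv U := by
        rw [← whisker_exchange]; monoidal
    _ = c ⊗≫ (η_ U †U ≫ 𝟙 U ▷ †U ≫ pivEv U) := by rw [a.inv_hom_id]; monoidal
    _ = _ := by rw [← rightTrace, rightTrace_of_iso_unit i]; monoidal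

theorem evLoop_of_iso_unit {σ : ∀ A : C, A ⊗ V ⟶ V ⊗ A} (h : IsHB σ) {U : C}
    (i : 𝟙_ C ≅ U) (d : 𝟙_ C ⟶ V) : η_ U †U ≫ insertCoHom U d ≫ evLoop U σ = d := by
  rw [evLoop, insertCoHom, h.of_iso_unit i]
  calc _ = η_ U †U ⊗≫ (U ◁ d ≫ i.inv ▷ V) ▷ †U ⊗≫ V ◁ (i.hom ▷ †U) ⊗≫ V ◁ pivEv U ⊗≫ 𝟙 V := by
        monoidal
    _ = η_ U †U ⊗≫ i.inv ▷ †U ⊗≫ (d ▷ (𝟙_ C ⊗ †U) ≫ V ◁ (i.hom ▷ †U)) ⊗≫ V ◁ pivEv U ⊗≫ 𝟙 V := by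
        rw [whisker_exchange]; monoidal
    _ = η_ U †U ⊗≫ (i.inv ≫ i.hom) ▷ †U ⊗≫ (d ▷ (U ⊗ †U) ≫ V ◁ pivEv U) ⊗≫ 𝟙 V := by
        rw [← whisker_exchange]; monoidal
    _ = (η_ U †U ≫ 𝟙 U ▷ †U ≫ pivEv U) ⊗≫ d := by
        rw [← whisker_exchange, i.inv_hom_id]; monoidal
    _ = _ := by rw [← rightTrace, rightTrace_of_iso_unit i]; monoidal

end UnitIso

section BoxLoop

variable {C : Type u} [Category.{v} C] [MonoidalCategory C] [BraidedCategory C]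
  [RightRigidCategory C] [PivotalCategory C]

/-- The half-braiding of `X ⊗ Y` in which `A` passes under `X` and over `Y`. -/
abbrev boxγ (X Y : C) : ∀ A : C, A ⊗ (X ⊗ Y) ⟶ (X ⊗ Y) ⊗ A := prodγ (underγ X) (overγ Y)

theorem isHB_box (X Y : C) : IsHB (boxγ X Y) := (isHB_under X).prod (isHB_over Y)

theorem coev_evLoop_box (X Z : C) :
    insertCoHom Z (η_ X †X) ≫ evLoop Z (boxγ X †X) ≫ pivEv X =
      loop X (underγ Z) (overγ Z) ▷ †Z ≫ pivEv Z := by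
  have h1 : 𝟙 Z ⊗≫ Z ◁ η_ X †X ⊗≫ (β_ Z X).hom ▷ †X ⊗≫ 𝟙 (X ⊗ Z ⊗ †X) =
      𝟙 Z ⊗≫ η_ X †X ▷ Z ⊗≫ X ◁ overγ Z †X ⊗≫ 𝟙 (X ⊗ Z ⊗ †X) := by
    calc _ = (𝟙 Z ⊗≫ Z ◁ η_ X †X ⊗≫ 𝟙 (Z ⊗ X ⊗ †X)) ⊗≫ (β_ Z X).hom ▷ †X ⊗≫ 𝟙 (X ⊗ Z ⊗ †X) := by
          monoidal
      _ = 𝟙 Z ⊗≫ η_ X †X ▷ Z ⊗≫ X ◁ overγ Z †X ⊗≫ (overγ Z X ≫ (β_ Z X).hom) ▷ †X ⊗≫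
          𝟙 (X ⊗ Z ⊗ †X) := by rw [← (isHB_over Z).cup]; monoidal
      _ = _ := by simp only [overγ, Iso.inv_hom_id]; monoidal
  have := (isHB_under Z).iso †X
  have h2 : inv (underγ Z †X) = (β_ †X Z).inv := by
    rw [IsIso.inv_eq_of_hom_inv_id]; simp [underγ]
  rw [loop_eq_trace X (isHB_under Z), h2, insertCoHom, evLoop, boxγ, prodγ]
  calc _ = 𝟙 _ ⊗≫ (𝟙 Z ⊗≫ Z ◁ η_ X †X ⊗≫ (β_ Z X).hom ▷ †X ⊗≫ 𝟙 (X ⊗ Z ⊗ †X)) ▷ †Z ⊗≫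
        X ◁ (β_ †X Z).inv ▷ †Z ⊗≫ ((X ⊗ †X) ◁ pivEv Z ≫ pivEv X ▷ 𝟙_ C) ⊗≫ 𝟙 _ := by
        simp only [underγ, overγ]; monoidal
    _ = _ := by rw [h1, whisker_exchange]; monoidal

end BoxLoop

section Unit
variable {𝕜 : Type w} [Field 𝕜] [IsAlgClosed 𝕜] {C : Type u} [Category.{v} C]
  [Abelian C] [Linear 𝕜 C] [FiniteSemisimple 𝕜 C] [MonoidalCategory C] [MonoidalPreadditive C]
  [MonoidalLinear 𝕜 C] [Simple (𝟙_ C)] [BraidedCategory C] [RightRigidCategory C]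
  [PivotalCategory C] [SphericalCategory C] (I : SimpleData 𝕜 C)

variable {V W : C}

theorem vertex₀_pivEv {A X S : C} (p : A ⊗ X ⟶ S) (q : S ⟶ A ⊗ X) :
    vertex₀ p q ≫ pivEv S ▷ A =
      𝟙 (A ⊗ X ⊗ †X) ⊗≫ (p ≫ q) ▷ †X ⊗≫ A ◁ pivEv X ⊗≫ 𝟙 (𝟙_ C ⊗ A) := by
  have := vertex_pivEv p q
  rw [vertex₀]
  calc _ = 𝟙 (A ⊗ X ⊗ †X) ⊗≫ (p ▷ †X ⊗≫ S ◁ rot q ⊗≫ pivEv S ▷ A ⊗≫ 𝟙 A) ⊗≫ 𝟙 (𝟙_ C ⊗ A) := by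
        monoidal
    _ = _ := by rw [this]; monoidal

theorem sum_coevLoop_vertex {σ : ∀ A : C, A ⊗ V ⟶ V ⊗ A} (h : IsHB σ) (A : C) (j : I.ι) :
    ∑ i, ∑ m, dim 𝕜 (I.X i) • (A ◁ coevLoop (I.X i) σ ≫ vertex (homDual 𝕜 (I.X j) (A ⊗ I.X i) m)
        (homBasis 𝕜 (I.X j) (A ⊗ I.X i) m) V) =
      dim 𝕜 (I.X j) • (σ A ≫ coevLoop (I.X j) σ ▷ A) := by
  have e := congrArg (fun f => 𝟙 (A ⊗ V) ⊗≫ f ▷ V ⊗≫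
      (I.X j ⊗ †(I.X j)) ◁ σ A ⊗≫ I.X j ◁ σ †(I.X j) ▷ A ⊗≫ 𝟙 ((I.X j ⊗ V ⊗ †(I.X j)) ⊗ A))
    (I.sum_coev_vertex A j)
  simp only [sum_whiskerRight, sum_coherence_comp, coherence_comp_sum,
    MonoidalLinear.smul_whiskerRight, smul_coherence_comp, coherence_comp_smul] at e
  simp only [coevLoop_vertex h]
  rw [e, coevLoop]
  congr 1
  calc _ = 𝟙 (A ⊗ V) ⊗≫ (η_ (I.X j) †(I.X j) ▷ (A ⊗ V) ≫ (I.X j ⊗ †(I.X j)) ◁ σ A) ⊗≫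
        I.X j ◁ σ †(I.X j) ▷ A ⊗≫ 𝟙 ((I.X j ⊗ V ⊗ †(I.X j)) ⊗ A) := by monoidal
    _ = _ := by rw [← whisker_exchange]; monoidal

theorem sum_vertex_evLoop {σ : ∀ A : C, A ⊗ V ⟶ V ⊗ A} (h : IsHB σ) (A : C) (i : I.ι) :
    ∑ j, ∑ m, vertex (homDual 𝕜 (I.X j) (A ⊗ I.X i) m) (homBasis 𝕜 (I.X j) (A ⊗ I.X i) m) V ≫
        evLoop (I.X j) σ ▷ A = A ◁ evLoop (I.X i) σ ≫ σ A := by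
  have e := congrArg (fun f => 𝟙 (A ⊗ I.X i ⊗ V ⊗ †(I.X i)) ⊗≫
    A ◁ σ (I.X i) ▷ †(I.X i) ⊗≫ σ A ▷ (I.X i ⊗ †(I.X i)) ⊗≫ V ◁ f ⊗≫ 𝟙 (V ⊗ A))
    (I.sum_vertex_pivEv A i)
  simp only [whiskerLeft_sum, sum_coherence_comp, coherence_comp_sum] at e
  simp only [vertex_evLoop h]
  rw [e, evLoop]
  calc _ = 𝟙 (A ⊗ I.X i ⊗ V ⊗ †(I.X i)) ⊗≫ A ◁ σ (I.X i) ▷ †(I.X i) ⊗≫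
        (σ A ▷ (I.X i ⊗ †(I.X i)) ≫ (V ⊗ A) ◁ pivEv (I.X i)) ⊗≫ 𝟙 (V ⊗ A) := by
        monoidal
    _ = _ := by rw [← whisker_exchange]; monoidal

namespace SimpleData

/-- The underlying object of the reduced unit. -/
abbrev unitObj : C := (PreCenter.unit I).obj

/-- The inclusion of a summand of the reduced unit. -/
def unitι (i : I.ι) : I.X i ⊗ †(I.X i) ⟶ I.unitObj := biproduct.ι (fun i => I.X i ⊗ †(I.X i)) i

/-- The projection to a summand of the reduced unit. -/
def unitπ (i : I.ι) : I.unitObj ⟶ I.X i ⊗ †(I.X i) := biproduct.π (fun i => I.X i ⊗ †(I.X i)) i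

theorem unitι_π_self (i : I.ι) : I.unitι i ≫ I.unitπ i = 𝟙 _ := biproduct.ι_π_self _ i

theorem unitι_π_ne {i j : I.ι} (h : i ≠ j) : I.unitι i ≫ I.unitπ j = 0 := biproduct.ι_π_ne _ h

theorem sum_unitπ_ι : ∑ i, I.unitπ i ≫ I.unitι i = 𝟙 I.unitObj := biproduct.total

/-- The half-braiding of the reduced unit. -/
abbrev unitγ (A : C) : A ⊗ I.unitObj ⟶ I.unitObj ⊗ A := (PreCenter.unit I).γ A

theorem unitγ_eq (A : C) : I.unitγ A = ∑ i, ∑ j, ∑ m,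
    (I.sqrtDim i * I.sqrtDim j * (dim 𝕜 (I.X j))⁻¹) •
    (A ◁ I.unitπ i ≫ vertex₀ (homDual 𝕜 (I.X j) (A ⊗ I.X i) m) (homBasis 𝕜 (I.X j) (A ⊗ I.X i) m) ≫
      I.unitι j ▷ A) := rfl

theorem unitι_unitγ (A : C) (i : I.ι) : A ◁ I.unitι i ≫ I.unitγ A = ∑ j, ∑ m,
    (I.sqrtDim i * I.sqrtDim j * (dim 𝕜 (I.X j))⁻¹) •
    (vertex₀ (homDual 𝕜 (I.X j) (A ⊗ I.X i) m) (homBasis 𝕜 (I.X j) (A ⊗ I.X i) m) ≫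
      I.unitι j ▷ A) := by
  classical
  rw [unitγ_eq, Preadditive.comp_sum, Finset.sum_eq_single i]
  · simp only [Preadditive.comp_sum, Linear.comp_smul]
    refine Finset.sum_congr rfl fun j _ => Finset.sum_congr rfl fun m _ => ?_
    rw [← MonoidalCategory.whiskerLeft_comp_assoc, unitι_π_self]
    simp
  · intro k _ hk
    simp only [Preadditive.comp_sum, Linear.comp_smul]
    refine Finset.sum_eq_zero fun j _ => Finset.sum_eq_zero fun m _ => ?_
    rw [← MonoidalCategory.whiskerLeft_comp_assoc, I.unitι_π_ne hk.symm]
    simp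
  · simp

theorem unitγ_unitπ (A : C) (j : I.ι) : I.unitγ A ≫ I.unitπ j ▷ A = ∑ i, ∑ m,
    (I.sqrtDim i * I.sqrtDim j * (dim 𝕜 (I.X j))⁻¹) •
    (A ◁ I.unitπ i ≫
      vertex₀ (homDual 𝕜 (I.X j) (A ⊗ I.X i) m) (homBasis 𝕜 (I.X j) (A ⊗ I.X i) m)) := by
  classical
  rw [unitγ_eq, Preadditive.sum_comp]
  refine Finset.sum_congr rfl fun i _ => ?_
  rw [Preadditive.sum_comp, Finset.sum_eq_single j]
  · simp only [Preadditive.sum_comp, Linear.smul_comp, Category.assoc]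
    refine Finset.sum_congr rfl fun m _ => ?_
    rw [← comp_whiskerRight, unitι_π_self]
    simp
  · intro k _ hk
    simp only [Preadditive.sum_comp, Linear.smul_comp, Category.assoc]
    refine Finset.sum_eq_zero fun m _ => ?_
    rw [← comp_whiskerRight, I.unitι_π_ne hk]
    simp
  · simp

/-- The morphism to the reduced unit induced by `c : V ⟶ 𝟙`. -/
def toUnit (σ : ∀ A : C, A ⊗ V ⟶ V ⊗ A) (c : V ⟶ 𝟙_ C) : V ⟶ I.unitObj :=
  ∑ i, (I.sqrtDim i * I.sqrtGlobalDim⁻¹) • (coevLoop (I.X i) σ ≫ insertHom (I.X i) c ≫ I.unitι i)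

/-- The morphism from the reduced unit induced by `d : 𝟙 ⟶ V`. -/
def fromUnit (σ : ∀ A : C, A ⊗ V ⟶ V ⊗ A) (d : 𝟙_ C ⟶ V) : I.unitObj ⟶ V :=
  ∑ i, (I.sqrtDim i * I.sqrtGlobalDim⁻¹) • (I.unitπ i ≫ insertCoHom (I.X i) d ≫ evLoop (I.X i) σ)

theorem toUnit_intertwines {σ : ∀ A : C, A ⊗ V ⟶ V ⊗ A} (h : IsHB σ) (c : V ⟶ 𝟙_ C) :
    Intertwines σ I.unitγ (I.toUnit σ c) := by
  intro A
  have e : ∀ j, σ A ≫ (coevLoop (I.X j) σ ≫ insertHom (I.X j) c ≫ I.unitι j) ▷ A =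
      (dim 𝕜 (I.X j))⁻¹ • ((∑ i, ∑ m, dim 𝕜 (I.X i) • (A ◁ coevLoop (I.X i) σ ≫
        vertex (homDual 𝕜 (I.X j) (A ⊗ I.X i) m) (homBasis 𝕜 (I.X j) (A ⊗ I.X i) m) V)) ≫
        insertHom (I.X j) c ▷ A ≫ I.unitι j ▷ A) := by
    intro j
    rw [sum_coevLoop_vertex I h A j, Linear.smul_comp, smul_smul,
      inv_mul_cancel₀ (dim_ne_zero (I.X j)), one_smul]
    simp
  simp only [toUnit, whiskerLeft_sum, sum_whiskerRight, MonoidalLinear.whiskerLeft_smul,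
    MonoidalLinear.smul_whiskerRight, Preadditive.sum_comp, Preadditive.comp_sum, Linear.smul_comp,
    Linear.comp_smul, e, MonoidalCategory.whiskerLeft_comp, Category.assoc, unitι_unitγ,
    Finset.smul_sum, smul_smul]
  rw [Finset.sum_comm]
  refine Finset.sum_congr rfl fun j _ => Finset.sum_congr rfl fun i _ =>
    Finset.sum_congr rfl fun m _ => ?_
  rw [reassoc_of% (vertex_insertHom (V := V) (homDual 𝕜 (I.X j) (A ⊗ I.X i) m)
    (homBasis 𝕜 (I.X j) (A ⊗ I.X i) m) c)]
  congr 1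
  rw [← I.sqrtDim_sq i]
  ring

theorem fromUnit_intertwines {σ : ∀ A : C, A ⊗ V ⟶ V ⊗ A} (h : IsHB σ) (d : 𝟙_ C ⟶ V) :
    Intertwines I.unitγ σ (I.fromUnit σ d) := by
  intro A
  have e : ∀ i, A ◁ (I.unitπ i ≫ insertCoHom (I.X i) d ≫ evLoop (I.X i) σ) ≫ σ A =
      ∑ j, ∑ m, A ◁ I.unitπ i ≫ A ◁ insertCoHom (I.X i) d ≫
        vertex (homDual 𝕜 (I.X j) (A ⊗ I.X i) m) (homBasis 𝕜 (I.X j) (A ⊗ I.X i) m) V ≫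
        evLoop (I.X j) σ ▷ A := by
    intro i
    simp only [MonoidalCategory.whiskerLeft_comp, Category.assoc, ← sum_vertex_evLoop I h A i,
      Preadditive.comp_sum]
  simp only [fromUnit, whiskerLeft_sum, sum_whiskerRight, MonoidalLinear.whiskerLeft_smul,
    MonoidalLinear.smul_whiskerRight, Preadditive.sum_comp, Preadditive.comp_sum, Linear.smul_comp,
    Linear.comp_smul, e, comp_whiskerRight]
  simp only [← Category.assoc, unitγ_unitπ, Preadditive.sum_comp, Linear.smul_comp,
    Finset.smul_sum, smul_smul]
  rw [Finset.sum_comm]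
  refine Finset.sum_congr rfl fun j _ => Finset.sum_congr rfl fun i _ =>
    Finset.sum_congr rfl fun m _ => ?_
  have e2 := insertCoHom_vertex (V := V) (homDual 𝕜 (I.X j) (A ⊗ I.X i) m)
    (homBasis 𝕜 (I.X j) (A ⊗ I.X i) m) d
  simp only [Category.assoc]
  rw [reassoc_of% e2]
  congr 1
  have hd := dim_ne_zero (𝕜 := 𝕜) (I.X j)
  rw [← I.sqrtDim_sq j] at hd ⊢
  have : I.sqrtDim j ≠ 0 := fun h0 => hd (by rw [h0]; simp)
  field_simp

/-- The counit `unit ⟶ 𝟙` on the summand of the unit object. -/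
def unitCounit : I.unitObj ⟶ 𝟙_ C := I.unitπ I.one ≫ pivEv (I.X I.one)

/-- The morphism `𝟙 ⟶ unit` to the summand of the unit object. -/
def unitPoint : 𝟙_ C ⟶ I.unitObj := η_ (I.X I.one) †(I.X I.one) ≫ I.unitι I.one

theorem toUnit_unitCounit {σ : ∀ A : C, A ⊗ V ⟶ V ⊗ A} (h : IsHB σ) (c : V ⟶ 𝟙_ C) :
    I.toUnit σ c ≫ I.unitCounit = I.sqrtGlobalDim⁻¹ • c := by
  classical
  rw [toUnit, unitCounit, Preadditive.sum_comp, Finset.sum_eq_single I.one]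
  · rw [Linear.smul_comp, Category.assoc, Category.assoc, reassoc_of% unitι_π_self,
      coevLoop_of_iso_unit h I.oneIso, I.sqrtDim_one, one_mul]
  · intro k _ hk
    rw [Linear.smul_comp, Category.assoc, Category.assoc, ← Category.assoc (I.unitι k),
      I.unitι_π_ne hk]
    simp
  · simp

theorem unitPoint_fromUnit {σ : ∀ A : C, A ⊗ V ⟶ V ⊗ A} (h : IsHB σ) (d : 𝟙_ C ⟶ V) :
    I.unitPoint ≫ I.fromUnit σ d = I.sqrtGlobalDim⁻¹ • d := by
  classical
  rw [fromUnit, unitPoint, Preadditive.comp_sum, Finset.sum_eq_single I.one]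
  · rw [Linear.comp_smul, Category.assoc, reassoc_of% unitι_π_self,
      evLoop_of_iso_unit h I.oneIso, I.sqrtDim_one, one_mul]
  · intro k _ hk
    rw [Linear.comp_smul, Category.assoc, reassoc_of% (I.unitι_π_ne hk.symm)]
    simp
  · simp

end SimpleData

end Unit

section UnitCounit

variable {𝕜 : Type w} [Field 𝕜] [IsAlgClosed 𝕜] {C : Type u} [Category.{v} C]
  [Abelian C] [Linear 𝕜 C] [FiniteSemisimple 𝕜 C] [MonoidalCategory C] [MonoidalPreadditive C]
  [MonoidalLinear 𝕜 C] [Simple (𝟙_ C)] [BraidedCategory C] [RightRigidCategory C]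
  [PivotalCategory C] [SphericalCategory C] (I : SimpleData 𝕜 C)

variable {V W : C}

theorem eq_pivCoev_bend {S : C} (g : 𝟙_ C ⟶ †S ⊗ V) :
    g = pivCoev S ⊗≫ †S ◁ (𝟙 S ⊗≫ S ◁ g ⊗≫ pivEv S ▷ V ⊗≫ 𝟙 V) := by
  calc g = g ⊗≫ (𝟙 †S ⊗≫ pivCoev S ▷ †S ⊗≫ †S ◁ pivEv S ⊗≫ 𝟙 †S) ▷ V := by
        rw [pivCoev_zigzag]; monoidal
    _ = 𝟙 (𝟙_ C) ⊗≫ (𝟙_ C ◁ g ≫ pivCoev S ▷ (†S ⊗ V)) ⊗≫ †S ◁ pivEv S ▷ V ⊗≫ 𝟙 (†S ⊗ V) := by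
        monoidal
    _ = _ := by rw [whisker_exchange]; monoidal

theorem eq_bend_ev {S : C} (r : †S ⊗ V ⟶ 𝟙_ C) :
    r = †S ◁ (𝟙 V ⊗≫ η_ S †S ▷ V ⊗≫ S ◁ r ⊗≫ 𝟙 S) ≫ ε_ S †S := by
  calc r = (𝟙 †S ⊗≫ †S ◁ η_ S †S ⊗≫ ε_ S †S ▷ †S ⊗≫ 𝟙 †S) ▷ V ⊗≫ r := by
        rw [ev_zigzag]; monoidal
    _ = 𝟙 (†S ⊗ V) ⊗≫ †S ◁ η_ S †S ▷ V ⊗≫ (ε_ S †S ▷ (†S ⊗ V) ≫ 𝟙_ C ◁ r) ⊗≫ 𝟙 (𝟙_ C) := by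
        monoidal
    _ = _ := by rw [← whisker_exchange]; monoidal

theorem exists_eq_smul_ev {S : C} [Simple S] (r : †S ⊗ S ⟶ 𝟙_ C) : ∃ c : 𝕜, r = c • ε_ S †S := by
  obtain ⟨c, hc⟩ := exists_eq_smul_id (𝕜 := 𝕜) (𝟙 S ⊗≫ η_ S †S ▷ S ⊗≫ S ◁ r ⊗≫ 𝟙 S)
  refine ⟨c, ?_⟩
  rw [eq_bend_ev r, hc]
  simp

theorem exists_eq_smul_pivCoev {S : C} [Simple S] (g : 𝟙_ C ⟶ †S ⊗ S) :
    ∃ c : 𝕜, g = c • pivCoev S := by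
  obtain ⟨c, hc⟩ := exists_eq_smul_id (𝕜 := 𝕜) (𝟙 S ⊗≫ S ◁ g ⊗≫ pivEv S ▷ S ⊗≫ 𝟙 S)
  refine ⟨c, ?_⟩
  rw [eq_pivCoev_bend g, hc]
  simp [monoidalComp]

theorem sum_homDual_comp_homBasis_of_ne {i j : I.ι} (h : i ≠ j) :
    ∑ m, homDual 𝕜 (I.X I.one) (†(I.X j) ⊗ I.X i) m ≫
      homBasis 𝕜 (I.X I.one) (†(I.X j) ⊗ I.X i) m = 0 := by
  refine Finset.sum_eq_zero fun m _ => ?_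
  have : homBasis 𝕜 (I.X I.one) (†(I.X j) ⊗ I.X i) m = 0 := by
    rw [← cancel_epi I.oneIso.hom, eq_pivCoev_bend (I.oneIso.hom ≫ _),
      I.hom_eq_zero h.symm (𝟙 (I.X j) ⊗≫ _)]
    simp [monoidalComp]
  rw [this, comp_zero]

theorem sum_homDual_comp_homBasis_self (j : I.ι) :
    ∑ m, homDual 𝕜 (I.X I.one) (†(I.X j) ⊗ I.X j) m ≫
      homBasis 𝕜 (I.X I.one) (†(I.X j) ⊗ I.X j) m =
      (dim 𝕜 (I.X j))⁻¹ • (ε_ (I.X j) †(I.X j) ≫ pivCoev (I.X j)) := by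
  have key : ∀ m, ∃ c : 𝕜, homBasis 𝕜 (I.X I.one) (†(I.X j) ⊗ I.X j) m =
      c • (I.oneIso.inv ≫ pivCoev (I.X j)) := by
    intro m
    obtain ⟨c, hc⟩ := exists_eq_smul_pivCoev (𝕜 := 𝕜)
      (I.oneIso.hom ≫ homBasis 𝕜 (I.X I.one) (†(I.X j) ⊗ I.X j) m)
    refine ⟨c, ?_⟩
    rw [← Linear.comp_smul, ← hc, Iso.inv_hom_id_assoc]
  choose c hc using key
  obtain ⟨b, hb⟩ := exists_eq_smul_ev (𝕜 := 𝕜)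
    (∑ m, c m • (homDual 𝕜 (I.X I.one) (†(I.X j) ⊗ I.X j) m ≫ I.oneIso.inv))
  have h1 : ∑ m, homDual 𝕜 (I.X I.one) (†(I.X j) ⊗ I.X j) m ≫
      homBasis 𝕜 (I.X I.one) (†(I.X j) ⊗ I.X j) m =
      b • (ε_ (I.X j) †(I.X j) ≫ pivCoev (I.X j)) := by
    rw [← Linear.smul_comp, ← hb, Preadditive.sum_comp]
    refine Finset.sum_congr rfl fun m _ => ?_
    rw [hc m]
    simp
  have h2 := sum_comp_homDual_comp_homBasis (𝕜 := 𝕜) (I.oneIso.inv ≫ pivCoev (I.X j))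
  rw [← Preadditive.comp_sum, h1, Category.assoc, cancel_epi, Linear.comp_smul] at h2
  have h3 : pivCoev (I.X j) ≫ ε_ (I.X j) †(I.X j) = dim 𝕜 (I.X j) • 𝟙 (𝟙_ C) := by
    rw [dim_smul_id, ← SphericalCategory.trace_eq, leftTrace]
    simp
  rw [reassoc_of% h3, Linear.smul_comp, Category.id_comp, smul_smul] at h2
  have h4 : (b * dim 𝕜 (I.X j)) • 𝟙 (𝟙_ C) = (1 : 𝕜) • 𝟙 (𝟙_ C) := by
    have h5 := congrArg (· ≫ ε_ (I.X j) †(I.X j)) h2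
    simp only [Linear.smul_comp, h3] at h5
    have h6 := smul_id_injective (𝕜 := 𝕜) (S := 𝟙_ C) (a := b * dim 𝕜 (I.X j) * dim 𝕜 (I.X j))
      (b := dim 𝕜 (I.X j)) (by rw [mul_smul]; exact h5)
    rw [mul_right_cancel₀ (dim_ne_zero (I.X j)) (h6.trans (one_mul _).symm)]
  rw [h1, eq_inv_of_mul_eq_one_left (smul_id_injective (𝕜 := 𝕜) h4)]

namespace SimpleData

theorem sqrtDim_ne_zero (j : I.ι) : I.sqrtDim j ≠ 0 := fun h =>
  dim_ne_zero (𝕜 := 𝕜) (I.X j) (by rw [← I.sqrtDim_sq j, h]; simp)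

theorem sqrtDim_mul_inv (j : I.ι) : I.sqrtDim j * (dim 𝕜 (I.X j))⁻¹ = (I.sqrtDim j)⁻¹ := by
  have := I.sqrtDim_ne_zero j
  rw [← I.sqrtDim_sq j]
  field_simp

theorem unitγ_unitCounit (j : I.ι) : I.unitγ †(I.X j) ≫ I.unitCounit ▷ †(I.X j) =
    (I.sqrtDim j)⁻¹ • (†(I.X j) ◁ I.unitπ j ≫
      (𝟙 _ ⊗≫ ε_ (I.X j) †(I.X j) ▷ †(I.X j) ⊗≫ 𝟙 (𝟙_ C ⊗ †(I.X j)))) := by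
  classical
  have key : ∀ i, ∑ m, ((I.sqrtDim i * I.sqrtDim I.one * (dim 𝕜 (I.X I.one))⁻¹) •
      (†(I.X j) ◁ I.unitπ i ≫ vertex₀ (homDual 𝕜 (I.X I.one) (†(I.X j) ⊗ I.X i) m)
        (homBasis 𝕜 (I.X I.one) (†(I.X j) ⊗ I.X i) m))) ≫ pivEv (I.X I.one) ▷ †(I.X j) =
      I.sqrtDim i • (†(I.X j) ◁ I.unitπ i ≫ (𝟙 (†(I.X j) ⊗ I.X i ⊗ †(I.X i)) ⊗≫
        (∑ m, homDual 𝕜 (I.X I.one) (†(I.X j) ⊗ I.X i) m ≫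
          homBasis 𝕜 (I.X I.one) (†(I.X j) ⊗ I.X i) m) ▷ †(I.X i) ⊗≫
          †(I.X j) ◁ pivEv (I.X i) ⊗≫ 𝟙 (𝟙_ C ⊗ †(I.X j)))) := by
    intro i
    simp only [sum_whiskerRight, coherence_comp_sum, sum_coherence_comp, Preadditive.comp_sum,
      Finset.smul_sum, I.sqrtDim_one, I.dim_one, inv_one, mul_one, Category.assoc, vertex₀_pivEv,
      Linear.smul_comp]
  rw [unitCounit, comp_whiskerRight, ← Category.assoc, unitγ_unitπ, Preadditive.sum_comp]
  simp only [Preadditive.sum_comp, key]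
  rw [Finset.sum_eq_single j, sum_homDual_comp_homBasis_self]
  · rw [MonoidalLinear.smul_whiskerRight, smul_coherence_comp, coherence_comp_smul,
      Linear.comp_smul, smul_smul, I.sqrtDim_mul_inv]
    congr 2
    calc _ = 𝟙 _ ⊗≫ ε_ (I.X j) †(I.X j) ▷ †(I.X j) ⊗≫ (𝟙 †(I.X j) ⊗≫
          pivCoev (I.X j) ▷ †(I.X j) ⊗≫ †(I.X j) ◁ pivEv (I.X j) ⊗≫ 𝟙 †(I.X j)) ⊗≫
          𝟙 (𝟙_ C ⊗ †(I.X j)) := by monoidal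
      _ = _ := by rw [pivCoev_zigzag]; monoidal
  · intro i _ hi
    rw [sum_homDual_comp_homBasis_of_ne I hi]
    simp [monoidalComp]
  · simp

/-- A morphism to `unit ⊗ P` that intertwines half-braidings is determined by its component at the
summand of the unit object. -/
theorem eq_zero_of_comp_unitCounit {P : C} {τ : ∀ A : C, A ⊗ W ⟶ W ⊗ A}
    {υ : ∀ A : C, A ⊗ P ⟶ P ⊗ A} (hυ : IsHB υ) {f : W ⟶ I.unitObj ⊗ P}
    (h : Intertwines τ (prodγ I.unitγ υ) f) (hf : f ≫ I.unitCounit ▷ P = 0) : f = 0 := by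
  have h0 : ∀ j, f ≫ I.unitπ j ▷ P = 0 := by
    intro j
    have h1 := congrArg (· ≫ I.unitCounit ▷ P ▷ †(I.X j)) (h.eq †(I.X j))
    have hz : f ▷ †(I.X j) ≫ I.unitCounit ▷ P ▷ †(I.X j) = 0 := by
      rw [← comp_whiskerRight, hf]; simp
    simp only [Category.assoc, hz, comp_zero] at h1
    have h2 : prodγ I.unitγ υ †(I.X j) ≫ I.unitCounit ▷ P ▷ †(I.X j) =
        𝟙 _ ⊗≫ (I.unitγ †(I.X j) ≫ I.unitCounit ▷ †(I.X j)) ▷ P ⊗≫ 𝟙_ C ◁ υ †(I.X j) ⊗≫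
          𝟙 ((𝟙_ C ⊗ P) ⊗ †(I.X j)) := by
      rw [prodγ]
      calc _ = 𝟙 _ ⊗≫ I.unitγ †(I.X j) ▷ P ⊗≫ (I.unitObj ◁ υ †(I.X j) ≫
            I.unitCounit ▷ (P ⊗ †(I.X j))) ⊗≫ 𝟙 ((𝟙_ C ⊗ P) ⊗ †(I.X j)) := by monoidal
        _ = _ := by rw [whisker_exchange]; monoidal
    rw [h2, I.unitγ_unitCounit] at h1
    simp only [MonoidalLinear.smul_whiskerRight, coherence_comp_smul, smul_coherence_comp,
      Linear.comp_smul] at h1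
    have h3 := (smul_eq_zero.mp h1).resolve_left (inv_ne_zero (I.sqrtDim_ne_zero j))
    have := hυ.iso †(I.X j)
    have h4 : †(I.X j) ◁ f ≫ (𝟙 _ ⊗≫ (†(I.X j) ◁ I.unitπ j ≫
        (𝟙 _ ⊗≫ ε_ (I.X j) †(I.X j) ▷ †(I.X j) ⊗≫ 𝟙 (𝟙_ C ⊗ †(I.X j)))) ▷ P ⊗≫
          𝟙 (†(I.X j) ⊗ P)) = 0 := by
      rw [← cancel_mono (υ †(I.X j)), ← cancel_mono ((λ_ P).inv ▷ †(I.X j))]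
      calc _ = _ := by monoidal
        _ = 0 := h3
        _ = _ := by simp
    calc f ≫ I.unitπ j ▷ P = (f ≫ I.unitπ j ▷ P) ⊗≫ (𝟙 (I.X j) ⊗≫ η_ (I.X j) †(I.X j) ▷ I.X j ⊗≫
          I.X j ◁ ε_ (I.X j) †(I.X j) ⊗≫ 𝟙 (I.X j)) ▷ (†(I.X j) ⊗ P) ⊗≫
            𝟙 ((I.X j ⊗ †(I.X j)) ⊗ P) := by rw [coev_zigzag]; monoidal
      _ = 𝟙 W ⊗≫ (𝟙_ C ◁ (f ≫ I.unitπ j ▷ P) ≫ η_ (I.X j) †(I.X j) ▷ _) ⊗≫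
          I.X j ◁ ε_ (I.X j) †(I.X j) ▷ (†(I.X j) ⊗ P) ⊗≫ 𝟙 ((I.X j ⊗ †(I.X j)) ⊗ P) := by
        monoidal
      _ = 𝟙 W ⊗≫ η_ (I.X j) †(I.X j) ▷ W ⊗≫ I.X j ◁ (†(I.X j) ◁ f ≫ (𝟙 _ ⊗≫
          (†(I.X j) ◁ I.unitπ j ≫ (𝟙 _ ⊗≫ ε_ (I.X j) †(I.X j) ▷ †(I.X j) ⊗≫
            𝟙 (𝟙_ C ⊗ †(I.X j)))) ▷ P ⊗≫ 𝟙 (†(I.X j) ⊗ P))) ⊗≫ 𝟙 ((I.X j ⊗ †(I.X j)) ⊗ P) := by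
        rw [whisker_exchange]; monoidal
      _ = 0 := by rw [h4]; simp [monoidalComp]
  calc f = f ≫ (∑ j, I.unitπ j ≫ I.unitι j) ▷ P := by rw [I.sum_unitπ_ι]; simp
    _ = ∑ j, (f ≫ I.unitπ j ▷ P) ≫ I.unitι j ▷ P := by
      rw [sum_whiskerRight, Preadditive.comp_sum]; simp
    _ = 0 := by simp [h0]

end SimpleData

end UnitCounit

section UnitHalfBraiding

variable {𝕜 : Type w} [Field 𝕜] [IsAlgClosed 𝕜] {C : Type u} [Category.{v} C]
  [Abelian C] [Linear 𝕜 C] [FiniteSemisimple 𝕜 C] [MonoidalCategory C] [MonoidalPreadditive C]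
  [MonoidalLinear 𝕜 C] [Simple (𝟙_ C)] [BraidedCategory C] [RightRigidCategory C]
  [PivotalCategory C] [SphericalCategory C] (I : SimpleData 𝕜 C)

variable {V W : C} {σ : ∀ A : C, A ⊗ V ⟶ V ⊗ A} {τ : ∀ A : C, A ⊗ W ⟶ W ⊗ A}

theorem Intertwines.smul {f : V ⟶ W} (hf : Intertwines σ τ f) (r : 𝕜) :
    Intertwines σ τ (r • f) := by
  intro A
  have h1 := hf.eq A
  change A ◁ (r • f) ≫ τ A = σ A ≫ (r • f) ▷ A
  simp only [MonoidalLinear.whiskerLeft_smul, MonoidalLinear.smul_whiskerRight,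
    Linear.smul_comp, Linear.comp_smul, h1]

theorem Intertwines.sum {α : Type*} (s : Finset α) {f : α → (V ⟶ W)}
    (hf : ∀ a, Intertwines σ τ (f a)) : Intertwines σ τ (∑ a ∈ s, f a) := by
  intro A
  have h1 := fun a => (hf a).eq A
  change A ◁ (∑ a ∈ s, f a) ≫ τ A = σ A ≫ (∑ a ∈ s, f a) ▷ A
  simp only [whiskerLeft_sum, sum_whiskerRight, Preadditive.sum_comp, Preadditive.comp_sum, h1]

theorem Intertwines.sub {f g : V ⟶ W} (hf : Intertwines σ τ f) (hg : Intertwines σ τ g) :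
    Intertwines σ τ (f - g) := by
  intro A
  have h1 := hf.eq A
  have h2 := hg.eq A
  change A ◁ (f - g) ≫ τ A = σ A ≫ (f - g) ▷ A
  have h3 : A ◁ (f - g) = A ◁ f - A ◁ g := (tensorLeft A).map_sub
  have h4 : (f - g) ▷ A = f ▷ A - g ▷ A := (tensorRight A).map_sub
  rw [h3, h4, Preadditive.sub_comp, Preadditive.comp_sub, h1, h2]

theorem IsHB.of_total {α : Type*} [Fintype α] {Z : α → C}
    {υ : ∀ a, ∀ A : C, A ⊗ Z a ⟶ Z a ⊗ A} (h : ∀ a, IsHB (υ a)) {ι : ∀ a, Z a ⟶ V}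
    {π : ∀ a, V ⟶ Z a} (hι : ∀ a, Intertwines (υ a) σ (ι a))
    (hπ : ∀ a, Intertwines σ (υ a) (π a)) (total : ∑ a, π a ≫ ι a = 𝟙 V) : IsHB σ := by
  let e := Fintype.equivFin α
  refine RedCenter.isHalfBraiding_of_total (P := ⟨V, σ⟩)
    (Z := fun k => ⟨⟨Z (e.symm k), υ (e.symm k)⟩, h _⟩) (fun k => ι (e.symm k))
    (fun k => π (e.symm k)) (fun k => hι _) (fun k => hπ _) ?_
  rw [← total]
  exact Equiv.sum_comp e.symm (fun a => π a ≫ ι a)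

theorem over_unit_right : Intertwines σ (prodγ σ (overγ (𝟙_ C))) (ρ_ V).inv := by
  intro A
  dsimp only [prodγ]
  rw [isCrossing_over.unit A]
  monoidal

theorem under_unit_left : Intertwines σ (prodγ (underγ (𝟙_ C)) σ) (λ_ V).inv := by
  intro A
  dsimp only [prodγ]
  rw [isCrossing_under.unit A]
  monoidal

theorem over_unit_right_hom : Intertwines (prodγ σ (overγ (𝟙_ C))) σ (ρ_ V).hom := by
  intro A
  dsimp only [prodγ]
  rw [isCrossing_over.unit A]
  monoidal

theorem under_unit_left_hom : Intertwines (prodγ (underγ (𝟙_ C)) σ) σ (λ_ V).hom := by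
  intro A
  dsimp only [prodγ]
  rw [isCrossing_under.unit A]
  monoidal

namespace SimpleData

theorem eq_zero_of_unitCounit {f : W ⟶ I.unitObj} (h : Intertwines τ I.unitγ f)
    (hf : f ≫ I.unitCounit = 0) : f = 0 := by
  rw [← cancel_mono (ρ_ I.unitObj).inv, zero_comp]
  refine I.eq_zero_of_comp_unitCounit (isHB_over (𝟙_ C)) (h.comp over_unit_right) ?_
  rw [Category.assoc, ← rightUnitor_inv_naturality, reassoc_of% hf, zero_comp]

theorem eq_of_unitCounit {f g : W ⟶ I.unitObj} (hf : Intertwines τ I.unitγ f)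
    (hg : Intertwines τ I.unitγ g) (h : f ≫ I.unitCounit = g ≫ I.unitCounit) : f = g := by
  rw [← sub_eq_zero]
  refine I.eq_zero_of_unitCounit (hf.sub hg) ?_
  rw [Preadditive.sub_comp, h, sub_self]

theorem eq_of_comp_unitCounit {P : C} {υ : ∀ A : C, A ⊗ P ⟶ P ⊗ A} (hυ : IsHB υ)
    {f g : W ⟶ I.unitObj ⊗ P} (hf : Intertwines τ (prodγ I.unitγ υ) f)
    (hg : Intertwines τ (prodγ I.unitγ υ) g)
    (h : f ≫ I.unitCounit ▷ P = g ≫ I.unitCounit ▷ P) : f = g := by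
  rw [← sub_eq_zero]
  refine I.eq_zero_of_comp_unitCounit hυ (hf.sub hg) ?_
  rw [Preadditive.sub_comp, h, sub_self]

variable (hI : IsModular I)

include hI

/-- The unit is a direct summand of the sum of the boxes of simple objects and their duals. -/
theorem unit_total : ∑ i, (dim 𝕜 (I.X i) • I.fromUnit (boxγ (I.X i) †(I.X i)) (η_ (I.X i) †(I.X i))) ≫
    I.toUnit (boxγ (I.X i) †(I.X i)) (pivEv (I.X i)) = 𝟙 I.unitObj := by
  classical
  refine I.eq_of_unitCounit (τ := I.unitγ) (Intertwines.sum _ fun i =>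
    ((I.fromUnit_intertwines (isHB_box _ _) _).smul _).comp
      (I.toUnit_intertwines (isHB_box _ _) _)) (Intertwines.id _) ?_
  rw [Category.id_comp, Preadditive.sum_comp]
  have key : ∀ i, ((dim 𝕜 (I.X i) •
      I.fromUnit (boxγ (I.X i) †(I.X i)) (η_ (I.X i) †(I.X i))) ≫
      I.toUnit (boxγ (I.X i) †(I.X i)) (pivEv (I.X i))) ≫ I.unitCounit =
      ∑ j, I.sqrtDim j • (I.unitπ j ≫ (((I.sqrtGlobalDim ^ 2)⁻¹ * dim 𝕜 (I.X i)) •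
        loop (I.X i) (underγ (I.X j)) (overγ (I.X j))) ▷ †(I.X j) ≫ pivEv (I.X j)) := by
    intro i
    rw [Category.assoc, I.toUnit_unitCounit (isHB_box _ _)]
    simp only [fromUnit, Linear.smul_comp, Linear.comp_smul, Preadditive.sum_comp,
      Finset.smul_sum, Category.assoc, coev_evLoop_box, smul_smul,
      MonoidalLinear.smul_whiskerRight]
    refine Finset.sum_congr rfl fun j _ => ?_
    congr 1
    rw [sq, mul_inv]
    ring
  have avg_eq : ∀ j, ∑ i, ((I.sqrtGlobalDim ^ 2)⁻¹ * dim 𝕜 (I.X i)) •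
        loop (I.X i) (underγ (I.X j)) (overγ (I.X j)) =
      avg I (underγ (I.X j)) (overγ (I.X j)) := by
    intro j
    rw [avg, Finset.smul_sum]
    simp only [smul_smul]
  simp only [key]
  rw [Finset.sum_comm]
  simp only [← Finset.smul_sum, ← Preadditive.comp_sum, ← Preadditive.sum_comp, ← sum_whiskerRight,
    avg_eq]
  rw [Finset.sum_eq_single I.one]
  · rw [avg_under_over_unit I hI I.oneIso, I.sqrtDim_one, unitCounit]
    simp
  · intro j _ hj
    rw [avg_under_over_simple I hI hj]
    simp
  · simp

theorem isHB_unit : IsHB I.unitγ :=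
  IsHB.of_total (fun i => isHB_box (I.X i) †(I.X i))
    (fun i => I.toUnit_intertwines (isHB_box _ _) (pivEv (I.X i)))
    (fun i => (I.fromUnit_intertwines (isHB_box _ _) (η_ (I.X i) †(I.X i))).smul (dim 𝕜 (I.X i)))
    (I.unit_total hI)

end SimpleData

end UnitHalfBraiding


section LoopUnit

variable {C : Type u} [Category.{v} C] [MonoidalCategory C] [BraidedCategory C]
  [RightRigidCategory C] [PivotalCategory C]

theorem loop_comp_left {U P : C} (X : C) (Γ : ∀ A : C, A ⊗ U ⟶ U ⊗ A)
    (υ : ∀ A : C, A ⊗ P ⟶ P ⊗ A) (t : U ⟶ 𝟙_ C) :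
    loop X (prodγ (underγ U) υ) (prodγ Γ (overγ P)) ≫ t ▷ P ≫ (λ_ P).hom =
      𝟙 (U ⊗ P) ⊗≫ (𝟙 U ⊗≫ η_ X †X ▷ U ⊗≫ X ◁ (Γ †X ≫ t ▷ †X)) ▷ P ⊗≫ X ◁ overγ P †X ⊗≫
        υ X ▷ †X ⊗≫ P ◁ pivEv X ⊗≫ 𝟙 P := by
  rw [loop, prodγ, prodγ]
  calc _ = 𝟙 (U ⊗ P) ⊗≫ η_ X †X ▷ (U ⊗ P) ⊗≫ X ◁ (Γ †X) ▷ P ⊗≫ X ◁ U ◁ overγ P †X ⊗≫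
        underγ U X ▷ (P ⊗ †X) ⊗≫ U ◁ υ X ▷ †X ⊗≫ (U ◁ (P ◁ pivEv X ⊗≫ 𝟙 P) ≫ t ▷ P) ⊗≫ 𝟙 P := by
        monoidal
    _ = 𝟙 (U ⊗ P) ⊗≫ η_ X †X ▷ (U ⊗ P) ⊗≫ X ◁ (Γ †X) ▷ P ⊗≫ X ◁ U ◁ overγ P †X ⊗≫
        underγ U X ▷ (P ⊗ †X) ⊗≫ (U ◁ (υ X ▷ †X ⊗≫ 𝟙 (P ⊗ X ⊗ †X)) ≫ t ▷ (P ⊗ X ⊗ †X)) ⊗≫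
          (P ◁ pivEv X ⊗≫ 𝟙 P) := by
        rw [whisker_exchange]; monoidal
    _ = 𝟙 (U ⊗ P) ⊗≫ η_ X †X ▷ (U ⊗ P) ⊗≫ X ◁ (Γ †X) ▷ P ⊗≫ X ◁ U ◁ overγ P †X ⊗≫
        (underγ U X ≫ t ▷ X) ▷ (P ⊗ †X) ⊗≫ υ X ▷ †X ⊗≫ P ◁ pivEv X ⊗≫ 𝟙 P := by
        rw [whisker_exchange]; monoidal
    _ = 𝟙 (U ⊗ P) ⊗≫ η_ X †X ▷ (U ⊗ P) ⊗≫ X ◁ (Γ †X) ▷ P ⊗≫ X ◁ (U ◁ overγ P †X ≫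
        t ▷ (P ⊗ †X)) ⊗≫ υ X ▷ †X ⊗≫ P ◁ pivEv X ⊗≫ 𝟙 P := by
        rw [← isCrossing_under.nat t X, isCrossing_under.unit X]; monoidal
    _ = _ := by rw [whisker_exchange]; monoidal

theorem loop_comp_right {U P : C} (X : C) (Γ : ∀ A : C, A ⊗ U ⟶ U ⊗ A)
    (υ : ∀ A : C, A ⊗ P ⟶ P ⊗ A) (t : U ⟶ 𝟙_ C) :
    loop X (prodγ υ (overγ U)) (prodγ (underγ P) Γ) ≫ P ◁ t ≫ (ρ_ P).hom =
      𝟙 (P ⊗ U) ⊗≫ P ◁ η_ X †X ▷ U ⊗≫ (β_ X P).inv ▷ (†X ⊗ U) ⊗≫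
        (X ⊗ P) ◁ (Γ †X ≫ t ▷ †X) ⊗≫ υ X ▷ †X ⊗≫ P ◁ pivEv X ⊗≫ 𝟙 P := by
  rw [loop, prodγ, prodγ]
  calc _ = 𝟙 (P ⊗ U) ⊗≫ (𝟙 P ⊗≫ η_ X †X ▷ P ⊗≫ X ◁ underγ P †X ⊗≫ 𝟙 (X ⊗ P ⊗ †X)) ▷ U ⊗≫
        (X ⊗ P) ◁ Γ †X ⊗≫ υ X ▷ (U ⊗ †X) ⊗≫ P ◁ (overγ U X ▷ †X ⊗≫ (U ◁ pivEv X ≫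
          t ▷ 𝟙_ C)) ⊗≫ 𝟙 P := by monoidal
    _ = 𝟙 (P ⊗ U) ⊗≫ (𝟙 P ⊗≫ η_ X †X ▷ P ⊗≫ X ◁ underγ P †X ⊗≫ 𝟙 (X ⊗ P ⊗ †X)) ▷ U ⊗≫
        (X ⊗ P) ◁ Γ †X ⊗≫ υ X ▷ (U ⊗ †X) ⊗≫ P ◁ (overγ U X ≫ t ▷ X) ▷ †X ⊗≫ P ◁ pivEv X ⊗≫
          𝟙 P := by rw [whisker_exchange]; monoidal
    _ = 𝟙 (P ⊗ U) ⊗≫ (𝟙 P ⊗≫ η_ X †X ▷ P ⊗≫ X ◁ underγ P †X ⊗≫ 𝟙 (X ⊗ P ⊗ †X)) ▷ U ⊗≫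
        (X ⊗ P) ◁ Γ †X ⊗≫ (υ X ▷ (U ⊗ †X) ≫ (P ⊗ X) ◁ (t ▷ †X)) ⊗≫ P ◁ pivEv X ⊗≫
          𝟙 P := by
        rw [← isCrossing_over.nat t X, isCrossing_over.unit X]; monoidal
    _ = _ := by rw [← whisker_exchange, coev_underγ]; monoidal

end LoopUnit

section Unitors

variable {𝕜 : Type w} [Field 𝕜] [IsAlgClosed 𝕜] {C : Type u} [Category.{v} C]
  [Abelian C] [Linear 𝕜 C] [FiniteSemisimple 𝕜 C] [MonoidalCategory C] [MonoidalPreadditive C]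
  [MonoidalLinear 𝕜 C] [Simple (𝟙_ C)] [BraidedCategory C] [RightRigidCategory C]
  [PivotalCategory C] [SphericalCategory C] (I : SimpleData 𝕜 C)

namespace PreCenter

variable {P R S : PreCenter C}

theorem loop_unit_left (P : PreCenter C) (j : I.ι) :
    loop (I.X j) (rightγ (unit I) P) (leftγ (unit I) P) ≫ I.unitCounit ▷ P.obj ≫ (λ_ P.obj).hom =
      (I.sqrtDim j)⁻¹ • (I.unitπ j ▷ P.obj ≫ (𝟙 _ ⊗≫ I.X j ◁ (β_ P.obj †(I.X j)).inv ⊗≫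
        P.γ (I.X j) ▷ †(I.X j) ⊗≫ P.obj ◁ pivEv (I.X j) ⊗≫ 𝟙 _)) := by
  rw [rightγ, leftγ, loop_comp_left (I.X j) I.unitγ P.γ I.unitCounit, I.unitγ_unitCounit]
  simp only [MonoidalLinear.whiskerLeft_smul, MonoidalLinear.smul_whiskerRight,
    coherence_comp_smul, smul_coherence_comp]
  congr 1
  calc _ = 𝟙 (I.unitObj ⊗ P.obj) ⊗≫ (η_ (I.X j) †(I.X j) ▷ I.unitObj ≫
        (I.X j ⊗ †(I.X j)) ◁ I.unitπ j) ▷ P.obj ⊗≫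
        I.X j ◁ ε_ (I.X j) †(I.X j) ▷ (†(I.X j) ⊗ P.obj) ⊗≫ I.X j ◁ overγ P.obj †(I.X j) ⊗≫
        P.γ (I.X j) ▷ †(I.X j) ⊗≫ P.obj ◁ pivEv (I.X j) ⊗≫ 𝟙 P.obj := by monoidal
    _ = I.unitπ j ▷ P.obj ⊗≫ (𝟙 (I.X j) ⊗≫ η_ (I.X j) †(I.X j) ▷ I.X j ⊗≫
        I.X j ◁ ε_ (I.X j) †(I.X j) ⊗≫ 𝟙 (I.X j)) ▷ (†(I.X j) ⊗ P.obj) ⊗≫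
        I.X j ◁ overγ P.obj †(I.X j) ⊗≫
        P.γ (I.X j) ▷ †(I.X j) ⊗≫ P.obj ◁ pivEv (I.X j) ⊗≫ 𝟙 P.obj := by
        rw [← whisker_exchange]; monoidal
    _ = _ := by rw [coev_zigzag, overγ]; monoidal

theorem loop_unit_right (P : PreCenter C) (j : I.ι) :
    loop (I.X j) (leftγ P (unit I)) (rightγ P (unit I)) ≫ P.obj ◁ I.unitCounit ≫ (ρ_ P.obj).hom =
      (I.sqrtDim j)⁻¹ • (P.obj ◁ I.unitπ j ≫ (𝟙 _ ⊗≫ (β_ (I.X j) P.obj).inv ▷ †(I.X j) ⊗≫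
        P.γ (I.X j) ▷ †(I.X j) ⊗≫ P.obj ◁ pivEv (I.X j) ⊗≫ 𝟙 _)) := by
  rw [rightγ, leftγ, loop_comp_right (I.X j) I.unitγ P.γ I.unitCounit, I.unitγ_unitCounit]
  simp only [MonoidalLinear.whiskerLeft_smul, coherence_comp_smul, smul_coherence_comp]
  congr 1
  calc _ = 𝟙 (P.obj ⊗ I.unitObj) ⊗≫ P.obj ◁ η_ (I.X j) †(I.X j) ▷ I.unitObj ⊗≫
        ((β_ (I.X j) P.obj).inv ▷ (†(I.X j) ⊗ I.unitObj) ≫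
          (I.X j ⊗ P.obj) ◁ (†(I.X j) ◁ I.unitπ j ⊗≫ ε_ (I.X j) †(I.X j) ▷ †(I.X j))) ⊗≫
        P.γ (I.X j) ▷ †(I.X j) ⊗≫ P.obj ◁ pivEv (I.X j) ⊗≫ 𝟙 P.obj := by monoidal
    _ = 𝟙 (P.obj ⊗ I.unitObj) ⊗≫ P.obj ◁ (η_ (I.X j) †(I.X j) ▷ I.unitObj ≫
          (I.X j ⊗ †(I.X j)) ◁ I.unitπ j) ⊗≫
        P.obj ◁ I.X j ◁ ε_ (I.X j) †(I.X j) ▷ †(I.X j) ⊗≫ (β_ (I.X j) P.obj).inv ▷ †(I.X j) ⊗≫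
        P.γ (I.X j) ▷ †(I.X j) ⊗≫ P.obj ◁ pivEv (I.X j) ⊗≫ 𝟙 P.obj := by
        rw [← whisker_exchange]; monoidal
    _ = P.obj ◁ I.unitπ j ⊗≫ P.obj ◁ (𝟙 (I.X j) ⊗≫ η_ (I.X j) †(I.X j) ▷ I.X j ⊗≫
        I.X j ◁ ε_ (I.X j) †(I.X j) ⊗≫ 𝟙 (I.X j)) ▷ †(I.X j) ⊗≫ (β_ (I.X j) P.obj).inv ▷ †(I.X j) ⊗≫
        P.γ (I.X j) ▷ †(I.X j) ⊗≫ P.obj ◁ pivEv (I.X j) ⊗≫ 𝟙 P.obj := by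
        rw [← whisker_exchange]; monoidal
    _ = _ := by rw [coev_zigzag]; monoidal

theorem unitor_coeff (hD : I.sqrtGlobalDim ≠ 0) (j : I.ι) :
    I.sqrtGlobalDim * ((I.sqrtGlobalDim ^ 2)⁻¹ * (dim 𝕜 (I.X j) * (I.sqrtDim j)⁻¹)) =
      I.sqrtDim j * I.sqrtGlobalDim⁻¹ := by
  have := I.sqrtDim_ne_zero j
  rw [← I.sqrtDim_sq j]
  field_simp

variable (hI : IsModular I)

include hI

theorem isHalfBraiding_unit : (unit I).IsHalfBraiding := I.isHB_unit hI

theorem leftUnitor_eq (hP : P.IsHalfBraiding) : leftUnitor I P =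
    I.sqrtGlobalDim • (tensorι I (unit I) P ≫ I.unitCounit ▷ P.obj ≫ (λ_ P.obj).hom) := by
  have hD := sqrtGlobalDim_ne_zero I hI
  have hU := isHalfBraiding_unit I hI
  have key : I.sqrtGlobalDim • (proj I (unit I) P ≫ I.unitCounit ▷ P.obj ≫ (λ_ P.obj).hom) =
      ∑ i, (I.sqrtDim i * I.sqrtGlobalDim⁻¹) •
        (I.unitπ i ▷ P.obj ≫
          (𝟙 _ ⊗≫ I.X i ◁ (β_ P.obj (I.X i)ᘁ).inv ⊗≫ P.γ (I.X i) ▷ (I.X i)ᘁ ⊗≫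
            P.obj ◁ pivEv (I.X i) ⊗≫ 𝟙 _)) := by
    rw [proj_eq_avg, (compatible hU hP).avg_symm I hD, avg]
    simp only [Linear.smul_comp, Preadditive.sum_comp, loop_unit_left, Finset.smul_sum, smul_smul]
    refine Finset.sum_congr rfl fun j _ => ?_
    rw [← unitor_coeff I hD j]
    simp only [mul_assoc]
  change tensorι I (unit I) P ≫ (∑ i, _) = _
  rw [← Linear.comp_smul]
  refine (congrArg (fun f => tensorι I (unit I) P ≫ f) key.symm).trans ?_
  rw [Linear.comp_smul, Linear.comp_smul, ← Category.assoc, tensorι_proj I hD hU hP]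

theorem rightUnitor_eq (hP : P.IsHalfBraiding) : rightUnitor I P =
    I.sqrtGlobalDim • (tensorι I P (unit I) ≫ P.obj ◁ I.unitCounit ≫ (ρ_ P.obj).hom) := by
  have hD := sqrtGlobalDim_ne_zero I hI
  have hU := isHalfBraiding_unit I hI
  have key : I.sqrtGlobalDim • (proj I P (unit I) ≫ P.obj ◁ I.unitCounit ≫ (ρ_ P.obj).hom) =
      ∑ i, (I.sqrtDim i * I.sqrtGlobalDim⁻¹) •
        (P.obj ◁ I.unitπ i ≫
          (𝟙 _ ⊗≫ (β_ (I.X i) P.obj).inv ▷ (I.X i)ᘁ ⊗≫ P.γ (I.X i) ▷ (I.X i)ᘁ ⊗≫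
            P.obj ◁ pivEv (I.X i) ⊗≫ 𝟙 _)) := by
    rw [proj_eq_avg, avg]
    simp only [Linear.smul_comp, Preadditive.sum_comp, loop_unit_right, Finset.smul_sum, smul_smul]
    refine Finset.sum_congr rfl fun j _ => ?_
    rw [← unitor_coeff I hD j]
    simp only [mul_assoc]
  change tensorι I P (unit I) ≫ (∑ i, _) = _
  rw [← Linear.comp_smul]
  refine (congrArg (fun f => tensorι I P (unit I) ≫ f) key.symm).trans ?_
  rw [Linear.comp_smul, Linear.comp_smul, ← Category.assoc, tensorι_proj I hD hP hU]

theorem isHom_leftUnitor (hP : P.IsHalfBraiding) : IsHom _ _ (leftUnitor I P) := by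
  have hD := sqrtGlobalDim_ne_zero I hI
  have hU := isHalfBraiding_unit I hI
  rw [leftUnitor_eq I hI hP]
  exact ((tensorι_right I hD hU hP).comp
    (((under_natural I.unitCounit).whiskerRight P.γ).comp under_unit_left_hom)).smul _

theorem isHom_rightUnitor (hP : P.IsHalfBraiding) : IsHom _ _ (rightUnitor I P) := by
  have hD := sqrtGlobalDim_ne_zero I hI
  have hU := isHalfBraiding_unit I hI
  rw [rightUnitor_eq I hI hP]
  exact ((tensorι_left I hD hP hU).comp
    (((over_natural I.unitCounit).whiskerLeft P.γ).comp over_unit_right_hom)).smul _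

end PreCenter

end Unitors

section UnitorInverse

variable {𝕜 : Type w} [Field 𝕜] [IsAlgClosed 𝕜] {C : Type u} [Category.{v} C]
  [Abelian C] [Linear 𝕜 C] [FiniteSemisimple 𝕜 C] [MonoidalCategory C] [MonoidalPreadditive C]
  [MonoidalLinear 𝕜 C] [Simple (𝟙_ C)] [BraidedCategory C] [RightRigidCategory C]
  [PivotalCategory C] [SphericalCategory C] (I : SimpleData 𝕜 C)

variable {V W : C}

namespace SimpleData

theorem eq_zero_of_comp_unitCounit_right {P : C} {τ : ∀ A : C, A ⊗ W ⟶ W ⊗ A}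
    {υ : ∀ A : C, A ⊗ P ⟶ P ⊗ A} (hυ : IsHB υ) {f : W ⟶ P ⊗ I.unitObj}
    (h : Intertwines τ (prodγ υ I.unitγ) f) (hf : f ≫ P ◁ I.unitCounit = 0) : f = 0 := by
  have h0 : ∀ j, f ≫ P ◁ I.unitπ j = 0 := by
    intro j
    have h1 := congrArg (· ≫ (P ◁ I.unitCounit) ▷ †(I.X j)) (h.eq †(I.X j))
    have hz : f ▷ †(I.X j) ≫ (P ◁ I.unitCounit) ▷ †(I.X j) = 0 := by
      rw [← comp_whiskerRight, hf]; simp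
    simp only [Category.assoc, hz, comp_zero] at h1
    have h2 : prodγ υ I.unitγ †(I.X j) ≫ (P ◁ I.unitCounit) ▷ †(I.X j) =
        𝟙 _ ⊗≫ υ †(I.X j) ▷ I.unitObj ⊗≫ P ◁ (I.unitγ †(I.X j) ≫ I.unitCounit ▷ †(I.X j)) ⊗≫
          𝟙 ((P ⊗ 𝟙_ C) ⊗ †(I.X j)) := by
      rw [prodγ]
      monoidal
    rw [h2, I.unitγ_unitCounit] at h1
    simp only [MonoidalLinear.whiskerLeft_smul, coherence_comp_smul, smul_coherence_comp,
      Linear.comp_smul] at h1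
    have h3 := (smul_eq_zero.mp h1).resolve_left (inv_ne_zero (I.sqrtDim_ne_zero j))
    calc f ≫ P ◁ I.unitπ j = (f ≫ P ◁ I.unitπ j) ⊗≫ P ◁ (𝟙 (I.X j) ⊗≫
          η_ (I.X j) †(I.X j) ▷ I.X j ⊗≫
          I.X j ◁ ε_ (I.X j) †(I.X j) ⊗≫ 𝟙 (I.X j)) ▷ †(I.X j) ⊗≫
            𝟙 (P ⊗ I.X j ⊗ †(I.X j)) := by rw [coev_zigzag]; monoidal
      _ = (f ≫ P ◁ I.unitπ j) ⊗≫ (𝟙 P ⊗≫ P ◁ η_ (I.X j) †(I.X j) ⊗≫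
          𝟙 (P ⊗ I.X j ⊗ †(I.X j))) ▷ (I.X j ⊗ †(I.X j)) ⊗≫
          P ◁ I.X j ◁ ε_ (I.X j) †(I.X j) ▷ †(I.X j) ⊗≫ 𝟙 (P ⊗ I.X j ⊗ †(I.X j)) := by monoidal
      _ = 𝟙 W ⊗≫ (𝟙_ C ◁ (f ≫ P ◁ I.unitπ j) ≫
            η_ (I.X j) †(I.X j) ▷ (P ⊗ I.X j ⊗ †(I.X j))) ⊗≫
          I.X j ◁ υ †(I.X j) ▷ (I.X j ⊗ †(I.X j)) ⊗≫ (υ (I.X j) ▷ ((†(I.X j) ⊗ I.X j) ⊗ †(I.X j)) ≫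
          (P ⊗ I.X j) ◁ (ε_ (I.X j) †(I.X j) ▷ †(I.X j))) ⊗≫ 𝟙 (P ⊗ I.X j ⊗ †(I.X j)) := by
        rw [← hυ.cup]; monoidal
      _ = 𝟙 W ⊗≫ (𝟙_ C ◁ (f ≫ P ◁ I.unitπ j) ≫
            η_ (I.X j) †(I.X j) ▷ (P ⊗ I.X j ⊗ †(I.X j))) ⊗≫
          I.X j ◁ υ †(I.X j) ▷ (I.X j ⊗ †(I.X j)) ⊗≫
          (I.X j ⊗ P) ◁ (ε_ (I.X j) †(I.X j) ▷ †(I.X j)) ⊗≫ υ (I.X j) ▷ †(I.X j) ⊗≫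
            𝟙 (P ⊗ I.X j ⊗ †(I.X j)) := by
        rw [← whisker_exchange (υ (I.X j))]; monoidal
      _ = 𝟙 W ⊗≫ η_ (I.X j) †(I.X j) ▷ W ⊗≫ (I.X j ⊗ †(I.X j)) ◁ f ⊗≫
          I.X j ◁ ((†(I.X j) ⊗ P) ◁ I.unitπ j ≫ υ †(I.X j) ▷ (I.X j ⊗ †(I.X j))) ⊗≫
          (I.X j ⊗ P) ◁ (ε_ (I.X j) †(I.X j) ▷ †(I.X j)) ⊗≫ υ (I.X j) ▷ †(I.X j) ⊗≫
            𝟙 (P ⊗ I.X j ⊗ †(I.X j)) := by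
        rw [whisker_exchange]; monoidal
      _ = 𝟙 W ⊗≫ η_ (I.X j) †(I.X j) ▷ W ⊗≫ I.X j ◁ (†(I.X j) ◁ f ≫ (𝟙 _ ⊗≫
          υ †(I.X j) ▷ I.unitObj ⊗≫ P ◁ (†(I.X j) ◁ I.unitπ j ≫
            (𝟙 _ ⊗≫ ε_ (I.X j) †(I.X j) ▷ †(I.X j) ⊗≫ 𝟙 (𝟙_ C ⊗ †(I.X j)))) ⊗≫
              𝟙 ((P ⊗ 𝟙_ C) ⊗ †(I.X j)))) ⊗≫ υ (I.X j) ▷ †(I.X j) ⊗≫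
            𝟙 (P ⊗ I.X j ⊗ †(I.X j)) := by
        rw [whisker_exchange]; monoidal
      _ = 0 := by rw [h3]; simp [monoidalComp]
  calc f = f ≫ P ◁ (∑ j, I.unitπ j ≫ I.unitι j) := by rw [I.sum_unitπ_ι]; simp
    _ = ∑ j, (f ≫ P ◁ I.unitπ j) ≫ P ◁ I.unitι j := by
      rw [whiskerLeft_sum, Preadditive.comp_sum]; simp
    _ = 0 := by simp [h0]

theorem eq_of_comp_unitCounit_right {P : C} {τ : ∀ A : C, A ⊗ W ⟶ W ⊗ A}
    {υ : ∀ A : C, A ⊗ P ⟶ P ⊗ A} (hυ : IsHB υ)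
    {f g : W ⟶ P ⊗ I.unitObj} (hf : Intertwines τ (prodγ υ I.unitγ) f)
    (hg : Intertwines τ (prodγ υ I.unitγ) g)
    (h : f ≫ P ◁ I.unitCounit = g ≫ P ◁ I.unitCounit) : f = g := by
  rw [← sub_eq_zero]
  refine I.eq_zero_of_comp_unitCounit_right hυ (hf.sub hg) ?_
  rw [Preadditive.sub_comp, h, sub_self]

theorem unitPoint_unitπ_one : I.unitPoint ≫ I.unitπ I.one = η_ (I.X I.one) †(I.X I.one) := by
  rw [unitPoint, Category.assoc, unitι_π_self, Category.comp_id]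

theorem unitPoint_unitπ_of_ne {j : I.ι} (h : j ≠ I.one) : I.unitPoint ≫ I.unitπ j = 0 := by
  rw [unitPoint, Category.assoc, I.unitι_π_ne h.symm, comp_zero]

end SimpleData

namespace PreCenter

variable {P R S P₁ R₁ : PreCenter C}

/-- The inverse of the left unit constraint. -/
def leftUnitorInv (P : PreCenter C) : P.obj ⟶ (tensor I (unit I) P).obj :=
  I.sqrtGlobalDim • ((λ_ P.obj).inv ≫ I.unitPoint ▷ P.obj ≫ tensorπ I (unit I) P)

/-- The inverse of the right unit constraint. -/
def rightUnitorInv (P : PreCenter C) : P.obj ⟶ (tensor I P (unit I)).obj :=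
  I.sqrtGlobalDim • ((ρ_ P.obj).inv ≫ P.obj ◁ I.unitPoint ≫ tensorπ I P (unit I))

open scoped Classical in
theorem unitPoint_loop_left (hP : P.IsHalfBraiding) (j : I.ι) :
    I.unitPoint ▷ P.obj ≫ loop (I.X j) (rightγ (unit I) P) (leftγ (unit I) P) ≫
      I.unitCounit ▷ P.obj ≫ (λ_ P.obj).hom = if j = I.one then (λ_ P.obj).hom else 0 := by
  rw [loop_unit_left]
  split_ifs with h
  · subst h
    rw [I.sqrtDim_one, inv_one, one_smul, ← comp_whiskerRight_assoc, I.unitPoint_unitπ_one]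
    have := loop_of_iso_unit hP (isHB_over P.obj) I.oneIso
    calc _ = (λ_ P.obj).hom ≫ loop (I.X I.one) P.γ (overγ P.obj) := by
          rw [loop, overγ]; monoidal
      _ = _ := by rw [this, Category.comp_id]
  · rw [Linear.comp_smul, ← comp_whiskerRight_assoc, I.unitPoint_unitπ_of_ne h]
    simp

open scoped Classical in
theorem unitPoint_loop_right (hP : P.IsHalfBraiding) (j : I.ι) :
    P.obj ◁ I.unitPoint ≫ loop (I.X j) (leftγ P (unit I)) (rightγ P (unit I)) ≫
      P.obj ◁ I.unitCounit ≫ (ρ_ P.obj).hom = if j = I.one then (ρ_ P.obj).hom else 0 := by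
  rw [loop_unit_right]
  split_ifs with h
  · subst h
    rw [I.sqrtDim_one, inv_one, one_smul, ← whiskerLeft_comp_assoc, I.unitPoint_unitπ_one]
    have := loop_of_iso_unit hP (isHB_under P.obj) I.oneIso
    calc _ = (ρ_ P.obj).hom ≫ (𝟙 P.obj ⊗≫ P.obj ◁ η_ (I.X I.one) †(I.X I.one) ⊗≫
          (β_ (I.X I.one) P.obj).inv ▷ †(I.X I.one) ⊗≫ 𝟙 (I.X I.one ⊗ P.obj ⊗ †(I.X I.one))) ⊗≫
          P.γ (I.X I.one) ▷ †(I.X I.one) ⊗≫ P.obj ◁ pivEv (I.X I.one) ⊗≫ 𝟙 P.obj := by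
          monoidal
      _ = (ρ_ P.obj).hom ≫ loop (I.X I.one) P.γ (underγ P.obj) := by
          rw [← coev_underγ, loop]; monoidal
      _ = _ := by rw [this, Category.comp_id]
  · rw [Linear.comp_smul, ← whiskerLeft_comp_assoc, I.unitPoint_unitπ_of_ne h]
    simp

variable (hI : IsModular I)

include hI

theorem tensorι_unitCounit (hP : P.IsHalfBraiding) :
    tensorι I (unit I) P ≫ I.unitCounit ▷ P.obj =
      I.sqrtGlobalDim⁻¹ • (leftUnitor I P ≫ (λ_ P.obj).inv) := by
  rw [leftUnitor_eq I hI hP, Linear.smul_comp, smul_smul,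
    inv_mul_cancel₀ (sqrtGlobalDim_ne_zero I hI)]
  simp

theorem tensorι_unitCounit_right (hP : P.IsHalfBraiding) :
    tensorι I P (unit I) ≫ P.obj ◁ I.unitCounit =
      I.sqrtGlobalDim⁻¹ • (rightUnitor I P ≫ (ρ_ P.obj).inv) := by
  rw [rightUnitor_eq I hI hP, Linear.smul_comp, smul_smul,
    inv_mul_cancel₀ (sqrtGlobalDim_ne_zero I hI)]
  simp

theorem leftUnitorInv_leftUnitor (hP : P.IsHalfBraiding) :
    leftUnitorInv I P ≫ leftUnitor I P = 𝟙 P.obj := by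
  have hD := sqrtGlobalDim_ne_zero I hI
  have hU := isHalfBraiding_unit I hI
  rw [leftUnitor_eq I hI hP, leftUnitorInv, Linear.smul_comp, Linear.comp_smul, smul_smul]
  simp only [Category.assoc]
  rw [reassoc_of% (tensorπ_ι I (unit I) P), proj_eq_avg, (compatible hU hP).avg_symm I hD, avg]
  simp only [Linear.smul_comp, Preadditive.sum_comp, Linear.comp_smul, Preadditive.comp_sum,
    unitPoint_loop_left I hP, smul_smul]
  classical
  simp [I.dim_one, ← sq, hD, comp_ite]

theorem rightUnitorInv_rightUnitor (hP : P.IsHalfBraiding) :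
    rightUnitorInv I P ≫ rightUnitor I P = 𝟙 P.obj := by
  have hD := sqrtGlobalDim_ne_zero I hI
  rw [rightUnitor_eq I hI hP, rightUnitorInv, Linear.smul_comp, Linear.comp_smul, smul_smul]
  simp only [Category.assoc]
  rw [reassoc_of% (tensorπ_ι I P (unit I)), proj_eq_avg, avg]
  simp only [Linear.smul_comp, Preadditive.sum_comp, Linear.comp_smul, Preadditive.comp_sum,
    unitPoint_loop_right I hP, smul_smul]
  classical
  simp [I.dim_one, ← sq, hD, comp_ite]

theorem isHom_leftUnitorInv (hP : P.IsHalfBraiding) : IsHom _ _ (leftUnitorInv I P) := by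
  have hD := sqrtGlobalDim_ne_zero I hI
  have hU := isHalfBraiding_unit I hI
  exact (under_unit_left.comp (((under_natural I.unitPoint).whiskerRight P.γ).comp
    (tensorπ_right I hD hU hP))).smul _

theorem isHom_rightUnitorInv (hP : P.IsHalfBraiding) : IsHom _ _ (rightUnitorInv I P) := by
  have hD := sqrtGlobalDim_ne_zero I hI
  have hU := isHalfBraiding_unit I hI
  exact (over_unit_right.comp (((over_natural I.unitPoint).whiskerLeft P.γ).comp
    (tensorπ_left I hD hP hU))).smul _

theorem leftUnitor_leftUnitorInv (hP : P.IsHalfBraiding) :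
    leftUnitor I P ≫ leftUnitorInv I P = 𝟙 _ := by
  have hD := sqrtGlobalDim_ne_zero I hI
  have hU := isHalfBraiding_unit I hI
  rw [← cancel_mono (tensorι I (unit I) P)]
  refine I.eq_of_comp_unitCounit (isHB_over P.obj)
    (((Intertwines.comp (isHom_leftUnitor I hI hP) (isHom_leftUnitorInv I hI hP))).comp
      (tensorι_left I hD hU hP)) ((Intertwines.id _).comp (tensorι_left I hD hU hP)) ?_
  have e := leftUnitorInv_leftUnitor I hI hP
  have e2 := tensorι_unitCounit I hI hP
  simp only [Category.assoc, Category.id_comp]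
  rw [e2, Linear.comp_smul, Linear.comp_smul, reassoc_of% e]

theorem rightUnitor_rightUnitorInv (hP : P.IsHalfBraiding) :
    rightUnitor I P ≫ rightUnitorInv I P = 𝟙 _ := by
  have hD := sqrtGlobalDim_ne_zero I hI
  have hU := isHalfBraiding_unit I hI
  rw [← cancel_mono (tensorι I P (unit I))]
  refine I.eq_of_comp_unitCounit_right (isHB_under P.obj)
    (((Intertwines.comp (isHom_rightUnitor I hI hP) (isHom_rightUnitorInv I hI hP))).comp
      (tensorι_right I hD hP hU)) ((Intertwines.id _).comp (tensorι_right I hD hP hU)) ?_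
  have e := rightUnitorInv_rightUnitor I hI hP
  have e2 := tensorι_unitCounit_right I hI hP
  simp only [Category.assoc, Category.id_comp]
  rw [e2, Linear.comp_smul, Linear.comp_smul, reassoc_of% e]

theorem isIso_leftUnitor (hP : P.IsHalfBraiding) : IsIso (leftUnitor I P) :=
  ⟨leftUnitorInv I P, leftUnitor_leftUnitorInv I hI hP, leftUnitorInv_leftUnitor I hI hP⟩

theorem isIso_rightUnitor (hP : P.IsHalfBraiding) : IsIso (rightUnitor I P) :=
  ⟨rightUnitorInv I P, rightUnitor_rightUnitorInv I hI hP, rightUnitorInv_rightUnitor I hI hP⟩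

theorem leftUnitor_naturality (hP : P.IsHalfBraiding) (hP₁ : P₁.IsHalfBraiding)
    {f : P.obj ⟶ P₁.obj} (hf : IsHom P P₁ f) :
    tensorHom I (P := unit I) (P₁ := unit I) (𝟙 (unit I).obj) f ≫ leftUnitor I P₁ =
      leftUnitor I P ≫ f := by
  have hD := sqrtGlobalDim_ne_zero I hI
  have hU := isHalfBraiding_unit I hI
  rw [leftUnitor_eq I hI hP₁, leftUnitor_eq I hI hP, Linear.comp_smul, Linear.smul_comp,
    reassoc_of% (tensorHom_ι I hD hU hP (P₁ := unit I) (f := 𝟙 (unit I).obj) (Intertwines.id _) hf)]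
  congr 1
  simp only [id_tensorHom, Category.assoc]
  rw [whisker_exchange_assoc]
  simp

theorem rightUnitor_naturality (hP : P.IsHalfBraiding) (hP₁ : P₁.IsHalfBraiding)
    {f : P.obj ⟶ P₁.obj} (hf : IsHom P P₁ f) :
    tensorHom I (R := unit I) (R₁ := unit I) f (𝟙 (unit I).obj) ≫ rightUnitor I P₁ =
      rightUnitor I P ≫ f := by
  have hD := sqrtGlobalDim_ne_zero I hI
  have hU := isHalfBraiding_unit I hI
  rw [rightUnitor_eq I hI hP₁, rightUnitor_eq I hI hP, Linear.comp_smul, Linear.smul_comp,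
    reassoc_of% (tensorHom_ι I hD hP hU (R₁ := unit I) (g := 𝟙 (unit I).obj) hf (Intertwines.id _))]
  congr 1
  simp only [tensorHom_id, Category.assoc]
  rw [← whisker_exchange_assoc]
  simp

end PreCenter

end UnitorInverse

section Coherence

variable {𝕜 : Type w} [Field 𝕜] [IsAlgClosed 𝕜] {C : Type u} [Category.{v} C]
  [Abelian C] [Linear 𝕜 C] [FiniteSemisimple 𝕜 C] [MonoidalCategory C] [MonoidalPreadditive C]
  [MonoidalLinear 𝕜 C] [Simple (𝟙_ C)] [BraidedCategory C] [RightRigidCategory C]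
  [PivotalCategory C] [SphericalCategory C] (I : SimpleData 𝕜 C)

namespace PreCenter

theorem mono_whiskerLeft_tensorι (hD : I.sqrtGlobalDim ≠ 0) {P R : PreCenter C}
    (hP : P.IsHalfBraiding) (hR : R.IsHalfBraiding) (A : C) : Mono (A ◁ tensorι I P R) := by
  have : SplitMono (A ◁ tensorι I P R) := ⟨A ◁ tensorπ I P R, by
    rw [← whiskerLeft_comp, tensorι_π I hD hP hR, whiskerLeft_id]⟩
  exact this.mono

variable (hI : IsModular I) {W X Y Z X₁ Y₁ Z₁ : PreCenter C}

include hI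

theorem assoc_naturality (hX : X.IsHalfBraiding) (hY : Y.IsHalfBraiding) (hZ : Z.IsHalfBraiding)
    (hX₁ : X₁.IsHalfBraiding) (hY₁ : Y₁.IsHalfBraiding) (hZ₁ : Z₁.IsHalfBraiding)
    {f : X.obj ⟶ X₁.obj} {g : Y.obj ⟶ Y₁.obj} {h : Z.obj ⟶ Z₁.obj} (hf : IsHom X X₁ f)
    (hg : IsHom Y Y₁ g) (hh : IsHom Z Z₁ h) :
    tensorHom I (P := tensor I X Y) (P₁ := tensor I X₁ Y₁) (tensorHom I f g) h ≫
        assoc I X₁ Y₁ Z₁ =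
      assoc I X Y Z ≫ tensorHom I (R := tensor I Y Z) (R₁ := tensor I Y₁ Z₁) f
        (tensorHom I g h) := by
  have hD := sqrtGlobalDim_ne_zero I hI
  have hXY := isHalfBraiding_tensor I hD hX hY
  have hYZ := isHalfBraiding_tensor I hD hY hZ
  have hfg := isHom_tensorHom I hD hX hX₁ hY hY₁ g hf
  have e1 := tensorHom_ι I hD hXY hZ hfg hh
  have e2 := tensorHom_ι I hD hX hYZ hf (isHom_tensorHom I hD hY hY₁ hZ hZ₁ h hg)
  have e3 := tensorHom_ι I hD hX hY hf hg
  have e4 := tensorHom_ι I hD hY hZ hg hh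
  have := mono_whiskerLeft_tensorι I hD hY₁ hZ₁ X₁.obj
  rw [← cancel_mono (tensorι I X₁ (tensor I Y₁ Z₁)),
    ← cancel_mono (X₁.obj ◁ tensorι I Y₁ Z₁)]
  simp only [Category.assoc, assoc_ι I hD hX₁ hY₁ hZ₁, reassoc_of% e1, reassoc_of% e2]
  have e5 : (tensorHom I f g ⊗ₘ h) ≫ tensorι I X₁ Y₁ ▷ Z₁.obj =
      tensorι I X Y ▷ Z.obj ≫ ((f ⊗ₘ g) ⊗ₘ h) := by
    rw [MonoidalCategory.tensorHom_def', Category.assoc, ← comp_whiskerRight, e3,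
      MonoidalCategory.tensorHom_def' (f ⊗ₘ g) h, comp_whiskerRight, ← whisker_exchange_assoc]
  have e6 : (f ⊗ₘ tensorHom I g h) ≫ X₁.obj ◁ tensorι I Y₁ Z₁ =
      X.obj ◁ tensorι I Y Z ≫ (f ⊗ₘ (g ⊗ₘ h)) := by
    rw [MonoidalCategory.tensorHom_def, Category.assoc, ← whiskerLeft_comp, e4,
      MonoidalCategory.tensorHom_def f (g ⊗ₘ h), whiskerLeft_comp, whisker_exchange_assoc]
  rw [reassoc_of% e5, e6]
  have e7 := assoc_ι I hD hX hY hZ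
  rw [reassoc_of% e7, associator_naturality]

theorem pentagon (hW : W.IsHalfBraiding) (hX : X.IsHalfBraiding) (hY : Y.IsHalfBraiding)
    (hZ : Z.IsHalfBraiding) :
    tensorHom I (P := tensor I (tensor I W X) Y) (P₁ := tensor I W (tensor I X Y))
        (assoc I W X Y) (𝟙 Z.obj) ≫ assoc I W (tensor I X Y) Z ≫
        tensorHom I (R := tensor I (tensor I X Y) Z) (R₁ := tensor I X (tensor I Y Z))
          (𝟙 W.obj) (assoc I X Y Z) =
      assoc I (tensor I W X) Y Z ≫ assoc I W X (tensor I Y Z) := by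
  have hD := sqrtGlobalDim_ne_zero I hI
  have hWX := isHalfBraiding_tensor I hD hW hX
  have hXY := isHalfBraiding_tensor I hD hX hY
  have hYZ := isHalfBraiding_tensor I hD hY hZ
  have hWX_Y := isHalfBraiding_tensor I hD hWX hY
  have hXY_Z := isHalfBraiding_tensor I hD hXY hZ
  have e1 := tensorHom_ι I hD hWX_Y hZ (isHom_assoc I hD hW hX hY) (Intertwines.id Z.γ)
  have e2 := tensorHom_ι I hD hW hXY_Z (Intertwines.id W.γ) (isHom_assoc I hD hX hY hZ)
  have a1 := assoc_ι I hD hX hY hZ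
  have a2 := assoc_ι I hD hW hXY hZ
  have a3 := assoc_ι I hD hW hX hY
  have a4 := assoc_ι I hD hWX hY hZ
  have a5 := assoc_ι I hD hW hX hYZ
  have := mono_whiskerLeft_tensorι I hD hX hYZ W.obj
  have := mono_whiskerLeft_tensorι I hD hY hZ (W.obj ⊗ X.obj)
  rw [← cancel_mono (tensorι I W (tensor I X (tensor I Y Z))),
    ← cancel_mono (W.obj ◁ tensorι I X (tensor I Y Z)),
    ← cancel_mono (α_ W.obj X.obj (tensor I Y Z).obj).inv,
    ← cancel_mono ((W.obj ⊗ X.obj) ◁ tensorι I Y Z),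
    ← cancel_mono (α_ W.obj X.obj (Y.obj ⊗ Z.obj)).hom]
  simp only [Category.assoc, tensorHom_id, id_tensorHom] at e1 e2 ⊢
  rw [reassoc_of% e2, reassoc_of% a5]
  have c1 : W.obj ◁ assoc I X Y Z ≫ W.obj ◁ tensorι I X (tensor I Y Z) ≫
      (α_ W.obj X.obj (tensor I Y Z).obj).inv ≫ (W.obj ⊗ X.obj) ◁ tensorι I Y Z ≫
        (α_ W.obj X.obj (Y.obj ⊗ Z.obj)).hom = W.obj ◁ tensorι I (tensor I X Y) Z ≫
          W.obj ◁ tensorι I X Y ▷ Z.obj ≫ W.obj ◁ (α_ X.obj Y.obj Z.obj).hom := by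
    simpa using congrArg (W.obj ◁ ·) a1
  rw [c1, reassoc_of% a2, reassoc_of% e1]
  have b1 : assoc I W X Y ▷ Z.obj ≫ tensorι I W (tensor I X Y) ▷ Z.obj ≫
      (α_ W.obj (tensor I X Y).obj Z.obj).hom ≫ W.obj ◁ tensorι I X Y ▷ Z.obj =
      (tensorι I (tensor I W X) Y ≫ tensorι I W X ▷ Y.obj ≫ (α_ W.obj X.obj Y.obj).hom) ▷ Z.obj ≫
        (α_ W.obj (X.obj ⊗ Y.obj) Z.obj).hom := by
    rw [← a3]
    simp
  rw [reassoc_of% b1, Iso.hom_inv_id_assoc]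
  have b2 : tensorι I W X ▷ (tensor I Y Z).obj ≫ (W.obj ⊗ X.obj) ◁ tensorι I Y Z =
      (tensor I W X).obj ◁ tensorι I Y Z ≫ tensorι I W X ▷ (Y.obj ⊗ Z.obj) := by
    rw [whisker_exchange]
  rw [reassoc_of% b2, reassoc_of% a4]
  simp

theorem triangle (hX : X.IsHalfBraiding) (hY : Y.IsHalfBraiding) :
    assoc I X (unit I) Y ≫ tensorHom I (R := tensor I (unit I) Y) (𝟙 X.obj) (leftUnitor I Y) =
      tensorHom I (P := tensor I X (unit I)) (rightUnitor I X) (𝟙 Y.obj) := by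
  have hD := sqrtGlobalDim_ne_zero I hI
  have hU := isHalfBraiding_unit I hI
  have hXU := isHalfBraiding_tensor I hD hX hU
  have hUY := isHalfBraiding_tensor I hD hU hY
  have e1 := tensorHom_ι I hD hXU hY (isHom_rightUnitor I hI hX) (Intertwines.id Y.γ)
  have e2 := tensorHom_ι I hD hX hUY (Intertwines.id X.γ) (isHom_leftUnitor I hI hY)
  have a1 := assoc_ι I hD hX hU hY
  rw [← cancel_mono (tensorι I X Y)]
  simp only [Category.assoc, tensorHom_id, id_tensorHom] at e1 e2 ⊢
  rw [e1, e2, leftUnitor_eq I hI hY, rightUnitor_eq I hI hX]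
  simp only [MonoidalLinear.whiskerLeft_smul, MonoidalLinear.smul_whiskerRight, Linear.comp_smul,
    whiskerLeft_comp, reassoc_of% a1]
  simp

end PreCenter

end Coherence


section Dual

variable {C : Type u} [Category.{v} C] [MonoidalCategory C] [RightRigidCategory C]

variable [BraidedCategory C]

theorem under_coev_hom_ext {A X B : C} {f g : A ⊗ †X ⟶ B}
    (h : 𝟙 A ⊗≫ A ◁ η_ X †X ⊗≫ underγ X A ▷ †X ⊗≫ X ◁ f =
      𝟙 A ⊗≫ A ◁ η_ X †X ⊗≫ underγ X A ▷ †X ⊗≫ X ◁ g) : f = g := by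
  have key : ∀ f : A ⊗ †X ⟶ B, f = 𝟙 (A ⊗ †X) ⊗≫ underγ †X A ⊗≫
      †X ◁ (𝟙 A ⊗≫ A ◁ η_ X †X ⊗≫ underγ X A ▷ †X ⊗≫ X ◁ f) ⊗≫ ε_ X †X ▷ B ⊗≫ 𝟙 B := by
    intro f
    calc f = A ◁ (𝟙 †X ⊗≫ †X ◁ η_ X †X ⊗≫ ε_ X †X ▷ †X ⊗≫ 𝟙 †X) ≫ f := by
          rw [ev_zigzag]; simp
      _ = 𝟙 (A ⊗ †X) ⊗≫ (A ⊗ †X) ◁ η_ X †X ⊗≫ (𝟙 (A ⊗ †X ⊗ X) ⊗≫ A ◁ ε_ X †X ⊗≫ 𝟙 A) ▷ †X ⊗≫ f := by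
          monoidal
      _ = 𝟙 (A ⊗ †X) ⊗≫ ((A ⊗ †X) ◁ η_ X †X ≫ underγ †X A ▷ (X ⊗ †X)) ⊗≫
          †X ◁ underγ X A ▷ †X ⊗≫ (ε_ X †X ▷ (A ⊗ †X) ≫ 𝟙_ C ◁ f) ⊗≫ 𝟙 B := by
          rw [← isCrossing_under.cap]; monoidal
      _ = _ := by rw [whisker_exchange, ← whisker_exchange (ε_ X †X) f]; monoidal
  rw [key f, key g, h]

variable [PivotalCategory C]

namespace PreCenter

/-- The characterization of the half-braiding of the dual. -/
theorem coev_dualγ (P : PreCenter C) (A : C) :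
    A ◁ η_ P.obj †P.obj ≫ prodγ (underγ P.obj) (dualγ P) A =
      A ◁ η_ P.obj †P.obj ≫ prodγ P.γ (overγ †P.obj) A := by
  have e : dualγ P A = underγ †P.obj A ⊗≫ (†P.obj ⊗ A) ◁ η_ P.obj †P.obj ⊗≫
    †P.obj ◁ P.γ A ▷ †P.obj ⊗≫ ε_ P.obj †P.obj ▷ (A ⊗ †P.obj) ⊗≫ overγ †P.obj A := rfl
  dsimp only [prodγ]
  rw [e]
  calc _ = 𝟙 (A ⊗ 𝟙_ C) ⊗≫ (𝟙 A ⊗≫ A ◁ η_ P.obj †P.obj ⊗≫ underγ P.obj A ▷ †P.obj ⊗≫ P.obj ◁ underγ †P.obj A ⊗≫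
        𝟙 (P.obj ⊗ †P.obj ⊗ A)) ⊗≫ (P.obj ⊗ †P.obj ⊗ A) ◁ η_ P.obj †P.obj ⊗≫
        P.obj ◁ †P.obj ◁ P.γ A ▷ †P.obj ⊗≫ P.obj ◁ ε_ P.obj †P.obj ▷ (A ⊗ †P.obj) ⊗≫
        P.obj ◁ overγ †P.obj A ⊗≫ 𝟙 ((P.obj ⊗ †P.obj) ⊗ A) := by monoidal
    _ = 𝟙 (A ⊗ 𝟙_ C) ⊗≫ η_ P.obj †P.obj ▷ A ⊗≫ (P.obj ⊗ †P.obj) ◁ (𝟙 A ⊗≫ A ◁ η_ P.obj †P.obj ⊗≫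
        P.γ A ▷ †P.obj ⊗≫ 𝟙 (P.obj ⊗ A ⊗ †P.obj)) ⊗≫
        P.obj ◁ ε_ P.obj †P.obj ▷ (A ⊗ †P.obj) ⊗≫
        P.obj ◁ overγ †P.obj A ⊗≫ 𝟙 ((P.obj ⊗ †P.obj) ⊗ A) := by
        rw [isCrossing_under.cup]; monoidal
    _ = 𝟙 (A ⊗ 𝟙_ C) ⊗≫ (η_ P.obj †P.obj ▷ A ≫ (P.obj ⊗ †P.obj) ◁ (𝟙 A ⊗≫ A ◁ η_ P.obj †P.obj ⊗≫
        P.γ A ▷ †P.obj ⊗≫ 𝟙 (P.obj ⊗ A ⊗ †P.obj))) ⊗≫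
        P.obj ◁ ε_ P.obj †P.obj ▷ (A ⊗ †P.obj) ⊗≫
        P.obj ◁ overγ †P.obj A ⊗≫ 𝟙 ((P.obj ⊗ †P.obj) ⊗ A) := by
        monoidal
    _ = 𝟙 (A ⊗ 𝟙_ C) ⊗≫ A ◁ η_ P.obj †P.obj ⊗≫ P.γ A ▷ †P.obj ⊗≫
        (𝟙 P.obj ⊗≫ η_ P.obj †P.obj ▷ P.obj ⊗≫ P.obj ◁ ε_ P.obj †P.obj ⊗≫ 𝟙 P.obj) ▷ (A ⊗ †P.obj) ⊗≫
        P.obj ◁ overγ †P.obj A ⊗≫ 𝟙 ((P.obj ⊗ †P.obj) ⊗ A) := by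
        rw [← whisker_exchange]; monoidal
    _ = _ := by rw [coev_zigzag]; monoidal

theorem dualγ_ev (P : PreCenter C) (A : C) :
    prodγ (dualγ P) (overγ P.obj) A ≫ ε_ P.obj †P.obj ▷ A =
      prodγ (underγ †P.obj) P.γ A ≫ ε_ P.obj †P.obj ▷ A := by
  have e : dualγ P A = underγ †P.obj A ⊗≫ (†P.obj ⊗ A) ◁ η_ P.obj †P.obj ⊗≫
    †P.obj ◁ P.γ A ▷ †P.obj ⊗≫ ε_ P.obj †P.obj ▷ (A ⊗ †P.obj) ⊗≫ overγ †P.obj A := rfl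
  dsimp only [prodγ]
  rw [e]
  calc _ = 𝟙 (A ⊗ †P.obj ⊗ P.obj) ⊗≫ underγ †P.obj A ▷ P.obj ⊗≫
        (†P.obj ⊗ A) ◁ η_ P.obj †P.obj ▷ P.obj ⊗≫
        †P.obj ◁ P.γ A ▷ (†P.obj ⊗ P.obj) ⊗≫ ε_ P.obj †P.obj ▷ (A ⊗ †P.obj ⊗ P.obj) ⊗≫
        (𝟙 (A ⊗ †P.obj ⊗ P.obj) ⊗≫ overγ †P.obj A ▷ P.obj ⊗≫ †P.obj ◁ overγ P.obj A ⊗≫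
        ε_ P.obj †P.obj ▷ A ⊗≫ 𝟙 A) ⊗≫ 𝟙 (𝟙_ C ⊗ A) := by monoidal
    _ = 𝟙 (A ⊗ †P.obj ⊗ P.obj) ⊗≫ underγ †P.obj A ▷ P.obj ⊗≫
        (†P.obj ⊗ A) ◁ η_ P.obj †P.obj ▷ P.obj ⊗≫
        †P.obj ◁ P.γ A ▷ (†P.obj ⊗ P.obj) ⊗≫ (ε_ P.obj †P.obj ▷ (A ⊗ †P.obj ⊗ P.obj) ≫
        𝟙_ C ◁ (A ◁ ε_ P.obj †P.obj)) ⊗≫ 𝟙 (𝟙_ C ⊗ A) := by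
        rw [isCrossing_over.cap]; monoidal
    _ = 𝟙 (A ⊗ †P.obj ⊗ P.obj) ⊗≫ underγ †P.obj A ▷ P.obj ⊗≫
        (†P.obj ⊗ A) ◁ η_ P.obj †P.obj ▷ P.obj ⊗≫
        †P.obj ◁ (P.γ A ▷ (†P.obj ⊗ P.obj) ≫ (P.obj ⊗ A) ◁ ε_ P.obj †P.obj) ⊗≫
        ε_ P.obj †P.obj ▷ A ⊗≫ 𝟙 (𝟙_ C ⊗ A) := by
        rw [← whisker_exchange]; monoidal
    _ = 𝟙 (A ⊗ †P.obj ⊗ P.obj) ⊗≫ underγ †P.obj A ▷ P.obj ⊗≫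
        (†P.obj ⊗ A) ◁ (𝟙 P.obj ⊗≫ η_ P.obj †P.obj ▷ P.obj ⊗≫ P.obj ◁ ε_ P.obj †P.obj ⊗≫ 𝟙 P.obj) ⊗≫
        †P.obj ◁ P.γ A ⊗≫ ε_ P.obj †P.obj ▷ A ⊗≫ 𝟙 (𝟙_ C ⊗ A) := by
        rw [← whisker_exchange]; monoidal
    _ = _ := by rw [coev_zigzag]; monoidal

theorem dualγ_intertwines {P : PreCenter C} {T : C} {τ : ∀ A : C, A ⊗ T ⟶ T ⊗ A} {g : †P.obj ⟶ T}
    (h : ∀ A, A ◁ (η_ P.obj †P.obj ≫ P.obj ◁ g) ≫ prodγ (underγ P.obj) τ A =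
      A ◁ (η_ P.obj †P.obj ≫ P.obj ◁ g) ≫ prodγ P.γ (overγ T) A) : Intertwines (dualγ P) τ g := by
  intro A
  change A ◁ g ≫ τ A = dualγ P A ≫ g ▷ A
  apply under_coev_hom_ext
  have h1 := (over_natural g).whiskerLeft P.γ A
  have h2 := coev_dualγ P A
  dsimp only at h1
  have h3 : A ◁ η_ P.obj †P.obj ≫ prodγ (underγ P.obj) (dualγ P) A ≫ (P.obj ◁ g) ▷ A =
      A ◁ (η_ P.obj †P.obj ≫ P.obj ◁ g) ≫ prodγ (underγ P.obj) τ A := by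
    rw [h A, reassoc_of% h2, ← h1]
    simp
  calc _ = (ρ_ A).inv ≫ (A ◁ (η_ P.obj †P.obj ≫ P.obj ◁ g) ≫ prodγ (underγ P.obj) τ A) ≫
        (α_ _ _ _).hom := by
        dsimp only [prodγ]
        calc _ = 𝟙 A ⊗≫ A ◁ η_ P.obj †P.obj ⊗≫ (underγ P.obj A ▷ †P.obj ≫
              (P.obj ⊗ A) ◁ g) ⊗≫ P.obj ◁ τ A := by monoidal
          _ = _ := by rw [← whisker_exchange]; monoidal
    _ = _ := by
        rw [← h3]
        dsimp only [prodγ]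
        monoidal

theorem mate_intertwines {P R : PreCenter C} {f : P.obj ⟶ R.obj} (hf : IsHom P R f) :
    Intertwines (dualγ R) (dualγ P) (rightAdjointMate f) := by
  refine dualγ_intertwines fun A => ?_
  have h1 := (under_natural f).whiskerRight (dualγ P) A
  have h2 := Intertwines.whiskerRight (σ := P.γ) (σ' := R.γ) hf (overγ †P.obj) A
  have h3 := coev_dualγ P A
  dsimp only at h1 h2
  rw [coevaluation_comp_rightAdjointMate, whiskerLeft_comp, Category.assoc, Category.assoc]
  rw [h1, h2, reassoc_of% h3]

theorem rightDualTensorIso_intertwines (W Y : C) :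
    Intertwines (dualγ (box W Y)) (boxγ †Y †W) (rightDualTensorIso W Y).hom := by
  refine dualγ_intertwines fun A => ?_
  change A ◁ (η_ (W ⊗ Y) †(W ⊗ Y) ≫ (W ⊗ Y) ◁ (rightDualTensorIso W Y).hom) ≫
      prodγ (underγ (W ⊗ Y)) (boxγ †Y †W) A =
    A ◁ (η_ (W ⊗ Y) †(W ⊗ Y) ≫ (W ⊗ Y) ◁ (rightDualTensorIso W Y).hom) ≫
      prodγ (boxγ W Y) (overγ (†Y ⊗ †W)) A
  rw [coev_rightDualTensorIso_hom]
  simp only [prodγ, boxγ, under_tensor, over_tensor]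
  calc _ = 𝟙 (A ⊗ 𝟙_ C) ⊗≫ A ◁ η_ W †W ⊗≫ (A ◁ W ◁ (η_ Y †Y ▷ †W) ⊗≫ underγ W A ▷ ((Y ⊗ †Y) ⊗ †W)) ⊗≫
        W ◁ underγ Y A ▷ (†Y ⊗ †W) ⊗≫ (W ⊗ Y) ◁ underγ †Y A ▷ †W ⊗≫
          (W ⊗ Y ⊗ †Y) ◁ overγ †W A ⊗≫ 𝟙 (((W ⊗ Y) ⊗ †Y ⊗ †W) ⊗ A) := by monoidal
    _ = 𝟙 (A ⊗ 𝟙_ C) ⊗≫ A ◁ η_ W †W ⊗≫ ((A ⊗ W) ◁ (η_ Y †Y ▷ †W) ≫ underγ W A ▷ ((Y ⊗ †Y) ⊗ †W)) ⊗≫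
        W ◁ underγ Y A ▷ (†Y ⊗ †W) ⊗≫ (W ⊗ Y) ◁ underγ †Y A ▷ †W ⊗≫
          (W ⊗ Y ⊗ †Y) ◁ overγ †W A ⊗≫ 𝟙 (((W ⊗ Y) ⊗ †Y ⊗ †W) ⊗ A) := by monoidal
    _ = 𝟙 (A ⊗ 𝟙_ C) ⊗≫ A ◁ η_ W †W ⊗≫ underγ W A ▷ †W ⊗≫ W ◁ (𝟙 A ⊗≫ A ◁ η_ Y †Y ⊗≫
        underγ Y A ▷ †Y ⊗≫ Y ◁ underγ †Y A ⊗≫ 𝟙 (Y ⊗ †Y ⊗ A)) ▷ †W ⊗≫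
          (W ⊗ Y ⊗ †Y) ◁ overγ †W A ⊗≫ 𝟙 (((W ⊗ Y) ⊗ †Y ⊗ †W) ⊗ A) := by
        rw [whisker_exchange]; monoidal
    _ = 𝟙 (A ⊗ 𝟙_ C) ⊗≫ A ◁ η_ W †W ⊗≫ underγ W A ▷ †W ⊗≫ W ◁ (𝟙 A ⊗≫ A ◁ η_ Y †Y ⊗≫
        overγ Y A ▷ †Y ⊗≫ Y ◁ overγ †Y A ⊗≫ 𝟙 (Y ⊗ †Y ⊗ A)) ▷ †W ⊗≫
          (W ⊗ Y ⊗ †Y) ◁ overγ †W A ⊗≫ 𝟙 (((W ⊗ Y) ⊗ †Y ⊗ †W) ⊗ A) := by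
        rw [isCrossing_under.cup, isCrossing_over.cup]
    _ = 𝟙 (A ⊗ 𝟙_ C) ⊗≫ A ◁ η_ W †W ⊗≫ (underγ W A ▷ (𝟙_ C ⊗ †W) ≫
        (W ⊗ A) ◁ (η_ Y †Y ▷ †W)) ⊗≫
        W ◁ overγ Y A ▷ (†Y ⊗ †W) ⊗≫ (W ⊗ Y) ◁ overγ †Y A ▷ †W ⊗≫
          (W ⊗ Y ⊗ †Y) ◁ overγ †W A ⊗≫ 𝟙 (((W ⊗ Y) ⊗ †Y ⊗ †W) ⊗ A) := by monoidal
    _ = _ := by rw [← whisker_exchange]; monoidal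

end PreCenter

end Dual

section BoxHom


variable {𝕜 : Type w} [Field 𝕜] [IsAlgClosed 𝕜] {C : Type u} [Category.{v} C]
  [Abelian C] [Linear 𝕜 C] [FiniteSemisimple 𝕜 C] [MonoidalCategory C] [MonoidalPreadditive C]
  [MonoidalLinear 𝕜 C] [Simple (𝟙_ C)] [BraidedCategory C] [RightRigidCategory C]
  [PivotalCategory C] [SphericalCategory C] (I : SimpleData 𝕜 C)

/-- Every morphism of boxes is a sum of tensor products of morphisms. -/
theorem exists_eq_sum_tensorHom (hI : IsModular I) {W Y W₁ Y₁ : C} {F : W ⊗ Y ⟶ W₁ ⊗ Y₁}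
    (hF : Intertwines (boxγ W Y) (boxγ W₁ Y₁) F) :
    ∃ (n : ℕ) (f : Fin n → (W ⟶ W₁)) (g : Fin n → (Y ⟶ Y₁)), F = ∑ m, f m ⊗ₘ g m := by
  have hD := sqrtGlobalDim_ne_zero I hI
  let F' : W ⟶ W₁ ⊗ Y₁ ⊗ †Y := (ρ_ W).inv ≫ W ◁ η_ Y †Y ≫ (α_ W Y †Y).inv ≫ F ▷ †Y ≫
    (α_ W₁ Y₁ †Y).hom
  have h1 : Intertwines (underγ W) (prodγ (underγ W₁) (overγ (Y₁ ⊗ †Y))) F' := by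
    refine over_unit_right.comp (((over_natural (η_ Y †Y)).whiskerLeft (underγ W)).comp ?_)
    rw [← prodγ_over, ← prodγ_over]
    exact (prodγ_assoc_inv _ _ _).comp ((hF.whiskerRight (overγ †Y)).comp (prodγ_assoc _ _ _))
  have h2 : Intertwines (underγ W) (prodγ (underγ W₁) (underγ (Y₁ ⊗ †Y))) F' := by
    rw [prodγ_under]
    exact under_natural F'
  have h3 : F' ≫ W₁ ◁ avg I (overγ (Y₁ ⊗ †Y)) (underγ (Y₁ ⊗ †Y)) = F' := by
    rw [← avg_prod_left I (isHB_under W₁)]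
    exact comp_avg_of_eq I hD ((isHB_under W₁).prod (isHB_over _)) fun A =>
      (h1.eq A).trans (h2.eq A).symm
  rw [avg_over_under I hI, whiskerLeft_sum, Preadditive.comp_sum] at h3
  have h4 : F = 𝟙 (W ⊗ Y) ⊗≫ F' ▷ Y ⊗≫ (W₁ ⊗ Y₁) ◁ ε_ Y †Y ⊗≫ 𝟙 (W₁ ⊗ Y₁) := by
    symm
    calc _ = 𝟙 (W ⊗ Y) ⊗≫ W ◁ η_ Y †Y ▷ Y ⊗≫ (F ▷ (†Y ⊗ Y) ≫ (W₁ ⊗ Y₁) ◁ ε_ Y †Y) ⊗≫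
          𝟙 (W₁ ⊗ Y₁) := by monoidal
      _ = 𝟙 (W ⊗ Y) ⊗≫ W ◁ (𝟙 Y ⊗≫ η_ Y †Y ▷ Y ⊗≫ Y ◁ ε_ Y †Y ⊗≫ 𝟙 Y) ⊗≫ F := by
          rw [← whisker_exchange]; monoidal
      _ = F := by rw [coev_zigzag]; monoidal
  refine ⟨_, fun m => F' ≫ W₁ ◁ homDual 𝕜 (𝟙_ C) (Y₁ ⊗ †Y) m ≫ (ρ_ W₁).hom,
    fun m => (λ_ Y).inv ≫ homBasis 𝕜 (𝟙_ C) (Y₁ ⊗ †Y) m ▷ Y ≫ (α_ Y₁ †Y Y).hom ≫ Y₁ ◁ ε_ Y †Y ≫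
      (ρ_ Y₁).hom, ?_⟩
  conv_lhs => rw [h4, ← h3]
  simp only [sum_whiskerRight, coherence_comp_sum, sum_coherence_comp]
  refine Finset.sum_congr rfl fun m _ => ?_
  rw [MonoidalCategory.tensorHom_def]
  monoidal

namespace SimpleData

theorem simple_dual (i : I.ι) : Simple (†(I.X i)) := simple_rightDual 𝕜 (I.X i)

/-- The components of the decomposition of the reduced unit are orthogonal. -/
theorem toUnit_fromUnit_of_ne (hI : IsModular I) {i j : I.ι} (h : i ≠ j) :
    I.toUnit (boxγ (I.X i) †(I.X i)) (pivEv (I.X i)) ≫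
      I.fromUnit (boxγ (I.X j) †(I.X j)) (η_ (I.X j) †(I.X j)) = 0 := by
  obtain ⟨n, f, g, e⟩ := exists_eq_sum_tensorHom I hI
    ((I.toUnit_intertwines (isHB_box _ _) (pivEv (I.X i))).comp
      (I.fromUnit_intertwines (isHB_box _ _) (η_ (I.X j) †(I.X j))))
  rw [e]
  refine Finset.sum_eq_zero fun m _ => ?_
  rw [I.hom_eq_zero h (f m), MonoidalCategory.tensorHom_def]
  simp

theorem toUnit_fromUnit_self (hI : IsModular I) (i : I.ι) :
    I.toUnit (boxγ (I.X i) †(I.X i)) (pivEv (I.X i)) ≫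
      (dim 𝕜 (I.X i) • I.fromUnit (boxγ (I.X i) †(I.X i)) (η_ (I.X i) †(I.X i))) = 𝟙 _ := by
  classical
  have := I.simple_dual i
  let b := I.toUnit (boxγ (I.X i) †(I.X i)) (pivEv (I.X i))
  obtain ⟨n, f, g, e⟩ := exists_eq_sum_tensorHom I hI
    ((I.toUnit_intertwines (isHB_box _ _) (pivEv (I.X i))).comp
      ((I.fromUnit_intertwines (isHB_box _ _) (η_ (I.X i) †(I.X i))).smul (dim 𝕜 (I.X i))))
  choose c hc using fun m => exists_eq_smul_id (𝕜 := 𝕜) (f m)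
  choose c' hc' using fun m => exists_eq_smul_id (𝕜 := 𝕜) (g m)
  have e' : b ≫ (dim 𝕜 (I.X i) • I.fromUnit (boxγ (I.X i) †(I.X i)) (η_ (I.X i) †(I.X i))) =
      (∑ m, c m * c' m) • 𝟙 _ := by
    refine e.trans ?_
    rw [Finset.sum_smul]
    refine Finset.sum_congr rfl fun m _ => ?_
    rw [hc m, hc' m, MonoidalCategory.tensorHom_def, MonoidalLinear.smul_whiskerRight,
      MonoidalLinear.whiskerLeft_smul]
    simp [smul_smul, mul_comm]
  have hb : b = (∑ m, c m * c' m) • b := by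
    conv_lhs => rw [← Category.comp_id b, ← I.unit_total hI, Preadditive.comp_sum]
    rw [Finset.sum_eq_single i]
    · rw [← Category.assoc, e', Linear.smul_comp, Category.id_comp]
    · intro j _ hj
      rw [Linear.smul_comp, Linear.comp_smul, ← Category.assoc, I.toUnit_fromUnit_of_ne hI hj.symm,
        zero_comp, smul_zero]
    · simp
  have hb0 : b ≠ 0 := by
    intro h0
    have h1 := I.toUnit_unitCounit (isHB_box _ _) (pivEv (I.X i))
    change b ≫ _ = _ at h1
    rw [h0, zero_comp] at h1
    have h2 : pivEv (I.X i) = 0 :=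
      (smul_eq_zero.1 h1.symm).resolve_left (inv_ne_zero (sqrtGlobalDim_ne_zero I hI))
    have h3 := dim_smul_id (𝕜 := 𝕜) (I.X i)
    rw [rightTrace, h2, comp_zero, comp_zero, ← zero_smul 𝕜 (𝟙 (𝟙_ C))] at h3
    exact dim_ne_zero (𝕜 := 𝕜) (I.X i) (smul_id_injective h3)
  have h1 : ∑ m, c m * c' m = 1 := by
    by_contra hne
    apply hb0
    have : ((∑ m, c m * c' m) - 1) • b = 0 := by rw [sub_smul, one_smul, ← hb, sub_self]
    exact (smul_eq_zero.1 this).resolve_left (sub_ne_zero.2 hne)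
  rw [h1, one_smul] at e'
  exact e'

end SimpleData

end BoxHom

section Boxes

variable {𝕜 : Type w} [Field 𝕜] [IsAlgClosed 𝕜] {C : Type u} [Category.{v} C]
  [Abelian C] [Linear 𝕜 C] [FiniteSemisimple 𝕜 C] [MonoidalCategory C] [MonoidalPreadditive C]
  [MonoidalLinear 𝕜 C] [Simple (𝟙_ C)] [BraidedCategory C] [RightRigidCategory C]
  [PivotalCategory C] [SphericalCategory C] (I : SimpleData 𝕜 C)

theorem Intertwines.inv {V W : C} {σ : ∀ A : C, A ⊗ V ⟶ V ⊗ A} {τ : ∀ A : C, A ⊗ W ⟶ W ⊗ A}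
    {f : V ≅ W} (h : Intertwines σ τ f.hom) : Intertwines τ σ f.inv := by
  intro A
  change A ◁ f.inv ≫ σ A = τ A ≫ f.inv ▷ A
  have e : A ◁ f.hom ≫ τ A = σ A ≫ f.hom ▷ A := h.eq A
  have e' : τ A = A ◁ f.inv ≫ σ A ≫ f.hom ▷ A := by rw [← e]; simp
  rw [e']
  simp

namespace PreCenter

variable {P R : PreCenter C}

/-- The reduced tensor product of a box with an object is a box. -/
theorem exists_box_tensor (hD : I.sqrtGlobalDim ≠ 0) (X Y : C) (hP : P.IsHalfBraiding) :
    ∃ (V : C) (i : X ⊗ V ⟶ (tensor I ⟨X ⊗ Y, boxγ X Y⟩ P).obj)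
      (p : (tensor I ⟨X ⊗ Y, boxγ X Y⟩ P).obj ⟶ X ⊗ V),
      Intertwines (boxγ X V) (tensor I ⟨X ⊗ Y, boxγ X Y⟩ P).γ i ∧
      Intertwines (tensor I ⟨X ⊗ Y, boxγ X Y⟩ P).γ (boxγ X V) p ∧ i ≫ p = 𝟙 _ ∧ p ≫ i = 𝟙 _ := by
  have hB : (⟨X ⊗ Y, boxγ X Y⟩ : PreCenter C).IsHalfBraiding := isHB_box X Y
  let L := avg I (overγ (Y ⊗ P.obj)) (prodγ (underγ Y) P.γ)
  have hL : L ≫ L = L :=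
    (Compatible.over_right ((isHB_under Y).prod hP)).symm.avg_comp_avg I hD
  have hproj : proj I ⟨X ⊗ Y, boxγ X Y⟩ P = (α_ X Y P.obj).hom ≫ X ◁ L ≫ (α_ X Y P.obj).inv := by
    have e1 : X ◁ L = avg I (prodγ (underγ X) (prodγ (overγ Y) (overγ P.obj)))
        (prodγ (underγ X) (prodγ (underγ Y) P.γ)) := by
      rw [avg_prod_left I (isHB_under X), prodγ_over]
    have e2 : leftγ ⟨X ⊗ Y, boxγ X Y⟩ P = prodγ (prodγ (underγ X) (overγ Y)) (overγ P.obj) := rfl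
    have e3 : rightγ ⟨X ⊗ Y, boxγ X Y⟩ P = prodγ (prodγ (underγ X) (underγ Y)) P.γ := by
      rw [prodγ_under]
    have e4 := comp_avg I (prodγ_assoc (underγ X) (overγ Y) (overγ P.obj))
      (prodγ_assoc (underγ X) (underγ Y) P.γ)
    rw [proj_eq_avg, e2, e3, e1, reassoc_of% e4]
    simp
  have h1 : factorThruImage L ≫ image.ι L = L := image.fac L
  have h2 : image.ι L ≫ factorThruImage L = 𝟙 _ := by
    rw [← cancel_epi (factorThruImage L), ← cancel_mono (image.ι L)]
    simp [h1, hL]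
  refine ⟨image L, X ◁ image.ι L ≫ (α_ X Y P.obj).inv ≫ tensorπ I ⟨X ⊗ Y, boxγ X Y⟩ P,
    tensorι I ⟨X ⊗ Y, boxγ X Y⟩ P ≫ (α_ X Y P.obj).hom ≫ X ◁ factorThruImage L, ?_, ?_, ?_, ?_⟩
  · refine Intertwines.comp ((over_natural (image.ι L)).whiskerLeft (underγ X)) ?_
    rw [← prodγ_over]
    exact (prodγ_assoc_inv _ _ _).comp (tensorπ_left I hD hB hP)
  · refine Intertwines.comp (tensorι_left I hD hB hP) ((prodγ_assoc _ _ _).comp ?_)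
    rw [prodγ_over]
    exact (over_natural (factorThruImage L)).whiskerLeft (underγ X)
  · have e := tensorπ_ι I ⟨X ⊗ Y, boxγ X Y⟩ P
    simp only [Category.assoc]
    rw [reassoc_of% e, hproj]
    simp only [Category.assoc, Iso.inv_hom_id_assoc]
    have e' : image.ι L ≫ L ≫ factorThruImage L = 𝟙 _ := by
      calc _ = image.ι L ≫ (factorThruImage L ≫ image.ι L) ≫ factorThruImage L := by rw [h1]
        _ = _ := by rw [Category.assoc, reassoc_of% h2, h2]
    simp only [← whiskerLeft_comp]
    rw [e', whiskerLeft_id]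
  · have e := tensorι_proj I hD hB hP
    rw [hproj] at e
    simp only [Category.assoc]
    rw [← whiskerLeft_comp_assoc, h1, reassoc_of% e, tensorι_π I hD hB hP]

/-- Every object of the center is a direct sum of boxes. -/
theorem exists_boxes (hI : IsModular I) (hP : P.IsHalfBraiding) :
    ∃ (V : I.ι → C) (i : ∀ j, I.X j ⊗ V j ⟶ P.obj) (p : ∀ j, P.obj ⟶ I.X j ⊗ V j),
      (∀ j, Intertwines (boxγ (I.X j) (V j)) P.γ (i j)) ∧
      (∀ j, Intertwines P.γ (boxγ (I.X j) (V j)) (p j)) ∧ ∑ j, p j ≫ i j = 𝟙 P.obj ∧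
      (∀ j, i j ≫ p j = 𝟙 _) ∧ ∀ j k, j ≠ k → i j ≫ p k = 0 := by
  have hD := sqrtGlobalDim_ne_zero I hI
  have hU := isHalfBraiding_unit I hI
  choose V i p hi hp hip hpi using fun j => exists_box_tensor I hD (I.X j) †(I.X j) hP
  let B : I.ι → PreCenter C := fun j => ⟨I.X j ⊗ †(I.X j), boxγ (I.X j) †(I.X j)⟩
  have hB : ∀ j, (B j).IsHalfBraiding := fun j => isHB_box _ _
  let b : ∀ j, (B j).obj ⟶ (unit I).obj := fun j => I.toUnit (boxγ (I.X j) †(I.X j)) (pivEv (I.X j))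
  let a : ∀ j, (unit I).obj ⟶ (B j).obj := fun j =>
    dim 𝕜 (I.X j) • I.fromUnit (boxγ (I.X j) †(I.X j)) (η_ (I.X j) †(I.X j))
  have hb : ∀ j, IsHom (B j) (unit I) (b j) := fun j => I.toUnit_intertwines (isHB_box _ _) _
  have ha : ∀ j, IsHom (unit I) (B j) (a j) := fun j =>
    (I.fromUnit_intertwines (isHB_box _ _) _).smul _
  have hab : ∑ j, a j ≫ b j = 𝟙 _ := I.unit_total hI
  have hba : ∀ j k, (i j ≫ tensorHom I (b j) (𝟙 P.obj) ≫ leftUnitor I P) ≫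
      leftUnitorInv I P ≫ tensorHom I (a k) (𝟙 P.obj) ≫ p k =
      i j ≫ tensorι I (B j) P ≫ (b j ≫ a k) ▷ P.obj ≫ tensorπ I (B k) P ≫ p k := by
    intro j k
    have e := tensorHom_ι I hD (hB j) hP (hb j) (Intertwines.id P.γ)
    have e' := leftUnitor_leftUnitorInv I hI hP
    simp only [Category.assoc, reassoc_of% e']
    rw [tensorHom_eq I (a k), Category.assoc, Category.assoc, reassoc_of% e]
    simp
  refine ⟨V, fun j => i j ≫ tensorHom I (b j) (𝟙 P.obj) ≫ leftUnitor I P,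
    fun j => leftUnitorInv I P ≫ tensorHom I (a j) (𝟙 P.obj) ≫ p j, fun j => ?_, fun j => ?_, ?_,
    fun j => ?_, fun j k h => ?_⟩
  · exact (hi j).comp (Intertwines.comp (isHom_tensorHom I hD (hB j) hU hP hP _ (hb j))
      (isHom_leftUnitor I hI hP))
  · exact Intertwines.comp (isHom_leftUnitorInv I hI hP)
      (Intertwines.comp (isHom_tensorHom I hD hU (hB j) hP hP _ (ha j)) (hp j))
  · have key : ∀ j, tensorHom I (a j) (𝟙 P.obj) ≫ tensorHom I (b j) (𝟙 P.obj) =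
        tensorι I (unit I) P ≫ (a j ≫ b j) ▷ P.obj ≫ tensorπ I (unit I) P := by
      intro j
      have e := tensorHom_ι I hD hU hP (ha j) (Intertwines.id P.γ)
      rw [tensorHom_eq I (b j), reassoc_of% e]
      simp
    have total : ∑ j, tensorHom I (a j) (𝟙 P.obj) ≫ tensorHom I (b j) (𝟙 P.obj) = 𝟙 _ := by
      simp only [key]
      rw [← Preadditive.comp_sum, ← Preadditive.sum_comp, ← sum_whiskerRight, hab, id_whiskerRight,
        Category.id_comp, tensorι_π I hD hU hP]
    calc _ = leftUnitorInv I P ≫ (∑ j, tensorHom I (a j) (𝟙 P.obj) ≫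
          tensorHom I (b j) (𝟙 P.obj)) ≫ leftUnitor I P := by
          simp only [Preadditive.comp_sum, Preadditive.sum_comp, Category.assoc]
          refine Finset.sum_congr rfl fun j _ => ?_
          rw [reassoc_of% (hpi j)]
      _ = _ := by rw [total, Category.id_comp, leftUnitorInv_leftUnitor I hI hP]
  · have e1 : b j ≫ a j = 𝟙 _ := I.toUnit_fromUnit_self hI j
    have e2 := tensorι_π I hD (hB j) hP
    rw [hba, e1, id_whiskerRight, Category.id_comp, reassoc_of% e2, hip]
  · have e1 : b j ≫ a k = 0 :=
      (Linear.comp_smul _ _ _ _ _ _).trans (by rw [I.toUnit_fromUnit_of_ne hI h, smul_zero])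
    rw [hba, e1]
    simp

theorem isHB_dual_box (W Y : C) : IsHB (dualγ (box W Y)) :=
  IsHB.of_retract (isHB_box †Y †W) (rightDualTensorIso_intertwines W Y)
    (rightDualTensorIso_intertwines W Y).inv (Iso.hom_inv_id _)

theorem isHB_dual (hI : IsModular I) (hP : P.IsHalfBraiding) : IsHB (dualγ P) := by
  obtain ⟨V, i, p, hi, hp, h, -⟩ := exists_boxes I hI hP
  refine IsHB.of_total (fun j => isHB_dual_box (I.X j) (V j))
    (ι := fun j => rightAdjointMate (p j)) (π := fun j => rightAdjointMate (i j))
    (fun j => mate_intertwines (P := P) (R := box _ _) (hp j))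
    (fun j => mate_intertwines (P := box _ _) (R := P) (hi j)) ?_
  have := congrArg rightAdjointMate h
  rw [rightAdjointMate_sum, rightAdjointMate_id] at this
  rw [← this]
  exact Finset.sum_congr rfl fun j _ => comp_rightAdjointMate.symm

theorem isHalfBraiding_dual (hI : IsModular I) (hP : P.IsHalfBraiding) :
    P.dual.IsHalfBraiding := isHB_dual I hI hP

theorem piv_box_intertwines (W Y : C) : Intertwines (boxγ W Y) (dualγ (dual (box W Y)))
    (PivotalCategory.piv (W ⊗ Y)).hom := by
  rw [PivotalCategory.piv_tensor, doubleDualTensor]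
  refine Intertwines.comp (Intertwines.tensorHom (under_natural _) (over_natural _)) ?_
  refine Intertwines.comp (rightDualTensorIso_intertwines †Y †W).inv ?_
  exact mate_intertwines (P := dual (box W Y)) (R := box †Y †W) (rightDualTensorIso_intertwines W Y)

theorem isHom_piv (hI : IsModular I) (hP : P.IsHalfBraiding) :
    IsHom P P.dual.dual (PivotalCategory.piv P.obj).hom := by
  obtain ⟨V, i, p, hi, hp, h, -⟩ := exists_boxes I hI hP
  have e : (PivotalCategory.piv P.obj).hom = ∑ j, p j ≫ (PivotalCategory.piv (I.X j ⊗ V j)).hom ≫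
      rightAdjointMate (rightAdjointMate (i j)) := by
    simp only [← PivotalCategory.piv_naturality, ← Category.assoc, ← Preadditive.sum_comp, h]
    simp
  rw [e]
  refine Intertwines.sum _ fun j => (hp j).comp ((piv_box_intertwines _ _).comp ?_)
  exact mate_intertwines (P := P.dual) (R := (box _ _).dual)
    (mate_intertwines (P := box _ _) (R := P) (hi j))

theorem ev_eq (P : PreCenter C) : ev I P = tensorι I (dual P) P ≫
    I.toUnit (rightγ (dual P) P) (ε_ P.obj †P.obj) := by
  have e : ∀ i, coevLoop (I.X i) (prodγ (underγ †P.obj) P.γ) ≫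
      insertHom (I.X i) (ε_ P.obj †P.obj) = 𝟙 ((P.objᘁ : C) ⊗ P.obj) ⊗≫
        P.objᘁ ◁ η_ (I.X i) (I.X i)ᘁ ▷ P.obj ⊗≫
        (β_ (I.X i) P.objᘁ).inv ▷ ((I.X i)ᘁ ⊗ P.obj) ⊗≫
        (I.X i ⊗ P.objᘁ) ◁ P.γ (I.X i)ᘁ ⊗≫ I.X i ◁ ε_ P.obj P.objᘁ ▷ (I.X i)ᘁ ⊗≫ 𝟙 _ := by
    intro i
    rw [coevLoop, insertHom, prodγ]
    calc _ = 𝟙 (†P.obj ⊗ P.obj) ⊗≫ (𝟙 †P.obj ⊗≫ η_ (I.X i) †(I.X i) ▷ †P.obj ⊗≫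
          I.X i ◁ underγ †P.obj †(I.X i) ⊗≫ 𝟙 (I.X i ⊗ †P.obj ⊗ †(I.X i))) ▷ P.obj ⊗≫
          (I.X i ⊗ †P.obj) ◁ P.γ †(I.X i) ⊗≫ I.X i ◁ ε_ P.obj †P.obj ▷ †(I.X i) ⊗≫ 𝟙 _ := by
          monoidal
      _ = _ := by rw [coev_underγ]; monoidal
  have e2 : I.toUnit (prodγ (underγ †P.obj) P.γ) (ε_ P.obj †P.obj) =
      ∑ i, (I.sqrtDim i * I.sqrtGlobalDim⁻¹) • ((𝟙 ((P.objᘁ : C) ⊗ P.obj) ⊗≫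
        P.objᘁ ◁ η_ (I.X i) (I.X i)ᘁ ▷ P.obj ⊗≫
        (β_ (I.X i) P.objᘁ).inv ▷ ((I.X i)ᘁ ⊗ P.obj) ⊗≫
        (I.X i ⊗ P.objᘁ) ◁ P.γ (I.X i)ᘁ ⊗≫ I.X i ◁ ε_ P.obj P.objᘁ ▷ (I.X i)ᘁ ⊗≫ 𝟙 _) ≫
      I.unitι i) := by
    rw [SimpleData.toUnit]
    exact Finset.sum_congr rfl fun i _ => by rw [← e, Category.assoc]
  exact congrArg (fun f => tensorι I (dual P) P ≫ f) e2.symm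

theorem coev_eq (P : PreCenter C) : coev I P =
    I.fromUnit (leftγ P (dual P)) (η_ P.obj †P.obj) ≫ tensorπ I P (dual P) := by
  have e : ∀ i, insertCoHom (I.X i) (η_ P.obj †P.obj) ≫
      evLoop (I.X i) (prodγ P.γ (overγ †P.obj)) = 𝟙 _ ⊗≫ I.X i ◁ η_ P.obj P.objᘁ ▷ (I.X i)ᘁ ⊗≫
        P.γ (I.X i) ▷ (P.objᘁ ⊗ (I.X i)ᘁ) ⊗≫ (P.obj ⊗ I.X i) ◁ (β_ P.objᘁ (I.X i)ᘁ).hom ⊗≫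
        P.obj ◁ pivEv (I.X i) ▷ P.objᘁ ⊗≫ 𝟙 (P.obj ⊗ (P.objᘁ : C)) := by
    intro i
    rw [evLoop, insertCoHom, prodγ]
    calc _ = 𝟙 _ ⊗≫ I.X i ◁ η_ P.obj †P.obj ▷ †(I.X i) ⊗≫ P.γ (I.X i) ▷ (†P.obj ⊗ †(I.X i)) ⊗≫
          P.obj ◁ (𝟙 (I.X i ⊗ †P.obj ⊗ †(I.X i)) ⊗≫ overγ †P.obj (I.X i) ▷ †(I.X i) ⊗≫
          †P.obj ◁ pivEv (I.X i) ⊗≫ 𝟙 †P.obj) ⊗≫ 𝟙 (P.obj ⊗ †P.obj) := by monoidal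
      _ = _ := by rw [overγ_pivEv]; monoidal
  have e2 : I.fromUnit (prodγ P.γ (overγ †P.obj)) (η_ P.obj †P.obj) =
      ∑ i, (I.sqrtDim i * I.sqrtGlobalDim⁻¹) • (I.unitπ i ≫
        (𝟙 _ ⊗≫ I.X i ◁ η_ P.obj P.objᘁ ▷ (I.X i)ᘁ ⊗≫
        P.γ (I.X i) ▷ (P.objᘁ ⊗ (I.X i)ᘁ) ⊗≫ (P.obj ⊗ I.X i) ◁ (β_ P.objᘁ (I.X i)ᘁ).hom ⊗≫
        P.obj ◁ pivEv (I.X i) ▷ P.objᘁ ⊗≫ 𝟙 (P.obj ⊗ (P.objᘁ : C)))) := by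
    rw [SimpleData.fromUnit]
    exact Finset.sum_congr rfl fun i _ => by rw [← e]
  exact congrArg (fun f => f ≫ tensorπ I P (dual P)) e2.symm

theorem isHom_ev (hI : IsModular I) (hP : P.IsHalfBraiding) :
    IsHom (tensor I (dual P) P) (unit I) (ev I P) := by
  have hD := sqrtGlobalDim_ne_zero I hI
  have hP' := isHalfBraiding_dual I hI hP
  rw [ev_eq]
  exact Intertwines.comp (tensorι_right I hD hP' hP)
    (I.toUnit_intertwines ((isHB_under †P.obj).prod hP) _)

theorem isHom_coev (hI : IsModular I) (hP : P.IsHalfBraiding) :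
    IsHom (unit I) (tensor I P (dual P)) (coev I P) := by
  have hD := sqrtGlobalDim_ne_zero I hI
  have hP' := isHalfBraiding_dual I hI hP
  rw [coev_eq]
  exact Intertwines.comp (I.fromUnit_intertwines (IsHB.prod hP (isHB_over †P.obj)) _)
    (tensorπ_left I hD hP hP')

end PreCenter

theorem reducedWellDefined (hI : IsModular I) : ReducedWellDefined I where
  tensor _ _ hP hR := PreCenter.isHalfBraiding_tensor I (sqrtGlobalDim_ne_zero I hI) hP hR
  tensorHom _ g hP hP₁ hR hR₁ hf _ :=
    PreCenter.isHom_tensorHom I (sqrtGlobalDim_ne_zero I hI) hP hP₁ hR hR₁ g hf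
  unit := PreCenter.isHalfBraiding_unit I hI
  assoc _ _ _ hP hR hS := PreCenter.isHom_assoc I (sqrtGlobalDim_ne_zero I hI) hP hR hS
  leftUnitor _ hP := PreCenter.isHom_leftUnitor I hI hP
  rightUnitor _ hP := PreCenter.isHom_rightUnitor I hI hP
  dual _ hP := PreCenter.isHalfBraiding_dual I hI hP
  ev _ hP := PreCenter.isHom_ev I hI hP
  coev _ hP := PreCenter.isHom_coev I hI hP
  piv _ hP := PreCenter.isHom_piv I hI hP

end Boxes

section ReducedMonoidal


variable {𝕜 : Type w} [Field 𝕜] [IsAlgClosed 𝕜] {C : Type u} [Category.{v} C]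
  [Abelian C] [Linear 𝕜 C] [FiniteSemisimple 𝕜 C] [MonoidalCategory C] [MonoidalPreadditive C]
  [MonoidalLinear 𝕜 C] [Simple (𝟙_ C)] [BraidedCategory C] [RightRigidCategory C]
  [PivotalCategory C] [SphericalCategory C] (I : SimpleData 𝕜 C)

theorem RedCenter.isIso_of_isIso_f {X Y : RedCenter C} (f : X ⟶ Y) (h : IsIso f.f) : IsIso f :=
  have := h
  ⟨⟨⟨inv f.f, Intertwines.inv (f := asIso f.f) f.isHom⟩, RedCenter.hom_ext (IsIso.hom_inv_id f.f),
    RedCenter.hom_ext (IsIso.inv_hom_id f.f)⟩⟩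

theorem reducedData_isMonoidal (hI : IsModular I) (hw : ReducedWellDefined I) :
    (reducedData I hw).IsMonoidal := by
  have hD := sqrtGlobalDim_ne_zero I hI
  refine ⟨fun X Y => RedCenter.hom_ext ?_, fun {X₁ Y₁ Z₁ X₂ Y₂ Z₂} f₁ f₂ g₁ g₂ =>
    RedCenter.hom_ext ?_, fun X Y Z => RedCenter.isIso_of_isIso_f _ ?_,
    fun X => RedCenter.isIso_of_isIso_f _ ?_, fun X => RedCenter.isIso_of_isIso_f _ ?_,
    fun {X₁ X₂ X₃ Y₁ Y₂ Y₃} f₁ f₂ f₃ => RedCenter.hom_ext ?_, fun {X Y} f => RedCenter.hom_ext ?_,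
    fun {X Y} f => RedCenter.hom_ext ?_, fun W X Y Z => RedCenter.hom_ext ?_,
    fun X Y => RedCenter.hom_ext ?_⟩
  · change PreCenter.tensorHom I (𝟙 X.pre.obj) (𝟙 Y.pre.obj) = 𝟙 (PreCenter.tensor I X.pre Y.pre).obj
    rw [PreCenter.tensorHom_eq, id_tensorHom_id, Category.id_comp,
      PreCenter.tensorι_π I hD X.isHalfBraiding Y.isHalfBraiding]
  · change PreCenter.tensorHom I f₁.f f₂.f ≫ PreCenter.tensorHom I g₁.f g₂.f =
      PreCenter.tensorHom I (f₁.f ≫ g₁.f) (f₂.f ≫ g₂.f)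
    have e := PreCenter.tensorHom_ι I hD X₁.isHalfBraiding X₂.isHalfBraiding f₁.isHom f₂.isHom
    rw [PreCenter.tensorHom_eq I g₁.f, reassoc_of% e, PreCenter.tensorHom_eq]
    simp
  · exact PreCenter.isIso_assoc I hD X.isHalfBraiding Y.isHalfBraiding Z.isHalfBraiding
  · exact PreCenter.isIso_leftUnitor I hI X.isHalfBraiding
  · exact PreCenter.isIso_rightUnitor I hI X.isHalfBraiding
  · exact PreCenter.assoc_naturality I hI X₁.isHalfBraiding X₂.isHalfBraiding X₃.isHalfBraiding
      Y₁.isHalfBraiding Y₂.isHalfBraiding Y₃.isHalfBraiding f₁.isHom f₂.isHom f₃.isHom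
  · exact PreCenter.leftUnitor_naturality I hI X.isHalfBraiding Y.isHalfBraiding f.isHom
  · exact PreCenter.rightUnitor_naturality I hI X.isHalfBraiding Y.isHalfBraiding f.isHom
  · exact PreCenter.pentagon I hI W.isHalfBraiding X.isHalfBraiding Y.isHalfBraiding
      Z.isHalfBraiding
  · exact PreCenter.triangle I hI X.isHalfBraiding Y.isHalfBraiding

namespace PreCenter

variable {P : PreCenter C}

theorem unitPoint_coev (hP : P.IsHalfBraiding) :
    I.unitPoint ≫ coev I P = I.sqrtGlobalDim⁻¹ • (η_ P.obj †P.obj ≫ tensorπ I P (dual P)) := by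
  have e := I.unitPoint_fromUnit (IsHB.prod hP (isHB_over †P.obj)) (η_ P.obj †P.obj)
  rw [coev_eq]
  exact (Category.assoc _ _ _).symm.trans
    ((congrArg (fun f => f ≫ tensorπ I P (dual P)) e).trans (Linear.smul_comp _ _ _ _ _ _))

theorem ev_unitCounit (hP : P.IsHalfBraiding) :
    ev I P ≫ I.unitCounit = I.sqrtGlobalDim⁻¹ • (tensorι I (dual P) P ≫ ε_ P.obj †P.obj) := by
  have e := I.toUnit_unitCounit (IsHB.prod (isHB_under †P.obj) hP) (ε_ P.obj †P.obj)
  rw [ev_eq, Category.assoc]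
  exact (congrArg (fun f => tensorι I (dual P) P ≫ f) e).trans (Linear.comp_smul _ _ _ _ _ _)

theorem coev_proj (hD : I.sqrtGlobalDim ≠ 0) (hP : P.IsHalfBraiding) (hP' : P.dual.IsHalfBraiding) :
    η_ P.obj †P.obj ≫ proj I P (dual P) = η_ P.obj †P.obj :=
  comp_proj I hD hP hP' fun A => (coev_dualγ P A).symm

theorem proj_ev (hD : I.sqrtGlobalDim ≠ 0) (hP : P.IsHalfBraiding) (hP' : P.dual.IsHalfBraiding) :
    proj I (dual P) P ≫ ε_ P.obj †P.obj = ε_ P.obj †P.obj :=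
  proj_comp I hD hP' hP fun A => dualγ_ev P A

end PreCenter

end ReducedMonoidal

section ReducedRigid


variable {𝕜 : Type w} [Field 𝕜] [IsAlgClosed 𝕜] {C : Type u} [Category.{v} C]
  [Abelian C] [Linear 𝕜 C] [FiniteSemisimple 𝕜 C] [MonoidalCategory C] [MonoidalPreadditive C]
  [MonoidalLinear 𝕜 C] [Simple (𝟙_ C)] [BraidedCategory C] [RightRigidCategory C]
  [PivotalCategory C] [SphericalCategory C] (I : SimpleData 𝕜 C)

namespace PreCenter

/-- Duality data in the base that gives a duality for the reduced tensor product. -/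
structure ReducedPairing (P Q : PreCenter C) (η : 𝟙_ C ⟶ P.obj ⊗ Q.obj)
    (ε : Q.obj ⊗ P.obj ⟶ 𝟙_ C) (c : (unit I).obj ⟶ (tensor I P Q).obj)
    (e : (tensor I Q P).obj ⟶ (unit I).obj) : Prop where
  isHom_coev : IsHom (unit I) (tensor I P Q) c
  isHom_ev : IsHom (tensor I Q P) (unit I) e
  coev : I.unitPoint ≫ c = I.sqrtGlobalDim⁻¹ • (η ≫ tensorπ I P Q)
  ev : e ≫ I.unitCounit = I.sqrtGlobalDim⁻¹ • (tensorι I Q P ≫ ε)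
  coev_proj : η ≫ proj I P Q = η
  proj_ev : proj I Q P ≫ ε = ε
  coev_ev : Q.obj ◁ η ≫ (α_ Q.obj P.obj Q.obj).inv ≫ ε ▷ Q.obj =
    (ρ_ Q.obj).hom ≫ (λ_ Q.obj).inv
  ev_coev : η ▷ P.obj ≫ (α_ P.obj Q.obj P.obj).hom ≫ P.obj ◁ ε = (λ_ P.obj).hom ≫ (ρ_ P.obj).inv

variable {I} {P Q : PreCenter C} {η : 𝟙_ C ⟶ P.obj ⊗ Q.obj} {ε : Q.obj ⊗ P.obj ⟶ 𝟙_ C}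
  {c : (unit I).obj ⟶ (tensor I P Q).obj} {e : (tensor I Q P).obj ⟶ (unit I).obj}

theorem ReducedPairing.coev_ev_zigzag (h : ReducedPairing I P Q η ε c e) (hI : IsModular I)
    (hP : P.IsHalfBraiding) (hQ : Q.IsHalfBraiding)
    {a : (tensor I Q (tensor I P Q)).obj ⟶ (tensor I (tensor I Q P) Q).obj}
    (ha : a ≫ assoc I Q P Q = 𝟙 _) :
    tensorHom I (P := Q) (P₁ := Q) (R := unit I) (R₁ := tensor I P Q) (𝟙 Q.obj) c ≫ a ≫
      tensorHom I (P := tensor I Q P) (P₁ := unit I) (R := Q) (R₁ := Q) e (𝟙 Q.obj) ≫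
        leftUnitor I Q = rightUnitor I Q := by
  have hD := sqrtGlobalDim_ne_zero I hI
  have hU := isHalfBraiding_unit I hI
  have hPQ := isHalfBraiding_tensor I hD hP hQ
  have hQP := isHalfBraiding_tensor I hD hQ hP
  have haι : a ≫ tensorι I (tensor I Q P) Q ≫ tensorι I Q P ▷ Q.obj =
      tensorι I Q (tensor I P Q) ≫ Q.obj ◁ tensorι I P Q ≫ (α_ Q.obj P.obj Q.obj).inv := by
    have h0 := congrArg (fun f => a ≫ f ≫ (α_ Q.obj P.obj Q.obj).inv)
      (assoc_ι I hD hQ hP hQ)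
    simp only [Category.assoc, reassoc_of% ha, Iso.hom_inv_id, Category.comp_id] at h0
    exact h0.symm
  have e1 : leftUnitor I Q =
      I.sqrtGlobalDim • (tensorι I (unit I) Q ≫ I.unitCounit ▷ Q.obj ≫ (λ_ Q.obj).hom) :=
    leftUnitor_eq I hI hQ
  have e2 : tensorHom I (P := tensor I Q P) (P₁ := unit I) (R := Q) (R₁ := Q) e (𝟙 Q.obj) ≫
      leftUnitor I Q = tensorι I (tensor I Q P) Q ≫ tensorι I Q P ▷ Q.obj ≫ ε ▷ Q.obj ≫
        (λ_ Q.obj).hom := by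
    have := tensorHom_ι I hD hQP hQ h.isHom_ev (Intertwines.id Q.γ)
    rw [e1, Linear.comp_smul, reassoc_of% this, tensorHom_id,
      ← comp_whiskerRight_assoc, h.ev]
    rw [MonoidalLinear.smul_whiskerRight, Linear.smul_comp, Linear.comp_smul, smul_smul,
      mul_inv_cancel₀ hD, one_smul]
    simp
  have e3 : rightUnitorInv I Q ≫ tensorHom I (P := Q) (P₁ := Q) (R := unit I)
      (R₁ := tensor I P Q) (𝟙 Q.obj) c = (ρ_ Q.obj).inv ≫ Q.obj ◁ (η ≫ tensorπ I P Q) ≫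
        tensorπ I Q (tensor I P Q) := by
    have := tensorπ_tensorHom I hD hQ hPQ (Intertwines.id Q.γ) h.isHom_coev
    rw [rightUnitorInv, Linear.smul_comp, Category.assoc, Category.assoc, this, id_tensorHom,
      ← whiskerLeft_comp_assoc, h.coev]
    rw [MonoidalLinear.whiskerLeft_smul, Linear.smul_comp, Linear.comp_smul, smul_smul,
      mul_inv_cancel₀ hD, one_smul]
  have e4 : tensorπ I P Q ≫ tensorι I P Q = proj I P Q := tensorπ_ι I P Q
  have e5 := tensorπ_ι I Q (tensor I P Q)
  have e6 := proj_ι_right I hD hQ hP hQ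
  have := isIso_rightUnitor I hI hQ
  have e7 : IsIso (rightUnitorInv I Q) :=
    ⟨⟨rightUnitor I Q, rightUnitorInv_rightUnitor I hI hQ, rightUnitor_rightUnitorInv I hI hQ⟩⟩
  rw [← cancel_epi (rightUnitorInv I Q), e2, reassoc_of% e3, reassoc_of% haι, reassoc_of% e5,
    reassoc_of% e6, rightUnitorInv_rightUnitor I hI hQ, ← whiskerLeft_comp_assoc, Category.assoc, e4,
    h.coev_proj, Iso.hom_inv_id_assoc, ← comp_whiskerRight_assoc, h.proj_ev, reassoc_of% h.coev_ev]
  simp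

theorem ReducedPairing.ev_coev_zigzag (h : ReducedPairing I P Q η ε c e) (hI : IsModular I)
    (hP : P.IsHalfBraiding) (hQ : Q.IsHalfBraiding) :
    tensorHom I (P := unit I) (P₁ := tensor I P Q) (R := P) (R₁ := P) c (𝟙 P.obj) ≫
      assoc I P Q P ≫ tensorHom I (P := P) (P₁ := P) (R := tensor I Q P) (R₁ := unit I)
        (𝟙 P.obj) e ≫ rightUnitor I P = leftUnitor I P := by
  have hD := sqrtGlobalDim_ne_zero I hI
  have hU := isHalfBraiding_unit I hI
  have hPQ := isHalfBraiding_tensor I hD hP hQ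
  have hQP := isHalfBraiding_tensor I hD hQ hP
  have e1 : rightUnitor I P =
      I.sqrtGlobalDim • (tensorι I P (unit I) ≫ P.obj ◁ I.unitCounit ≫ (ρ_ P.obj).hom) :=
    rightUnitor_eq I hI hP
  have e2 : tensorHom I (P := P) (P₁ := P) (R := tensor I Q P) (R₁ := unit I) (𝟙 P.obj) e ≫
      rightUnitor I P = tensorι I P (tensor I Q P) ≫ P.obj ◁ tensorι I Q P ≫ P.obj ◁ ε ≫
        (ρ_ P.obj).hom := by
    have := tensorHom_ι I hD hP hQP (Intertwines.id P.γ) h.isHom_ev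
    rw [e1, Linear.comp_smul, reassoc_of% this, id_tensorHom, ← whiskerLeft_comp_assoc, h.ev]
    rw [MonoidalLinear.whiskerLeft_smul, Linear.smul_comp, Linear.comp_smul, smul_smul,
      mul_inv_cancel₀ hD, one_smul]
    simp
  have e3 : leftUnitorInv I P ≫ tensorHom I (P := unit I) (P₁ := tensor I P Q) (R := P)
      (R₁ := P) c (𝟙 P.obj) = (λ_ P.obj).inv ≫ (η ≫ tensorπ I P Q) ▷ P.obj ≫
        tensorπ I (tensor I P Q) P := by
    have := tensorπ_tensorHom I hD hPQ hP h.isHom_coev (Intertwines.id P.γ)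
    rw [leftUnitorInv, Linear.smul_comp, Category.assoc, Category.assoc, this, tensorHom_id,
      ← comp_whiskerRight_assoc, h.coev]
    rw [MonoidalLinear.smul_whiskerRight, Linear.smul_comp, Linear.comp_smul, smul_smul,
      mul_inv_cancel₀ hD, one_smul]
  have e4 : tensorπ I P Q ≫ tensorι I P Q = proj I P Q := tensorπ_ι I P Q
  have e5 := tensorπ_ι I (tensor I P Q) P
  have e6 := proj_ι_left I hD hP hQ hP
  have e8 := assoc_ι I hD hP hQ hP
  have e7 : IsIso (leftUnitorInv I P) :=
    ⟨⟨leftUnitor I P, leftUnitorInv_leftUnitor I hI hP, leftUnitor_leftUnitorInv I hI hP⟩⟩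
  rw [← cancel_epi (leftUnitorInv I P), e2, reassoc_of% e3, reassoc_of% e8, reassoc_of% e5,
    reassoc_of% e6, leftUnitorInv_leftUnitor I hI hP, ← comp_whiskerRight_assoc, Category.assoc, e4,
    h.coev_proj, Iso.inv_hom_id_assoc, ← whiskerLeft_comp_assoc, h.proj_ev, reassoc_of% h.ev_coev]
  simp

variable (I) in
theorem reducedPairing_dual (hI : IsModular I) (hP : P.IsHalfBraiding) :
    ReducedPairing I P (dual P) (η_ P.obj †P.obj) (ε_ P.obj †P.obj) (PreCenter.coev I P)
      (PreCenter.ev I P) where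
  isHom_coev := PreCenter.isHom_coev I hI hP
  isHom_ev := PreCenter.isHom_ev I hI hP
  coev := unitPoint_coev I hP
  ev := ev_unitCounit I hP
  coev_proj := PreCenter.coev_proj I (sqrtGlobalDim_ne_zero I hI) hP (isHalfBraiding_dual I hI hP)
  proj_ev := PreCenter.proj_ev I (sqrtGlobalDim_ne_zero I hI) hP (isHalfBraiding_dual I hI hP)
  coev_ev := ExactPairing.coevaluation_evaluation P.obj †P.obj
  ev_coev := ExactPairing.evaluation_coevaluation P.obj †P.obj

end PreCenter

theorem reducedData_isRigid (hI : IsModular I) (hw : ReducedWellDefined I)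
    (hm : (reducedData I hw).IsMonoidal) : (reducedData I hw).IsRigid hm := by
  let := hm.monoidalCategory
  constructor
  · intro X
    rw [← cancel_mono (λ_ ((reducedData I hw).dual X)).hom]
    simp only [Category.assoc, Iso.inv_hom_id, Category.comp_id]
    have ha : (α_ ((reducedData I hw).dual X) X ((reducedData I hw).dual X)).inv ≫
      (α_ ((reducedData I hw).dual X) X ((reducedData I hw).dual X)).hom = 𝟙 _ := Iso.inv_hom_id _
    exact RedCenter.hom_ext ((PreCenter.reducedPairing_dual I hI X.isHalfBraiding).coev_ev_zigzag hI
      X.isHalfBraiding (PreCenter.isHalfBraiding_dual I hI X.isHalfBraiding)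
      (congrArg RedCenter.Hom.f ha))
  · intro X
    rw [← cancel_mono (ρ_ X).hom]
    simp only [Category.assoc, Iso.inv_hom_id, Category.comp_id]
    exact RedCenter.hom_ext ((PreCenter.reducedPairing_dual I hI X.isHalfBraiding).ev_coev_zigzag hI
      X.isHalfBraiding (PreCenter.isHalfBraiding_dual I hI X.isHalfBraiding))

end ReducedRigid

section ReducedPivotal


variable {𝕜 : Type w} [Field 𝕜] [IsAlgClosed 𝕜] {C : Type u} [Category.{v} C]
  [Abelian C] [Linear 𝕜 C] [FiniteSemisimple 𝕜 C] [MonoidalCategory C] [MonoidalPreadditive C]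
  [MonoidalLinear 𝕜 C] [Simple (𝟙_ C)] [BraidedCategory C] [RightRigidCategory C]
  [PivotalCategory C] [SphericalCategory C] (I : SimpleData 𝕜 C)

namespace PreCenter

section Pairing

variable {I} {P Q R S T U V W : PreCenter C} {η : 𝟙_ C ⟶ P.obj ⊗ Q.obj}
  {ε : Q.obj ⊗ P.obj ⟶ 𝟙_ C} {c : (unit I).obj ⟶ (tensor I P Q).obj}
  {e : (tensor I Q P).obj ⟶ (unit I).obj}

theorem ReducedPairing.tensorHom_ev_unitCounit (h : ReducedPairing I P Q η ε c e)
    (hI : IsModular I) (hV : V.IsHalfBraiding) (hW : W.IsHalfBraiding) {f : V.obj ⟶ Q.obj}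
    {g : W.obj ⟶ P.obj} (hf : IsHom V Q f) (hg : IsHom W P g) :
    tensorHom I f g ≫ e ≫ I.unitCounit =
      I.sqrtGlobalDim⁻¹ • (tensorι I V W ≫ (f ⊗ₘ g) ≫ ε) := by
  have := tensorHom_ι I (sqrtGlobalDim_ne_zero I hI) hV hW hf hg
  rw [h.ev, Linear.comp_smul, reassoc_of% this]

theorem ReducedPairing.tensorHom_leftUnitor (h : ReducedPairing I P Q η ε c e) (hI : IsModular I)
    (hP : P.IsHalfBraiding) (hQ : Q.IsHalfBraiding) (hV : V.IsHalfBraiding) :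
    tensorHom I (P := tensor I Q P) (P₁ := unit I) (R := V) (R₁ := V) e (𝟙 V.obj) ≫
      leftUnitor I V = tensorι I (tensor I Q P) V ≫ tensorι I Q P ▷ V.obj ≫ ε ▷ V.obj ≫
        (λ_ V.obj).hom := by
  have hD := sqrtGlobalDim_ne_zero I hI
  have hQP := isHalfBraiding_tensor I hD hQ hP
  have := tensorHom_ι I hD hQP hV h.isHom_ev (Intertwines.id V.γ)
  rw [leftUnitor_eq I hI hV, Linear.comp_smul, reassoc_of% this, tensorHom_id,
    ← comp_whiskerRight_assoc, h.ev]
  rw [MonoidalLinear.smul_whiskerRight, Linear.smul_comp, Linear.comp_smul, smul_smul,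
    mul_inv_cancel₀ hD, one_smul]
  simp

/-- A morphism compatible with evaluations for the reduced tensor product is compatible with the
underlying evaluations. -/
theorem ReducedPairing.ev_of_reduced_ev (h : ReducedPairing I P Q η ε c e) (hI : IsModular I)
    (hP : P.IsHalfBraiding) (hQ : Q.IsHalfBraiding) (hR : R.IsHalfBraiding)
    (hS : S.IsHalfBraiding)
    {η' : 𝟙_ C ⟶ R.obj ⊗ S.obj} {ε' : S.obj ⊗ R.obj ⟶ 𝟙_ C}
    {c' : (unit I).obj ⟶ (tensor I R S).obj} {e' : (tensor I S R).obj ⟶ (unit I).obj}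
    (h' : ReducedPairing I R S η' ε' c' e')
    {η'' : 𝟙_ C ⟶ (tensor I P R).obj ⊗ U.obj} {ε'' : U.obj ⊗ (tensor I P R).obj ⟶ 𝟙_ C}
    {c'' : (unit I).obj ⟶ (tensor I (tensor I P R) U).obj}
    {e'' : (tensor I U (tensor I P R)).obj ⟶ (unit I).obj}
    (h'' : ReducedPairing I (tensor I P R) U η'' ε'' c'' e'')
    {a : (tensor I Q (tensor I P R)).obj ⟶ (tensor I (tensor I Q P) R).obj}
    (ha : a ≫ assoc I Q P R = 𝟙 _) {r : (tensor I S Q).obj ⟶ U.obj}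
    (ha' : IsHom (tensor I Q (tensor I P R)) (tensor I (tensor I Q P) R) a)
    (hr : IsHom (tensor I S Q) U r)
    (H : tensorHom I (P := tensor I S Q) (P₁ := U) (R := tensor I P R) (R₁ := tensor I P R) r
        (𝟙 (tensor I P R).obj) ≫ e'' =
      assoc I S Q (tensor I P R) ≫ tensorHom I (P := S) (P₁ := S) (R := tensor I Q (tensor I P R))
        (R₁ := R) (𝟙 S.obj) (a ≫ tensorHom I (P := tensor I Q P) (P₁ := unit I) (R := R) (R₁ := R) e
          (𝟙 R.obj) ≫ leftUnitor I R) ≫ e') :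
    r ▷ (tensor I P R).obj ≫ ε'' = (tensorι I S Q ⊗ₘ tensorι I P R) ≫
      (𝟙 _ ⊗≫ S.obj ◁ ε ▷ R.obj ⊗≫ ε') := by
  have hD := sqrtGlobalDim_ne_zero I hI
  have hPR := isHalfBraiding_tensor I hD hP hR
  have hSQ := isHalfBraiding_tensor I hD hS hQ
  have hQP := isHalfBraiding_tensor I hD hQ hP
  have hQPR := isHalfBraiding_tensor I hD hQ hPR
  have haι : a ≫ tensorι I (tensor I Q P) R ≫ tensorι I Q P ▷ R.obj =
      tensorι I Q (tensor I P R) ≫ Q.obj ◁ tensorι I P R ≫ (α_ Q.obj P.obj R.obj).inv := by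
    have h0 := congrArg (fun f => a ≫ f ≫ (α_ Q.obj P.obj R.obj).inv)
      (assoc_ι I hD hQ hP hR)
    simp only [Category.assoc, reassoc_of% ha, Iso.hom_inv_id, Category.comp_id] at h0
    exact h0.symm
  have hin : IsHom (tensor I Q (tensor I P R)) R (a ≫ tensorHom I (P := tensor I Q P)
      (P₁ := unit I) (R := R) (R₁ := R) e (𝟙 R.obj) ≫ leftUnitor I R) :=
    Intertwines.comp ha' (Intertwines.comp
      (isHom_tensorHom I hD hQP (isHalfBraiding_unit I hI) hR hR _ h.isHom_ev)
      (isHom_leftUnitor I hI hR))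
  have H' := congrArg (fun f => f ≫ I.unitCounit) H
  have e3 : (𝟙 S.obj ⊗ₘ (a ≫ tensorHom I (P := tensor I Q P) (P₁ := unit I) (R := R) (R₁ := R) e
          (𝟙 R.obj) ≫ leftUnitor I R)) = S.obj ◁ tensorι I Q (tensor I P R) ≫ S.obj ◁
      (Q.obj ◁ tensorι I P R ≫ (α_ Q.obj P.obj R.obj).inv ≫ ε ▷ R.obj ≫ (λ_ R.obj).hom) := by
    rw [h.tensorHom_leftUnitor hI hP hQ hR, reassoc_of% haι, id_tensorHom,
      MonoidalCategory.whiskerLeft_comp]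
  have e4 := assoc_ι I hD hS hQ hPR
  simp only [Category.assoc] at H'
  have hid : IsHom (tensor I P R) (tensor I P R) (𝟙 (tensor I P R).obj) := Intertwines.id _
  have hidS : IsHom S S (𝟙 S.obj) := Intertwines.id _
  rw [h''.tensorHom_ev_unitCounit hI hSQ hPR hr hid,
    h'.tensorHom_ev_unitCounit hI hS hQPR hidS hin, Linear.comp_smul, e3] at H'
  have H2 := smul_right_injective _ (inv_ne_zero hD) H'
  simp only [Category.assoc] at H2
  rw [reassoc_of% e4, tensorHom_id] at H2
  have e5 := proj_ι_left I hD hS hQ hPR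
  have e6 := proj_ι_right I hD hQ hP hR
  have e7 := h''.proj_ev
  have e8 := tensorHom_proj I hr hid
  rw [tensorHom_id] at e8
  have H3 := congrArg (fun f => tensorπ I (tensor I S Q) (tensor I P R) ≫ f) H2
  have e9 := tensorπ_ι I (tensor I S Q) (tensor I P R)
  rw [reassoc_of% e9, reassoc_of% e9, ← reassoc_of% e8, e7, reassoc_of% e5,
    Iso.inv_hom_id_assoc, ← whiskerLeft_comp_assoc, ← Category.assoc (proj I Q (tensor I P R)), e6] at H3
  simp only [Category.assoc, Iso.hom_inv_id_assoc] at H3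
  rw [← comp_whiskerRight_assoc (proj I Q P), h.proj_ev] at H3
  rw [H3, MonoidalCategory.tensorHom_def]
  monoidal

end Pairing

end PreCenter

end ReducedPivotal


section RigidGeneric

variable {D : Type u} [Category.{v} D] [MonoidalCategory D] [RightRigidCategory D]

theorem rightDualTensorIso_inv_ev_assoc (X Y : D) :
    (rightDualTensorIso X Y).inv ▷ (X ⊗ Y) ≫ ε_ (X ⊗ Y) (X ⊗ Y)ᘁ =
      (α_ †Y †X (X ⊗ Y)).hom ≫ †Y ◁ ((α_ †X X Y).inv ≫ ε_ X †X ▷ Y ≫ (λ_ Y).hom) ≫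
        ε_ Y †Y := by
  rw [rightDualTensorIso_inv_ev]
  monoidal

theorem eq_comp_rightDualTensorIso_inv {X Y T T' : D} {ι : T ⟶ X ⊗ Y} {ι' : T' ⟶ †Y ⊗ †X}
    {r : T' ⟶ †T}
    (h : r ▷ T ≫ ε_ T †T = (ι' ⊗ₘ ι) ≫ (𝟙 _ ⊗≫ †Y ◁ ε_ X †X ▷ Y ⊗≫ ε_ Y †Y)) :
    r = ι' ≫ (rightDualTensorIso X Y).inv ≫ rightAdjointMate ι := by
  apply dual_hom_ext
  rw [h, ← rightDualTensorIso_inv_ev, comp_whiskerRight, comp_whiskerRight, Category.assoc,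
    Category.assoc, rightAdjointMate_comp_evaluation, ← whisker_exchange_assoc,
    ← whisker_exchange_assoc, MonoidalCategory.tensorHom_def', Category.assoc]

theorem piv_eq_of_retract [PivotalCategory D] {X Y T T' T'' : D} {ι : T ⟶ X ⊗ Y}
    {ι' : T' ⟶ †Y ⊗ †X} {ι'' : T'' ⟶ †(†X) ⊗ †(†Y)} {r : T' ⟶ †T} {rh : †T ⟶ T'}
    {r' : T'' ⟶ †T'} {τ : T ⟶ T''}
    (hr : r = ι' ≫ (rightDualTensorIso X Y).inv ≫ rightAdjointMate ι)
    (hr' : r' = ι'' ≫ (rightDualTensorIso †Y †X).inv ≫ rightAdjointMate ι')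
    (hτ : τ ≫ ι'' = ι ≫ ((PivotalCategory.piv X).hom ⊗ₘ (PivotalCategory.piv Y).hom))
    (h : rh ≫ r = 𝟙 _) :
    (PivotalCategory.piv T).hom = τ ≫ r' ≫ rightAdjointMate rh := by
  have h1 : rightAdjointMate r ≫ rightAdjointMate rh = 𝟙 _ := by
    rw [← comp_rightAdjointMate, h, rightAdjointMate_id]
  have h2 : rightAdjointMate (rightDualTensorIso X Y).hom ≫
      rightAdjointMate (rightDualTensorIso X Y).inv = 𝟙 _ := by
    rw [← comp_rightAdjointMate, Iso.inv_hom_id, rightAdjointMate_id]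
  have h3 := PivotalCategory.piv_naturality ι
  rw [PivotalCategory.piv_tensor, doubleDualTensor] at h3
  calc _ = (PivotalCategory.piv T).hom ≫ rightAdjointMate r ≫ rightAdjointMate rh := by
        rw [h1, Category.comp_id]
    _ = ((PivotalCategory.piv T).hom ≫ rightAdjointMate (rightAdjointMate ι)) ≫
        rightAdjointMate (rightDualTensorIso X Y).inv ≫ rightAdjointMate ι' ≫
          rightAdjointMate rh := by
        rw [hr, comp_rightAdjointMate, comp_rightAdjointMate]
        simp only [Category.assoc]
    _ = (ι ≫ ((PivotalCategory.piv X).hom ⊗ₘ (PivotalCategory.piv Y).hom)) ≫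
        (rightDualTensorIso †Y †X).inv ≫ rightAdjointMate ι' ≫ rightAdjointMate rh := by
        rw [← h3]
        simp only [Category.assoc]
        rw [reassoc_of% h2]
    _ = _ := by
        rw [← hτ, hr']
        simp only [Category.assoc]

end RigidGeneric

section ReducedPivotal


variable {𝕜 : Type w} [Field 𝕜] [IsAlgClosed 𝕜] {C : Type u} [Category.{v} C]
  [Abelian C] [Linear 𝕜 C] [FiniteSemisimple 𝕜 C] [MonoidalCategory C] [MonoidalPreadditive C]
  [MonoidalLinear 𝕜 C] [Simple (𝟙_ C)] [BraidedCategory C] [RightRigidCategory C]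
  [PivotalCategory C] [SphericalCategory C] (I : SimpleData 𝕜 C)

theorem reducedData_mate_f (hI : IsModular I) (hw : ReducedWellDefined I)
    (hm : (reducedData I hw).IsMonoidal) (hr : (reducedData I hw).IsRigid hm) {X Y : RedCenter C}
    (f : X ⟶ Y) :
    letI := hm.monoidalCategory
    letI := hr.rightRigidCategory
    (rightAdjointMate f).f = rightAdjointMate f.f := by
  let := hm.monoidalCategory
  let := hr.rightRigidCategory
  let g : (Yᘁ : RedCenter C) ⟶ Xᘁ :=
    ⟨rightAdjointMate f.f, PreCenter.mate_intertwines f.isHom⟩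
  suffices h : rightAdjointMate f = g from congrArg RedCenter.Hom.f h
  apply dual_hom_ext
  rw [rightAdjointMate_comp_evaluation]
  have hX := X.isHalfBraiding
  have hY := Y.isHalfBraiding
  have hX' := PreCenter.isHalfBraiding_dual I hI hX
  have hY' := PreCenter.isHalfBraiding_dual I hI hY
  have hidX : PreCenter.IsHom X.pre X.pre (𝟙 X.pre.obj) := Intertwines.id _
  have hidY : PreCenter.IsHom Y.pre.dual Y.pre.dual (𝟙 Y.pre.dual.obj) := Intertwines.id _
  have hT := hw.tensor _ _ hY' hX
  have e1 := (PreCenter.reducedPairing_dual I hI hX).tensorHom_ev_unitCounit hI hY' hX g.isHom hidX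
  have e2 := (PreCenter.reducedPairing_dual I hI hY).tensorHom_ev_unitCounit hI hY' hX hidY f.isHom
  have e3 : (rightAdjointMate f.f ⊗ₘ 𝟙 X.pre.obj) ≫ ε_ X.pre.obj †X.pre.obj =
      (𝟙 †Y.pre.obj ⊗ₘ f.f) ≫ ε_ Y.pre.obj †Y.pre.obj := by
    rw [tensorHom_id, id_tensorHom, rightAdjointMate_comp_evaluation]
  refine RedCenter.hom_ext (I.eq_of_unitCounit (RedCenter.Hom.isHom _) (RedCenter.Hom.isHom _) ?_)
  refine (Category.assoc _ _ _).trans (e2.trans (Eq.trans ?_ (e1.symm.trans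
    (Category.assoc _ _ _).symm)))
  exact congrArg (fun f => I.sqrtGlobalDim⁻¹ • (PreCenter.tensorι I Y.pre.dual X.pre ≫ f)) e3.symm

theorem reducedData_rightDualTensorIso_inv_f (hI : IsModular I) (hw : ReducedWellDefined I)
    (hm : (reducedData I hw).IsMonoidal) (hr : (reducedData I hw).IsRigid hm)
    (X Y : RedCenter C) :
    letI := hm.monoidalCategory
    letI := hr.rightRigidCategory
    (rightDualTensorIso X Y).inv.f = PreCenter.tensorι I Y.pre.dual X.pre.dual ≫
      (rightDualTensorIso X.pre.obj Y.pre.obj).inv ≫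
        rightAdjointMate (PreCenter.tensorι I X.pre Y.pre) := by
  let := hm.monoidalCategory
  let := hr.rightRigidCategory
  have hX := X.isHalfBraiding
  have hY := Y.isHalfBraiding
  have hX' := PreCenter.isHalfBraiding_dual I hI hX
  have hY' := PreCenter.isHalfBraiding_dual I hI hY
  have ha : (α_ (Xᘁ : RedCenter C) X Y).inv ≫ (α_ (Xᘁ : RedCenter C) X Y).hom = 𝟙 _ :=
    Iso.inv_hom_id _
  apply eq_comp_rightDualTensorIso_inv
  exact (PreCenter.reducedPairing_dual I hI hX).ev_of_reduced_ev hI hX hX' hY hY'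
    (PreCenter.reducedPairing_dual I hI hY)
    (PreCenter.reducedPairing_dual I hI (X ⊗ Y : RedCenter C).isHalfBraiding)
    (congrArg RedCenter.Hom.f ha) (α_ (Xᘁ : RedCenter C) X Y).inv.isHom
    (rightDualTensorIso X Y).inv.isHom
    (congrArg RedCenter.Hom.f (rightDualTensorIso_inv_ev_assoc X Y))

theorem reducedData_isPivotal (hI : IsModular I) (hw : ReducedWellDefined I)
    (hm : (reducedData I hw).IsMonoidal) (hr : (reducedData I hw).IsRigid hm) :
    (reducedData I hw).IsPivotal hr := by
  let := hm.monoidalCategory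
  let := hr.rightRigidCategory
  refine ⟨fun X => RedCenter.isIso_of_isIso_f _ ?_, fun {X Y} f => RedCenter.hom_ext ?_,
    fun X Y => RedCenter.hom_ext ?_⟩
  · exact (PivotalCategory.piv X.pre.obj).isIso_hom
  · have e := reducedData_mate_f I hI hw hm hr (rightAdjointMate f)
    rw [reducedData_mate_f I hI hw hm hr f] at e
    exact (PivotalCategory.piv_naturality f.f).trans
      (congrArg (fun g => (PivotalCategory.piv X.pre.obj).hom ≫ g) e.symm)
  · have e1 := reducedData_rightDualTensorIso_inv_f I hI hw hm hr X Y
    have e2 := reducedData_rightDualTensorIso_inv_f I hI hw hm hr Yᘁ Xᘁ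
    have e3 := reducedData_mate_f I hI hw hm hr (rightDualTensorIso X Y).hom
    have h : (rightDualTensorIso X Y).hom ≫ (rightDualTensorIso X Y).inv = 𝟙 _ :=
      Iso.hom_inv_id _
    have hX := X.isHalfBraiding
    have hY := Y.isHalfBraiding
    refine (piv_eq_of_retract (τ := PreCenter.tensorHom I (P := X.pre) (P₁ := X.pre.dual.dual)
      (R := Y.pre) (R₁ := Y.pre.dual.dual) (PivotalCategory.piv X.pre.obj).hom
      (PivotalCategory.piv Y.pre.obj).hom) e1 e2 ?_ (congrArg RedCenter.Hom.f h)).trans ?_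
    · exact PreCenter.tensorHom_ι I (sqrtGlobalDim_ne_zero I hI) hX hY
        (PreCenter.isHom_piv I hI hX) (PreCenter.isHom_piv I hI hY)
    · exact congrArg (fun g => PreCenter.tensorHom I (P := X.pre) (P₁ := X.pre.dual.dual)
        (R := Y.pre) (R₁ := Y.pre.dual.dual) (PivotalCategory.piv X.pre.obj).hom
        (PivotalCategory.piv Y.pre.obj).hom ≫ (rightDualTensorIso (Yᘁ : RedCenter C) Xᘁ).inv.f ≫ g)
        e3.symm

theorem reducedData_isPivotalCategory (hI : IsModular I) (hw : ReducedWellDefined I) :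
    (reducedData I hw).IsPivotalCategory :=
  ⟨reducedData_isMonoidal I hI hw, reducedData_isRigid I hI hw _,
    reducedData_isPivotal I hI hw _ _⟩

end ReducedPivotal

section FunctorK


variable {𝕜 : Type w} [Field 𝕜] [IsAlgClosed 𝕜] {C : Type u} [Category.{v} C]
  [Abelian C] [Linear 𝕜 C] [FiniteSemisimple 𝕜 C] [MonoidalCategory C] [MonoidalPreadditive C]
  [MonoidalLinear 𝕜 C] [Simple (𝟙_ C)] [BraidedCategory C] [RightRigidCategory C]
  [PivotalCategory C] [SphericalCategory C] (I : SimpleData 𝕜 C)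

theorem eq_zero_of_whiskerLeft {X : C} (hX : dim 𝕜 X ≠ 0) {Y Y₁ : C} {g : Y ⟶ Y₁}
    (h : X ◁ g = 0) : g = 0 := by
  have h1 : leftTrace (𝟙 X) = dim 𝕜 X • 𝟙 (𝟙_ C) := by
    rw [SphericalCategory.trace_eq, dim_smul_id]
  have h2 : dim 𝕜 X • g = 𝟙 Y ⊗≫ pivCoev X ▷ Y ⊗≫ †X ◁ (X ◁ g) ⊗≫ ε_ X †X ▷ Y₁ ⊗≫ 𝟙 Y₁ := by
    symm
    calc _ = 𝟙 Y ⊗≫ pivCoev X ▷ Y ⊗≫ ((†X ⊗ X) ◁ g ≫ ε_ X †X ▷ Y₁) ⊗≫ 𝟙 Y₁ := by monoidal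
      _ = 𝟙 Y ⊗≫ (pivCoev X ≫ †X ◁ 𝟙 X ≫ ε_ X †X) ▷ Y ⊗≫ g := by
          rw [whisker_exchange, MonoidalCategory.whiskerLeft_id, Category.id_comp]; monoidal
      _ = _ := by
          change 𝟙 Y ⊗≫ leftTrace (𝟙 X) ▷ Y ⊗≫ g = _
          rw [h1, MonoidalLinear.smul_whiskerRight, smul_coherence_comp, coherence_comp_smul]
          simp [monoidalComp]
  have h3 : †X ◁ (0 : X ⊗ Y ⟶ X ⊗ Y₁) = 0 := by simp
  rw [h, h3] at h2
  have h4 : dim 𝕜 X • g = 0 := by rw [h2]; simp [monoidalComp]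
  exact (smul_eq_zero.1 h4).resolve_left hX

theorem RedCenter.sum_f {α : Type*} (s : Finset α) {X Y : RedCenter C} (f : α → (X ⟶ Y)) :
    (∑ a ∈ s, f a).f = ∑ a ∈ s, (f a).f :=
  map_sum (RedCenter.homToBase X Y) f s

include I in
theorem boxHom_injective (W W₁ Y Y₁ : C) : Function.Injective (boxHom 𝕜 W W₁ Y Y₁) := by
  rw [injective_iff_map_eq_zero]
  intro t ht
  obtain ⟨c, rfl⟩ := TensorProduct.eq_repr_basis_right (Module.finBasis 𝕜 (Y ⟶ Y₁)) t
  set b := Module.finBasis 𝕜 (Y ⟶ Y₁)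
  rw [Finsupp.sum_fintype _ _ (by simp)] at ht ⊢
  have h0 : ∑ n, (c n ⊗ₘ b n) = 0 := by
    have := congrArg RedCenter.Hom.f ht
    rw [map_sum, RedCenter.sum_f] at this
    exact this
  refine Finset.sum_eq_zero fun n _ => ?_
  suffices h : c n = 0 by rw [h, TensorProduct.zero_tmul]
  refine I.hom_ext fun k h => ?_
  rw [comp_zero, ← Module.forall_dual_apply_eq_zero_iff 𝕜]
  intro φ
  obtain ⟨g, hg⟩ := exists_dual_morphism 𝕜 (I.X k) W₁ φ
  have h1 : I.X k ◁ ∑ n, φ (h ≫ c n) • b n = 0 := by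
    have h2 := congrArg (fun F => h ▷ Y ≫ F ≫ g ▷ Y₁) h0
    simp only [Preadditive.sum_comp, Preadditive.comp_sum, zero_comp, comp_zero] at h2
    rw [whiskerLeft_sum, ← h2]
    refine Finset.sum_congr rfl fun n _ => ?_
    rw [MonoidalCategory.tensorHom_def, Category.assoc, whisker_exchange, ← comp_whiskerRight_assoc,
      ← comp_whiskerRight_assoc, hg, MonoidalLinear.smul_whiskerRight,
      MonoidalLinear.whiskerLeft_smul]
    simp
  have h2 := eq_zero_of_whiskerLeft (dim_ne_zero (𝕜 := 𝕜) (I.X k)) h1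
  exact Fintype.linearIndependent_iff.1 b.linearIndependent _ h2 n

theorem boxHom_surjective (hI : IsModular I) (W W₁ Y Y₁ : C) :
    Function.Surjective (boxHom 𝕜 W W₁ Y Y₁) := by
  intro F
  obtain ⟨n, f, g, e⟩ := exists_eq_sum_tensorHom I hI (W := W) (Y := Y) (W₁ := W₁) (Y₁ := Y₁) F.isHom
  refine ⟨∑ m, f m ⊗ₜ[𝕜] g m, RedCenter.hom_ext ?_⟩
  rw [map_sum, RedCenter.sum_f]
  exact e.symm

/-- The inclusion of a summand of `K(M)`. -/
def inclK (M : Deligne 𝕜 C) (i : M.ι) : boxFunctor.obj (M.X i) ⟶ functorK.obj M :=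
  biproduct.ι (fun i => boxFunctor.obj (M.X i)) i

/-- The projection to a summand of `K(M)`. -/
def projK (M : Deligne 𝕜 C) (i : M.ι) : functorK.obj M ⟶ boxFunctor.obj (M.X i) :=
  biproduct.π (fun i => boxFunctor.obj (M.X i)) i

theorem inclK_projK_self (M : Deligne 𝕜 C) (i : M.ι) : inclK M i ≫ projK M i = 𝟙 _ :=
  biproduct.ι_π_self _ _

theorem inclK_projK_ne (M : Deligne 𝕜 C) {i j : M.ι} (h : i ≠ j) : inclK M i ≫ projK M j = 0 :=
  biproduct.ι_π_ne _ h

theorem sum_projK_inclK (M : Deligne 𝕜 C) : ∑ i, projK M i ≫ inclK M i = 𝟙 (functorK.obj M) :=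
  biproduct.total

theorem inclK_map (M N : Deligne 𝕜 C) (f : M ⟶ N) (i : M.ι) :
    inclK M i ≫ functorK.map f = ∑ j, boxFunctor.map (f i j) ≫ inclK N j := by
  refine (biproduct.ι_matrix _ _).trans ?_
  rw [biproduct.lift_eq]
  rfl

theorem inclK_map_projK (M N : Deligne 𝕜 C) (f : M ⟶ N) (i : M.ι) (j : N.ι) :
    inclK M i ≫ functorK.map f ≫ projK N j = boxFunctor.map (f i j) := by
  refine (biproduct.ι_matrix_assoc _ _ _).trans ?_
  exact biproduct.lift_π _ _

theorem hom_ext_inclK {M : Deligne 𝕜 C} {P : RedCenter C} {f g : functorK.obj M ⟶ P}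
    (h : ∀ i, inclK M i ≫ f = inclK M i ≫ g) : f = g :=
  biproduct.hom_ext' _ _ h

theorem hom_ext_projK {M : Deligne 𝕜 C} {P : RedCenter C} {f g : P ⟶ functorK.obj M}
    (h : ∀ i, f ≫ projK M i = g ≫ projK M i) : f = g :=
  biproduct.hom_ext _ _ h

theorem functorK_faithful (I : SimpleData 𝕜 C) : (functorK (𝕜 := 𝕜) (C := C)).Faithful where
  map_injective {M N f g} h := by
    funext i j
    apply boxHom_injective I
    exact (inclK_map_projK M N f i j).symm.trans (h ▸ inclK_map_projK M N g i j)

theorem functorK_full (hI : IsModular I) : (functorK (𝕜 := 𝕜) (C := C)).Full where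
  map_surjective {M N} F := by
    choose f hf using fun i j => boxHom_surjective I hI (M.X i).fst (N.X j).fst (M.X i).snd
      (N.X j).snd (inclK M i ≫ F ≫ projK N j)
    refine ⟨f, hom_ext_inclK fun i => hom_ext_projK fun j => ?_⟩
    exact (Category.assoc _ _ _).trans ((inclK_map_projK M N f i j).trans
      ((hf i j).trans (Category.assoc _ _ _).symm))

/-- A decomposition of an object of the center as a direct sum of boxes. -/
def functorKObjIso (M : Deligne 𝕜 C) (P : RedCenter C) (i : ∀ j, boxFunctor.obj (M.X j) ⟶ P)
    (p : ∀ j, P ⟶ boxFunctor.obj (M.X j)) (h1 : ∑ j, p j ≫ i j = 𝟙 P)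
    (h2 : ∀ j, i j ≫ p j = 𝟙 _) (h3 : ∀ j k, j ≠ k → i j ≫ p k = 0) : functorK.obj M ≅ P where
  hom := ∑ j, projK M j ≫ i j
  inv := ∑ j, p j ≫ inclK M j
  hom_inv_id := by
    classical
    rw [Preadditive.sum_comp, ← sum_projK_inclK]
    refine Finset.sum_congr rfl fun j _ => ?_
    rw [Preadditive.comp_sum, Finset.sum_eq_single j]
    · rw [Category.assoc, reassoc_of% h2 j]
    · intro k _ hk
      rw [Category.assoc, reassoc_of% h3 j k hk.symm, zero_comp, comp_zero]
    · simp
  inv_hom_id := by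
    classical
    rw [Preadditive.sum_comp, ← h1]
    refine Finset.sum_congr rfl fun j _ => ?_
    rw [Preadditive.comp_sum, Finset.sum_eq_single j]
    · rw [Category.assoc, reassoc_of% inclK_projK_self]
    · intro k _ hk
      rw [Category.assoc, reassoc_of% (inclK_projK_ne M hk.symm), zero_comp, comp_zero]
    · simp

theorem functorK_essSurj (hI : IsModular I) : (functorK (𝕜 := 𝕜) (C := C)).EssSurj where
  mem_essImage P := by
    obtain ⟨V, i, p, hi, hp, h1, h2, h3⟩ := PreCenter.exists_boxes I hI P.isHalfBraiding
    let M : Deligne 𝕜 C := ⟨I.ι, fun j => ⟨I.X j, V j⟩⟩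
    refine ⟨M, ⟨functorKObjIso M P (fun j => ⟨i j, hi j⟩) (fun j => ⟨p j, hp j⟩)
      (RedCenter.hom_ext ?_) (fun j => RedCenter.hom_ext (h2 j))
      (fun j k hjk => RedCenter.hom_ext (h3 j k hjk))⟩⟩
    exact (RedCenter.sum_f _ _).trans h1

theorem functorK_isEquivalence (hI : IsModular I) :
    (functorK (𝕜 := 𝕜) (C := C)).IsEquivalence where
  faithful := functorK_faithful I
  full := functorK_full I hI
  essSurj := functorK_essSurj I hI

end FunctorK

section Transport

variable {D : Type*} [Category* D] {E : Type*} [Category* E] [MonoidalCategory E]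

/-- A comparison of raw monoidal data with a monoidal category along a functor. -/
structure MonoidalComparison (T : PivotalData D) (F : D ⥤ E) where
  μ : ∀ X Y, F.obj X ⊗ F.obj Y ≅ F.obj (T.tensorObj X Y)
  υ : F.obj T.unit ≅ 𝟙_ E
  tensorHom : ∀ {X X₁ Y Y₁ : D} (f : X ⟶ X₁) (g : Y ⟶ Y₁),
    (F.map f ⊗ₘ F.map g) ≫ (μ X₁ Y₁).hom = (μ X Y).hom ≫ F.map (T.tensorHom f g)
  assoc : ∀ X Y Z, (μ X Y).hom ▷ F.obj Z ≫ (μ (T.tensorObj X Y) Z).hom ≫ F.map (T.assoc X Y Z) =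
    (α_ _ _ _).hom ≫ F.obj X ◁ (μ Y Z).hom ≫ (μ X (T.tensorObj Y Z)).hom
  leftUnitor : ∀ X, (μ T.unit X).hom ≫ F.map (T.leftUnitor X) = υ.hom ▷ F.obj X ≫ (λ_ _).hom
  rightUnitor : ∀ X, (μ X T.unit).hom ≫ F.map (T.rightUnitor X) = F.obj X ◁ υ.hom ≫ (ρ_ _).hom

namespace MonoidalComparison

variable {T : PivotalData D} {F : D ⥤ E} (φ : MonoidalComparison T F)

include φ

section IsIso

variable [F.ReflectsIsomorphisms]

theorem isIso_assoc (X Y Z : D) : IsIso (T.assoc X Y Z) := by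
  have h : F.map (T.assoc X Y Z) = (φ.μ (T.tensorObj X Y) Z).inv ≫ (φ.μ X Y).inv ▷ F.obj Z ≫
      (α_ _ _ _).hom ≫ F.obj X ◁ (φ.μ Y Z).hom ≫ (φ.μ X (T.tensorObj Y Z)).hom := by
    rw [← φ.assoc]
    simp
  have : IsIso (F.map (T.assoc X Y Z)) := by rw [h]; infer_instance
  exact isIso_of_reflects_iso _ F

theorem isIso_leftUnitor (X : D) : IsIso (T.leftUnitor X) := by
  have h : F.map (T.leftUnitor X) = (φ.μ T.unit X).inv ≫ φ.υ.hom ▷ F.obj X ≫ (λ_ _).hom := by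
    rw [← φ.leftUnitor]
    simp
  have : IsIso (F.map (T.leftUnitor X)) := by rw [h]; infer_instance
  exact isIso_of_reflects_iso _ F

theorem isIso_rightUnitor (X : D) : IsIso (T.rightUnitor X) := by
  have h : F.map (T.rightUnitor X) = (φ.μ X T.unit).inv ≫ F.obj X ◁ φ.υ.hom ≫ (ρ_ _).hom := by
    rw [← φ.rightUnitor]
    simp
  have : IsIso (F.map (T.rightUnitor X)) := by rw [h]; infer_instance
  exact isIso_of_reflects_iso _ F

end IsIso

theorem isMonoidal [F.Faithful] [F.ReflectsIsomorphisms] : T.IsMonoidal := by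
  let S : MonoidalCategoryStruct D :=
    { tensorObj := T.tensorObj
      tensorHom f g := T.tensorHom f g
      whiskerLeft X _ _ f := T.tensorHom (𝟙 X) f
      whiskerRight f Y := T.tensorHom f (𝟙 Y)
      tensorUnit := T.unit
      associator X Y Z := @asIso _ _ _ _ (T.assoc X Y Z) (φ.isIso_assoc X Y Z)
      leftUnitor X := @asIso _ _ _ _ (T.leftUnitor X) (φ.isIso_leftUnitor X)
      rightUnitor X := @asIso _ _ _ _ (T.rightUnitor X) (φ.isIso_rightUnitor X) }
  have hT : ∀ {X X₁ Y Y₁ : D} (f : X ⟶ X₁) (g : Y ⟶ Y₁), F.map (T.tensorHom f g) =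
      (φ.μ X Y).inv ≫ (F.map f ⊗ₘ F.map g) ≫ (φ.μ X₁ Y₁).hom := by
    intro X X₁ Y Y₁ f g
    rw [φ.tensorHom, Iso.inv_hom_id_assoc]
  have data : Monoidal.InducingFunctorData F :=
    { μIso := φ.μ
      εIso := φ.υ.symm
      whiskerLeft_eq X _ _ f := by
        have := hT (𝟙 X) f
        rw [F.map_id, id_tensorHom] at this
        exact this
      whiskerRight_eq f Y := by
        have := hT f (𝟙 Y)
        rw [F.map_id, tensorHom_id] at this
        exact this
      tensorHom_eq f g := hT f g
      associator_eq X Y Z := by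
        refine ((Iso.eq_inv_comp _).2 ((Iso.eq_inv_comp (whiskerRightIso (φ.μ X Y) _)).2
          (φ.assoc X Y Z))).trans ?_
        simp
        rfl
      leftUnitor_eq X := by
        refine ((Iso.eq_inv_comp _).2 (φ.leftUnitor X)).trans ?_
        simp
        rfl
      rightUnitor_eq X := by
        refine ((Iso.eq_inv_comp _).2 (φ.rightUnitor X)).trans ?_
        simp
        rfl }
  let m := Monoidal.induced F data
  exact
    { tensorHom_id := m.id_tensorHom_id
      tensorHom_comp := m.tensorHom_comp_tensorHom
      assoc_isIso := φ.isIso_assoc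
      leftUnitor_isIso := φ.isIso_leftUnitor
      rightUnitor_isIso := φ.isIso_rightUnitor
      assoc_naturality := m.associator_naturality
      leftUnitor_naturality := m.leftUnitor_naturality
      rightUnitor_naturality := m.rightUnitor_naturality
      pentagon := m.pentagon
      triangle := m.triangle }

/-- The monoidal structure of the functor. -/
@[reducible]
def monoidal (hm : T.IsMonoidal) :
    letI := hm.monoidalCategory
    F.Monoidal :=
  letI := hm.monoidalCategory
  Functor.CoreMonoidal.toMonoidal
    { εIso := φ.υ.symm
      μIso := φ.μ
      μIso_hom_natural_left f Y := by
        have := φ.tensorHom f (𝟙 Y)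
        rw [F.map_id, tensorHom_id] at this
        exact this
      μIso_hom_natural_right X f := by
        have := φ.tensorHom (𝟙 X) f
        rw [F.map_id, id_tensorHom] at this
        exact this
      associativity := φ.assoc
      left_unitality X := by
        have := φ.leftUnitor X
        refine Eq.trans ?_ (congrArg (fun f => φ.υ.inv ▷ F.obj X ≫ f) this.symm)
        simp
      right_unitality X := by
        have := φ.rightUnitor X
        refine Eq.trans ?_ (congrArg (fun f => F.obj X ◁ φ.υ.inv ≫ f) this.symm)
        simp }

end MonoidalComparison

end Transport

section Duals

open Functor.LaxMonoidal Functor.OplaxMonoidal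

variable {D : Type*} [Category* D] [MonoidalCategory D] {E : Type*} [Category* E]
  [MonoidalCategory E] [RightRigidCategory E] (F : D ⥤ E) [F.Monoidal]

/-- Zigzag identities can be checked after applying a faithful monoidal functor. -/
theorem zigzag_of_faithful [F.Faithful] {X Y : D} (c : 𝟙_ D ⟶ X ⊗ Y) (e : Y ⊗ X ⟶ 𝟙_ D)
    (φ : F.obj Y ≅ †(F.obj X))
    (he : μ F Y X ≫ F.map e ≫ η F = φ.hom ▷ F.obj X ≫ ε_ (F.obj X) †(F.obj X))
    (hc : F.map c = η F ≫ η_ (F.obj X) †(F.obj X) ≫ F.obj X ◁ φ.inv ≫ μ F X Y) :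
    Y ◁ c ≫ (α_ Y X Y).inv ≫ e ▷ Y = (ρ_ Y).hom ≫ (λ_ Y).inv ∧
      c ▷ X ≫ (α_ X Y X).hom ≫ X ◁ e = (λ_ X).hom ≫ (ρ_ X).inv := by
  have he' : F.map e = δ F Y X ≫ φ.hom ▷ F.obj X ≫ ε_ (F.obj X) †(F.obj X) ≫ ε F := by
    rw [← reassoc_of% he]
    simp
  let P : ExactPairing (F.obj X) (F.obj Y) := exactPairingCongrRight φ
  let Q : ExactPairing X Y := ExactPairing.ofFaithful F e c
    (he'.trans (congrArg (fun f => δ F Y X ≫ f) (Category.assoc _ _ _).symm))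
    (hc.trans (congrArg (fun f => η F ≫ f) (Category.assoc _ _ _).symm))
  exact ⟨Q.coevaluation_evaluation', Q.evaluation_coevaluation'⟩

end Duals

section DualComparison

open Functor.LaxMonoidal Functor.OplaxMonoidal

variable {E : Type*} [Category* E] [MonoidalCategory E] [RightRigidCategory E]

theorem bend_ev {Z V : E} (e : Z ⊗ V ⟶ 𝟙_ E) :
    ((ρ_ Z).inv ≫ Z ◁ η_ V †V ≫ (α_ Z V †V).inv ≫ e ▷ †V ≫ (λ_ †V).hom) ▷ V ≫ ε_ V †V = e := by
  calc _ = 𝟙 (Z ⊗ V) ⊗≫ Z ◁ η_ V †V ▷ V ⊗≫ (e ▷ (†V ⊗ V) ≫ 𝟙_ E ◁ ε_ V †V) ⊗≫ 𝟙 (𝟙_ E) := by monoidal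
    _ = 𝟙 (Z ⊗ V) ⊗≫ Z ◁ (𝟙 V ⊗≫ η_ V †V ▷ V ⊗≫ V ◁ ε_ V †V ⊗≫ 𝟙 V) ⊗≫ e := by
        rw [← whisker_exchange]; monoidal
    _ = e := by rw [coev_zigzag]; monoidal

theorem rightDualTensorIso_inv_naturality {X X' Y Y' : E} (f : X ⟶ X') (g : Y ⟶ Y') :
    (rightAdjointMate g ⊗ₘ rightAdjointMate f) ≫ (rightDualTensorIso X Y).inv =
      (rightDualTensorIso X' Y').inv ≫ rightAdjointMate (f ⊗ₘ g) := by
  apply dual_hom_ext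
  rw [comp_whiskerRight, comp_whiskerRight, Category.assoc, Category.assoc,
    rightAdjointMate_comp_evaluation, ← whisker_exchange_assoc, rightDualTensorIso_inv_ev,
    rightDualTensorIso_inv_ev, MonoidalCategory.tensorHom_def, MonoidalCategory.tensorHom_def']
  calc _ = 𝟙 ((†Y' ⊗ †X') ⊗ X ⊗ Y) ⊗≫ rightAdjointMate g ▷ (†X' ⊗ X ⊗ Y) ⊗≫
        †Y ◁ (rightAdjointMate f ▷ X ≫ ε_ X †X) ▷ Y ⊗≫ ε_ Y †Y := by monoidal
    _ = 𝟙 ((†Y' ⊗ †X') ⊗ X ⊗ Y) ⊗≫ (rightAdjointMate g ▷ ((†X' ⊗ X) ⊗ Y) ≫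
        †Y ◁ ((†X' ◁ f ≫ ε_ X' †X') ▷ Y)) ⊗≫ ε_ Y †Y := by
        rw [rightAdjointMate_comp_evaluation]; monoidal
    _ = 𝟙 ((†Y' ⊗ †X') ⊗ X ⊗ Y) ⊗≫ †Y' ◁ ((†X' ◁ f ≫ ε_ X' †X') ▷ Y) ⊗≫
        (rightAdjointMate g ▷ Y ≫ ε_ Y †Y) := by
        rw [← whisker_exchange]; monoidal
    _ = 𝟙 ((†Y' ⊗ †X') ⊗ X ⊗ Y) ⊗≫ †Y' ◁ †X' ◁ f ▷ Y ⊗≫ †Y' ◁ (ε_ X' †X' ▷ Y ≫ 𝟙_ E ◁ g) ⊗≫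
        ε_ Y' †Y' := by
        rw [rightAdjointMate_comp_evaluation]; monoidal
    _ = 𝟙 ((†Y' ⊗ †X') ⊗ X ⊗ Y) ⊗≫ †Y' ◁ †X' ◁ (f ▷ Y ≫ X' ◁ g) ⊗≫ †Y' ◁ ε_ X' †X' ▷ Y' ⊗≫
        ε_ Y' †Y' := by
        rw [← whisker_exchange]; monoidal
    _ = _ := by rw [← whisker_exchange]; monoidal

variable {D : Type*} [Category* D] [MonoidalCategory D] [RightRigidCategory D] (F : D ⥤ E)
  [F.Monoidal]

theorem dualComparison_ev (X : D) : dualComparison F X ▷ F.obj X ≫ ε_ (F.obj X) †(F.obj X) =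
    μ F †X X ≫ F.map (ε_ X †X) ≫ η F :=
  bend_ev _

theorem dualComparison_eq {X : D} {φ : F.obj †X ⟶ †(F.obj X)}
    (h : μ F †X X ≫ F.map (ε_ X †X) ≫ η F = φ ▷ F.obj X ≫ ε_ (F.obj X) †(F.obj X)) :
    dualComparison F X = φ :=
  dual_hom_ext ((dualComparison_ev F X).trans h)

theorem dualComparison_naturality {X Y : D} (f : X ⟶ Y) :
    F.map (rightAdjointMate f) ≫ dualComparison F X =
      dualComparison F Y ≫ rightAdjointMate (F.map f) := by
  apply dual_hom_ext
  rw [comp_whiskerRight, Category.assoc, dualComparison_ev, comp_whiskerRight, Category.assoc,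
    rightAdjointMate_comp_evaluation, ← whisker_exchange_assoc, dualComparison_ev,
    μ_natural_left_assoc, μ_natural_right_assoc, ← F.map_comp_assoc, ← F.map_comp_assoc,
    rightAdjointMate_comp_evaluation]

theorem dualComparison_tensor (X Y : D) :
    μ F †Y †X ≫ F.map (rightDualTensorIso X Y).inv ≫ dualComparison F (X ⊗ Y) ≫
        rightAdjointMate (μ F X Y) =
      (dualComparison F Y ⊗ₘ dualComparison F X) ≫
        (rightDualTensorIso (F.obj X) (F.obj Y)).inv := by
  apply dual_hom_ext
  simp only [comp_whiskerRight, Category.assoc]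
  rw [rightAdjointMate_comp_evaluation, ← whisker_exchange_assoc, dualComparison_ev,
    ← whisker_exchange_assoc, ← whisker_exchange_assoc, rightDualTensorIso_inv_ev,
    μ_natural_left_assoc, ← F.map_comp_assoc, rightDualTensorIso_inv_ev_assoc]
  have h1 : F.obj †X ◁ μ F X Y ≫ μ F †X (X ⊗ Y) ≫
      F.map ((α_ †X X Y).inv ≫ ε_ X †X ▷ Y ≫ (λ_ Y).hom) =
      (α_ _ _ _).inv ≫ (μ F †X X ≫ F.map (ε_ X †X) ≫ η F) ▷ F.obj Y ≫ (λ_ (F.obj Y)).hom := by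
    rw [F.map_comp, F.map_comp, Functor.LaxMonoidal.associativity_inv_assoc,
      ← μ_natural_left_assoc, Functor.Monoidal.map_leftUnitor]
    simp
  rw [F.map_comp, F.map_comp]
  simp only [Category.assoc]
  rw [Functor.LaxMonoidal.associativity_assoc, ← μ_natural_right_assoc,
    associator_naturality_right_assoc, ← whiskerLeft_comp_assoc, ← whiskerLeft_comp_assoc,
    Category.assoc, h1, ← dualComparison_ev, ← dualComparison_ev, MonoidalCategory.tensorHom_def]
  calc _ = 𝟙 ((F.obj †Y ⊗ F.obj †X) ⊗ F.obj X ⊗ F.obj Y) ⊗≫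
        (F.obj †Y ◁ (((dualComparison F X ▷ F.obj X ≫ ε_ (F.obj X) †(F.obj X)) ▷ F.obj Y)) ≫
        dualComparison F Y ▷ (𝟙_ E ⊗ F.obj Y)) ⊗≫ ε_ (F.obj Y) †(F.obj Y) := by monoidal
    _ = _ := by rw [whisker_exchange]; monoidal

end DualComparison

section PivotalTransport

open Functor.LaxMonoidal Functor.OplaxMonoidal

variable {E : Type*} [Category* E] [MonoidalCategory E] [RightRigidCategory E] [PivotalCategory E]
  {D : Type*} [Category* D] [MonoidalCategory D] [RightRigidCategory D] {F : D ⥤ E}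
  [F.Monoidal] [F.Faithful] {p : ∀ X : D, X ⟶ †(†X)} (hi : ∀ X, IsIso (dualComparison F X))
  (hp : ∀ X, F.map (p X) ≫ dualComparison F †X =
    (PivotalCategory.piv (F.obj X)).hom ≫ rightAdjointMate (dualComparison F X))

include hi hp

theorem pivotal_naturality_of_faithful {X Y : D} (f : X ⟶ Y) :
    f ≫ p Y = p X ≫ rightAdjointMate (rightAdjointMate f) := by
  refine F.map_injective ?_
  have := hi †Y
  rw [← cancel_mono (dualComparison F †Y), F.map_comp, F.map_comp, Category.assoc, Category.assoc,
    hp, dualComparison_naturality, reassoc_of% hp, ← comp_rightAdjointMate,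
    dualComparison_naturality, comp_rightAdjointMate, ← Category.assoc, ← Category.assoc,
    PivotalCategory.piv_naturality]

theorem pivotal_tensor_of_faithful (X Y : D) :
    p (X ⊗ Y) = (p X ⊗ₘ p Y) ≫ doubleDualTensor X Y := by
  refine F.map_injective ?_
  have := hi †(X ⊗ Y)
  have m1 : rightAdjointMate (μ F †Y †X) ≫ rightAdjointMate (δ F †Y †X) = 𝟙 _ := by
    rw [← comp_rightAdjointMate, Functor.Monoidal.δ_μ, rightAdjointMate_id]
  have h1 : μ F †(†X) †(†Y) ≫ F.map (rightDualTensorIso †Y †X).inv ≫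
      dualComparison F (†Y ⊗ †X) = (dualComparison F †X ⊗ₘ dualComparison F †Y) ≫
        (rightDualTensorIso (F.obj †Y) (F.obj †X)).inv ≫ rightAdjointMate (δ F †Y †X) := by
    have := congrArg (fun f => f ≫ rightAdjointMate (δ F †Y †X)) (dualComparison_tensor F †Y †X)
    simp only [Category.assoc, m1, Category.comp_id] at this
    exact this
  have h2 : F.map (rightDualTensorIso X Y).hom ≫ δ F †Y †X ≫
      (dualComparison F Y ⊗ₘ dualComparison F X) = dualComparison F (X ⊗ Y) ≫
        rightAdjointMate (μ F X Y) ≫ (rightDualTensorIso (F.obj X) (F.obj Y)).hom := by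
    have h3 := congrArg (fun f => F.map (rightDualTensorIso X Y).hom ≫ δ F †Y †X ≫ f ≫
      (rightDualTensorIso (F.obj X) (F.obj Y)).hom) (dualComparison_tensor F X Y)
    simp only [Category.assoc, Iso.inv_hom_id, Category.comp_id, Functor.Monoidal.δ_μ_assoc] at h3
    rw [← h3, ← F.map_comp_assoc, Iso.hom_inv_id, F.map_id, Category.id_comp]
  have e1 := rightDualTensorIso_inv_naturality (dualComparison F Y) (dualComparison F X)
  have e2 := PivotalCategory.piv_naturality (μ F X Y)
  rw [PivotalCategory.piv_tensor, doubleDualTensor] at e2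
  rw [← cancel_mono (dualComparison F †(X ⊗ Y)), ← cancel_epi (μ F X Y), hp, reassoc_of% e2,
    doubleDualTensor, F.map_comp, F.map_comp]
  simp only [Category.assoc]
  rw [dualComparison_naturality, ← μ_natural_assoc, reassoc_of% h1, tensorHom_comp_tensorHom_assoc,
    hp, hp, ← tensorHom_comp_tensorHom_assoc, reassoc_of% e1]
  simp only [← comp_rightAdjointMate, Category.assoc, h2]

end PivotalTransport

structure PivotalComparison {D : Type*} [Category* D] {E : Type*} [Category* E]
    [MonoidalCategory E] [RightRigidCategory E] [PivotalCategory E] (T : PivotalData D)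
    (F : D ⥤ E) extends MonoidalComparison T F where
  dual : ∀ X, F.obj (T.dual X) ≅ †(F.obj X)
  ev : ∀ X, (μ (T.dual X) X).hom ≫ F.map (T.ev X) ≫ υ.hom =
    (dual X).hom ▷ F.obj X ≫ ε_ (F.obj X) †(F.obj X)
  coev : ∀ X, F.map (T.coev X) = υ.hom ≫ η_ (F.obj X) †(F.obj X) ≫ F.obj X ◁ (dual X).inv ≫
    (μ X (T.dual X)).hom
  piv : ∀ X, F.map (T.piv X) ≫ (dual (T.dual X)).hom =
    (PivotalCategory.piv (F.obj X)).hom ≫ rightAdjointMate (dual X).hom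

namespace PivotalComparison

variable {D : Type*} [Category* D] {E : Type*} [Category* E]
  [MonoidalCategory E] [RightRigidCategory E] [PivotalCategory E] {T : PivotalData D}
  {F : D ⥤ E} (φ : PivotalComparison T F)

include φ

theorem isRigid [F.Faithful] (hm : T.IsMonoidal) : T.IsRigid hm := by
  let := hm.monoidalCategory
  let := φ.monoidal hm
  have h := fun X => zigzag_of_faithful F (T.coev X : 𝟙_ D ⟶ X ⊗ T.dual X)
    (T.ev X : T.dual X ⊗ X ⟶ 𝟙_ D) (φ.dual X) (φ.ev X) (φ.coev X)
  exact ⟨fun X => (h X).1, fun X => (h X).2⟩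

theorem dualComparison_eq (hm : T.IsMonoidal) (hr : T.IsRigid hm) (X : D) :
    letI := hm.monoidalCategory
    letI := hr.rightRigidCategory
    letI := φ.monoidal hm
    dualComparison F X = (φ.dual X).hom := by
  let := hm.monoidalCategory
  let := hr.rightRigidCategory
  let := φ.monoidal hm
  exact ReducedTensor.dualComparison_eq F (φ.ev X)

theorem isPivotal [F.Faithful] [F.ReflectsIsomorphisms] (hm : T.IsMonoidal) (hr : T.IsRigid hm) :
    T.IsPivotal hr := by
  let := hm.monoidalCategory
  let := hr.rightRigidCategory
  let := φ.monoidal hm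
  have hi : ∀ X, IsIso (dualComparison F X) := fun X => by
    rw [φ.dualComparison_eq hm hr]
    exact (φ.dual X).isIso_hom
  have hp : ∀ X, F.map (T.piv X : X ⟶ †(†X)) ≫ dualComparison F †X =
      (PivotalCategory.piv (F.obj X)).hom ≫ rightAdjointMate (dualComparison F X) := fun X => by
    rw [φ.dualComparison_eq hm hr, φ.dualComparison_eq hm hr]
    exact φ.piv X
  refine ⟨fun X => ?_, pivotal_naturality_of_faithful hi hp, pivotal_tensor_of_faithful hi hp⟩
  have h1 : IsIso (rightAdjointMate (φ.dual X).hom) := by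
    refine ⟨⟨rightAdjointMate (φ.dual X).inv, ?_, ?_⟩⟩ <;> rw [← comp_rightAdjointMate] <;> simp
  have h2 : F.map (T.piv X) = (PivotalCategory.piv (F.obj X)).hom ≫
      rightAdjointMate (φ.dual X).hom ≫ (φ.dual (T.dual X)).inv := by
    rw [← reassoc_of% (φ.piv X)]
    simp
  have : IsIso (F.map (T.piv X)) := by rw [h2]; infer_instance
  exact isIso_of_reflects_iso _ F

theorem isPivotalCategory [F.Faithful] [F.ReflectsIsomorphisms] : T.IsPivotalCategory :=
  ⟨φ.isMonoidal, φ.isRigid _, φ.isPivotal _ _⟩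

theorem isPivotalFunctor (h : T.IsPivotalCategory) :
    letI := h.monoidal.monoidalCategory
    letI := h.rigid.rightRigidCategory
    letI := h.pivotal.pivotalCategory
    letI := φ.monoidal h.monoidal
    IsPivotalFunctor F := by
  let := h.monoidal.monoidalCategory
  let := h.rigid.rightRigidCategory
  let := h.pivotal.pivotalCategory
  let := φ.monoidal h.monoidal
  intro X
  rw [φ.dualComparison_eq h.monoidal h.rigid, φ.dualComparison_eq h.monoidal h.rigid]
  exact φ.piv X

end PivotalComparison

section MiddleCap

variable {𝕜 : Type w} [Field 𝕜] [IsAlgClosed 𝕜] {C : Type u} [Category.{v} C]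
  [Abelian C] [Linear 𝕜 C] [FiniteSemisimple 𝕜 C] [MonoidalCategory C] [MonoidalPreadditive C]
  [MonoidalLinear 𝕜 C] [Simple (𝟙_ C)] [BraidedCategory C] [RightRigidCategory C]
  [PivotalCategory C] [SphericalCategory C] (I : SimpleData 𝕜 C)

namespace PreCenter

variable {W W₁ U U₁ V V₁ Y Y₁ : C}

/-- The contraction of the two middle strands by `c`. -/
def midCap (W Y : C) {U V : C} (c : U ⊗ V ⟶ 𝟙_ C) : (W ⊗ U) ⊗ V ⊗ Y ⟶ W ⊗ Y :=
  𝟙 ((W ⊗ U) ⊗ V ⊗ Y) ⊗≫ W ◁ c ▷ Y ⊗≫ 𝟙 (W ⊗ Y)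

/-- The insertion of two middle strands by `d`. -/
def midCup (W Y : C) {U V : C} (d : 𝟙_ C ⟶ U ⊗ V) : W ⊗ Y ⟶ (W ⊗ U) ⊗ V ⊗ Y :=
  𝟙 (W ⊗ Y) ⊗≫ W ◁ d ▷ Y ⊗≫ 𝟙 ((W ⊗ U) ⊗ V ⊗ Y)

theorem midCup_midCap {d : 𝟙_ C ⟶ U ⊗ V} {c : U ⊗ V ⟶ 𝟙_ C} {r : 𝕜} (h : d ≫ c = r • 𝟙 (𝟙_ C)) :
    midCup W Y d ≫ midCap W Y c = r • 𝟙 (W ⊗ Y) := by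
  calc _ = 𝟙 (W ⊗ Y) ⊗≫ W ◁ (d ≫ c) ▷ Y ⊗≫ 𝟙 (W ⊗ Y) := by rw [midCup, midCap]; monoidal
    _ = r • (𝟙 (W ⊗ Y) ⊗≫ W ◁ 𝟙 (𝟙_ C) ▷ Y ⊗≫ 𝟙 (W ⊗ Y)) := by
      rw [h, MonoidalLinear.smul_whiskerRight, MonoidalLinear.whiskerLeft_smul,
        smul_coherence_comp, coherence_comp_smul]
    _ = _ := by congr 1; monoidal

theorem midCap_midCup (c : U ⊗ V ⟶ 𝟙_ C) (d : 𝟙_ C ⟶ U ⊗ V) : midCap W Y c ≫ midCup W Y d =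
    𝟙 _ ⊗≫ W ◁ (c ≫ d) ▷ Y ⊗≫ 𝟙 _ := by
  rw [midCup, midCap]
  monoidal

theorem midCap_smul (r : 𝕜) (c : U ⊗ V ⟶ 𝟙_ C) : midCap W Y (r • c) = r • midCap W Y c := by
  rw [midCap, midCap, MonoidalLinear.smul_whiskerRight, MonoidalLinear.whiskerLeft_smul,
    smul_coherence_comp, coherence_comp_smul]

theorem midCap_sum {α : Type*} (s : Finset α) (c : α → (U ⊗ V ⟶ 𝟙_ C)) :
    midCap W Y (∑ a ∈ s, c a) = ∑ a ∈ s, midCap W Y (c a) := by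
  simp only [midCap, sum_whiskerRight, whiskerLeft_sum, sum_coherence_comp, coherence_comp_sum]

theorem tensorHom_midCap (f : W ⟶ W₁) (g : U ⟶ U₁) (f' : V ⟶ V₁) (g' : Y ⟶ Y₁)
    (c : U₁ ⊗ V₁ ⟶ 𝟙_ C) : ((f ⊗ₘ g) ⊗ₘ (f' ⊗ₘ g')) ≫ midCap W₁ Y₁ c =
      midCap W Y ((g ⊗ₘ f') ≫ c) ≫ (f ⊗ₘ g') := by
  simp only [midCap, MonoidalCategory.tensorHom_def]
  calc _ = 𝟙 ((W ⊗ U) ⊗ V ⊗ Y) ⊗≫ f ▷ (U ⊗ V ⊗ Y) ⊗≫ W₁ ◁ g ▷ V ▷ Y ⊗≫ W₁ ◁ U₁ ◁ f' ▷ Y ⊗≫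
        W₁ ◁ ((U₁ ⊗ V₁) ◁ g' ≫ c ▷ Y₁) ⊗≫ 𝟙 (W₁ ⊗ Y₁) := by monoidal
    _ = 𝟙 ((W ⊗ U) ⊗ V ⊗ Y) ⊗≫ (f ▷ ((U ⊗ V) ⊗ Y) ≫ W₁ ◁ (g ▷ V ≫ U₁ ◁ f' ≫ c) ▷ Y) ⊗≫
        W₁ ◁ g' ⊗≫ 𝟙 (W₁ ⊗ Y₁) := by rw [whisker_exchange]; monoidal
    _ = _ := by rw [← whisker_exchange]; monoidal

theorem midCap_left (c : U ⊗ V ⟶ 𝟙_ C) :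
    Intertwines (leftγ (box W U) (box V Y)) (boxγ W Y) (midCap W Y c) := by
  have h1 := prodγ_assoc (underγ W) (overγ U) (overγ (V ⊗ Y))
  have h2 := (over_natural (𝟙 (U ⊗ V ⊗ Y) ⊗≫ c ▷ Y ⊗≫ 𝟙 Y)).whiskerLeft (underγ W)
  rw [← prodγ_over] at h2
  have h3 := h1.comp h2
  have e : (α_ W U (V ⊗ Y)).hom ≫ W ◁ (𝟙 (U ⊗ V ⊗ Y) ⊗≫ c ▷ Y ⊗≫ 𝟙 Y) = midCap W Y c := by
    rw [midCap]; monoidal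
  rw [e] at h3
  exact h3

theorem midCup_left (d : 𝟙_ C ⟶ U ⊗ V) :
    Intertwines (boxγ W Y) (leftγ (box W U) (box V Y)) (midCup W Y d) := by
  have h1 := prodγ_assoc_inv (underγ W) (overγ U) (overγ (V ⊗ Y))
  have h2 := (over_natural (𝟙 Y ⊗≫ d ▷ Y ⊗≫ 𝟙 (U ⊗ V ⊗ Y))).whiskerLeft (underγ W)
  rw [← prodγ_over] at h2
  have h3 := h2.comp h1
  have e : W ◁ (𝟙 Y ⊗≫ d ▷ Y ⊗≫ 𝟙 (U ⊗ V ⊗ Y)) ≫ (α_ W U (V ⊗ Y)).inv = midCup W Y d := by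
    rw [midCup]; monoidal
  rw [e] at h3
  exact h3

theorem proj_box (hI : IsModular I) (W U V Y : C) : proj I (box W U) (box V Y) =
    ∑ m, midCap W Y (homDual 𝕜 (𝟙_ C) (U ⊗ V) m) ≫ midCup W Y (homBasis 𝕜 (𝟙_ C) (U ⊗ V) m) := by
  let f : (W ⊗ U) ⊗ V ⊗ Y ≅ W ⊗ (U ⊗ V) ⊗ Y :=
    α_ W U (V ⊗ Y) ≪≫ whiskerLeftIso W (α_ U V Y).symm
  have h1 : Intertwines (leftγ (box W U) (box V Y)) (prodγ (underγ W) (prodγ (overγ (U ⊗ V)) (overγ Y)))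
      f.hom := by
    have h1 := (prodγ_assoc (underγ W) (overγ U) (overγ (V ⊗ Y)))
    have h2 := (prodγ_assoc_inv (overγ U) (overγ V) (overγ Y)).whiskerLeft (underγ W)
    rw [prodγ_over V Y, prodγ_over U V] at h2
    exact h1.comp h2
  have h2 : Intertwines (rightγ (box W U) (box V Y))
      (prodγ (underγ W) (prodγ (underγ (U ⊗ V)) (overγ Y))) f.hom := by
    have h1 := (prodγ_assoc (underγ W) (underγ U) (boxγ V Y))
    have h2 := (prodγ_assoc_inv (underγ U) (underγ V) (overγ Y)).whiskerLeft (underγ W)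
    rw [prodγ_under] at h1 h2
    exact h1.comp h2
  have h3 : f.hom ≫ avg I (prodγ (underγ W) (prodγ (overγ (U ⊗ V)) (overγ Y)))
      (prodγ (underγ W) (prodγ (underγ (U ⊗ V)) (overγ Y))) =
      avg I (prodγ (boxγ W U) (overγ (V ⊗ Y))) (prodγ (underγ (W ⊗ U)) (boxγ V Y)) ≫ f.hom :=
    comp_avg I h1 h2
  rw [avg_prod_left I (isHB_under W), avg_prod_right I (isHB_over Y), avg_over_under I hI,
    sum_whiskerRight, whiskerLeft_sum, Preadditive.comp_sum] at h3
  rw [proj_eq_avg]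
  refine (cancel_mono f.hom).1 (h3.symm.trans (Eq.trans ?_ (Preadditive.sum_comp _ _ _).symm))
  refine Finset.sum_congr rfl fun m _ => ?_
  rw [midCap_midCup]
  simp only [f, Iso.trans_hom, whiskerLeftIso_hom, Iso.symm_hom]
  monoidal

end PreCenter

end MiddleCap

section Summands

variable {𝕜 : Type w} [Field 𝕜] [IsAlgClosed 𝕜] {C : Type u} [Category.{v} C]
  [Abelian C] [Linear 𝕜 C] [FiniteSemisimple 𝕜 C] [MonoidalCategory C] [MonoidalPreadditive C]
  [MonoidalLinear 𝕜 C] [Simple (𝟙_ C)] [BraidedCategory C] [RightRigidCategory C]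
  [PivotalCategory C] [SphericalCategory C] (I : SimpleData 𝕜 C)

open PreCenter

/-- The underlying object of `K(M)`. -/
abbrev baseK (M : Deligne 𝕜 C) : C := (functorK.obj M).pre.obj

/-- The inclusion of a summand of the underlying object of `K(M)`. -/
def baseι (M : Deligne 𝕜 C) (i : M.ι) : (M.X i).fst ⊗ (M.X i).snd ⟶ baseK M := (inclK M i).f

/-- The projection to a summand of the underlying object of `K(M)`. -/
def baseπ (M : Deligne 𝕜 C) (i : M.ι) : baseK M ⟶ (M.X i).fst ⊗ (M.X i).snd := (projK M i).f

variable {M N P M₁ N₁ : Deligne 𝕜 C}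

theorem baseι_π_self (i : M.ι) : baseι M i ≫ baseπ M i = 𝟙 _ :=
  congrArg RedCenter.Hom.f (inclK_projK_self M i)

theorem baseι_π_ne {i j : M.ι} (h : i ≠ j) : baseι M i ≫ baseπ M j = 0 :=
  congrArg RedCenter.Hom.f (inclK_projK_ne M h)

theorem sum_baseπ_ι (M : Deligne 𝕜 C) : ∑ i, baseπ M i ≫ baseι M i = 𝟙 (baseK M) :=
  (RedCenter.sum_f _ _).symm.trans (congrArg RedCenter.Hom.f (sum_projK_inclK M))

theorem base_hom_ext_ι {V : C} {f g : baseK M ⟶ V} (h : ∀ i, baseι M i ≫ f = baseι M i ≫ g) :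
    f = g := by
  rw [← Category.id_comp f, ← Category.id_comp g, ← sum_baseπ_ι M]
  simp only [Preadditive.sum_comp, Category.assoc, h]

theorem base_hom_ext_π {V : C} {f g : V ⟶ baseK M} (h : ∀ i, f ≫ baseπ M i = g ≫ baseπ M i) :
    f = g := by
  rw [← Category.comp_id f, ← Category.comp_id g, ← sum_baseπ_ι M]
  simp only [Preadditive.comp_sum, ← Category.assoc, h]

theorem base_tensor_hom_ext {V : C} {f g : baseK M ⊗ baseK N ⟶ V}
    (h : ∀ i j, (baseι M i ⊗ₘ baseι N j) ≫ f = (baseι M i ⊗ₘ baseι N j) ≫ g) : f = g := by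
  have key : ∀ f : baseK M ⊗ baseK N ⟶ V, f =
      ∑ i, ∑ j, (baseπ M i ⊗ₘ baseπ N j) ≫ (baseι M i ⊗ₘ baseι N j) ≫ f := by
    intro f
    conv_lhs => rw [← Category.id_comp f, ← MonoidalCategory.id_tensorHom_id, ← sum_baseπ_ι M,
      ← sum_baseπ_ι N]
    simp only [sum_tensor, tensor_sum, Preadditive.sum_comp, ← tensorHom_comp_tensorHom,
      Category.assoc]
    exact Finset.sum_comm
  rw [key f, key g]
  simp only [h]

theorem baseι_intertwines (i : M.ι) :
    Intertwines (boxγ (M.X i).fst (M.X i).snd) (functorK.obj M).pre.γ (baseι M i) :=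
  (inclK M i).isHom

theorem baseπ_intertwines (i : M.ι) :
    Intertwines (functorK.obj M).pre.γ (boxγ (M.X i).fst (M.X i).snd) (baseπ M i) :=
  (projK M i).isHom

/-- The linear extension of `f ⊠ g ↦ f ⊗ g` to the underlying morphisms. -/
def boxMap {A B : BoxPair 𝕜 C} (f : A ⟶ B) : A.fst ⊗ A.snd ⟶ B.fst ⊗ B.snd :=
  (boxFunctor.map f).f

theorem boxMap_homMk {A B : BoxPair 𝕜 C} (f : A.fst ⟶ B.fst) (g : A.snd ⟶ B.snd) :
    boxMap (BoxPair.homMk f g : A ⟶ B) = f ⊗ₘ g := rfl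

theorem boxMap_zero (A B : BoxPair 𝕜 C) : boxMap (0 : A ⟶ B) = 0 :=
  congrArg RedCenter.Hom.f (boxFunctor.map_zero A B)

theorem boxMap_add {A B : BoxPair 𝕜 C} (f g : A ⟶ B) : boxMap (f + g) = boxMap f + boxMap g :=
  congrArg RedCenter.Hom.f (boxFunctor.map_add (f := f) (g := g))

theorem boxMap_smul {A B : BoxPair 𝕜 C} (r : 𝕜) (f : A ⟶ B) : boxMap (r • f) = r • boxMap f :=
  congrArg RedCenter.Hom.f (map_smul (boxHom 𝕜 A.fst B.fst A.snd B.snd) r f)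

theorem boxMap_sum {α : Type*} (s : Finset α) {A B : BoxPair 𝕜 C} (f : α → (A ⟶ B)) :
    boxMap (∑ a ∈ s, f a) = ∑ a ∈ s, boxMap (f a) := by
  classical
  induction s using Finset.induction_on with
  | empty => exact boxMap_zero A B
  | insert a s ha h => rw [Finset.sum_insert ha, Finset.sum_insert ha, boxMap_add, h]

theorem boxMap_eqToHom {A B : BoxPair 𝕜 C} (h : A = B) :
    boxMap (eqToHom h) = eqToHom (by rw [h]) := by
  subst h
  exact congrArg RedCenter.Hom.f (boxFunctor.map_id A)

theorem boxMap_induction {A B : BoxPair 𝕜 C} {p : (A ⟶ B) → Prop} (f : A ⟶ B) (h0 : p 0)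
    (h1 : ∀ f g, p (BoxPair.homMk f g)) (h2 : ∀ f g, p f → p g → p (f + g)) : p f :=
  TensorProduct.induction_on f h0 h1 h2

theorem baseι_map (f : M ⟶ N) (i : M.ι) :
    baseι M i ≫ (functorK.map f).f = ∑ j, boxMap (f i j) ≫ baseι N j :=
  (congrArg RedCenter.Hom.f (inclK_map M N f i)).trans (RedCenter.sum_f _ _)

open Deligne in
/-- A morphism that maps the summand `i` to the summand `e i`. -/
theorem baseι_diag (e : M.ι → N.ι) (f : ∀ i, M.X i ⟶ N.X (e i)) (i : M.ι) :
    baseι M i ≫ (functorK.map (Deligne.diag e f)).f = boxMap (f i) ≫ baseι N (e i) := by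
  classical
  rw [baseι_map, Finset.sum_eq_single (e i)]
  · rw [Deligne.diag, dif_pos rfl, eqToHom_refl, Category.comp_id]
  · intro j _ hj
    rw [Deligne.diag, dif_neg hj.symm, boxMap_zero, zero_comp]
  · simp

theorem baseι_relabel (e : M.ι → N.ι) (h : ∀ a, M.X a = N.X (e a)) (i : M.ι) :
    baseι M i ≫ (functorK.map (Deligne.relabel e h)).f =
      eqToHom (by rw [h]) ≫ baseι N (e i) := by
  classical
  rw [baseι_map, Finset.sum_eq_single (e i)]
  · rw [Deligne.relabel, dif_pos rfl, boxMap_eqToHom]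
  · intro j _ hj
    rw [Deligne.relabel, dif_neg hj.symm, boxMap_zero, zero_comp]
  · simp

end Summands

section Contraction

variable {𝕜 : Type w} [Field 𝕜] [IsAlgClosed 𝕜] {C : Type u} [Category.{v} C]
  [Abelian C] [Linear 𝕜 C] [FiniteSemisimple 𝕜 C] [MonoidalCategory C] [MonoidalPreadditive C]
  [MonoidalLinear 𝕜 C] [Simple (𝟙_ C)] [BraidedCategory C] [RightRigidCategory C]
  [PivotalCategory C] [SphericalCategory C] (I : SimpleData 𝕜 C)

open PreCenter

theorem SimpleData.unit_hom_ext_left (I : SimpleData 𝕜 C) {V : C} {g h : V ⟶ 𝟙_ C}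
    (H : ∀ f : 𝟙_ C ⟶ V, f ≫ g = f ≫ h) : g = h := by
  refine I.hom_ext fun i f => ?_
  by_cases hi : i = I.one
  · subst hi
    rw [← cancel_epi I.oneIso.hom, ← Category.assoc, ← Category.assoc, H]
  · rw [← cancel_mono I.oneIso.hom, Category.assoc, Category.assoc, I.hom_eq_zero hi (f ≫ g ≫ _),
      I.hom_eq_zero hi (f ≫ h ≫ _)]

/-- The expansion of a morphism to the unit object in the basis `homDual`. -/
theorem SimpleData.eq_sum_smul_homDual (I : SimpleData 𝕜 C) {V : C} (h : V ⟶ 𝟙_ C)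
    (r : Fin (Module.finrank 𝕜 (𝟙_ C ⟶ V)) → 𝕜)
    (hr : ∀ m, homBasis 𝕜 (𝟙_ C) V m ≫ h = r m • 𝟙 (𝟙_ C)) :
    h = ∑ m, r m • homDual 𝕜 (𝟙_ C) V m := by
  refine I.unit_hom_ext_left fun f => ?_
  conv_lhs => rw [← (homBasis 𝕜 (𝟙_ C) V).sum_repr f]
  rw [Preadditive.sum_comp, Preadditive.comp_sum]
  refine Finset.sum_congr rfl fun m _ => ?_
  rw [Linear.smul_comp, hr, Linear.comp_smul, comp_homDual, Module.Basis.coord_apply, smul_smul,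
    smul_smul, mul_comm]

variable (M N P : Deligne 𝕜 C)

/-- The contraction of the middle strands `K(M) ⊗ K(N) ⟶ K(M ⊗ N)`. -/
def contract : baseK M ⊗ baseK N ⟶ baseK (Deligne.tensorObj M N) :=
  ∑ p : (Deligne.tensorObj M N).ι, (baseπ M p.1 ⊗ₘ baseπ N p.2.1) ≫
    midCap (M.X p.1).fst (N.X p.2.1).snd
      (homDual 𝕜 (𝟙_ C) ((M.X p.1).snd ⊗ (N.X p.2.1).fst) p.2.2) ≫
    baseι (Deligne.tensorObj M N) p

/-- The inclusion of a summand of `K(M ⊗ N)`. -/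
def tensorBaseι (i : M.ι) (j : N.ι) (m : Fin (Deligne.mult 𝕜 (M.X i).snd (N.X j).fst)) :
    (M.X i).fst ⊗ (N.X j).snd ⟶ baseK (Deligne.tensorObj M N) :=
  baseι (Deligne.tensorObj M N) ⟨i, j, m⟩

/-- The projection to a summand of `K(M ⊗ N)`. -/
def tensorBaseπ (i : M.ι) (j : N.ι) (m : Fin (Deligne.mult 𝕜 (M.X i).snd (N.X j).fst)) :
    baseK (Deligne.tensorObj M N) ⟶ (M.X i).fst ⊗ (N.X j).snd :=
  baseπ (Deligne.tensorObj M N) ⟨i, j, m⟩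

/-- The insertion of middle strands `K(M ⊗ N) ⟶ K(M) ⊗ K(N)`. -/
def expand : baseK (Deligne.tensorObj M N) ⟶ baseK M ⊗ baseK N :=
  ∑ i, ∑ j, ∑ m, tensorBaseπ M N i j m ≫
    midCup (M.X i).fst (N.X j).snd (homBasis 𝕜 (𝟙_ C) ((M.X i).snd ⊗ (N.X j).fst) m) ≫
    (baseι M i ⊗ₘ baseι N j)

theorem contract_eq : contract M N = ∑ i, ∑ j, ∑ m, (baseπ M i ⊗ₘ baseπ N j) ≫
    midCap (M.X i).fst (N.X j).snd (homDual 𝕜 (𝟙_ C) ((M.X i).snd ⊗ (N.X j).fst) m) ≫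
      tensorBaseι M N i j m := by
  refine (Fintype.sum_sigma _).trans (Finset.sum_congr rfl fun i _ => ?_)
  exact Fintype.sum_sigma _

variable {M N}

theorem tensorBaseι_π_self (i : M.ι) (j : N.ι) (m) :
    tensorBaseι M N i j m ≫ tensorBaseπ M N i j m = 𝟙 _ :=
  baseι_π_self (M := Deligne.tensorObj M N) ⟨i, j, m⟩

theorem tensorBaseι_π_ne {i k : M.ι} {j l : N.ι} {m n}
    (h : (⟨i, j, m⟩ : (Deligne.tensorObj M N).ι) ≠ ⟨k, l, n⟩) :
    tensorBaseι M N i j m ≫ tensorBaseπ M N k l n = 0 :=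
  baseι_π_ne (M := Deligne.tensorObj M N) h

theorem tensorBase_hom_ext_ι {V : C} {f g : baseK (Deligne.tensorObj M N) ⟶ V}
    (h : ∀ i j m, tensorBaseι M N i j m ≫ f = tensorBaseι M N i j m ≫ g) : f = g :=
  base_hom_ext_ι fun p => h p.1 p.2.1 p.2.2

theorem tensorBase_hom_ext_π {V : C} {f g : V ⟶ baseK (Deligne.tensorObj M N)}
    (h : ∀ i j m, f ≫ tensorBaseπ M N i j m = g ≫ tensorBaseπ M N i j m) : f = g :=
  base_hom_ext_π fun p => h p.1 p.2.1 p.2.2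

theorem contract_baseπ (k : M.ι) (l : N.ι) (n) :
    contract M N ≫ tensorBaseπ M N k l n = (baseπ M k ⊗ₘ baseπ N l) ≫
      midCap (M.X k).fst (N.X l).snd (homDual 𝕜 (𝟙_ C) ((M.X k).snd ⊗ (N.X l).fst) n) := by
  classical
  simp only [contract_eq, Preadditive.sum_comp, Category.assoc]
  rw [Finset.sum_eq_single k, Finset.sum_eq_single l, Finset.sum_eq_single n, tensorBaseι_π_self,
    Category.comp_id]
  · intro m _ h
    rw [tensorBaseι_π_ne (fun e => h (by simpa using e)), comp_zero, comp_zero]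
  · simp
  · intro j _ h
    refine Finset.sum_eq_zero fun m _ => ?_
    rw [tensorBaseι_π_ne (fun e => h (by simpa using (congrArg (fun p => p.2.1) e))), comp_zero,
      comp_zero]
  · simp
  · intro i _ h
    refine Finset.sum_eq_zero fun j _ => Finset.sum_eq_zero fun m _ => ?_
    rw [tensorBaseι_π_ne (fun e => h (congrArg Sigma.fst e)), comp_zero, comp_zero]
  · simp

theorem tensorBaseι_expand (k : M.ι) (l : N.ι) (n) : tensorBaseι M N k l n ≫ expand M N =
    midCup (M.X k).fst (N.X l).snd (homBasis 𝕜 (𝟙_ C) ((M.X k).snd ⊗ (N.X l).fst) n) ≫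
      (baseι M k ⊗ₘ baseι N l) := by
  classical
  simp only [expand, Preadditive.comp_sum]
  rw [Finset.sum_eq_single k, Finset.sum_eq_single l, Finset.sum_eq_single n,
    reassoc_of% tensorBaseι_π_self]
  · intro m _ h
    rw [reassoc_of% (tensorBaseι_π_ne (fun e => h (by simpa using e.symm))), zero_comp]
  · simp
  · intro j _ h
    refine Finset.sum_eq_zero fun m _ => ?_
    rw [reassoc_of% (tensorBaseι_π_ne (fun e => h (by simpa using (congrArg (fun p => p.2.1) e.symm)))),
      zero_comp]
  · simp
  · intro i _ h
    refine Finset.sum_eq_zero fun j _ => Finset.sum_eq_zero fun m _ => ?_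
    rw [reassoc_of% (tensorBaseι_π_ne (fun e => h (congrArg Sigma.fst e.symm))), zero_comp]
  · simp

theorem tensor_baseι_contract (i : M.ι) (j : N.ι) : (baseι M i ⊗ₘ baseι N j) ≫ contract M N =
    ∑ m, midCap (M.X i).fst (N.X j).snd (homDual 𝕜 (𝟙_ C) ((M.X i).snd ⊗ (N.X j).fst) m) ≫
      tensorBaseι M N i j m := by
  classical
  simp only [contract_eq, Preadditive.comp_sum, tensorHom_comp_tensorHom_assoc]
  rw [Finset.sum_eq_single i, Finset.sum_eq_single j]
  · simp only [baseι_π_self, MonoidalCategory.id_tensorHom_id, Category.id_comp]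
  · intro l _ hl
    simp only [baseι_π_ne hl.symm, MonoidalPreadditive.tensor_zero, zero_comp,
      Finset.sum_const_zero]
  · simp
  · intro k _ hk
    simp only [baseι_π_ne hk.symm, MonoidalPreadditive.zero_tensor, zero_comp,
      Finset.sum_const_zero]
  · simp

variable (M N)

theorem expand_contract : expand M N ≫ contract M N = 𝟙 _ := by
  classical
  refine tensorBase_hom_ext_ι fun i j m => ?_
  rw [reassoc_of% tensorBaseι_expand, Category.comp_id, tensor_baseι_contract, Preadditive.comp_sum,
    Finset.sum_eq_single m]
  · rw [← Category.assoc, midCup_midCap (r := (1 : 𝕜)) (by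
      rw [homBasis_comp_homDual, if_pos rfl, one_smul]), one_smul, Category.id_comp]
  · intro n _ hn
    rw [← Category.assoc, midCup_midCap (r := (0 : 𝕜)) (by
      rw [homBasis_comp_homDual, if_neg hn.symm, zero_smul]), zero_smul, zero_comp]
  · simp

theorem contract_expand (hI : IsModular I) :
    contract M N ≫ expand M N = proj I (functorK.obj M).pre (functorK.obj N).pre := by
  refine base_tensor_hom_ext fun i j => ?_
  rw [reassoc_of% tensor_baseι_contract]
  refine Eq.trans ?_ (tensorHom_proj I (P := box (M.X i).fst (M.X i).snd)
    (R := box (N.X j).fst (N.X j).snd) (baseι_intertwines i) (baseι_intertwines j)).symm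
  refine Eq.trans ?_ (congrArg (· ≫ (baseι M i ⊗ₘ baseι N j))
    (proj_box I hI (M.X i).fst (M.X i).snd (N.X j).fst (N.X j).snd)).symm
  refine Eq.trans ?_ (Preadditive.sum_comp _ _ _).symm
  rw [Preadditive.sum_comp]
  refine Finset.sum_congr rfl fun m _ => ?_
  rw [Category.assoc, tensorBaseι_expand]
  exact (Category.assoc _ _ _).symm

theorem contract_left : Intertwines (leftγ (functorK.obj M).pre (functorK.obj N).pre)
    (functorK.obj (Deligne.tensorObj M N)).pre.γ (contract M N) :=
  Intertwines.sum _ fun p =>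
    (Intertwines.tensorHom (baseπ_intertwines p.1) (over_natural (baseπ N p.2.1))).comp
      (Intertwines.comp (midCap_left _) (baseι_intertwines p))

theorem expand_left : Intertwines (functorK.obj (Deligne.tensorObj M N)).pre.γ
    (leftγ (functorK.obj M).pre (functorK.obj N).pre) (expand M N) :=
  Intertwines.sum _ fun i => Intertwines.sum _ fun j => Intertwines.sum _ fun m =>
    (baseπ_intertwines (M := Deligne.tensorObj M N) ⟨i, j, m⟩).comp (Intertwines.comp (midCup_left _)
      (Intertwines.tensorHom (baseι_intertwines i) (over_natural (baseι N j))))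

theorem proj_contract (hI : IsModular I) :
    proj I (functorK.obj M).pre (functorK.obj N).pre ≫ contract M N = contract M N := by
  rw [← contract_expand I M N hI, Category.assoc, expand_contract, Category.comp_id]

variable {M N} {M₁ N₁ : Deligne 𝕜 C}

theorem tensorHom_boxMap_midCap {A A₁ B B₁ : BoxPair 𝕜 C} (I : SimpleData 𝕜 C) (f : A ⟶ A₁)
    (g : B ⟶ B₁) (n : Fin (Deligne.mult 𝕜 A₁.snd B₁.fst)) :
    (boxMap f ⊗ₘ boxMap g) ≫ midCap A₁.fst B₁.snd (homDual 𝕜 (𝟙_ C) (A₁.snd ⊗ B₁.fst) n) =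
      ∑ m, midCap A.fst B.snd (homDual 𝕜 (𝟙_ C) (A.snd ⊗ B.fst) m) ≫
        boxMap (Deligne.tensorEntry f g m n) := by
  induction f using boxMap_induction with
  | h0 => simp [boxMap_zero, Deligne.tensorEntry]
  | h2 f f' h h' =>
    have e : ∀ m, Deligne.tensorEntry (f + f') g m n = Deligne.tensorEntry f g m n +
        Deligne.tensorEntry f' g m n := fun m => by
      simp only [Deligne.tensorEntry, map_add, TensorProduct.add_tmul]
    simp only [e, boxMap_add, MonoidalPreadditive.add_tensor, Preadditive.add_comp,
      Preadditive.comp_add, h, h', Finset.sum_add_distrib]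
  | h1 f f' =>
    induction g using boxMap_induction with
    | h0 => simp [boxMap_zero, Deligne.tensorEntry]
    | h2 g g' h h' =>
      have e : ∀ m, Deligne.tensorEntry (BoxPair.homMk f f' : A ⟶ A₁) (g + g') m n =
          Deligne.tensorEntry (BoxPair.homMk f f' : A ⟶ A₁) g m n +
          Deligne.tensorEntry (BoxPair.homMk f f' : A ⟶ A₁) g' m n := fun m => by
        simp only [Deligne.tensorEntry, map_add, TensorProduct.tmul_add]
      simp only [e, boxMap_add, MonoidalPreadditive.tensor_add, Preadditive.add_comp,
        Preadditive.comp_add, h, h', Finset.sum_add_distrib]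
    | h1 g g' =>
      simp only [boxMap_homMk, tensorHom_midCap, Deligne.tensorEntry_homMk, boxMap_smul]
      rw [I.eq_sum_smul_homDual ((f' ⊗ₘ g) ≫ homDual 𝕜 (𝟙_ C) (A₁.snd ⊗ B₁.fst) n) _
        (fun m => by rw [← Category.assoc, comp_homDual]), midCap_sum, Preadditive.sum_comp]
      simp only [midCap_smul, Linear.smul_comp, Linear.comp_smul]

theorem map_contract (I : SimpleData 𝕜 C) (f : M ⟶ M₁) (g : N ⟶ N₁) :
    ((functorK.map f).f ⊗ₘ (functorK.map g).f) ≫ contract M₁ N₁ =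
      contract M N ≫ (functorK.map (Deligne.tensorHom f g)).f := by
  refine base_tensor_hom_ext fun i j => tensorBase_hom_ext_π fun k l n => ?_
  have hf : ∀ {M M₁ : Deligne 𝕜 C} (f : M ⟶ M₁) i k,
      baseι M i ≫ (functorK.map f).f ≫ baseπ M₁ k = boxMap (f i k) := fun f i k =>
    congrArg RedCenter.Hom.f (inclK_map_projK _ _ f i k)
  have e : ∀ m, tensorBaseι M N i j m ≫ (functorK.map (Deligne.tensorHom f g)).f ≫
      tensorBaseπ M₁ N₁ k l n = boxMap (Deligne.tensorEntry (f i k) (g j l) m n) :=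
    fun m => hf (Deligne.tensorHom f g) ⟨i, j, m⟩ ⟨k, l, n⟩
  simp only [Category.assoc]
  rw [reassoc_of% tensor_baseι_contract, contract_baseπ, tensorHom_comp_tensorHom_assoc,
    tensorHom_comp_tensorHom_assoc, Category.assoc, Category.assoc, hf, hf,
    tensorHom_boxMap_midCap I, Preadditive.sum_comp]
  refine Finset.sum_congr rfl fun m _ => ?_
  rw [Category.assoc, e]

variable {P}

theorem base_tensor_hom_ext₃ {V : C} {f g : (baseK M ⊗ baseK N) ⊗ baseK P ⟶ V}
    (h : ∀ i j k, ((baseι M i ⊗ₘ baseι N j) ⊗ₘ baseι P k) ≫ f =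
      ((baseι M i ⊗ₘ baseι N j) ⊗ₘ baseι P k) ≫ g) : f = g := by
  have key : ∀ f : (baseK M ⊗ baseK N) ⊗ baseK P ⟶ V, f = ∑ k, ∑ j, ∑ i,
      ((baseπ M i ⊗ₘ baseπ N j) ⊗ₘ baseπ P k) ≫ ((baseι M i ⊗ₘ baseι N j) ⊗ₘ baseι P k) ≫ f := by
    intro f
    conv_lhs => rw [← Category.id_comp f, ← MonoidalCategory.id_tensorHom_id,
      ← MonoidalCategory.id_tensorHom_id, ← sum_baseπ_ι M, ← sum_baseπ_ι N, ← sum_baseπ_ι P]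
    simp only [sum_tensor, tensor_sum, Preadditive.sum_comp, ← tensorHom_comp_tensorHom,
      Category.assoc]
  rw [key f, key g]
  simp only [h]

theorem midCap_midCap {W U V U₁ V₁ Y : C} (c : U ⊗ V ⟶ 𝟙_ C) (d : U₁ ⊗ V₁ ⟶ 𝟙_ C) :
    midCap W U₁ c ▷ (V₁ ⊗ Y) ≫ midCap W Y d =
      (α_ _ _ _).hom ≫ (W ⊗ U) ◁ midCap V Y d ≫ midCap W Y c := by
  simp only [midCap]
  calc _ = 𝟙 (((W ⊗ U) ⊗ V ⊗ U₁) ⊗ V₁ ⊗ Y) ⊗≫ W ◁ ((c ▷ (U₁ ⊗ V₁) ≫ 𝟙_ C ◁ d) ▷ Y) ⊗≫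
        𝟙 (W ⊗ Y) := by monoidal
    _ = _ := by rw [← whisker_exchange]; monoidal

variable (M N P) in
theorem contract_assoc : contract M N ▷ baseK P ≫ contract (Deligne.tensorObj M N) P ≫
    (functorK.map (Deligne.assoc M N P)).f =
      (α_ _ _ _).hom ≫ baseK M ◁ contract N P ≫ contract M (Deligne.tensorObj N P) := by
  refine base_tensor_hom_ext₃ fun i j k => ?_
  obtain ⟨t, ht⟩ : ∃ t : ∀ (m : Fin (Deligne.mult 𝕜 (M.X i).snd (N.X j).fst))
      (n : Fin (Deligne.mult 𝕜 (N.X j).snd (P.X k).fst)), (M.X i).fst ⊗ (P.X k).snd ⟶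
      baseK (Deligne.tensorObj M (Deligne.tensorObj N P)),
      ∀ m n, tensorBaseι M (Deligne.tensorObj N P) i ⟨j, k, n⟩ m = t m n := ⟨_, fun _ _ => rfl⟩
  have e1 : ∀ m n, tensorBaseι (Deligne.tensorObj M N) P ⟨i, j, m⟩ k n ≫
      (functorK.map (Deligne.assoc M N P)).f = t m n := fun m n =>
    (baseι_relabel _ _ _).trans ((Category.id_comp _).trans (ht m n))
  have e2 : ∀ m, (tensorBaseι M N i j m ⊗ₘ baseι P k) ≫ contract (Deligne.tensorObj M N) P ≫
      (functorK.map (Deligne.assoc M N P)).f =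
      ∑ n, midCap (M.X i).fst (P.X k).snd (homDual 𝕜 (𝟙_ C) ((N.X j).snd ⊗ (P.X k).fst) n) ≫
        t m n := fun m => by
    refine ((reassoc_of% (tensor_baseι_contract (M := Deligne.tensorObj M N) (N := P)
      ⟨i, j, m⟩ k)) _).trans ?_
    refine (Preadditive.sum_comp _ _ _).trans (Finset.sum_congr rfl fun n _ => ?_)
    exact (Category.assoc _ _ _).trans (congrArg _ (e1 m n))
  have e3 : ∀ n, (baseι M i ⊗ₘ tensorBaseι N P j k n) ≫ contract M (Deligne.tensorObj N P) =
      ∑ m, midCap (M.X i).fst (P.X k).snd (homDual 𝕜 (𝟙_ C) ((M.X i).snd ⊗ (N.X j).fst) m) ≫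
        t m n := fun n => by
    refine (tensor_baseι_contract (M := M) (N := Deligne.tensorObj N P) i ⟨j, k, n⟩).trans ?_
    exact Finset.sum_congr rfl fun m _ => congrArg _ (ht m n)
  have l : ((baseι M i ⊗ₘ baseι N j) ⊗ₘ baseι P k) ≫ contract M N ▷ baseK P ≫
      contract (Deligne.tensorObj M N) P ≫ (functorK.map (Deligne.assoc M N P)).f =
      ∑ m, ∑ n, midCap (M.X i).fst (N.X j).snd (homDual 𝕜 (𝟙_ C) ((M.X i).snd ⊗ (N.X j).fst) m) ▷
        ((P.X k).fst ⊗ (P.X k).snd) ≫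
        midCap (M.X i).fst (P.X k).snd (homDual 𝕜 (𝟙_ C) ((N.X j).snd ⊗ (P.X k).fst) n) ≫
        t m n := by
    rw [← tensorHom_id, tensorHom_comp_tensorHom_assoc, Category.comp_id, tensor_baseι_contract,
      sum_tensor, Preadditive.sum_comp]
    refine Finset.sum_congr rfl fun m _ => ?_
    conv_lhs => rw [← Category.id_comp (baseι P k), ← tensorHom_comp_tensorHom, tensorHom_id,
      Category.assoc, e2 m, Preadditive.comp_sum]
  have r : ((baseι M i ⊗ₘ baseι N j) ⊗ₘ baseι P k) ≫ (α_ _ _ _).hom ≫ baseK M ◁ contract N P ≫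
      contract M (Deligne.tensorObj N P) =
      ∑ n, ∑ m, (α_ _ _ _).hom ≫ ((M.X i).fst ⊗ (M.X i).snd) ◁
        midCap (N.X j).fst (P.X k).snd (homDual 𝕜 (𝟙_ C) ((N.X j).snd ⊗ (P.X k).fst) n) ≫
        midCap (M.X i).fst (P.X k).snd (homDual 𝕜 (𝟙_ C) ((M.X i).snd ⊗ (N.X j).fst) m) ≫
        t m n := by
    rw [associator_naturality_assoc, ← id_tensorHom, tensorHom_comp_tensorHom_assoc,
      Category.comp_id, tensor_baseι_contract, tensor_sum, Preadditive.sum_comp,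
      Preadditive.comp_sum]
    refine Finset.sum_congr rfl fun n _ => ?_
    conv_lhs => rw [← Category.id_comp (baseι M i), ← tensorHom_comp_tensorHom, id_tensorHom,
      Category.assoc, e3, Preadditive.comp_sum, Preadditive.comp_sum]
  rw [l, r, Finset.sum_comm]
  refine Finset.sum_congr rfl fun n _ => Finset.sum_congr rfl fun m _ => ?_
  rw [reassoc_of% (midCap_midCap (W := (M.X i).fst) (U := (M.X i).snd) (V := (N.X j).fst)
    (U₁ := (N.X j).snd) (V₁ := (P.X k).fst) (Y := (P.X k).snd))]

end Contraction

section TensorComparison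

variable {𝕜 : Type w} [Field 𝕜] [IsAlgClosed 𝕜] {C : Type u} [Category.{v} C]
  [Abelian C] [Linear 𝕜 C] [FiniteSemisimple 𝕜 C] [MonoidalCategory C] [MonoidalPreadditive C]
  [MonoidalLinear 𝕜 C] [Simple (𝟙_ C)] [BraidedCategory C] [RightRigidCategory C]
  [PivotalCategory C] [SphericalCategory C] (I : SimpleData 𝕜 C)

open PreCenter

variable (hI : IsModular I) (hw : ReducedWellDefined I)

include hI in
theorem proj_contract_assoc (M N : Deligne 𝕜 C) {V : C}
    (f : baseK (Deligne.tensorObj M N) ⟶ V) :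
    tensorπ I (functorK.obj M).pre (functorK.obj N).pre ≫
      tensorι I (functorK.obj M).pre (functorK.obj N).pre ≫ contract M N ≫ f =
        contract M N ≫ f := by
  rw [← Category.assoc, tensorπ_ι, ← Category.assoc, proj_contract I M N hI]

/-- The tensor isomorphism of `K`. -/
def tensorIsoK (M N : Deligne 𝕜 C) : (reducedData I hw).tensorObj (functorK.obj M) (functorK.obj N) ≅
    functorK.obj (Deligne.tensorObj M N) where
  hom := ⟨tensorK I M N, Intertwines.comp
    (tensorι_left I (sqrtGlobalDim_ne_zero I hI) (functorK.obj M).isHalfBraiding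
      (functorK.obj N).isHalfBraiding) (contract_left M N)⟩
  inv := ⟨expand M N ≫ tensorπ I _ _, Intertwines.comp (expand_left M N)
    (tensorπ_left I (sqrtGlobalDim_ne_zero I hI) (functorK.obj M).isHalfBraiding
      (functorK.obj N).isHalfBraiding)⟩
  hom_inv_id := RedCenter.hom_ext (by
    change (tensorι I _ _ ≫ contract M N) ≫ expand M N ≫ tensorπ I _ _ = 𝟙 _
    rw [Category.assoc, ← Category.assoc (contract M N), contract_expand I M N hI,
      proj_tensorπ I (sqrtGlobalDim_ne_zero I hI) (functorK.obj M).isHalfBraiding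
        (functorK.obj N).isHalfBraiding,
      tensorι_π I (sqrtGlobalDim_ne_zero I hI) (functorK.obj M).isHalfBraiding
        (functorK.obj N).isHalfBraiding])
  inv_hom_id := RedCenter.hom_ext (by
    change (expand M N ≫ tensorπ I _ _) ≫ tensorι I _ _ ≫ contract M N = 𝟙 _
    rw [Category.assoc, ← Category.assoc (tensorπ I _ _), tensorπ_ι, proj_contract I M N hI,
      expand_contract])

theorem tensorIsoK_naturality {M M₁ N N₁ : Deligne 𝕜 C} (f : M ⟶ M₁) (g : N ⟶ N₁) :
    (reducedData I hw).tensorHom (functorK.map f) (functorK.map g) ≫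
      (tensorIsoK I hI hw M₁ N₁).hom =
        (tensorIsoK I hI hw M N).hom ≫ functorK.map (Deligne.tensorHom f g) := by
  refine RedCenter.hom_ext ?_
  change (tensorι I _ _ ≫ ((functorK.map f).f ⊗ₘ (functorK.map g).f) ≫ tensorπ I _ _) ≫
    tensorι I _ _ ≫ contract M₁ N₁ =
      (tensorι I _ _ ≫ contract M N) ≫ (functorK.map (Deligne.tensorHom f g)).f
  rw [Category.assoc, Category.assoc, Category.assoc, ← map_contract I,
    ← Category.assoc (tensorπ I _ _), tensorπ_ι, proj_contract I M₁ N₁ hI]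

theorem tensorIsoK_assoc (M N P : Deligne 𝕜 C) :
    (reducedData I hw).tensorHom (tensorIsoK I hI hw M N).hom (𝟙 (functorK.obj P)) ≫
      (tensorIsoK I hI hw (Deligne.tensorObj M N) P).hom ≫ functorK.map (Deligne.assoc M N P) =
    (reducedData I hw).assoc (functorK.obj M) (functorK.obj N) (functorK.obj P) ≫
      (reducedData I hw).tensorHom (𝟙 (functorK.obj M)) (tensorIsoK I hI hw N P).hom ≫
        (tensorIsoK I hI hw M (Deligne.tensorObj N P)).hom := by
  have hD := sqrtGlobalDim_ne_zero I hI
  have hM := (functorK.obj M).isHalfBraiding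
  have hN := (functorK.obj N).isHalfBraiding
  have hP := (functorK.obj P).isHalfBraiding
  refine RedCenter.hom_ext ?_
  have l : (tensorι I _ _ ≫ ((tensorι I _ _ ≫ contract M N) ⊗ₘ 𝟙 (baseK P)) ≫ tensorπ I _ _) ≫
      (tensorι I _ _ ≫ contract (Deligne.tensorObj M N) P) ≫
        (functorK.map (Deligne.assoc M N P)).f = tensorι I
          (tensor I (functorK.obj M).pre (functorK.obj N).pre) (functorK.obj P).pre ≫
          tensorι I _ _ ▷ baseK P ≫ (α_ _ _ _).hom ≫ baseK M ◁ contract N P ≫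
            contract M (Deligne.tensorObj N P) := by
    simp only [Category.assoc]
    rw [proj_contract_assoc I hI, ← contract_assoc, tensorHom_id, comp_whiskerRight,
      Category.assoc]
  have r : assoc I _ _ _ ≫ (tensorι I _ _ ≫ (𝟙 (baseK M) ⊗ₘ (tensorι I _ _ ≫ contract N P)) ≫
      tensorπ I _ _) ≫ tensorι I _ _ ≫ contract M (Deligne.tensorObj N P) = tensorι I
          (tensor I (functorK.obj M).pre (functorK.obj N).pre) (functorK.obj P).pre ≫
          tensorι I _ _ ▷ baseK P ≫ (α_ _ _ _).hom ≫ baseK M ◁ contract N P ≫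
            contract M (Deligne.tensorObj N P) := by
    have := proj_contract_assoc I hI M (Deligne.tensorObj N P) (𝟙 _)
    simp only [Category.comp_id] at this
    simp only [Category.assoc]
    rw [this, id_tensorHom, MonoidalCategory.whiskerLeft_comp, Category.assoc,
      reassoc_of% (assoc_ι I hD hM hN hP)]
  exact l.trans r.symm

end TensorComparison

section UnitComparison

variable {𝕜 : Type w} [Field 𝕜] [IsAlgClosed 𝕜] {C : Type u} [Category.{v} C]
  [Abelian C] [Linear 𝕜 C] [FiniteSemisimple 𝕜 C] [MonoidalCategory C] [MonoidalPreadditive C]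
  [MonoidalLinear 𝕜 C] [Simple (𝟙_ C)] [BraidedCategory C] [RightRigidCategory C]
  [PivotalCategory C] [SphericalCategory C] (I : SimpleData 𝕜 C)

open PreCenter

theorem clasp_eq (i j : I.ι) : clasp I i j =
    coevLoop (I.X j) (boxγ (I.X i) †(I.X i)) ≫ insertHom (I.X j) (pivEv (I.X i)) := by
  rw [coevLoop, insertHom, boxγ, prodγ]
  calc _ = (𝟙 _ ⊗≫ I.X i ◁ η_ (I.X j) †(I.X j) ⊗≫ (β_ (I.X j) (I.X i)).inv ▷ †(I.X j) ⊗≫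
        𝟙 (I.X j ⊗ I.X i ⊗ †(I.X j))) ▷ †(I.X i) ⊗≫ (I.X j ⊗ I.X i) ◁ (overγ †(I.X i) †(I.X j)) ⊗≫
        I.X j ◁ pivEv (I.X i) ▷ †(I.X j) ⊗≫ 𝟙 _ := by rw [clasp, overγ]; monoidal
    _ = (𝟙 _ ⊗≫ η_ (I.X j) †(I.X j) ▷ I.X i ⊗≫ I.X j ◁ underγ (I.X i) †(I.X j) ⊗≫
        𝟙 (I.X j ⊗ I.X i ⊗ †(I.X j))) ▷ †(I.X i) ⊗≫ (I.X j ⊗ I.X i) ◁ (overγ †(I.X i) †(I.X j)) ⊗≫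
        I.X j ◁ pivEv (I.X i) ▷ †(I.X j) ⊗≫ 𝟙 _ := by rw [coev_underγ]
    _ = _ := by monoidal

/-- The inclusion of a summand of `K(unit)`. -/
def unitBaseι (i : I.ι) : I.X i ⊗ †(I.X i) ⟶ baseK (Deligne.unit I) := baseι (Deligne.unit I) i

/-- The projection to a summand of `K(unit)`. -/
def unitBaseπ (i : I.ι) : baseK (Deligne.unit I) ⟶ I.X i ⊗ †(I.X i) := baseπ (Deligne.unit I) i

theorem unitBaseι_π_self (i : I.ι) : unitBaseι I i ≫ unitBaseπ I i = 𝟙 _ :=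
  baseι_π_self (M := Deligne.unit I) i

theorem unitBaseι_π_ne {i j : I.ι} (h : i ≠ j) : unitBaseι I i ≫ unitBaseπ I j = 0 :=
  baseι_π_ne (M := Deligne.unit I) h

theorem sum_unitBaseπ_ι : ∑ i, unitBaseπ I i ≫ unitBaseι I i = 𝟙 _ :=
  sum_baseπ_ι (Deligne.unit I)

theorem unitBaseι_intertwines (i : I.ι) : Intertwines (boxγ (I.X i) †(I.X i))
    (functorK.obj (Deligne.unit I)).pre.γ (unitBaseι I i) :=
  baseι_intertwines (M := Deligne.unit I) i

theorem unitBaseπ_intertwines (i : I.ι) : Intertwines (functorK.obj (Deligne.unit I)).pre.γ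
    (boxγ (I.X i) †(I.X i)) (unitBaseπ I i) :=
  baseπ_intertwines (M := Deligne.unit I) i

theorem unitK_eq : unitK I = ∑ i, I.sqrtDim i • (unitBaseπ I i ≫
    I.toUnit (boxγ (I.X i) †(I.X i)) (pivEv (I.X i))) := by
  have e : unitK I = I.sqrtGlobalDim⁻¹ • ∑ i, ∑ j, (I.sqrtDim i * I.sqrtDim j) •
      (unitBaseπ I i ≫ clasp I i j ≫ I.unitι j) := rfl
  rw [e, Finset.smul_sum]
  refine Finset.sum_congr rfl fun i _ => ?_
  rw [SimpleData.toUnit, Preadditive.comp_sum, Finset.smul_sum, Finset.smul_sum]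
  refine Finset.sum_congr rfl fun j _ => ?_
  rw [Linear.comp_smul, smul_smul, smul_smul, clasp_eq, Category.assoc]
  congr 1
  ring

/-- The inverse of the unit isomorphism of `K`. -/
def unitKInv : I.unitObj ⟶ baseK (Deligne.unit I) := ∑ i, I.sqrtDim i •
  (I.fromUnit (boxγ (I.X i) †(I.X i)) (η_ (I.X i) †(I.X i)) ≫ unitBaseι I i)

theorem unitK_unitKInv (hI : IsModular I) : unitK I ≫ unitKInv I = 𝟙 _ := by
  classical
  rw [unitK_eq, Preadditive.sum_comp, ← sum_unitBaseπ_ι]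
  refine Finset.sum_congr rfl fun i _ => ?_
  rw [unitKInv, Preadditive.comp_sum, Finset.sum_eq_single i]
  · have := I.toUnit_fromUnit_self hI i
    rw [Linear.comp_smul] at this
    rw [Linear.smul_comp, Linear.comp_smul, smul_smul, ← pow_two, I.sqrtDim_sq, Category.assoc,
      ← Category.assoc (I.toUnit _ _), ← Linear.comp_smul, ← Linear.smul_comp, this,
      Category.id_comp]
  · intro j _ hj
    rw [Linear.smul_comp, Linear.comp_smul, Category.assoc, ← Category.assoc (I.toUnit _ _),
      I.toUnit_fromUnit_of_ne hI hj.symm, zero_comp, comp_zero, smul_zero, smul_zero]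
  · simp

theorem unitKInv_unitK (hI : IsModular I) : unitKInv I ≫ unitK I = 𝟙 _ := by
  classical
  rw [unitKInv, Preadditive.sum_comp, ← I.unit_total hI]
  refine Finset.sum_congr rfl fun i _ => ?_
  rw [unitK_eq, Preadditive.comp_sum, Finset.sum_eq_single i]
  · rw [Linear.smul_comp, Linear.comp_smul, smul_smul, ← pow_two, I.sqrtDim_sq, Category.assoc,
      reassoc_of% unitBaseι_π_self, Linear.smul_comp]
  · intro j _ hj
    rw [Linear.smul_comp, Linear.comp_smul, Category.assoc, reassoc_of% (unitBaseι_π_ne I hj.symm),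
      zero_comp, comp_zero, smul_zero, smul_zero]
  · simp

theorem unitK_intertwines :
    Intertwines (functorK.obj (Deligne.unit I)).pre.γ I.unitγ (unitK I) := by
  rw [unitK_eq]
  exact Intertwines.sum _ fun i => ((unitBaseπ_intertwines I i).comp
    (I.toUnit_intertwines (isHB_box _ _) _)).smul _

theorem unitKInv_intertwines :
    Intertwines I.unitγ (functorK.obj (Deligne.unit I)).pre.γ (unitKInv I) :=
  Intertwines.sum _ fun i => ((I.fromUnit_intertwines (isHB_box _ _) _).comp
    (unitBaseι_intertwines I i)).smul _

/-- The unit isomorphism of `K`. -/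
def unitIsoK (hI : IsModular I) (hw : ReducedWellDefined I) :
    functorK.obj (Deligne.unit I) ≅ (reducedData I hw).unit where
  hom := ⟨unitK I, unitK_intertwines I⟩
  inv := ⟨unitKInv I, unitKInv_intertwines I⟩
  hom_inv_id := RedCenter.hom_ext (unitK_unitKInv I hI)
  inv_hom_id := RedCenter.hom_ext (unitKInv_unitK I hI)

/-- The counit of `K(unit)`. -/
def baseCounit : baseK (Deligne.unit I) ⟶ 𝟙_ C :=
  ∑ i, I.sqrtDim i • (unitBaseπ I i ≫ pivEv (I.X i))

theorem unitK_unitCounit : unitK I ≫ I.unitCounit = I.sqrtGlobalDim⁻¹ • baseCounit I := by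
  rw [unitK_eq, baseCounit, Preadditive.sum_comp, Finset.smul_sum]
  refine Finset.sum_congr rfl fun i _ => ?_
  rw [Linear.smul_comp, Category.assoc, I.toUnit_unitCounit (isHB_box _ _), Linear.comp_smul,
    smul_comm]

theorem unitBaseι_counit (i : I.ι) :
    unitBaseι I i ≫ baseCounit I = I.sqrtDim i • pivEv (I.X i) := by
  classical
  rw [baseCounit, Preadditive.comp_sum, Finset.sum_eq_single i]
  · rw [Linear.comp_smul, reassoc_of% unitBaseι_π_self]
  · intro j _ hj
    rw [Linear.comp_smul, reassoc_of% (unitBaseι_π_ne I hj.symm), zero_comp, smul_zero]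
  · simp

theorem expand_counit_left (M : Deligne 𝕜 C) :
    expand (Deligne.unit I) M ≫ baseCounit I ▷ baseK M ≫ (λ_ (baseK M)).hom =
      (functorK.map (Deligne.leftUnitor I M)).f := by
  refine tensorBase_hom_ext_ι fun (k : I.ι) l n => ?_
  obtain ⟨t, ht⟩ : ∃ t : I.X k ⊗ (M.X l).snd ⟶ baseK (Deligne.tensorObj (Deligne.unit I) M),
    t = tensorBaseι (Deligne.unit I) M k l n := ⟨_, rfl⟩
  suffices h : t ≫ expand (Deligne.unit I) M ≫ baseCounit I ▷ baseK M ≫ (λ_ (baseK M)).hom =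
      t ≫ (functorK.map (Deligne.leftUnitor I M)).f by subst ht; exact h
  have e1 : t ≫ expand (Deligne.unit I) M =
      midCup (I.X k) (M.X l).snd (homBasis 𝕜 (𝟙_ C) (†(I.X k) ⊗ (M.X l).fst) n) ≫
        (unitBaseι I k ⊗ₘ baseι M l) := ht ▸ tensorBaseι_expand (M := Deligne.unit I) k l n
  have e2 : t ≫ (functorK.map (Deligne.leftUnitor I M)).f =
      boxMap (I.sqrtDim k • (BoxPair.homMk (Deligne.bendLeft I k (M.X l).fst (homBasis 𝕜 (𝟙_ C)
        (†(I.X k) ⊗ (M.X l).fst) n)) (𝟙 (M.X l).snd) :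
          (⟨I.X k, (M.X l).snd⟩ : BoxPair 𝕜 C) ⟶ M.X l)) ≫ baseι M l := ht ▸ baseι_diag _ _ _
  rw [reassoc_of% e1, e2, boxMap_smul, boxMap_homMk]
  have e3 : (unitBaseι I k ⊗ₘ baseι M l) ≫ baseCounit I ▷ baseK M ≫ (λ_ (baseK M)).hom =
      I.sqrtDim k • (pivEv (I.X k) ▷ ((M.X l).fst ⊗ (M.X l).snd) ≫ (λ_ _).hom ≫ baseι M l) := by
    rw [← tensorHom_id, tensorHom_comp_tensorHom_assoc, unitBaseι_counit, Category.comp_id,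
      MonoidalCategory.tensorHom_def, MonoidalLinear.smul_whiskerRight, Linear.smul_comp,
      Linear.smul_comp, Category.assoc, MonoidalCategory.leftUnitor_naturality]
  rw [e3, Linear.comp_smul, Linear.smul_comp, tensorHom_id, Deligne.bendLeft, midCup]
  congr 1
  simp only [← Category.assoc]
  congr 1
  monoidal

theorem expand_counit_right (M : Deligne 𝕜 C) :
    expand M (Deligne.unit I) ≫ baseK M ◁ baseCounit I ≫ (ρ_ (baseK M)).hom =
      (functorK.map (Deligne.rightUnitor I M)).f := by
  refine tensorBase_hom_ext_ι fun k (l : I.ι) n => ?_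
  obtain ⟨t, ht⟩ : ∃ t : (M.X k).fst ⊗ †(I.X l) ⟶ baseK (Deligne.tensorObj M (Deligne.unit I)),
    t = tensorBaseι M (Deligne.unit I) k l n := ⟨_, rfl⟩
  suffices h : t ≫ expand M (Deligne.unit I) ≫ baseK M ◁ baseCounit I ≫ (ρ_ (baseK M)).hom =
      t ≫ (functorK.map (Deligne.rightUnitor I M)).f by subst ht; exact h
  have e1 : t ≫ expand M (Deligne.unit I) =
      midCup (M.X k).fst †(I.X l) (homBasis 𝕜 (𝟙_ C) ((M.X k).snd ⊗ I.X l) n) ≫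
        (baseι M k ⊗ₘ unitBaseι I l) := ht ▸ tensorBaseι_expand (N := Deligne.unit I) k l n
  have e2 : t ≫ (functorK.map (Deligne.rightUnitor I M)).f =
      boxMap (I.sqrtDim l • (BoxPair.homMk (𝟙 (M.X k).fst) (Deligne.bendRight I l (M.X k).snd
        (homBasis 𝕜 (𝟙_ C) ((M.X k).snd ⊗ I.X l) n)) :
          (⟨(M.X k).fst, †(I.X l)⟩ : BoxPair 𝕜 C) ⟶ M.X k)) ≫ baseι M k := ht ▸ baseι_diag _ _ _
  rw [reassoc_of% e1, e2, boxMap_smul, boxMap_homMk]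
  have e3 : (baseι M k ⊗ₘ unitBaseι I l) ≫ baseK M ◁ baseCounit I ≫ (ρ_ (baseK M)).hom =
      I.sqrtDim l • (((M.X k).fst ⊗ (M.X k).snd) ◁ pivEv (I.X l) ≫ (ρ_ _).hom ≫ baseι M k) := by
    rw [← id_tensorHom, tensorHom_comp_tensorHom_assoc, unitBaseι_counit, Category.comp_id,
      MonoidalCategory.tensorHom_def', MonoidalLinear.whiskerLeft_smul, Linear.smul_comp,
      Linear.smul_comp, Category.assoc, MonoidalCategory.rightUnitor_naturality]
  rw [e3, Linear.comp_smul, Linear.smul_comp, id_tensorHom, Deligne.bendRight, midCup]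
  congr 1
  simp only [← Category.assoc]
  congr 1
  monoidal

theorem unitIsoK_left (hI : IsModular I) (hw : ReducedWellDefined I) (M : Deligne 𝕜 C) :
    (tensorIsoK I hI hw (Deligne.unit I) M).hom ≫ functorK.map (Deligne.leftUnitor I M) =
      (reducedData I hw).tensorHom (unitIsoK I hI hw).hom (𝟙 (functorK.obj M)) ≫
        (reducedData I hw).leftUnitor (functorK.obj M) := by
  have hD := sqrtGlobalDim_ne_zero I hI
  have hM := (functorK.obj M).isHalfBraiding
  have hU := (functorK.obj (Deligne.unit I)).isHalfBraiding
  refine RedCenter.hom_ext ?_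
  have l : (tensorι I _ _ ≫ contract (Deligne.unit I) M) ≫
      (functorK.map (Deligne.leftUnitor I M)).f = tensorι I (functorK.obj (Deligne.unit I)).pre
        (functorK.obj M).pre ≫ baseCounit I ▷ baseK M ≫ (λ_ (baseK M)).hom := by
    rw [← expand_counit_left, Category.assoc, ← Category.assoc (contract _ _),
      contract_expand I _ _ hI, ← Category.assoc, tensorι_proj I hD hU hM]
  have r : tensorHom I (P₁ := PreCenter.unit I) (R := (functorK.obj M).pre)
      (R₁ := (functorK.obj M).pre) (unitK I) (𝟙 _) ≫
      PreCenter.leftUnitor I (functorK.obj M).pre = tensorι I (functorK.obj (Deligne.unit I)).pre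
        (functorK.obj M).pre ≫ baseCounit I ▷ baseK M ≫ (λ_ (baseK M)).hom := by
    rw [leftUnitor_eq I hI hM, Linear.comp_smul, ← Category.assoc, tensorHom_ι I hD hU hM
      (unitK_intertwines I) (Intertwines.id _), tensorHom_id, Category.assoc,
      ← comp_whiskerRight_assoc, unitK_unitCounit, MonoidalLinear.smul_whiskerRight,
      Linear.smul_comp, Linear.comp_smul, smul_smul, mul_inv_cancel₀ hD, one_smul]
  exact l.trans r.symm

theorem unitIsoK_right (hI : IsModular I) (hw : ReducedWellDefined I) (M : Deligne 𝕜 C) :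
    (tensorIsoK I hI hw M (Deligne.unit I)).hom ≫ functorK.map (Deligne.rightUnitor I M) =
      (reducedData I hw).tensorHom (𝟙 (functorK.obj M)) (unitIsoK I hI hw).hom ≫
        (reducedData I hw).rightUnitor (functorK.obj M) := by
  have hD := sqrtGlobalDim_ne_zero I hI
  have hM := (functorK.obj M).isHalfBraiding
  have hU := (functorK.obj (Deligne.unit I)).isHalfBraiding
  refine RedCenter.hom_ext ?_
  have l : (tensorι I _ _ ≫ contract M (Deligne.unit I)) ≫
      (functorK.map (Deligne.rightUnitor I M)).f = tensorι I (functorK.obj M).pre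
        (functorK.obj (Deligne.unit I)).pre ≫ baseK M ◁ baseCounit I ≫ (ρ_ (baseK M)).hom := by
    rw [← expand_counit_right, Category.assoc, ← Category.assoc (contract _ _),
      contract_expand I _ _ hI, ← Category.assoc, tensorι_proj I hD hM hU]
  have r : tensorHom I (P := (functorK.obj M).pre) (P₁ := (functorK.obj M).pre)
      (R₁ := PreCenter.unit I) (𝟙 _) (unitK I) ≫
      PreCenter.rightUnitor I (functorK.obj M).pre = tensorι I (functorK.obj M).pre
        (functorK.obj (Deligne.unit I)).pre ≫ baseK M ◁ baseCounit I ≫ (ρ_ (baseK M)).hom := by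
    rw [rightUnitor_eq I hI hM, Linear.comp_smul, ← Category.assoc, tensorHom_ι I hD hM hU
      (Intertwines.id _) (unitK_intertwines I), id_tensorHom, Category.assoc,
      ← MonoidalCategory.whiskerLeft_comp_assoc, unitK_unitCounit, MonoidalLinear.whiskerLeft_smul,
      Linear.smul_comp, Linear.comp_smul, smul_smul, mul_inv_cancel₀ hD, one_smul]
  exact l.trans r.symm

end UnitComparison

section DualComparison

variable {𝕜 : Type w} [Field 𝕜] [IsAlgClosed 𝕜] {C : Type u} [Category.{v} C]
  [Abelian C] [Linear 𝕜 C] [FiniteSemisimple 𝕜 C] [MonoidalCategory C] [MonoidalPreadditive C]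
  [MonoidalLinear 𝕜 C] [Simple (𝟙_ C)] [BraidedCategory C] [RightRigidCategory C]
  [PivotalCategory C] [SphericalCategory C] (I : SimpleData 𝕜 C)

open PreCenter

/-- The inclusion of a summand of `K(M*)`. -/
def dualBaseι (M : Deligne 𝕜 C) (i : M.ι) :
    †(M.X i).snd ⊗ †(M.X i).fst ⟶ baseK (Deligne.dual M) := baseι (Deligne.dual M) i

/-- The projection to a summand of `K(M*)`. -/
def dualBaseπ (M : Deligne 𝕜 C) (i : M.ι) :
    baseK (Deligne.dual M) ⟶ †(M.X i).snd ⊗ †(M.X i).fst := baseπ (Deligne.dual M) i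

variable (M : Deligne 𝕜 C)

theorem dualBaseι_π_self (i : M.ι) : dualBaseι M i ≫ dualBaseπ M i = 𝟙 _ :=
  baseι_π_self (M := Deligne.dual M) i

theorem dualBaseι_π_ne {i j : M.ι} (h : i ≠ j) : dualBaseι M i ≫ dualBaseπ M j = 0 :=
  baseι_π_ne (M := Deligne.dual M) h

/-- The isomorphism `K(M*) ≅ K(M)*` on underlying objects. -/
def dualK : baseK (Deligne.dual M) ⟶ †(baseK M) := ∑ i, dualBaseπ M i ≫
  (rightDualTensorIso (M.X i).fst (M.X i).snd).inv ≫ rightAdjointMate (baseπ M i)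

/-- The inverse of `dualK`. -/
def dualKInv : †(baseK M) ⟶ baseK (Deligne.dual M) := ∑ i, rightAdjointMate (baseι M i) ≫
  (rightDualTensorIso (M.X i).fst (M.X i).snd).hom ≫ dualBaseι M i

theorem dualBaseι_dualK (i : M.ι) : dualBaseι M i ≫ dualK M =
    (rightDualTensorIso (M.X i).fst (M.X i).snd).inv ≫ rightAdjointMate (baseπ M i) := by
  classical
  rw [dualK, Preadditive.comp_sum, Finset.sum_eq_single i]
  · rw [reassoc_of% dualBaseι_π_self]
  · intro j _ hj
    rw [reassoc_of% (dualBaseι_π_ne M hj.symm), zero_comp]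
  · simp

theorem dualKInv_dualBaseπ (i : M.ι) : dualKInv M ≫ dualBaseπ M i =
    rightAdjointMate (baseι M i) ≫ (rightDualTensorIso (M.X i).fst (M.X i).snd).hom := by
  classical
  rw [dualKInv, Preadditive.sum_comp, Finset.sum_eq_single i]
  · rw [Category.assoc, Category.assoc, dualBaseι_π_self, Category.comp_id]
  · intro j _ hj
    rw [Category.assoc, Category.assoc, dualBaseι_π_ne M hj, comp_zero, comp_zero]
  · simp

theorem mate_baseπ_mate_baseι_self (i : M.ι) :
    rightAdjointMate (baseπ M i) ≫ rightAdjointMate (baseι M i) = 𝟙 _ := by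
  rw [← comp_rightAdjointMate, baseι_π_self, rightAdjointMate_id]

theorem mate_baseπ_mate_baseι_ne {i j : M.ι} (h : i ≠ j) :
    rightAdjointMate (baseπ M i) ≫ rightAdjointMate (baseι M j) = 0 := by
  rw [← comp_rightAdjointMate, baseι_π_ne h.symm, rightAdjointMate_zero]

theorem dualK_mate_baseι (i : M.ι) : dualK M ≫ rightAdjointMate (baseι M i) =
    dualBaseπ M i ≫ (rightDualTensorIso (M.X i).fst (M.X i).snd).inv := by
  classical
  rw [dualK, Preadditive.sum_comp, Finset.sum_eq_single i]
  · rw [Category.assoc, Category.assoc, mate_baseπ_mate_baseι_self, Category.comp_id]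
  · intro j _ hj
    rw [Category.assoc, Category.assoc, mate_baseπ_mate_baseι_ne M hj, comp_zero, comp_zero]
  · simp

theorem dualK_dualKInv : dualK M ≫ dualKInv M = 𝟙 _ := by
  have e : ∑ i, dualBaseπ M i ≫ dualBaseι M i = 𝟙 (baseK (Deligne.dual M)) :=
    sum_baseπ_ι (Deligne.dual M)
  rw [dualKInv, Preadditive.comp_sum, ← e]
  refine Finset.sum_congr rfl fun i _ => ?_
  rw [reassoc_of% (dualK_mate_baseι M i), Iso.inv_hom_id_assoc]

theorem dualKInv_dualK : dualKInv M ≫ dualK M = 𝟙 _ := by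
  rw [dualKInv, Preadditive.sum_comp, ← rightAdjointMate_id, ← sum_baseπ_ι M,
    rightAdjointMate_sum]
  refine Finset.sum_congr rfl fun i _ => ?_
  rw [Category.assoc, Category.assoc, dualBaseι_dualK, Iso.hom_inv_id_assoc,
    comp_rightAdjointMate]

theorem dualK_intertwines : Intertwines (functorK.obj (Deligne.dual M)).pre.γ
    (dualγ (functorK.obj M).pre) (dualK M) :=
  Intertwines.sum _ fun i => (baseπ_intertwines (M := Deligne.dual M) i).comp
    (Intertwines.comp
      (rightDualTensorIso_intertwines (M.X i).fst (M.X i).snd).inv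
      (mate_intertwines (P := (functorK.obj M).pre) (R := box _ _) (baseπ_intertwines i)))

theorem dualKInv_intertwines : Intertwines (dualγ (functorK.obj M).pre)
    (functorK.obj (Deligne.dual M)).pre.γ (dualKInv M) :=
  Intertwines.sum _ fun i => Intertwines.comp
    (mate_intertwines (P := box _ _) (R := (functorK.obj M).pre) (baseι_intertwines i))
    ((rightDualTensorIso_intertwines (M.X i).fst (M.X i).snd).comp
      (baseι_intertwines (M := Deligne.dual M) i))

/-- The isomorphism `K(M*) ≅ K(M)*`. -/
def dualIsoK (hw : ReducedWellDefined I) :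
    functorK.obj (Deligne.dual M) ≅ (reducedData I hw).dual (functorK.obj M) where
  hom := ⟨dualK M, dualK_intertwines M⟩
  inv := ⟨dualKInv M, dualKInv_intertwines M⟩
  hom_inv_id := RedCenter.hom_ext (dualK_dualKInv M)
  inv_hom_id := RedCenter.hom_ext (dualKInv_dualK M)

theorem map_piv_dualK : (functorK.map (Deligne.piv M)).f ≫ dualK (Deligne.dual M) =
    (PivotalCategory.piv (baseK M)).hom ≫ rightAdjointMate (dualK M) := by
  refine base_hom_ext_ι fun i => ?_
  obtain ⟨t, ht⟩ : ∃ t : †(†(M.X i).fst) ⊗ †(†(M.X i).snd) ⟶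
    baseK (Deligne.dual (Deligne.dual M)), t = dualBaseι (Deligne.dual M) i := ⟨_, rfl⟩
  have e1 : baseι M i ≫ (functorK.map (Deligne.piv M)).f =
      ((PivotalCategory.piv (M.X i).fst).hom ⊗ₘ (PivotalCategory.piv (M.X i).snd).hom) ≫ t :=
    ht ▸ baseι_diag _ _ _
  have e2 : t ≫ dualK (Deligne.dual M) = (rightDualTensorIso †(M.X i).snd †(M.X i).fst).inv ≫
      rightAdjointMate (dualBaseπ M i) := ht ▸ dualBaseι_dualK (Deligne.dual M) i
  rw [reassoc_of% e1, e2, ← Category.assoc (baseι M i), PivotalCategory.piv_naturality,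
    Category.assoc, ← comp_rightAdjointMate, dualK_mate_baseι, comp_rightAdjointMate,
    PivotalCategory.piv_tensor, doubleDualTensor, Category.assoc, Category.assoc,
    ← Category.assoc (rightAdjointMate _) (rightAdjointMate _), ← comp_rightAdjointMate,
    Iso.inv_hom_id, rightAdjointMate_id, Category.id_comp]

theorem eval_mate_ev {Y : C} (j : I.ι) (t) :
    (homDual 𝕜 (I.X j) †Y t ⊗ₘ ((PivotalCategory.piv Y).hom ≫
      rightAdjointMate (homBasis 𝕜 (I.X j) †Y t))) ≫ pivEv (I.X j) =
      (homDual 𝕜 (I.X j) †Y t ≫ homBasis 𝕜 (I.X j) †Y t) ▷ Y ≫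
        †Y ◁ (PivotalCategory.piv Y).hom ≫ pivEv †Y := by
  rw [MonoidalCategory.tensorHom_def, MonoidalCategory.whiskerLeft_comp, Category.assoc,
    Category.assoc, ← pivEv_natural, comp_whiskerRight, Category.assoc, whisker_exchange_assoc]

theorem sum_eval_mate_ev (Y : C) : ∑ j, ∑ t, (homDual 𝕜 (I.X j) †Y t ⊗ₘ
    ((PivotalCategory.piv Y).hom ≫ rightAdjointMate (homBasis 𝕜 (I.X j) †Y t))) ≫ pivEv (I.X j) =
      ε_ Y †Y := by
  simp only [eval_mate_ev, ← Preadditive.sum_comp, ← sum_whiskerRight, I.complete]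
  rw [ev_eq_pivEv_dual, id_whiskerRight, Category.id_comp]

theorem sum_coev_mate (W : C) : ∑ j, ∑ t, η_ (I.X j) †(I.X j) ≫ (homBasis 𝕜 (I.X j) W t ⊗ₘ
    rightAdjointMate (homDual 𝕜 (I.X j) W t)) = η_ W †W := by
  have e : ∀ j t, η_ (I.X j) †(I.X j) ≫ (homBasis 𝕜 (I.X j) W t ⊗ₘ
      rightAdjointMate (homDual 𝕜 (I.X j) W t)) = η_ W †W ≫
        (homDual 𝕜 (I.X j) W t ≫ homBasis 𝕜 (I.X j) W t) ▷ †W := by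
    intro j t
    rw [MonoidalCategory.tensorHom_def', coevaluation_comp_rightAdjointMate_assoc,
      comp_whiskerRight]
  simp only [e, ← Preadditive.comp_sum, ← sum_whiskerRight, I.complete]
  rw [id_whiskerRight, Category.comp_id]

end DualComparison

section EvaluationComparison

variable {𝕜 : Type w} [Field 𝕜] [IsAlgClosed 𝕜] {C : Type u} [Category.{v} C]
  [Abelian C] [Linear 𝕜 C] [FiniteSemisimple 𝕜 C] [MonoidalCategory C] [MonoidalPreadditive C]
  [MonoidalLinear 𝕜 C] [Simple (𝟙_ C)] [BraidedCategory C] [RightRigidCategory C]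
  [PivotalCategory C] [SphericalCategory C] (I : SimpleData 𝕜 C)

open PreCenter

variable (M : Deligne 𝕜 C)

theorem mate_tensorHom_ev {V V' W : C} (p : V ⟶ V') (i : W ⟶ V) {T : C} (r : T ⟶ †V') :
    (r ≫ rightAdjointMate p ⊗ₘ i) ≫ ε_ V †V = r ▷ W ≫ †V' ◁ (i ≫ p) ≫ ε_ V' †V' := by
  rw [MonoidalCategory.tensorHom_def, comp_whiskerRight, Category.assoc, Category.assoc,
    ← whisker_exchange_assoc, rightAdjointMate_comp_evaluation,
    MonoidalCategory.whiskerLeft_comp, Category.assoc]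

theorem coev_tensorHom_mate {V V' W : C} (p : V ⟶ V') (i : W ⟶ V) {T : C} (r : †W ⟶ T) :
    η_ V †V ≫ (p ⊗ₘ rightAdjointMate i ≫ r) = η_ W †W ≫ (i ≫ p) ▷ †W ≫ V' ◁ r := by
  rw [MonoidalCategory.tensorHom_def', MonoidalCategory.whiskerLeft_comp, Category.assoc,
    coevaluation_comp_rightAdjointMate_assoc, whisker_exchange, comp_whiskerRight_assoc]

theorem boxMap_ev_self (k : M.ι) (n : Fin (Deligne.mult 𝕜 †(M.X k).fst (M.X k).fst)) (j : I.ι) :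
    boxMap (A := ⟨†(M.X k).snd, (M.X k).snd⟩) (B := ⟨I.X j, †(I.X j)⟩)
      (Deligne.ev I M ⟨k, k, n⟩ j) =
      scalar 𝕜 (homBasis 𝕜 (𝟙_ C) (†(M.X k).fst ⊗ (M.X k).fst) n ≫ ε_ (M.X k).fst †(M.X k).fst) •
        ∑ t, (I.sqrtDim j)⁻¹ • (homDual 𝕜 (I.X j) †(M.X k).snd t ⊗ₘ
          ((PivotalCategory.piv (M.X k).snd).hom ≫
            rightAdjointMate (homBasis 𝕜 (I.X j) †(M.X k).snd t))) := by
  refine (congrArg boxMap (dif_pos rfl)).trans ?_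
  rw [boxMap_smul, boxMap_sum]
  simp only [eqToHom_refl, MonoidalCategory.whiskerLeft_id, Category.id_comp, boxMap_smul,
    boxMap_homMk, I.sqrtDim_mul_inv]

theorem boxMap_ev_ne {k l : M.ι} (h : l ≠ k)
    (n : Fin (Deligne.mult 𝕜 †(M.X k).fst (M.X l).fst)) (j : I.ι) :
    boxMap (A := ⟨†(M.X k).snd, (M.X l).snd⟩) (B := ⟨I.X j, †(I.X j)⟩)
      (Deligne.ev I M ⟨k, l, n⟩ j) = 0 :=
  (congrArg boxMap (dif_neg h)).trans (boxMap_zero _ _)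

theorem boxMap_coev_self (k : M.ι) (n : Fin (Deligne.mult 𝕜 (M.X k).snd †(M.X k).snd)) (j : I.ι) :
    boxMap (A := ⟨I.X j, †(I.X j)⟩) (B := ⟨(M.X k).fst, †(M.X k).fst⟩)
      (Deligne.coev I M j ⟨k, k, n⟩) =
      (homBasis 𝕜 (𝟙_ C) ((M.X k).snd ⊗ †(M.X k).snd)).coord n (η_ (M.X k).snd †(M.X k).snd) •
        ∑ t, (I.sqrtDim j)⁻¹ • (homBasis 𝕜 (I.X j) (M.X k).fst t ⊗ₘ
            rightAdjointMate (homDual 𝕜 (I.X j) (M.X k).fst t)) := by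
  refine (congrArg boxMap (dif_pos rfl)).trans ?_
  rw [boxMap_smul, boxMap_sum]
  simp only [eqToHom_refl, MonoidalCategory.whiskerLeft_id, Category.comp_id, boxMap_smul,
    boxMap_homMk, I.sqrtDim_mul_inv]

theorem boxMap_coev_ne {k l : M.ι} (h : k ≠ l)
    (n : Fin (Deligne.mult 𝕜 (M.X k).snd †(M.X l).snd)) (j : I.ι) :
    boxMap (A := ⟨I.X j, †(I.X j)⟩) (B := ⟨(M.X k).fst, †(M.X l).fst⟩)
      (Deligne.coev I M j ⟨k, l, n⟩) = 0 :=
  (congrArg boxMap (dif_neg h)).trans (boxMap_zero _ _)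

theorem midCup_rightDualTensorIso_ev (W Y : C) (d : 𝟙_ C ⟶ †W ⊗ W) :
    midCup †Y Y d ≫ (rightDualTensorIso W Y).inv ▷ (W ⊗ Y) ≫ ε_ (W ⊗ Y) †(W ⊗ Y) =
      scalar 𝕜 (d ≫ ε_ W †W) • ε_ Y †Y := by
  rw [rightDualTensorIso_inv_ev]
  calc _ = 𝟙 (†Y ⊗ Y) ⊗≫ †Y ◁ (d ≫ ε_ W †W) ▷ Y ⊗≫ ε_ Y †Y := by rw [midCup]; monoidal
    _ = scalar 𝕜 (d ≫ ε_ W †W) • (𝟙 (†Y ⊗ Y) ⊗≫ †Y ◁ 𝟙 (𝟙_ C) ▷ Y ⊗≫ ε_ Y †Y) := by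
      conv_lhs => rw [← scalar_smul_id (𝕜 := 𝕜) (d ≫ ε_ W †W)]
      rw [MonoidalLinear.smul_whiskerRight, MonoidalLinear.whiskerLeft_smul, smul_coherence_comp,
        coherence_comp_smul]
    _ = _ := by congr 1; monoidal

theorem coev_rightDualTensorIso_midCap (W Y : C) {c : Y ⊗ †Y ⟶ 𝟙_ C} {r : 𝕜}
    (h : η_ Y †Y ≫ c = r • 𝟙 (𝟙_ C)) : η_ (W ⊗ Y) †(W ⊗ Y) ≫
      (W ⊗ Y) ◁ (rightDualTensorIso W Y).hom ≫ midCap W †W c = r • η_ W †W := by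
  rw [reassoc_of% coev_rightDualTensorIso_hom]
  calc _ = η_ W †W ⊗≫ W ◁ (η_ Y †Y ≫ c) ▷ †W ⊗≫ 𝟙 (W ⊗ †W) := by rw [midCap]; monoidal
    _ = r • (η_ W †W ⊗≫ W ◁ 𝟙 (𝟙_ C) ▷ †W ⊗≫ 𝟙 (W ⊗ †W)) := by
      rw [h, MonoidalLinear.smul_whiskerRight, MonoidalLinear.whiskerLeft_smul, smul_coherence_comp,
        coherence_comp_smul]
    _ = _ := by congr 1; monoidal

theorem map_ev_baseCounit : (functorK.map (Deligne.ev I M)).f ≫ baseCounit I =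
    expand (Deligne.dual M) M ≫ dualK M ▷ baseK M ≫ ε_ (baseK M) †(baseK M) := by
  refine tensorBase_hom_ext_ι fun (k l : M.ι)
    (n : Fin (Deligne.mult 𝕜 †(M.X k).fst (M.X l).fst)) => ?_
  obtain ⟨t, ht⟩ : ∃ t : †(M.X k).snd ⊗ (M.X l).snd ⟶ baseK (Deligne.tensorObj (Deligne.dual M) M),
    t = tensorBaseι (Deligne.dual M) M k l n := ⟨_, rfl⟩
  suffices h : t ≫ (functorK.map (Deligne.ev I M)).f ≫ baseCounit I =
      t ≫ expand (Deligne.dual M) M ≫ dualK M ▷ baseK M ≫ ε_ (baseK M) †(baseK M) by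
    subst ht; exact h
  have e1 : t ≫ expand (Deligne.dual M) M = midCup †(M.X k).snd (M.X l).snd
      (homBasis 𝕜 (𝟙_ C) (†(M.X k).fst ⊗ (M.X l).fst) n) ≫ (dualBaseι M k ⊗ₘ baseι M l) :=
    ht ▸ tensorBaseι_expand (M := Deligne.dual M) k l n
  have e2 : t ≫ (functorK.map (Deligne.ev I M)).f = ∑ j : I.ι, boxMap
      (A := ⟨†(M.X k).snd, (M.X l).snd⟩) (B := ⟨I.X j, †(I.X j)⟩) (Deligne.ev I M ⟨k, l, n⟩ j) ≫
        unitBaseι I j := ht ▸ baseι_map _ _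
  rw [reassoc_of% e1, reassoc_of% e2, ← tensorHom_id, tensorHom_comp_tensorHom_assoc,
    dualBaseι_dualK, Category.comp_id, mate_tensorHom_ev, Preadditive.sum_comp]
  by_cases h : l = k
  · subst h
    have e3 := fun j : I.ι => congrArg (· ≫ unitBaseι I j ≫ baseCounit I) (boxMap_ev_self I M l n j)
    simp only [Category.assoc]
    refine (Finset.sum_congr rfl fun j _ => e3 j).trans ?_
    simp only [unitBaseι_counit]
    rw [baseι_π_self, MonoidalCategory.whiskerLeft_id, Category.id_comp,
      midCup_rightDualTensorIso_ev (𝕜 := 𝕜), ← sum_eval_mate_ev I (M.X l).snd, Finset.smul_sum]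
    refine Finset.sum_congr rfl fun j _ => ?_
    rw [Linear.smul_comp, Preadditive.sum_comp]
    congr 1
    refine Finset.sum_congr rfl fun t _ => ?_
    rw [Linear.smul_comp, Linear.comp_smul, smul_smul, inv_mul_cancel₀ (I.sqrtDim_ne_zero j),
      one_smul]
  · have e3 := fun j : I.ι => congrArg (· ≫ unitBaseι I j ≫ baseCounit I) (boxMap_ev_ne I M h n j)
    simp only [Category.assoc]
    refine (Finset.sum_congr rfl fun j _ => e3 j).trans ?_
    simp only [zero_comp, Finset.sum_const_zero]
    rw [baseι_π_ne h, MonoidalPreadditive.whiskerLeft_zero, zero_comp, comp_zero, comp_zero]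

/-- The point of `K(unit)`. -/
def basePoint : 𝟙_ C ⟶ baseK (Deligne.unit I) :=
  ∑ i, I.sqrtDim i • (η_ (I.X i) †(I.X i) ≫ unitBaseι I i)

theorem unitPoint_unitKInv : I.unitPoint ≫ unitKInv I = I.sqrtGlobalDim⁻¹ • basePoint I := by
  rw [unitKInv, basePoint, Preadditive.comp_sum, Finset.smul_sum]
  refine Finset.sum_congr rfl fun i _ => ?_
  rw [Linear.comp_smul, ← Category.assoc, I.unitPoint_fromUnit (isHB_box _ _), Linear.smul_comp,
    smul_comm]

theorem basePoint_map_coev : basePoint I ≫ (functorK.map (Deligne.coev I M)).f =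
    η_ (baseK M) †(baseK M) ≫ baseK M ◁ dualKInv M ≫ contract M (Deligne.dual M) := by
  refine tensorBase_hom_ext_π fun (k l : M.ι)
    (n : Fin (Deligne.mult 𝕜 (M.X k).snd †(M.X l).snd)) => ?_
  obtain ⟨t, ht⟩ : ∃ t : baseK (Deligne.tensorObj M (Deligne.dual M)) ⟶ (M.X k).fst ⊗ †(M.X l).fst,
    t = tensorBaseπ M (Deligne.dual M) k l n := ⟨_, rfl⟩
  suffices h : (basePoint I ≫ (functorK.map (Deligne.coev I M)).f) ≫ t =
      (η_ (baseK M) †(baseK M) ≫ baseK M ◁ dualKInv M ≫ contract M (Deligne.dual M)) ≫ t by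
    subst ht; exact h
  have e1 : contract M (Deligne.dual M) ≫ t = (baseπ M k ⊗ₘ dualBaseπ M l) ≫
      midCap (M.X k).fst †(M.X l).fst (homDual 𝕜 (𝟙_ C) ((M.X k).snd ⊗ †(M.X l).snd) n) :=
    ht ▸ contract_baseπ (N := Deligne.dual M) k l n
  have e2 : ∀ j : I.ι, unitBaseι I j ≫ (functorK.map (Deligne.coev I M)).f ≫ t = boxMap
      (A := ⟨I.X j, †(I.X j)⟩) (B := ⟨(M.X k).fst, †(M.X l).fst⟩)
        (Deligne.coev I M j ⟨k, l, n⟩) := fun j =>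
    ht ▸ congrArg RedCenter.Hom.f (inclK_map_projK _ _ (Deligne.coev I M) j ⟨k, l, n⟩)
  simp only [Category.assoc]
  rw [e1, ← id_tensorHom, tensorHom_comp_tensorHom_assoc, Category.id_comp, dualKInv_dualBaseπ,
    reassoc_of% (coev_tensorHom_mate (baseπ M k) (baseι M l)), basePoint, Preadditive.sum_comp]
  by_cases h : k = l
  · subst h
    have e3 := fun j : I.ι => congrArg (fun z => I.sqrtDim j • (η_ (I.X j) †(I.X j) ≫ z))
      (boxMap_coev_self I M k n j)
    simp only [Linear.smul_comp, Category.assoc, e2]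
    refine (Finset.sum_congr rfl fun j _ => e3 j).trans ?_
    rw [baseι_π_self, id_whiskerRight, Category.id_comp]
    refine Eq.trans ?_ (coev_rightDualTensorIso_midCap (𝕜 := 𝕜) (M.X k).fst (M.X k).snd
      (c := homDual 𝕜 (𝟙_ C) ((M.X k).snd ⊗ †(M.X k).snd) n) (comp_homDual _ n)).symm
    rw [← sum_coev_mate I (M.X k).fst,
      Finset.smul_sum]
    refine Finset.sum_congr rfl fun j _ => ?_
    rw [Linear.comp_smul, smul_comm, Preadditive.comp_sum]
    congr 1
    rw [Finset.smul_sum]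
    refine Finset.sum_congr rfl fun t _ => ?_
    rw [Linear.comp_smul, smul_smul, mul_inv_cancel₀ (I.sqrtDim_ne_zero j), one_smul]
  · have e3 := fun j : I.ι => congrArg (fun z => I.sqrtDim j • (η_ (I.X j) †(I.X j) ≫ z))
      (boxMap_coev_ne I M h n j)
    simp only [Linear.smul_comp, Category.assoc, e2]
    refine (Finset.sum_congr rfl fun j _ => e3 j).trans ?_
    simp only [comp_zero, smul_zero, Finset.sum_const_zero]
    rw [baseι_π_ne (Ne.symm h), MonoidalPreadditive.zero_whiskerRight, zero_comp, comp_zero]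

end EvaluationComparison

section UnitPoint

variable {𝕜 : Type w} [Field 𝕜] [IsAlgClosed 𝕜] {C : Type u} [Category.{v} C]
  [Abelian C] [Linear 𝕜 C] [FiniteSemisimple 𝕜 C] [MonoidalCategory C] [MonoidalPreadditive C]
  [MonoidalLinear 𝕜 C] [Simple (𝟙_ C)] [BraidedCategory C] [RightRigidCategory C]
  [PivotalCategory C] [SphericalCategory C] (I : SimpleData 𝕜 C)

open PreCenter

/-- A morphism from the reduced unit is determined by its value on the point. -/
theorem eq_of_unitPoint (hI : IsModular I) {P : PreCenter C} (hP : P.IsHalfBraiding)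
    {f g : I.unitObj ⟶ P.obj} (hf : IsHom (unit I) P f) (hg : IsHom (unit I) P g)
    (h : I.unitPoint ≫ f = I.unitPoint ≫ g) : f = g := by
  have hD := sqrtGlobalDim_ne_zero I hI
  have hU := isHalfBraiding_unit I hI
  have e : PreCenter.leftUnitor I (unit I) = PreCenter.rightUnitor I (unit I) := by
    let := (reducedData_isMonoidal I hI (reducedWellDefined I hI)).monoidalCategory
    exact congrArg RedCenter.Hom.f (unitors_equal (C := RedCenter C))
  have e1 : leftUnitorInv I (unit I) = rightUnitorInv I (unit I) := by
    rw [← Category.id_comp (leftUnitorInv I (unit I)),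
      ← rightUnitorInv_rightUnitor I hI hU, Category.assoc, ← e,
      leftUnitor_leftUnitorInv I hI hU, Category.comp_id]
  have key : ∀ f : I.unitObj ⟶ P.obj, IsHom (unit I) P f → f =
      I.sqrtGlobalDim • ((ρ_ I.unitObj).inv ≫ I.unitObj ◁ (I.unitPoint ≫ f) ≫
        tensorπ I (unit I) P ≫ PreCenter.leftUnitor I P) := by
    intro f hf
    have hid : IsHom (unit I) (unit I) (𝟙 (unit I).obj) := Intertwines.id _
    have h1 := PreCenter.leftUnitor_naturality I hI hU hP hf
    have h2 := tensorπ_tensorHom I hD hU hP hid hf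
    calc f = leftUnitorInv I (unit I) ≫ PreCenter.leftUnitor I (unit I) ≫ f := by
          rw [← Category.assoc, leftUnitorInv_leftUnitor I hI hU]
          exact (Category.id_comp f).symm
      _ = _ := by
          rw [← h1, e1, rightUnitorInv, Linear.smul_comp, Category.assoc, Category.assoc,
            reassoc_of% h2, id_tensorHom, ← MonoidalCategory.whiskerLeft_comp_assoc]
  rw [key f hf, key g hg, h]

end UnitPoint

section Comparison


variable {𝕜 : Type w} [Field 𝕜] [IsAlgClosed 𝕜] {C : Type u} [Category.{v} C]
  [Abelian C] [Linear 𝕜 C] [FiniteSemisimple 𝕜 C] [MonoidalCategory C] [MonoidalPreadditive C]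
  [MonoidalLinear 𝕜 C] [Simple (𝟙_ C)] [BraidedCategory C] [RightRigidCategory C]
  [PivotalCategory C] [SphericalCategory C] (I : SimpleData 𝕜 C)

open PreCenter

theorem tensorIsoK_ev (hI : IsModular I) (hw : ReducedWellDefined I) (M : Deligne 𝕜 C) :
    (tensorIsoK I hI hw (Deligne.dual M) M).hom ≫ functorK.map (Deligne.ev I M) ≫
      (unitIsoK I hI hw).hom =
    (reducedData I hw).tensorHom (dualIsoK I M hw).hom (𝟙 (functorK.obj M)) ≫
      (reducedData I hw).ev (functorK.obj M) := by
  have hD := sqrtGlobalDim_ne_zero I hI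
  have hN := (functorK.obj (Deligne.dual M)).isHalfBraiding
  have hM := (functorK.obj M).isHalfBraiding
  refine RedCenter.hom_ext (I.eq_of_unitCounit (RedCenter.Hom.isHom _) (RedCenter.Hom.isHom _) ?_)
  change ((tensorι I (functorK.obj (Deligne.dual M)).pre (functorK.obj M).pre ≫
      contract (Deligne.dual M) M) ≫ (functorK.map (Deligne.ev I M)).f ≫ unitK I) ≫ I.unitCounit =
    (PreCenter.tensorHom I (R := (functorK.obj M).pre) (P := (functorK.obj (Deligne.dual M)).pre)
      (P₁ := (functorK.obj M).pre.dual) (R₁ := (functorK.obj M).pre)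
      (dualK M) (𝟙 (functorK.obj M).pre.obj) ≫ PreCenter.ev I (functorK.obj M).pre) ≫ I.unitCounit
  have e1 := PreCenter.tensorHom_ι I hD hN hM (dualK_intertwines M)
    (R₁ := (functorK.obj M).pre) (Intertwines.id _)
  have e2 := ev_unitCounit I hM
  have e3 := map_ev_baseCounit I M
  have e4 := contract_expand I (Deligne.dual M) M hI
  have e5 := tensorι_proj I hD hN hM
  refine Eq.trans (b := I.sqrtGlobalDim⁻¹ • (tensorι I (functorK.obj (Deligne.dual M)).pre
    (functorK.obj M).pre ≫ dualK M ▷ baseK M ≫ ε_ (baseK M) †(baseK M))) ?_ ?_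
  · rw [Category.assoc, Category.assoc, Category.assoc, unitK_unitCounit, Linear.comp_smul,
      Linear.comp_smul, Linear.comp_smul, e3, reassoc_of% e4, reassoc_of% e5]
  · refine Eq.symm ((Category.assoc _ _ _).trans ((congrArg (fun f => PreCenter.tensorHom I _ _ ≫ f)
      e2).trans ((Linear.comp_smul _ _ _ _ _ _).trans (congrArg (fun f => I.sqrtGlobalDim⁻¹ • f)
        ((Category.assoc _ _ _).symm.trans ((congrArg (fun f => f ≫ ε_ (baseK M) †(baseK M))
          e1).trans ?_))))))
    rw [Category.assoc]
    congr 2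
    exact tensorHom_id _ _

theorem tensorIsoK_coev (hI : IsModular I) (hw : ReducedWellDefined I) (M : Deligne 𝕜 C) :
    functorK.map (Deligne.coev I M) = (unitIsoK I hI hw).hom ≫
      (reducedData I hw).coev (functorK.obj M) ≫
      (reducedData I hw).tensorHom (𝟙 (functorK.obj M)) (dualIsoK I M hw).inv ≫
      (tensorIsoK I hI hw M (Deligne.dual M)).hom := by
  have hD := sqrtGlobalDim_ne_zero I hI
  have hN := (functorK.obj (Deligne.dual M)).isHalfBraiding
  have hM := (functorK.obj M).isHalfBraiding
  rw [← Iso.inv_comp_eq]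
  refine RedCenter.hom_ext (eq_of_unitPoint I hI (functorK.obj _).isHalfBraiding
    (RedCenter.Hom.isHom _) (RedCenter.Hom.isHom _) ?_)
  change I.unitPoint ≫ unitKInv I ≫ (functorK.map (Deligne.coev I M)).f = I.unitPoint ≫
    PreCenter.coev I (functorK.obj M).pre ≫ PreCenter.tensorHom I (P := (functorK.obj M).pre)
      (R := (functorK.obj M).pre.dual) (P₁ := (functorK.obj M).pre)
      (R₁ := (functorK.obj (Deligne.dual M)).pre) (𝟙 (functorK.obj M).pre.obj) (dualKInv M) ≫
      tensorι I (functorK.obj M).pre (functorK.obj (Deligne.dual M)).pre ≫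
        contract M (Deligne.dual M)
  have e1 := PreCenter.tensorπ_tensorHom I hD (P := (functorK.obj M).pre) hM hN (Intertwines.id _)
    (R := (functorK.obj M).pre.dual) (dualKInv_intertwines M)
  have e2 := unitPoint_coev I hM
  have e3 := basePoint_map_coev I M
  have e4 := proj_contract I M (Deligne.dual M) hI
  refine Eq.trans (b := I.sqrtGlobalDim⁻¹ • (η_ (baseK M) †(baseK M) ≫ baseK M ◁ dualKInv M ≫
    contract M (Deligne.dual M))) ?_ ?_
  · rw [← Category.assoc, unitPoint_unitKInv, Linear.smul_comp, e3]
  · refine Eq.symm ?_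
    rw [reassoc_of% e2]
    refine (Linear.smul_comp _ _ _ _ _ _).trans (congrArg (fun f => I.sqrtGlobalDim⁻¹ • f) ?_)
    refine (Category.assoc _ _ _).trans (congrArg (fun f => η_ (baseK M) †(baseK M) ≫ f) ?_)
    refine (Category.assoc _ _ _).symm.trans ((congrArg (fun f => f ≫
      tensorι I (functorK.obj M).pre (functorK.obj (Deligne.dual M)).pre ≫
        contract M (Deligne.dual M)) e1).trans ?_)
    have e5 := tensorπ_ι I (functorK.obj M).pre (functorK.obj (Deligne.dual M)).pre
    rw [Category.assoc, reassoc_of% e5, e4]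
    exact congrArg (fun f => f ≫ contract M (Deligne.dual M)) (id_tensorHom _ _)

/-- The comparison of the reduced tensor product on `C ⊠ C` with that of the center. -/
def comparisonK (hI : IsModular I) (hw : ReducedWellDefined I)
    (hZ : (reducedData I hw).IsPivotalCategory) :
    letI := hZ.monoidal.monoidalCategory
    letI := hZ.rigid.rightRigidCategory
    letI := hZ.pivotal.pivotalCategory
    PivotalComparison (deligneData I) (functorK (𝕜 := 𝕜) (C := C)) :=
  letI := hZ.monoidal.monoidalCategory
  letI := hZ.rigid.rightRigidCategory
  letI := hZ.pivotal.pivotalCategory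
  { μ := tensorIsoK I hI hw
    υ := unitIsoK I hI hw
    tensorHom := tensorIsoK_naturality I hI hw
    assoc := tensorIsoK_assoc I hI hw
    leftUnitor := unitIsoK_left I hI hw
    rightUnitor := unitIsoK_right I hI hw
    dual M := dualIsoK I M hw
    ev := tensorIsoK_ev I hI hw
    coev := tensorIsoK_coev I hI hw
    piv M := RedCenter.hom_ext ((map_piv_dualK M).trans (congrArg
      (fun f => (PivotalCategory.piv (functorK.obj M).pre.obj).hom ≫ f)
      (reducedData_mate_f I hI hw hZ.monoidal hZ.rigid (dualIsoK I M hw).hom).symm)) }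

end Comparison

section SemisimpleFamily

/-- A finite family of pairwise orthogonal objects with scalar endomorphisms which additively
generates the category. -/
structure IsSimpleFamily (𝕜 : Type w) [Field 𝕜] {D : Type u} [Category.{v} D] [Preadditive D]
    [Linear 𝕜 D] {ι : Type*} (S : ι → D) : Prop where
  id_ne_zero : ∀ i, 𝟙 (S i) ≠ 0
  eq_smul_id : ∀ (i : ι) (f : S i ⟶ S i), ∃ c : 𝕜, f = c • 𝟙 (S i)
  eq_zero : ∀ {i j : ι} (f : S i ⟶ S j), i ≠ j → f = 0
  exists_total : ∀ X : D, ∃ (n : ℕ) (k : Fin n → ι) (p : ∀ a, X ⟶ S (k a)) (u : ∀ a, S (k a) ⟶ X),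
    ∑ a, p a ≫ u a = 𝟙 X

namespace IsSimpleFamily

variable {𝕜 : Type w} [Field 𝕜] {D : Type u} [Category.{v} D] [Preadditive D]
    [Linear 𝕜 D] {ι : Type*} {S : ι → D}

theorem of_equivalence {E : Type*} [Category* E] [Preadditive E] [Linear 𝕜 E] {T : ι → E}
    (hT : IsSimpleFamily 𝕜 T) (F : D ⥤ E) [F.Additive] [F.Linear 𝕜] [F.IsEquivalence] :
    IsSimpleFamily 𝕜 fun i => F.objPreimage (T i) where
  id_ne_zero i h := hT.id_ne_zero i (by
    have h1 : 𝟙 (F.obj (F.objPreimage (T i))) = 0 := by rw [← F.map_id, h, F.map_zero]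
    have e := F.objObjPreimageIso (T i)
    rw [← e.inv_hom_id, ← Category.id_comp e.hom, h1, zero_comp, comp_zero])
  eq_smul_id i f := by
    have e := F.objObjPreimageIso (T i)
    obtain ⟨c, hc⟩ := hT.eq_smul_id i (e.inv ≫ F.map f ≫ e.hom)
    refine ⟨c, F.map_injective ?_⟩
    rw [F.map_smul, F.map_id, ← cancel_epi e.inv, ← cancel_mono e.hom, Category.assoc, hc]
    simp
  eq_zero {i j} f h := by
    refine F.map_injective ?_
    have ei := F.objObjPreimageIso (T i)
    have ej := F.objObjPreimageIso (T j)
    rw [F.map_zero, ← cancel_epi ei.inv, ← cancel_mono ej.hom, Category.assoc,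
      hT.eq_zero (ei.inv ≫ F.map f ≫ ej.hom) h]
    simp
  exists_total X := by
    obtain ⟨n, k, p, u, h⟩ := hT.exists_total (F.obj X)
    refine ⟨n, k, fun a => F.preimage (p a ≫ (F.objObjPreimageIso _).inv),
      fun a => F.preimage ((F.objObjPreimageIso _).hom ≫ u a), F.map_injective ?_⟩
    rw [F.map_sum, F.map_id, ← h]
    exact Finset.sum_congr rfl fun a _ => by simp

variable (hS : IsSimpleFamily 𝕜 S)

include hS

theorem hom_ext {V W : D} {f g : V ⟶ W} (h : ∀ i (s : S i ⟶ V), s ≫ f = s ≫ g) : f = g := by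
  obtain ⟨n, k, p, u, e⟩ := hS.exists_total V
  rw [← Category.id_comp f, ← Category.id_comp g, ← e, Preadditive.sum_comp, Preadditive.sum_comp]
  exact Finset.sum_congr rfl fun a _ => by rw [Category.assoc, Category.assoc, h]

theorem comp_linear {V W : D} (r : ∀ i, (S i ⟶ V) →ₗ[𝕜] (S i ⟶ W)) {i j : ι} (f : S i ⟶ S j)
    (s : S j ⟶ V) : f ≫ r j s = r i (f ≫ s) := by
  by_cases h : i = j
  · subst h
    obtain ⟨c, rfl⟩ := hS.eq_smul_id _ f
    simp
  · rw [hS.eq_zero f h]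
    simp

theorem exists_hom {V W : D} (r : ∀ i, (S i ⟶ V) →ₗ[𝕜] (S i ⟶ W)) :
    ∃ g : V ⟶ W, ∀ i (s : S i ⟶ V), s ≫ g = r i s := by
  obtain ⟨n, k, p, u, e⟩ := hS.exists_total V
  refine ⟨∑ a, p a ≫ r (k a) (u a), fun i s => ?_⟩
  rw [Preadditive.comp_sum]
  calc _ = ∑ a, r i (s ≫ p a ≫ u a) := Finset.sum_congr rfl fun a _ => by
        rw [← Category.assoc, hS.comp_linear, Category.assoc]
    _ = _ := by rw [← map_sum, ← Preadditive.comp_sum, e, Category.comp_id]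

/-- Every morphism is von Neumann regular. -/
theorem exists_regular {V W : D} (f : V ⟶ W) : ∃ g : W ⟶ V, f ≫ g ≫ f = f := by
  have h : ∀ i, ∃ r : (S i ⟶ W) →ₗ[𝕜] (S i ⟶ V), ∀ s : S i ⟶ V, r (s ≫ f) ≫ f = s ≫ f := by
    intro i
    let T : (S i ⟶ V) →ₗ[𝕜] (S i ⟶ W) := Linear.rightComp 𝕜 (S i) f
    obtain ⟨q, hq⟩ := T.rangeRestrict.exists_rightInverse_of_surjective T.range_rangeRestrict
    obtain ⟨r, hr⟩ := LinearMap.exists_extend q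
    refine ⟨r, fun s => ?_⟩
    have h1 := LinearMap.congr_fun hr (T.rangeRestrict s)
    have h2 := congrArg Subtype.val (LinearMap.congr_fun hq (T.rangeRestrict s))
    rw [LinearMap.comp_apply] at h1
    exact (congrArg (fun t => t ≫ f) h1).trans h2
  choose r hr using h
  obtain ⟨g, hg⟩ := hS.exists_hom r
  refine ⟨g, hS.hom_ext fun i s => ?_⟩
  rw [← Category.assoc, ← Category.assoc, hg, hr]

theorem finiteDimensional (X Y : D) : FiniteDimensional 𝕜 (X ⟶ Y) := by
  have h1 : ∀ i j, FiniteDimensional 𝕜 (S i ⟶ S j) := fun i j => by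
    by_cases h : i = j
    · subst h
      refine Module.Finite.of_surjective (LinearMap.toSpanSingleton 𝕜 (S i ⟶ S i) (𝟙 _)) fun f => ?_
      obtain ⟨c, rfl⟩ := hS.eq_smul_id i f
      exact ⟨c, rfl⟩
    · exact Module.Finite.of_surjective (0 : 𝕜 →ₗ[𝕜] (S i ⟶ S j)) fun f =>
        ⟨0, (hS.eq_zero f h).symm⟩
  have h2 : ∀ i, FiniteDimensional 𝕜 (S i ⟶ Y) := fun i => by
    obtain ⟨n, k, p, u, e⟩ := hS.exists_total Y
    refine Module.Finite.of_injective (LinearMap.pi fun a => Linear.rightComp 𝕜 (S i) (p a))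
      fun f g h => ?_
    rw [← Category.comp_id f, ← Category.comp_id g, ← e, Preadditive.comp_sum, Preadditive.comp_sum]
    refine Finset.sum_congr rfl fun a _ => ?_
    rw [← Category.assoc, ← Category.assoc]
    exact congrArg (fun t => t ≫ u a) (congrFun h a)
  obtain ⟨n, k, p, u, e⟩ := hS.exists_total X
  refine Module.Finite.of_injective (LinearMap.pi fun a => Linear.leftComp 𝕜 Y (u a))
    fun f g h => ?_
  rw [← Category.id_comp f, ← Category.id_comp g, ← e, Preadditive.sum_comp, Preadditive.sum_comp]
  refine Finset.sum_congr rfl fun a _ => ?_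
  rw [Category.assoc, Category.assoc]
  exact congrArg (fun t => p a ≫ t) (congrFun h a)

/-- Idempotents split through sums of members of the family. -/
theorem exists_splitting [Fintype ι] {X : D} (e : X ⟶ X) (he : e ≫ e = e) :
    ∃ (n : ℕ) (k : Fin n → ι) (v : ∀ a, X ⟶ S (k a)) (u : ∀ a, S (k a) ⟶ X),
      ∑ a, v a ≫ u a = e ∧ (∀ a, u a ≫ v a = 𝟙 _) ∧ ∀ a b, a ≠ b → u a ≫ v b = 0 := by
  classical
  have := hS.finiteDimensional
  let T : ∀ i, (S i ⟶ X) →ₗ[𝕜] (S i ⟶ X) := fun i => Linear.rightComp 𝕜 (S i) e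
  let R : ∀ i, Submodule 𝕜 (S i ⟶ X) := fun i => LinearMap.range (T i)
  let B : ∀ i, Module.Basis (Fin (Module.finrank 𝕜 (R i))) 𝕜 (R i) := fun i => Module.finBasis 𝕜 (R i)
  let J := Σ i, Fin (Module.finrank 𝕜 (R i))
  have hv : ∀ a : J, ∃ v : X ⟶ S a.1, (∀ s : S a.1 ⟶ X,
      s ≫ v = (B a.1).coord a.2 ((T a.1).rangeRestrict s) • 𝟙 _) ∧
        ∀ i, i ≠ a.1 → ∀ s : S i ⟶ X, s ≫ v = 0 := by
    rintro ⟨i, m⟩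
    obtain ⟨v, hv⟩ := hS.exists_hom (V := X) (W := S i) fun j => if h : i = j then by
      subst h
      exact LinearMap.toSpanSingleton 𝕜 (S i ⟶ S i) (𝟙 _) ∘ₗ (B i).coord m ∘ₗ (T i).rangeRestrict
      else 0
    refine ⟨v, fun s => ?_, fun j h s => hS.eq_zero _ h⟩
    rw [hv, dif_pos rfl]
    rfl
  choose v hv hv' using hv
  let u : ∀ a : J, S a.1 ⟶ X := fun a => (B a.1 a.2 : S a.1 ⟶ X)
  have hT : ∀ a : J, (T a.1).rangeRestrict (u a) = B a.1 a.2 := by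
    rintro ⟨i, m⟩
    refine Subtype.ext ?_
    obtain ⟨s, hs⟩ := (B i m).2
    change (B i m : S i ⟶ X) ≫ e = B i m
    rw [← hs]
    change (s ≫ e) ≫ e = s ≫ e
    rw [Category.assoc, he]
  have huv : ∀ a, u a ≫ v a = 𝟙 _ := fun a => by
    rw [hv, hT]
    simp
  have huv' : ∀ a b, a ≠ b → u a ≫ v b = 0 := by
    rintro ⟨i, m⟩ ⟨j, m'⟩ h
    by_cases hij : i = j
    · subst hij
      have hm : m ≠ m' := fun hm => h (by rw [hm])
      rw [hv ⟨i, m'⟩, hT ⟨i, m⟩]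
      simp [hm]
    · exact hv' _ _ hij _
  have htot : ∑ a, v a ≫ u a = e := by
    refine hS.hom_ext fun i s => ?_
    rw [Preadditive.comp_sum, Fintype.sum_sigma, Finset.sum_eq_single i]
    · have h := congrArg Subtype.val ((B i).sum_repr ((T i).rangeRestrict s))
      refine Eq.trans (Finset.sum_congr rfl fun m _ => ?_) ((Submodule.coe_sum _ _ _).symm.trans h)
      rw [← Category.assoc, hv ⟨i, m⟩ s, Linear.smul_comp, Category.id_comp]
      rfl
    · intro j _ hj
      refine Finset.sum_eq_zero fun m _ => ?_
      rw [← Category.assoc, hv' ⟨j, m⟩ i hj.symm s, zero_comp]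
    · simp
  let E := (Fintype.equivFin J).symm
  refine ⟨Fintype.card J, fun a => (E a).1, fun a => v (E a), fun a => u (E a), ?_,
    fun a => huv _, fun a b h => huv' _ _ (E.injective.ne h)⟩
  rw [← htot]
  exact E.sum_comp fun a => v a ≫ u a

theorem exists_retract [Fintype ι] [HasFiniteBiproducts D] {X : D} (e : X ⟶ X) (he : e ≫ e = e) :
    ∃ (n : ℕ) (k : Fin n → ι) (v : X ⟶ ⨁ fun a => S (k a)) (u : (⨁ fun a => S (k a)) ⟶ X),
      v ≫ u = e ∧ u ≫ v = 𝟙 _ := by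
  classical
  obtain ⟨n, k, v, u, h1, h2, h3⟩ := hS.exists_splitting e he
  refine ⟨n, k, biproduct.lift v, biproduct.desc u, ?_, ?_⟩
  · rw [biproduct.lift_desc, h1]
  · refine biproduct.hom_ext' _ _ fun a => biproduct.hom_ext _ _ fun b => ?_
    by_cases h : a = b
    · subst h
      simp [h2]
    · simp [h3 a b h, biproduct.ι_π_ne _ h]

theorem isSplitMono_of_mono {X Y : D} (f : X ⟶ Y) [Mono f] : ∃ g : Y ⟶ X, f ≫ g = 𝟙 X := by
  obtain ⟨g, hg⟩ := hS.exists_regular f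
  exact ⟨g, by rw [← cancel_mono f, Category.assoc, hg, Category.id_comp]⟩

theorem isSplitEpi_of_epi {X Y : D} (f : X ⟶ Y) [Epi f] : ∃ g : Y ⟶ X, g ≫ f = 𝟙 Y := by
  obtain ⟨g, hg⟩ := hS.exists_regular f
  exact ⟨g, by rw [← cancel_epi f, hg, Category.comp_id]⟩

theorem simple (i : ι) : Simple (S i) where
  mono_isIso_iff_nonzero {Y} f _ := by
    obtain ⟨g, hg⟩ := hS.isSplitMono_of_mono f
    refine ⟨fun _ h => hS.id_ne_zero i ?_, fun h => ?_⟩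
    · exact (IsIso.inv_hom_id f).symm.trans ((congrArg (fun t => inv f ≫ t) h).trans comp_zero)
    · obtain ⟨c, hc⟩ := hS.eq_smul_id i (g ≫ f)
      have h1 : c • f = f := by
        have : f ≫ g ≫ f = c • f := by rw [hc, Linear.comp_smul, Category.comp_id]
        rw [← this, ← Category.assoc, hg, Category.id_comp]
      have h2 : c = 1 := by
        by_contra hc1
        have : (c - 1) • f = 0 := by rw [sub_smul, h1, one_smul, sub_self]
        exact h ((smul_eq_zero.1 this).resolve_left (sub_ne_zero.2 hc1))
      exact ⟨⟨g, hg, by rw [hc, h2, one_smul]⟩⟩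

theorem finiteSemisimple [Fintype ι] [HasFiniteBiproducts D] : FiniteSemisimple 𝕜 D where
  finiteDimensional := hS.finiteDimensional
  exists_iso_biproduct X := by
    obtain ⟨n, k, v, u, h1, h2⟩ := hS.exists_retract (𝟙 X) (Category.id_comp _)
    exact ⟨n, fun a => S (k a), fun a => hS.simple _, ⟨⟨v, u, h1, h2⟩⟩⟩
  finite_simples := by
    refine ⟨Fintype.card ι, fun a => S ((Fintype.equivFin ι).symm a), fun X hX => ?_⟩
    obtain ⟨n, k, v, u, h1, h2, h3⟩ := hS.exists_splitting (𝟙 X) (Category.id_comp _)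
    have hn : Nonempty (Fin n) := by
      by_contra h
      rw [not_nonempty_iff] at h
      exact id_nonzero X (h1.symm.trans (Finset.sum_of_isEmpty _))
    obtain ⟨a⟩ := hn
    have hu : Mono (u a) := ⟨fun f g h => by
      rw [← Category.comp_id f, ← Category.comp_id g, ← h2 a, reassoc_of% h]⟩
    have h0 : u a ≠ 0 := fun h => hS.id_ne_zero _ (by rw [← h2 a, h, zero_comp])
    have := isIso_of_mono_of_nonzero h0
    refine ⟨Fintype.equivFin ι (k a), ⟨(asIso (u a)).symm ≪≫ eqToIso ?_⟩⟩
    simp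

theorem hasKernels [Fintype ι] [HasFiniteBiproducts D] : HasKernels D where
  has_limit {X Y} f := by
    obtain ⟨g, hg⟩ := hS.exists_regular f
    have he : (𝟙 X - f ≫ g) ≫ (𝟙 X - f ≫ g) = 𝟙 X - f ≫ g := by
      simp [Preadditive.sub_comp, Preadditive.comp_sub, reassoc_of% hg]
    obtain ⟨n, k, v, u, h1, h2⟩ := hS.exists_retract _ he
    have h0 : u ≫ f = 0 := by
      rw [← Category.id_comp u, ← h2, Category.assoc, Category.assoc, reassoc_of% h1]
      simp [Preadditive.sub_comp, hg]
    refine ⟨⟨⟨KernelFork.ofι u h0, KernelFork.IsLimit.ofι u h0 (fun t _ => t ≫ v)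
      (fun t ht => ?_) fun t ht m hm => ?_⟩⟩⟩
    · rw [Category.assoc, h1, Preadditive.comp_sub, reassoc_of% ht]
      simp
    · rw [← hm, Category.assoc, h2, Category.comp_id]

theorem hasCokernels [Fintype ι] [HasFiniteBiproducts D] : HasCokernels D where
  has_colimit {X Y} f := by
    obtain ⟨g, hg⟩ := hS.exists_regular f
    have he : (𝟙 Y - g ≫ f) ≫ (𝟙 Y - g ≫ f) = 𝟙 Y - g ≫ f := by
      simp [Preadditive.sub_comp, Preadditive.comp_sub, hg]
    obtain ⟨n, k, v, u, h1, h2⟩ := hS.exists_retract _ he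
    have h0 : f ≫ v = 0 := by
      rw [← Category.comp_id v, ← h2, ← Category.assoc, ← Category.assoc, Category.assoc f, h1]
      simp [Preadditive.comp_sub, hg]
    refine ⟨⟨⟨CokernelCofork.ofπ v h0, CokernelCofork.IsColimit.ofπ v h0 (fun t _ => u ≫ t)
      (fun t ht => ?_) fun t ht m hm => ?_⟩⟩⟩
    · rw [← Category.assoc, h1, Preadditive.sub_comp, Category.assoc, ht]
      simp
    · rw [← hm, ← Category.assoc, h2, Category.id_comp]

theorem isNormalMonoCategory : IsNormalMonoCategory D where
  normalMonoOfMono {X Y} f _ := by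
    obtain ⟨g, hg⟩ := hS.isSplitMono_of_mono f
    have h0 : f ≫ (𝟙 Y - g ≫ f) = 0 := by
      rw [Preadditive.comp_sub, ← Category.assoc, hg]; simp
    refine ⟨⟨Y, 𝟙 Y - g ≫ f, h0, KernelFork.IsLimit.ofι f h0 (fun t _ => t ≫ g)
      (fun t ht => ?_) fun t ht m hm => ?_⟩⟩
    · rw [Preadditive.comp_sub, sub_eq_zero, Category.comp_id] at ht
      rw [Category.assoc, ← ht]
    · rw [← hm, Category.assoc, hg, Category.comp_id]

theorem isNormalEpiCategory : IsNormalEpiCategory D where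
  normalEpiOfEpi {X Y} f _ := by
    obtain ⟨g, hg⟩ := hS.isSplitEpi_of_epi f
    have h0 : (𝟙 X - f ≫ g) ≫ f = 0 := by
      rw [Preadditive.sub_comp, Category.assoc, hg]; simp
    refine ⟨⟨X, 𝟙 X - f ≫ g, h0, CokernelCofork.IsColimit.ofπ f h0 (fun t _ => g ≫ t)
      (fun t ht => ?_) fun t ht m hm => ?_⟩⟩
    · rw [Preadditive.sub_comp, sub_eq_zero, Category.id_comp] at ht
      rw [← Category.assoc, ← ht]
    · rw [← hm, ← Category.assoc, hg, Category.id_comp]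

end IsSimpleFamily

end SemisimpleFamily

section Multifusion


variable {𝕜 : Type w} [Field 𝕜] [IsAlgClosed 𝕜] {C : Type u} [Category.{v} C]
  [Abelian C] [Linear 𝕜 C] [FiniteSemisimple 𝕜 C] [MonoidalCategory C] [MonoidalPreadditive C]
  [MonoidalLinear 𝕜 C] [Simple (𝟙_ C)] [BraidedCategory C] [RightRigidCategory C]
  [PivotalCategory C] [SphericalCategory C] (I : SimpleData 𝕜 C)

open PreCenter

theorem boxFunctor_map_eq_sum (hI : IsModular I) {W W₁ Y Y₁ : C}
    (F : boxFunctor.obj (⟨W, Y⟩ : BoxPair 𝕜 C) ⟶ boxFunctor.obj (⟨W₁, Y₁⟩ : BoxPair 𝕜 C)) :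
    ∃ (n : ℕ) (f : Fin n → (W ⟶ W₁)) (g : Fin n → (Y ⟶ Y₁)), F.f = ∑ m, (f m ⊗ₘ g m) :=
  exists_eq_sum_tensorHom I hI (W := W) (Y := Y) (W₁ := W₁) (Y₁ := Y₁) F.isHom

theorem isSimpleFamily_box (hI : IsModular I) : IsSimpleFamily 𝕜 fun i : I.ι × I.ι =>
    boxFunctor.obj (⟨I.X i.1, I.X i.2⟩ : BoxPair 𝕜 C) where
  id_ne_zero i h := by
    have h1 : I.X i.1 ◁ 𝟙 (I.X i.2) = 0 :=
      (MonoidalCategory.whiskerLeft_id _ _).trans (congrArg RedCenter.Hom.f h)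
    exact id_nonzero _ (eq_zero_of_whiskerLeft (dim_ne_zero (𝕜 := 𝕜) (I.X i.1)) h1)
  eq_smul_id i F := by
    obtain ⟨n, f, g, e⟩ := boxFunctor_map_eq_sum I hI F
    choose a ha using fun m => endomorphism_simple_eq_smul_id 𝕜 (f m)
    choose b hb using fun m => endomorphism_simple_eq_smul_id 𝕜 (g m)
    refine ⟨∑ m, a m * b m, RedCenter.hom_ext (e.trans ?_)⟩
    change _ = (∑ m, a m * b m) • 𝟙 (I.X i.1 ⊗ I.X i.2)
    rw [Finset.sum_smul]
    refine Finset.sum_congr rfl fun m _ => ?_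
    rw [← ha, ← hb, MonoidalCategory.tensorHom_def, MonoidalLinear.smul_whiskerRight,
      MonoidalLinear.whiskerLeft_smul, Linear.smul_comp, Linear.comp_smul, smul_smul]
    simp
  eq_zero {i j} F h := by
    obtain ⟨n, f, g, e⟩ := boxFunctor_map_eq_sum I hI F
    refine RedCenter.hom_ext (e.trans (Finset.sum_eq_zero fun m _ => ?_))
    by_cases h1 : i.1 = j.1
    · rw [I.hom_eq_zero (fun h2 => h (Prod.ext h1 h2)) (g m), MonoidalPreadditive.tensor_zero]
      rfl
    · rw [I.hom_eq_zero h1 (f m), MonoidalPreadditive.zero_tensor]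
      rfl
  exists_total P := by
    obtain ⟨V, i, p, hi, hp, h1, -, -⟩ := PreCenter.exists_boxes I hI P.isHalfBraiding
    let J := Σ j : I.ι, Σ k : I.ι, Fin (Module.finrank 𝕜 (I.X k ⟶ V j))
    let p' : ∀ a : J, P ⟶ boxFunctor.obj (⟨I.X a.1, I.X a.2.1⟩ : BoxPair 𝕜 C) := fun a =>
      ⟨p a.1 ≫ (𝟙 (I.X a.1) ⊗ₘ homDual 𝕜 (I.X a.2.1) (V a.1) a.2.2),
        Intertwines.comp (hp a.1) (isHom_box _ _)⟩
    let u' : ∀ a : J, boxFunctor.obj (⟨I.X a.1, I.X a.2.1⟩ : BoxPair 𝕜 C) ⟶ P := fun a =>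
      ⟨(𝟙 (I.X a.1) ⊗ₘ homBasis 𝕜 (I.X a.2.1) (V a.1) a.2.2) ≫ i a.1,
        Intertwines.comp (isHom_box _ _) (hi a.1)⟩
    let E := (Fintype.equivFin J).symm
    refine ⟨Fintype.card J, fun a => ((E a).1, (E a).2.1), fun a => p' (E a), fun a => u' (E a),
      (E.sum_comp fun a => p' a ≫ u' a).trans (RedCenter.hom_ext ?_)⟩
    rw [RedCenter.sum_f, Fintype.sum_sigma]
    refine Eq.trans (Finset.sum_congr rfl fun j _ => ?_) h1
    change ∑ a : Σ k : I.ι, Fin (Module.finrank 𝕜 (I.X k ⟶ V j)),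
      (p j ≫ (𝟙 (I.X j) ⊗ₘ homDual 𝕜 (I.X a.1) (V j) a.2)) ≫
        (𝟙 (I.X j) ⊗ₘ homBasis 𝕜 (I.X a.1) (V j) a.2) ≫ i j = p j ≫ i j
    simp only [Category.assoc, tensorHom_comp_tensorHom_assoc, Category.comp_id]
    rw [← Preadditive.comp_sum, ← Preadditive.sum_comp]
    simp only [id_tensorHom]
    rw [← whiskerLeft_sum, Fintype.sum_sigma, I.complete,
      MonoidalCategory.whiskerLeft_id, Category.id_comp]

theorem exactPairing_of_pivotal {D : Type*} [Category* D] [MonoidalCategory D]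
    [RightRigidCategory D] [PivotalCategory D] (X : D) :
    (∃ Y : D, Nonempty (ExactPairing X Y)) ∧ ∃ Y : D, Nonempty (ExactPairing Y X) :=
  ⟨⟨†X, ⟨inferInstance⟩⟩, ⟨†X, ⟨exactPairingCongrRight (PivotalCategory.piv X)⟩⟩⟩

theorem reducedData_monoidalPreadditive (hw : ReducedWellDefined I)
    (hm : (reducedData I hw).IsMonoidal) :
    letI := hm.monoidalCategory
    MonoidalPreadditive (RedCenter C) := by
  let := hm.monoidalCategory
  have h : ∀ {X X₁ Y Y₁ : RedCenter C} (f : X ⟶ X₁) (g : Y ⟶ Y₁), (f ⊗ₘ g).f =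
      tensorι I X.pre Y.pre ≫ (f.f ⊗ₘ g.f) ≫ tensorπ I X₁.pre Y₁.pre := fun f g => rfl
  refine ⟨?_, ?_, ?_, ?_⟩
  · intro X Y Z
    rw [← id_tensorHom]
    refine RedCenter.hom_ext ((h _ _).trans ?_)
    simp
    rfl
  · intro X Y Z
    rw [← tensorHom_id]
    refine RedCenter.hom_ext ((h _ _).trans ?_)
    simp
    rfl
  · intro X Y Z f g
    simp only [← id_tensorHom]
    refine RedCenter.hom_ext ((h _ _).trans ?_)
    refine Eq.trans ?_ (congrArg₂ (· + ·) (h _ _) (h _ _)).symm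
    simp
    rfl
  · intro X Y Z f g
    simp only [← tensorHom_id]
    refine RedCenter.hom_ext ((h _ _).trans ?_)
    refine Eq.trans ?_ (congrArg₂ (· + ·) (h _ _) (h _ _)).symm
    simp
    rfl

theorem reducedData_monoidalLinear (hw : ReducedWellDefined I)
    (hm : (reducedData I hw).IsMonoidal) :
    letI := hm.monoidalCategory
    letI := reducedData_monoidalPreadditive I hw hm
    MonoidalLinear 𝕜 (RedCenter C) := by
  let := hm.monoidalCategory
  have h : ∀ {X X₁ Y Y₁ : RedCenter C} (f : X ⟶ X₁) (g : Y ⟶ Y₁), (f ⊗ₘ g).f =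
      tensorι I X.pre Y.pre ≫ (f.f ⊗ₘ g.f) ≫ tensorπ I X₁.pre Y₁.pre := fun f g => rfl
  refine @MonoidalLinear.mk _ _ _ _ _ _ _ (reducedData_monoidalPreadditive I hw hm) ?_ ?_
  · intro X Y Z r f
    simp only [← id_tensorHom]
    refine RedCenter.hom_ext ((h _ _).trans ?_)
    refine Eq.trans ?_ (congrArg (r • ·) (h _ _)).symm
    simp
    rfl
  · intro r Y Z f X
    simp only [← tensorHom_id]
    refine RedCenter.hom_ext ((h _ _).trans ?_)
    refine Eq.trans ?_ (congrArg (r • ·) (h _ _)).symm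
    simp
    rfl

theorem reducedData_isMultifusion (hI : IsModular I) (hw : ReducedWellDefined I)
    (hZ : (reducedData I hw).IsPivotalCategory) :
    letI := hZ.monoidal.monoidalCategory
    IsMultifusion 𝕜 (RedCenter C) := by
  let := hZ.monoidal.monoidalCategory
  let := hZ.rigid.rightRigidCategory
  let := hZ.pivotal.pivotalCategory
  have hS := isSimpleFamily_box I hI
  exact
    { hasKernels := hS.hasKernels
      hasCokernels := hS.hasCokernels
      normalMono := hS.isNormalMonoCategory
      normalEpi := hS.isNormalEpiCategory
      finiteSemisimple := hS.finiteSemisimple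
      monoidalPreadditive := reducedData_monoidalPreadditive I hw hZ.monoidal
      monoidalLinear := reducedData_monoidalLinear I hw hZ.monoidal
      rigid := exactPairing_of_pivotal }

theorem deligneData_isPivotalCategory (hI : IsModular I) :
    (deligneData I).IsPivotalCategory := by
  have hw := reducedWellDefined I hI
  have hZ := reducedData_isPivotalCategory I hI hw
  let := hZ.monoidal.monoidalCategory
  let := hZ.rigid.rightRigidCategory
  let := hZ.pivotal.pivotalCategory
  have := functorK_isEquivalence I hI
  exact (comparisonK I hI hw hZ).isPivotalCategory

theorem deligneData_isMultifusion (hI : IsModular I) (hA : (deligneData I).IsPivotalCategory) :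
    letI := hA.monoidal.monoidalCategory
    IsMultifusion 𝕜 (Deligne 𝕜 C) := by
  have hw := reducedWellDefined I hI
  have hZ := reducedData_isPivotalCategory I hI hw
  let := hZ.monoidal.monoidalCategory
  let := hZ.rigid.rightRigidCategory
  let := hZ.pivotal.pivotalCategory
  let := hA.monoidal.monoidalCategory
  let := hA.rigid.rightRigidCategory
  let := hA.pivotal.pivotalCategory
  let := (comparisonK I hI hw hZ).monoidal hA.monoidal
  have := functorK_isEquivalence I hI
  have := reducedData_monoidalPreadditive I hw hZ.monoidal
  have := reducedData_monoidalLinear I hw hZ.monoidal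
  have hP := monoidalPreadditive_of_faithful (functorK (𝕜 := 𝕜) (C := C))
  have hS := (isSimpleFamily_box I hI).of_equivalence (functorK (𝕜 := 𝕜) (C := C))
  exact
    { hasKernels := hS.hasKernels
      hasCokernels := hS.hasCokernels
      normalMono := hS.isNormalMonoCategory
      normalEpi := hS.isNormalEpiCategory
      finiteSemisimple := hS.finiteSemisimple
      monoidalPreadditive := hP
      monoidalLinear := MonoidalLinear.ofFaithful 𝕜 (functorK (𝕜 := 𝕜) (C := C))
      rigid := exactPairing_of_pivotal }

end Multifusion

end ReducedTensor

end

theorem theoremt {𝕜 : Type w} [Field 𝕜] [IsAlgClosed 𝕜] [CharZero 𝕜]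
    {C : Type u} [Category.{v} C] [Abelian C] [Linear 𝕜 C] [ReducedTensor.FiniteSemisimple 𝕜 C]
    [MonoidalCategory C] [MonoidalPreadditive C] [MonoidalLinear 𝕜 C] [Simple (𝟙_ C)]
    [BraidedCategory C] [RightRigidCategory C] [ReducedTensor.PivotalCategory C]
    [ReducedTensor.SphericalCategory C]
    (I : ReducedTensor.SimpleData 𝕜 C) (hI : ReducedTensor.IsModular I) :
    ∃ (hw : ReducedTensor.ReducedWellDefined I)
      (hA : (ReducedTensor.deligneData I).IsPivotalCategory)
      (hZ : (ReducedTensor.reducedData I hw).IsPivotalCategory),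
      letI := hA.monoidal.monoidalCategory
      letI := hA.rigid.rightRigidCategory
      letI := hA.pivotal.pivotalCategory
      letI := hZ.monoidal.monoidalCategory
      letI := hZ.rigid.rightRigidCategory
      letI := hZ.pivotal.pivotalCategory
      ReducedTensor.IsMultifusion 𝕜 (ReducedTensor.Deligne 𝕜 C) ∧
      ReducedTensor.IsMultifusion 𝕜 (ReducedTensor.RedCenter C) ∧
      (ReducedTensor.functorK (𝕜 := 𝕜) (C := C)).Linear 𝕜 ∧
      (ReducedTensor.functorK (𝕜 := 𝕜) (C := C)).IsEquivalence ∧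
      ∃ _ : (ReducedTensor.functorK (𝕜 := 𝕜) (C := C)).Monoidal,
        ReducedTensor.IsPivotalFunctor (ReducedTensor.functorK (𝕜 := 𝕜) (C := C)) ∧
        (∀ M N : ReducedTensor.Deligne 𝕜 C,
          (Functor.LaxMonoidal.μ (ReducedTensor.functorK (𝕜 := 𝕜) (C := C)) M N).f =
            ReducedTensor.tensorK I M N) ∧
        (Functor.OplaxMonoidal.η (ReducedTensor.functorK (𝕜 := 𝕜) (C := C))).f =
          ReducedTensor.unitK I := by
  have hw := ReducedTensor.reducedWellDefined I hI
  have hA := ReducedTensor.deligneData_isPivotalCategory I hI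
  have hZ := ReducedTensor.reducedData_isPivotalCategory I hI hw
  refine ⟨hw, hA, hZ, ReducedTensor.deligneData_isMultifusion I hI hA,
    ReducedTensor.reducedData_isMultifusion I hI hw hZ, inferInstance,
    ReducedTensor.functorK_isEquivalence I hI, ?_⟩
  let := hZ.monoidal.monoidalCategory
  let := hZ.rigid.rightRigidCategory
  let := hZ.pivotal.pivotalCategory
  exact ⟨(ReducedTensor.comparisonK I hI hw hZ).monoidal hA.monoidal,
    (ReducedTensor.comparisonK I hI hw hZ).isPivotalFunctor hA, fun _ _ => rfl, rfl⟩
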